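/- Let $S^1=\mathbb{R}/2\mathbb{Z}$ and give all spaces of smooth loops the $C^\infty$ topology. A framed loop is a pair $(\gamma,V)$ of smooth maps $S^1\to\mathbb{R}^3$ with $\gamma$ an immersion and $V$ a unit normal field along $\gamma$; put $T=\gamma'/\|\gamma'\|$, $W=T\times V$. The loop group $\mathcal{L}\mathbb{S}^1=C^\infty(S^1,\mathbb{S}^1)$ acts on framed loops by frame twisting, $e^{i\alpha}\cdot(\gamma,V)=(\gamma,\cos(2\alpha)V+\sin(2\alpha)W)$. Let $\mathrm{Sim}$ be the group of orientation-preserving similarities $x\mapsto rAx+b$ ($r>0$, $A\in SO(3)$, $b\in\mathbb{R}^3$) of $\mathbb{R}^3$, acting on framed loops by $(\gamma,V)\mapsto(rA\gamma+b,AV)$. Let $\mathcal{M}$ be the quotient of the space of framed loops by $\mathrm{Sim}\times\mathbb{S}^1$, where $\mathbb{S}^1\subset\mathcal{L}\mathbb{S}^1$ is the group of constant loops, and let $\mathcal{B}=\mathrm{Imm}(S^1,\mathbb{R}^3)/\mathrm{Sim}$. Let $\pi:\mathcal{M}\to\mathcal{B}$, $[\gamma,V]\mapsto[\gamma]$. The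 spaces $\mathcal{B}$, $\mathcal{M}$ and $\mathcal{L}\mathbb{S}^1/\mathbb{S}^1$ are Fréchet manifolds, with the quotient smooth structures (those for which the quotient maps from the space of immersed loops, the space of framed loops and $\mathcal{L}\mathbb{S}^1$ are smooth and have smooth local sections through every point), and $\mathcal{L}\mathbb{S}^1/\mathbb{S}^1$ is a Fréchet Lie group. **Theorem.** Every connected component $X$ of $\mathcal{M}$ is, via $\pi$, a smooth principal bundle over $\mathcal{B}$ with structure group the based loop group $\mathcal{L}\mathbb{S}^1/\mathbb{S}^1$ acting by frame twisting: $X$ is open and invariant, the action on $X$ is smooth and free, $\pi:X\to\mathcal{B}$ is smooth and surjective with the orbits in $X$ as its fibers, and it is locally trivial through equivariant diffeomorphisms $X\cap\pi^{-1}(U)\cong U\times(\mathcal{L}\mathbb{S}^1/\mathbb{S}^1)$ over $U$. Moreover, for a unit normal field $V$ along $\gamma$ let $\mathrm{tw}=\langle\frac{dV}{ds},W\rangle$ be its twist rate ($s$ arclength) and $\mathrm{Tw}=\frac1{2\pi}\int\mathrm{tw}\,ds$ (over one period) its total twist; $V$ is an anti-framing if it is defined and smooth on $\mathbb{R}$ with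 $V(t+2)=-V(t)$. Let $\mathcal{U}\subset\mathcal{B}$ be the set of $[\gamma]$ such that $\gamma$ has no framing with $\mathrm{tw}\equiv0$, and $\mathcal{U}'\subset\mathcal{B}$ the set of $[\gamma]$ such that $\gamma$ has no anti-framing with $\mathrm{tw}\equiv0$. Then $\mathcal{U}$ and $\mathcal{U}'$ are open, $\mathcal{U}\cup\mathcal{U}'=\mathcal{B}$, and for every component $X$ of $\mathcal{M}$: 1. for each $b\in\mathcal{B}$ there is exactly one point of $X$ over $b$ of the form $[\gamma,V]$ with $V$ a framing of constant twist rate and total twist in $[0,2)$, and $b\mapsto[\gamma,V]$ is a smooth section of $X$ over $\mathcal{U}$; 2. for each $b\in\mathcal{B}$ there is exactly one point of $X$ over $b$ of the form $[e^{i\pi t/4}\cdot(\gamma,V)]$ with $V$ an anti-framing of constant twist rate and total twist in $[0,2)$, and this defines a smooth section of $X$ over $\mathcal{U}'$. -/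

import Mathlib

open Set Filter Topology
open scoped ContDiff Matrix

/-! ## Calculus in Fréchet spaces and Fréchet manifolds -/

/-- A real Fréchet space: a complete metrizable locally convex topological vector space. -/
class IsFrechetSpace (E : Type) [AddCommGroup E] [Module ℝ E] [TopologicalSpace E] : Prop
    extends IsTopologicalAddGroup E, ContinuousSMul ℝ E, LocallyConvexSpace ℝ E where
  metrizable : TopologicalSpace.MetrizableSpace E
  complete : @CompleteSpace E (IsTopologicalAddGroup.rightUniformSpace E)

/-- `f` is of class `C^n` on the (open) set `U`: `f` is continuous on `U` and, for `n ≥ 1`, all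
directional derivatives `df (x, v) = lim_{t → 0} (f (x + t v) - f x) / t` exist for `x ∈ U` and
`df` is of class `C^(n-1)` on `U × E`. -/
def FrechetCn : (n : ℕ) → {E F : Type} →
    [AddCommGroup E] → [Module ℝ E] → [TopologicalSpace E] →
    [AddCommGroup F] → [Module ℝ F] → [TopologicalSpace F] →
    (E → F) → Set E → Prop
  | 0, _, _, _, _, _, _, _, _, f, U => ContinuousOn f U
  | n + 1, E, F, _, _, _, _, _, _, f, U => ContinuousOn f U ∧
      ∃ df : E × E → F,
        (∀ x ∈ U, ∀ v : E,
          Tendsto (fun t : ℝ => t⁻¹ • (f (x + t • v) - f x)) (𝓝[≠] 0) (𝓝 (df (x, v)))) ∧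
        FrechetCn n df (U ×ˢ (univ : Set E))

section Calculus

variable {E F : Type} [AddCommGroup E] [Module ℝ E] [TopologicalSpace E]
  [AddCommGroup F] [Module ℝ F] [TopologicalSpace F]

/-- Smoothness of a map on an arbitrary subset `S` of a Fréchet space: locally the map extends to
a `C^∞` map on an open set.  (For open `S` this is ordinary `C^∞` smoothness on `S`.) -/
def FrechetSmoothOn (f : E → F) (S : Set E) : Prop :=
  ∀ x ∈ S, ∃ W : Set E, IsOpen W ∧ x ∈ W ∧
    ∃ g : E → F, EqOn f g (S ∩ W) ∧ ∀ n : ℕ, FrechetCn n g W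

end Calculus

/-- A chart of `M` with values in a Fréchet space. -/
structure FrechetChart (M : Type) [TopologicalSpace M] where
  E : Type
  [instAddCommGroup : AddCommGroup E]
  [instModule : Module ℝ E]
  [instTopologicalSpace : TopologicalSpace E]
  [instFrechet : IsFrechetSpace E]
  toHomeo : OpenPartialHomeomorph M E

attribute [instance] FrechetChart.instAddCommGroup FrechetChart.instModule
  FrechetChart.instTopologicalSpace FrechetChart.instFrechet

/-- A Fréchet manifold structure on a topological space: the space is Hausdorff and carries an
atlas of charts with values in Fréchet spaces, with smooth coordinate transitions. -/
structure FrechetManifold (M : Type) [TopologicalSpace M] where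
  t2 : T2Space M
  atlas : Set (FrechetChart M)
  covers : ∀ x : M, ∃ c ∈ atlas, x ∈ c.toHomeo.source
  compatible : ∀ c ∈ atlas, ∀ c' ∈ atlas,
    FrechetSmoothOn (fun y : c.E => c'.toHomeo (c.toHomeo.symm y))
      {y | y ∈ c.toHomeo.target ∧ c.toHomeo.symm y ∈ c'.toHomeo.source}

section Manifold

variable {M N P : Type} [TopologicalSpace M] [TopologicalSpace N] [TopologicalSpace P]

/-- Smoothness, on an open subset `U` of `M`, of a map between Fréchet manifolds. -/
def FrechetManifold.SmoothOn (𝓜 : FrechetManifold M) (𝓝' : FrechetManifold N)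
    (f : M → N) (U : Set M) : Prop :=
  ContinuousOn f U ∧
  ∀ c ∈ 𝓜.atlas, ∀ c' ∈ 𝓝'.atlas,
    FrechetSmoothOn (fun y : c.E => c'.toHomeo (f (c.toHomeo.symm y)))
      {y | y ∈ c.toHomeo.target ∧ c.toHomeo.symm y ∈ U ∧
        f (c.toHomeo.symm y) ∈ c'.toHomeo.source}

/-- Smoothness, on `U × V` with `U`, `V` open, of a map from the product of two Fréchet manifolds
to a Fréchet manifold. -/
def FrechetManifold.SmoothOn₂ (𝓜 : FrechetManifold M) (𝓝' : FrechetManifold N)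
    (𝓠 : FrechetManifold P) (f : M → N → P) (U : Set M) (V : Set N) : Prop :=
  ContinuousOn (Function.uncurry f) (U ×ˢ V) ∧
  ∀ c ∈ 𝓜.atlas, ∀ c' ∈ 𝓝'.atlas, ∀ c'' ∈ 𝓠.atlas,
    FrechetSmoothOn
      (fun y : c.E × c'.E => c''.toHomeo (f (c.toHomeo.symm y.1) (c'.toHomeo.symm y.2)))
      {y | (y.1 ∈ c.toHomeo.target ∧ c.toHomeo.symm y.1 ∈ U) ∧
        (y.2 ∈ c'.toHomeo.target ∧ c'.toHomeo.symm y.2 ∈ V) ∧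
        f (c.toHomeo.symm y.1) (c'.toHomeo.symm y.2) ∈ c''.toHomeo.source}

/-- Let `ι : S → E` identify `S` with a subset of a Fréchet space `E`, and let `q : S → M` be a
quotient map.  The Fréchet manifold structure on `M` is the quotient structure if `q` is a smooth
submersion: `q` is smooth in the charts of `M`, and through every point of `S` there is
a smooth local section of `q`.  These conditions determine the smooth structure of `M`. -/
structure IsQuotientManifold {S E : Type} [AddCommGroup E] [Module ℝ E] [TopologicalSpace E]
    (ι : S → E) (q : S → M) (𝓜 : FrechetManifold M) : Prop where
  smooth : ∀ c ∈ 𝓜.atlas, ∀ p : S, q p ∈ c.toHomeo.source →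
    ∃ W : Set E, IsOpen W ∧ ι p ∈ W ∧ ∃ g : E → c.E, FrechetSmoothOn g W ∧
      ∀ p' : S, ι p' ∈ W → q p' ∈ c.toHomeo.source ∧ g (ι p') = c.toHomeo (q p')
  sections : ∀ c ∈ 𝓜.atlas, ∀ p : S, q p ∈ c.toHomeo.source →
    ∃ W : Set c.E, IsOpen W ∧ c.toHomeo (q p) ∈ W ∧ W ⊆ c.toHomeo.target ∧
      ∃ s : c.E → S, s (c.toHomeo (q p)) = p ∧ FrechetSmoothOn (fun y => ι (s y)) W ∧
        ∀ y ∈ W, q (s y) = c.toHomeo.symm y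

/-- `G` is a Fréchet Lie group. -/
structure IsFrechetLieGroup {G : Type} [TopologicalSpace G] [Group G]
    (𝓖 : FrechetManifold G) : Prop where
  smooth_mul : 𝓖.SmoothOn₂ 𝓖 𝓖 (fun g h => g * h) univ univ
  smooth_inv : 𝓖.SmoothOn 𝓖 (fun g => g⁻¹) univ

/-- The open subset `X` of the Fréchet manifold `M`, with the projection `π`, is a smooth
principal bundle over the Fréchet manifold `B` with structure group the Fréchet Lie group `G`. -/
structure IsFrechetPrincipalBundle {G B : Type} [TopologicalSpace G] [Group G]
    [TopologicalSpace B] [MulAction G M]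
    (𝓖 : FrechetManifold G) (𝓜 : FrechetManifold M) (𝓑 : FrechetManifold B)
    (π : M → B) (X : Set M) : Prop where
  lieGroup : IsFrechetLieGroup 𝓖
  isOpen_total : IsOpen X
  smul_mem : ∀ (g : G), ∀ x ∈ X, g • x ∈ X
  smooth_smul : 𝓖.SmoothOn₂ 𝓜 𝓜 (fun g x => g • x) univ X
  smooth_proj : 𝓜.SmoothOn 𝓑 π X
  surj : π '' X = univ
  free : ∀ (g : G), ∀ x ∈ X, g • x = x → g = 1
  fibers : ∀ x ∈ X, ∀ y ∈ X, π x = π y ↔ ∃ g : G, g • x = y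
  /-- Around each point of the base there are an open set `U` and an equivariant diffeomorphism
  `x ↦ (π x, φ x)` from the part of `X` over `U` onto `U × G`, with inverse `ψ`. -/
  locallyTrivial : ∀ b : B, ∃ U : Set B, IsOpen U ∧ b ∈ U ∧ ∃ (φ : M → G) (ψ : B → G → M),
    𝓜.SmoothOn 𝓖 φ (X ∩ π ⁻¹' U) ∧
    𝓑.SmoothOn₂ 𝓖 𝓜 ψ U univ ∧
    (∀ b' ∈ U, ∀ g : G, ψ b' g ∈ X ∧ π (ψ b' g) = b' ∧ φ (ψ b' g) = g) ∧
    (∀ x ∈ X, π x ∈ U → ψ (π x) (φ x) = x) ∧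
    (∀ x ∈ X, π x ∈ U → ∀ g : G, φ (g • x) = g * φ x)

end Manifold

/-! ## Loop spaces -/

/-- Smooth maps `ℝ → F` of period `2`, that is, smooth loops on `S¹ = ℝ / 2ℤ`. -/
def smoothLoops (F : Type) [NormedAddCommGroup F] [NormedSpace ℝ F] : Submodule ℝ (ℝ → F) where
  carrier := {f | ContDiff ℝ ∞ f ∧ Function.Periodic f 2}
  add_mem' := fun hf hg => ⟨hf.1.add hg.1, hf.2.add hg.2⟩
  zero_mem' := ⟨contDiff_const, fun _ => rfl⟩
  smul_mem' := fun c _ hf => ⟨contDiff_const.smul hf.1, fun t => congrArg (c • ·) (hf.2 t)⟩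

/-- The loop space `C^∞(S¹, F)`. -/
def SmoothLoop (F : Type) [NormedAddCommGroup F] [NormedSpace ℝ F] : Type := ↥(smoothLoops F)

section SmoothLoop

variable {F : Type} [NormedAddCommGroup F] [NormedSpace ℝ F]

noncomputable instance : AddCommGroup (SmoothLoop F) :=
  inferInstanceAs (AddCommGroup (smoothLoops F))
noncomputable instance : Module ℝ (SmoothLoop F) := inferInstanceAs (Module ℝ (smoothLoops F))

instance : CoeFun (SmoothLoop F) (fun _ => ℝ → F) := ⟨fun f => f.1⟩

theorem SmoothLoop.contDiff (f : SmoothLoop F) : ContDiff ℝ ∞ (f : ℝ → F) := f.2.1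
theorem SmoothLoop.periodic (f : SmoothLoop F) : Function.Periodic (f : ℝ → F) 2 := f.2.2

/-- The `k`-th derivative of a loop. -/
noncomputable def SmoothLoop.jet (f : SmoothLoop F) (k : ℕ) : C(ℝ, F) :=
  ⟨iteratedDeriv k (f : ℝ → F), f.contDiff.continuous_iteratedDeriv k (by exact_mod_cast le_top)⟩

/-- The `C^∞` topology: (locally) uniform convergence of all derivatives. -/
noncomputable instance : TopologicalSpace (SmoothLoop F) :=
  TopologicalSpace.induced (fun f (k : ℕ) => f.jet k) inferInstance

end SmoothLoop

/-- Smooth loops in the unit circle of `ℂ`, as a subgroup of all maps `ℝ → Circle`. -/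
def circleLoops : Subgroup (ℝ → Circle) where
  carrier := {u | ContDiff ℝ ∞ (fun t => (u t : ℂ)) ∧ Function.Periodic u 2}
  mul_mem' := by
    rintro u v ⟨hu, hu'⟩ ⟨hv, hv'⟩
    refine ⟨?_, hu'.mul hv'⟩
    simpa using hu.mul hv
  one_mem' := ⟨by simpa using contDiff_const, fun _ => rfl⟩
  inv_mem' := by
    rintro u ⟨hu, hu'⟩
    refine ⟨?_, fun t => by simp [hu' t]⟩
    simp only [Pi.inv_apply, Circle.coe_inv_eq_conj]
    exact Complex.conjCLE.contDiff.comp hu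

/-- The loop group `C^∞(S¹, 𝕊¹)`. -/
def LoopGroup : Type := ↥circleLoops

noncomputable instance : CommGroup LoopGroup := inferInstanceAs (CommGroup circleLoops)

instance : CoeFun LoopGroup (fun _ => ℝ → Circle) := ⟨fun u => u.1⟩

/-- A loop in the circle, as a loop in `ℂ`. -/
def LoopGroup.toLoop (u : LoopGroup) : SmoothLoop ℂ :=
  ⟨fun t => (u t : ℂ), u.2.1, fun t => congrArg _ (u.2.2 t)⟩

noncomputable instance : TopologicalSpace LoopGroup := TopologicalSpace.induced LoopGroup.toLoop inferInstance

/-- The subgroup `𝕊¹` of constant loops. -/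
def constantLoops : Subgroup LoopGroup where
  carrier := {u | ∃ z : Circle, ∀ t, u t = z}
  mul_mem' := by
    rintro u v ⟨z, hz⟩ ⟨w, hw⟩
    exact ⟨z * w, fun t => congrArg₂ (· * ·) (hz t) (hw t)⟩
  one_mem' := ⟨1, fun _ => rfl⟩
  inv_mem' := by
    rintro u ⟨z, hz⟩
    exact ⟨z⁻¹, fun t => congrArg (·⁻¹) (hz t)⟩

/-- The based loop group `C^∞(S¹, 𝕊¹) / 𝕊¹`. -/
abbrev BasedLoopGroup : Type := LoopGroup ⧸ constantLoops

/-! ## Frames in Euclidean space -/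

/-- Euclidean 3-space. -/
abbrev Vec3 : Type := EuclideanSpace ℝ (Fin 3)

/-- The cross product. -/
noncomputable def cross (u v : Vec3) : Vec3 := WithLp.toLp 2 (crossProduct u.ofLp v.ofLp)

/-- The rotation group. -/
abbrev SO3 : Type := Matrix.specialOrthogonalGroup (Fin 3) ℝ

/-- The action of a rotation on a vector. -/
noncomputable def rot (A : SO3) (v : Vec3) : Vec3 := Matrix.toEuclideanLin A.1 v

/-- For a unit vector `T` and `V` orthogonal to `T`, and `z = e^{iα}`:
the vector `cos (2α) V + sin (2α) T × V`. -/
noncomputable def twistVec (T V : Vec3) (z : ℂ) : Vec3 :=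
  (z ^ 2).re • V + (z ^ 2).im • cross T V

/-- The unit tangent `T = γ' / ‖γ'‖`. -/
noncomputable def unitTangent (γ : ℝ → Vec3) (t : ℝ) : Vec3 := ‖deriv γ t‖⁻¹ • deriv γ t

/-- The twist rate `⟨dV/ds, W⟩`, where `W = T × V` and `s` is arclength. -/
noncomputable def twistRate (γ V : ℝ → Vec3) (t : ℝ) : ℝ :=
  inner ℝ (‖deriv γ t‖⁻¹ • deriv V t) (cross (unitTangent γ t) (V t))

/-- The total twist `(1/2π) ∫ tw ds`. -/
noncomputable def totalTwist (γ V : ℝ → Vec3) : ℝ :=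
  1 / (2 * Real.pi) * ∫ t in (0 : ℝ)..2, twistRate γ V t * ‖deriv γ t‖

/-- `V` is a unit normal field along the curve `γ`. -/
def IsUnitNormal (γ V : ℝ → Vec3) : Prop :=
  ∀ t, ‖V t‖ = 1 ∧ inner ℝ (V t) (deriv γ t) = 0

section Lemmas

theorem rot_mul (A B : SO3) (v : Vec3) : rot (A * B) v = rot A (rot B v) := by
  simp [rot, Matrix.toLpLin_apply, Matrix.mulVec_mulVec]

theorem rot_one (v : Vec3) : rot 1 v = v := by
  simp [rot]

theorem rot_inv (A : SO3) (v : Vec3) : rot A⁻¹ (rot A v) = v := by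
  rw [← rot_mul, inv_mul_cancel, rot_one]

theorem rot_add (A : SO3) (v w : Vec3) : rot A (v + w) = rot A v + rot A w := by simp [rot]
theorem rot_sub (A : SO3) (v w : Vec3) : rot A (v - w) = rot A v - rot A w := by simp [rot]
theorem rot_smul (A : SO3) (c : ℝ) (v : Vec3) : rot A (c • v) = c • rot A v := by simp [rot]

theorem SO3.transpose_mul (A : SO3) : A.1ᵀ * A.1 = 1 := by
  have h := (Matrix.mem_specialOrthogonalGroup_iff.1 A.2).1
  exact (Matrix.mem_orthogonalGroup_iff' (Fin 3) ℝ).1 h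

theorem SO3.adjugate_eq (A : SO3) : A.1.adjugate = A.1ᵀ := by
  have hd : A.1.det = 1 := (Matrix.mem_specialOrthogonalGroup_iff.1 A.2).2
  calc A.1.adjugate = (A.1ᵀ * A.1) * A.1.adjugate := by rw [A.transpose_mul, one_mul]
    _ = A.1ᵀ := by rw [mul_assoc, Matrix.mul_adjugate, hd, one_smul, mul_one]

theorem inner_rot (A : SO3) (v w : Vec3) : inner ℝ (rot A v) (rot A w) = inner ℝ v w := by
  simp only [rot, Matrix.toLpLin_apply, EuclideanSpace.inner_eq_star_dotProduct, star_trivial]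
  rw [Matrix.dotProduct_mulVec, ← Matrix.mulVec_transpose, Matrix.mulVec_mulVec,
    A.transpose_mul, Matrix.one_mulVec]

theorem norm_rot (A : SO3) (v : Vec3) : ‖rot A v‖ = ‖v‖ := by
  have h := inner_rot A v v
  rw [real_inner_self_eq_norm_sq, real_inner_self_eq_norm_sq] at h
  exact (sq_eq_sq₀ (norm_nonneg _) (norm_nonneg _)).1 h

theorem cross_rot (A : SO3) (v w : Vec3) : cross (rot A v) (rot A w) = rot A (cross v w) := by
  have h := A.adjugate_eq
  rw [Matrix.adjugate_fin_three] at h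
  have e := fun i j => congrFun (congrFun h i) j
  have e00 := e 0 0
  have e01 := e 0 1
  have e02 := e 0 2
  have e10 := e 1 0
  have e11 := e 1 1
  have e12 := e 1 2
  have e20 := e 2 0
  have e21 := e 2 1
  have e22 := e 2 2
  simp only [Matrix.of_apply, Matrix.cons_val', Matrix.cons_val, Matrix.transpose_apply] at e00 e01 e02 e10 e11 e12 e20 e21 e22
  ext i
  fin_cases i <;>
    simp [cross, rot, cross_apply, Matrix.toLpLin_apply, Matrix.mulVec, dotProduct,
      Fin.sum_univ_three] <;>
    [rw [← e00, ← e10, ← e20]; rw [← e01, ← e11, ← e21]; rw [← e02, ← e12, ← e22]] <;> ring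

theorem twistVec_rot (A : SO3) (T V : Vec3) (z : ℂ) :
    twistVec (rot A T) (rot A V) z = rot A (twistVec T V z) := by
  simp only [twistVec, cross_rot, rot_add, rot_smul]

theorem twistVec_one (T V : Vec3) : twistVec T V 1 = V := by simp [twistVec]

theorem cross_add_right (u v w : Vec3) : cross u (v + w) = cross u v + cross u w := by
  simp [cross]

theorem cross_smul_right (c : ℝ) (u v : Vec3) : cross u (c • v) = c • cross u v := by
  simp [cross]

theorem inner_vec3 (u v : Vec3) : inner ℝ u v = u 0 * v 0 + u 1 * v 1 + u 2 * v 2 := by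
  simp [PiLp.inner_apply, Fin.sum_univ_three, mul_comm]

theorem cross_zero (u v : Vec3) : cross u v 0 = u 1 * v 2 - u 2 * v 1 := by
  simp [cross, cross_apply]

theorem cross_one (u v : Vec3) : cross u v 1 = u 2 * v 0 - u 0 * v 2 := by
  simp [cross, cross_apply]

theorem cross_two (u v : Vec3) : cross u v 2 = u 0 * v 1 - u 1 * v 0 := by
  simp [cross, cross_apply]

theorem inner_cross_left (T V : Vec3) : inner ℝ (cross T V) T = 0 := by
  rw [inner_vec3, cross_zero, cross_one, cross_two]
  ring

theorem inner_cross_right (T V : Vec3) : inner ℝ (cross T V) V = 0 := by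
  rw [inner_vec3, cross_zero, cross_one, cross_two]
  ring

theorem cross_cross_self (T V : Vec3) :
    cross T (cross T V) = (inner ℝ V T) • T - (‖T‖ ^ 2) • V := by
  rw [← real_inner_self_eq_norm_sq, inner_vec3, inner_vec3]
  ext i
  fin_cases i <;>
    simp only [Fin.zero_eta, Fin.mk_one, Fin.reduceFinMk, cross_zero, cross_one, cross_two,
      PiLp.sub_apply, PiLp.smul_apply, smul_eq_mul] <;> ring

theorem inner_cross_cross (T V : Vec3) :
    inner ℝ (cross T V) (cross T V) = ‖T‖ ^ 2 * ‖V‖ ^ 2 - (inner ℝ V T) ^ 2 := by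
  rw [← real_inner_self_eq_norm_sq, ← real_inner_self_eq_norm_sq]
  simp only [inner_vec3, cross_zero, cross_one, cross_two]
  ring

theorem twistVec_mul {T V : Vec3} (hT : ‖T‖ = 1) (hV : inner ℝ V T = 0) (z w : ℂ) :
    twistVec T (twistVec T V z) w = twistVec T V (w * z) := by
  simp only [twistVec, cross_add_right, cross_smul_right, cross_cross_self, hT, hV, mul_pow,
    Complex.mul_re, Complex.mul_im]
  module

theorem twistVec_normal {T V : Vec3} (hV : inner ℝ V T = 0) (z : ℂ) :
    inner ℝ (twistVec T V z) T = 0 := by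
  simp only [twistVec, inner_add_left, inner_smul_left, hV, inner_cross_left]
  simp

theorem twistVec_norm {T V : Vec3} (hT : ‖T‖ = 1) (hV : inner ℝ V T = 0) (hV1 : ‖V‖ = 1)
    {z : ℂ} (hz : ‖z‖ = 1) : ‖twistVec T V z‖ = 1 := by
  have hz2 : (z ^ 2).re * (z ^ 2).re + (z ^ 2).im * (z ^ 2).im = 1 := by
    rw [← Complex.normSq_apply, Complex.normSq_eq_norm_sq, norm_pow, hz]
    norm_num
  have h : ‖twistVec T V z‖ ^ 2 = 1 := by
    rw [← real_inner_self_eq_norm_sq]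
    simp only [twistVec, inner_add_left, inner_add_right, inner_smul_left, inner_smul_right,
      inner_cross_cross, inner_cross_right, real_inner_comm (cross T V) V, hT, hV, hV1,
      conj_trivial]
    rw [real_inner_self_eq_norm_sq, hV1]
    linear_combination hz2
  exact (sq_eq_sq₀ (norm_nonneg _) zero_le_one).1 (by rw [h]; norm_num)

theorem norm_unitTangent {γ : ℝ → Vec3} {t : ℝ} (h : deriv γ t ≠ 0) : ‖unitTangent γ t‖ = 1 := by
  rw [unitTangent, norm_smul, norm_inv, norm_norm, inv_mul_cancel₀ (norm_ne_zero_iff.2 h)]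

theorem inner_unitTangent {γ V : ℝ → Vec3} (h : IsUnitNormal γ V) (t : ℝ) :
    inner ℝ (V t) (unitTangent γ t) = 0 := by
  rw [unitTangent, inner_smul_right, (h t).2, mul_zero]

theorem contDiff_cross {f g : ℝ → Vec3} (hf : ContDiff ℝ ∞ f) (hg : ContDiff ℝ ∞ g) :
    ContDiff ℝ ∞ (fun t => cross (f t) (g t)) := by
  rw [contDiff_euclidean] at hf hg ⊢
  have hf0 := hf 0
  have hf1 := hf 1
  have hf2 := hf 2
  have hg0 := hg 0
  have hg1 := hg 1
  have hg2 := hg 2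
  intro i
  fin_cases i <;> simp [cross, cross_apply] <;> fun_prop

theorem contDiff_deriv_infty {γ : ℝ → Vec3} (hγ : ContDiff ℝ ∞ γ) : ContDiff ℝ ∞ (deriv γ) :=
  (contDiff_infty_iff_deriv.1 hγ).2

theorem contDiff_unitTangent {γ : ℝ → Vec3} (hγ : ContDiff ℝ ∞ γ) (h : ∀ t, deriv γ t ≠ 0) :
    ContDiff ℝ ∞ (unitTangent γ) := by
  have h1 := contDiff_deriv_infty hγ
  exact ((h1.norm ℝ h).inv fun t => norm_ne_zero_iff.2 (h t)).smul h1

theorem periodic_deriv {γ : ℝ → Vec3} (h : Function.Periodic γ 2) :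
    Function.Periodic (deriv γ) 2 := by
  intro t
  rw [← deriv_comp_add_const]
  exact congrArg (fun f => deriv f t) (funext h)

theorem contDiff_twist {γ V : ℝ → Vec3} {u : ℝ → ℂ} (hγ : ContDiff ℝ ∞ γ)
    (h : ∀ t, deriv γ t ≠ 0) (hV : ContDiff ℝ ∞ V) (hu : ContDiff ℝ ∞ u) :
    ContDiff ℝ ∞ (fun t => twistVec (unitTangent γ t) (V t) (u t)) := by
  have hre : ContDiff ℝ ∞ (fun t => (u t ^ 2).re) := Complex.reCLM.contDiff.comp (hu.pow 2)
  have him : ContDiff ℝ ∞ (fun t => (u t ^ 2).im) := Complex.imCLM.contDiff.comp (hu.pow 2)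
  exact (hre.smul hV).add (him.smul (contDiff_cross (contDiff_unitTangent hγ h) hV))

theorem isUnitNormal_twist {γ V : ℝ → Vec3} {u : ℝ → ℂ} (h : ∀ t, deriv γ t ≠ 0)
    (hV : IsUnitNormal γ V) (hu : ∀ t, ‖u t‖ = 1) :
    IsUnitNormal γ (fun t => twistVec (unitTangent γ t) (V t) (u t)) := by
  intro t
  refine ⟨twistVec_norm (norm_unitTangent (h t)) (inner_unitTangent hV t) (hV t).1 (hu t), ?_⟩
  have h1 := twistVec_normal (inner_unitTangent hV t) (u t)
  rw [unitTangent, inner_smul_right] at h1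
  exact (mul_eq_zero.1 h1).resolve_left (inv_ne_zero (norm_ne_zero_iff.2 (h t)))

/-- The similarity `x ↦ r A x + b` rotates the unit tangent by `A`. -/
theorem unitTangent_sim {γ γ' : ℝ → Vec3} {r : ℝ} (hr : 0 < r) (A : SO3) (b : Vec3)
    (hγ : ContDiff ℝ ∞ γ) (h : ∀ t, γ' t = r • rot A (γ t) + b) (t : ℝ) :
    unitTangent γ' t = rot A (unitTangent γ t) := by
  have hd : HasDerivAt γ' (r • rot A (deriv γ t)) t := by
    have h0 : HasDerivAt γ (deriv γ t) t :=
      ((hγ.differentiable (by simp)) t).hasDerivAt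
    have h1 := ((LinearMap.toContinuousLinearMap
      (Matrix.toEuclideanLin A.1)).hasFDerivAt.comp_hasDerivAt t h0)
    have h2 := (h1.const_smul r).add_const b
    rw [show γ' = fun t => r • rot A (γ t) + b from funext h]
    exact h2
  rw [unitTangent, unitTangent, hd.deriv, norm_smul, norm_rot, rot_smul, smul_smul, Real.norm_eq_abs,
    abs_of_pos hr]
  congr 1
  field_simp

end Lemmas

/-! ## Framed loops and their moduli space -/

/-- Immersed loops in 3-space, as a subspace of the loop space. -/
abbrev ImmersedLoop : Type := {γ : SmoothLoop Vec3 // ∀ t, deriv (γ : ℝ → Vec3) t ≠ 0}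

/-- A framed loop: an immersed smooth loop with a smooth closed unit normal field. -/
structure FramedLoop where
  curve : SmoothLoop Vec3
  framing : SmoothLoop Vec3
  immersed : ∀ t, deriv (curve : ℝ → Vec3) t ≠ 0
  normal : IsUnitNormal curve framing

/-- The inclusion of the space of framed loops into a product of loop spaces. -/
def FramedLoop.incl (p : FramedLoop) : SmoothLoop Vec3 × SmoothLoop Vec3 := (p.curve, p.framing)

noncomputable instance : TopologicalSpace FramedLoop := TopologicalSpace.induced FramedLoop.incl inferInstance

/-- Forgetting the framing. -/
def FramedLoop.base (p : FramedLoop) : ImmersedLoop := ⟨p.curve, p.immersed⟩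

theorem FramedLoop.ext' {p q : FramedLoop} (h : p.curve = q.curve)
    (h' : ∀ t, p.framing t = q.framing t) : p = q := by
  have h2 : p.framing = q.framing := Subtype.ext (funext h')
  cases p
  cases q
  simp only at h h2
  subst h
  subst h2
  rfl

/-- The frame twisting action of the loop group:
`e^{iα} · (γ, V) = (γ, cos (2α) V + sin (2α) W)`, with `W = T × V`. -/
noncomputable instance : SMul LoopGroup FramedLoop where
  smul u p :=
    { curve := p.curve
      framing := ⟨fun t => twistVec (unitTangent p.curve t) (p.framing t) (u t),
        contDiff_twist p.curve.contDiff p.immersed p.framing.contDiff u.2.1, fun t => by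
          simp only [unitTangent]
          rw [periodic_deriv p.curve.periodic t, p.framing.periodic t, u.2.2 t]⟩
      immersed := p.immersed
      normal := isUnitNormal_twist p.immersed p.normal fun t => Circle.norm_coe _ }

theorem FramedLoop.smul_curve (u : LoopGroup) (p : FramedLoop) : (u • p).curve = p.curve := rfl

theorem FramedLoop.smul_framing (u : LoopGroup) (p : FramedLoop) (t : ℝ) :
    (u • p).framing t = twistVec (unitTangent p.curve t) (p.framing t) (u t) := rfl

noncomputable instance : MulAction LoopGroup FramedLoop where
  one_smul p := FramedLoop.ext' rfl fun t => by
    rw [FramedLoop.smul_framing]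
    exact twistVec_one _ _
  mul_smul u v p := FramedLoop.ext' rfl fun t => by
    rw [FramedLoop.smul_framing, FramedLoop.smul_framing, FramedLoop.smul_framing,
      FramedLoop.smul_curve, twistVec_mul (norm_unitTangent (p.immersed t))
        (inner_unitTangent p.normal t)]
    rfl

/-- Two immersed loops are equivalent if they differ by an orientation-preserving similarity
`x ↦ r A x + b`. -/
def loopSetoid : Setoid ImmersedLoop where
  r γ₁ γ₂ := ∃ (r : ℝ) (A : SO3) (b : Vec3), 0 < r ∧ ∀ t, γ₂.1 t = r • rot A (γ₁.1 t) + b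
  iseqv :=
    { refl := fun _ => ⟨1, 1, 0, one_pos, fun t => by simp [rot_one]⟩
      symm := by
        rintro γ₁ γ₂ ⟨r, A, b, hr, h⟩
        refine ⟨r⁻¹, A⁻¹, -(r⁻¹ • rot A⁻¹ b), inv_pos.2 hr, fun t => ?_⟩
        rw [h t, rot_add, rot_smul, rot_inv, smul_add, smul_smul, inv_mul_cancel₀ hr.ne', one_smul]
        abel
      trans := by
        rintro γ₁ γ₂ γ₃ ⟨r, A, b, hr, h⟩ ⟨r', A', b', hr', h'⟩
        refine ⟨r' * r, A' * A, r' • rot A' b + b', mul_pos hr' hr, fun t => ?_⟩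
        rw [h' t, h t, rot_add, rot_smul, rot_mul, smul_add, smul_smul, add_assoc] }

/-- Two framed loops are equivalent if they differ by an orientation-preserving similarity
`x ↦ r A x + b` (which acts on framings by `A`) and a constant frame twist `z ∈ 𝕊¹`. -/
def framedSetoid : Setoid FramedLoop where
  r p q := ∃ (r : ℝ) (A : SO3) (b : Vec3) (z : Circle), 0 < r ∧
    (∀ t, q.curve t = r • rot A (p.curve t) + b) ∧
    (∀ t, q.framing t = rot A (twistVec (unitTangent p.curve t) (p.framing t) z))
  iseqv :=
    { refl := fun _ => ⟨1, 1, 0, 1, one_pos, fun t => by simp [rot_one],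
        fun t => by rw [rot_one, Circle.coe_one, twistVec_one]⟩
      symm := by
        rintro p q ⟨r, A, b, z, hr, h, hV⟩
        refine ⟨r⁻¹, A⁻¹, -(r⁻¹ • rot A⁻¹ b), z⁻¹, inv_pos.2 hr, fun t => ?_, fun t => ?_⟩
        · rw [h t, rot_add, rot_smul, rot_inv, smul_add, smul_smul, inv_mul_cancel₀ hr.ne',
            one_smul]
          abel
        · rw [hV t, unitTangent_sim hr A b p.curve.contDiff h t, twistVec_rot, rot_inv,
            twistVec_mul (norm_unitTangent (p.immersed t)) (inner_unitTangent p.normal t),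
            ← Circle.coe_mul, inv_mul_cancel, Circle.coe_one, twistVec_one]
      trans := by
        rintro p₁ p₂ p₃ ⟨r, A, b, z, hr, h, hV⟩ ⟨r', A', b', z', hr', h', hV'⟩
        refine ⟨r' * r, A' * A, r' • rot A' b + b', z' * z, mul_pos hr' hr, fun t => ?_,
          fun t => ?_⟩
        · rw [h' t, h t, rot_add, rot_smul, rot_mul, smul_add, smul_smul, add_assoc]
        · rw [hV' t, hV t, unitTangent_sim hr A b p₁.curve.contDiff h t, twistVec_rot,
            twistVec_mul (norm_unitTangent (p₁.immersed t)) (inner_unitTangent p₁.normal t),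
            rot_mul, Circle.coe_mul] }

/-- The moduli space `ℬ = Imm(S¹, ℝ³) / Sim` of unframed loops. -/
def LoopModuli : Type := Quotient loopSetoid

/-- The moduli space `ℳ` of framed loops: relatively framed loops modulo similarities. -/
def FramedModuli : Type := Quotient framedSetoid

instance : TopologicalSpace LoopModuli := inferInstanceAs (TopologicalSpace (Quotient loopSetoid))
instance : TopologicalSpace FramedModuli :=
  inferInstanceAs (TopologicalSpace (Quotient framedSetoid))

/-- The class `[γ]` of an immersed loop. -/
def LoopModuli.mk (γ : ImmersedLoop) : LoopModuli := Quotient.mk loopSetoid γ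

/-- The class `[γ, V]` of a framed loop. -/
def FramedModuli.mk (p : FramedLoop) : FramedModuli := Quotient.mk framedSetoid p

/-- The forget framing map `[γ, V] ↦ [γ]`. -/
def forgetFraming : FramedModuli → LoopModuli :=
  Quotient.map' (s₁ := framedSetoid) (s₂ := loopSetoid) FramedLoop.base (by
    rintro p q ⟨r, A, b, _, hr, h, _⟩
    exact ⟨r, A, b, hr, h⟩)

/-- Frame twisting on the moduli space: `e^{iα} · [γ, V] = [e^{iα} · (γ, V)]`. -/
noncomputable instance : SMul LoopGroup FramedModuli where
  smul u := Quotient.map' (s₁ := framedSetoid) (s₂ := framedSetoid) (fun p => u • p) (by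
    rintro p q ⟨r, A, b, z, hr, h, hV⟩
    refine ⟨r, A, b, z, hr, h, fun t => ?_⟩
    rw [FramedLoop.smul_framing, FramedLoop.smul_framing, FramedLoop.smul_curve, hV t,
      unitTangent_sim hr A b p.curve.contDiff h t, twistVec_rot,
      twistVec_mul (norm_unitTangent (p.immersed t)) (inner_unitTangent p.normal t),
      twistVec_mul (norm_unitTangent (p.immersed t)) (inner_unitTangent p.normal t), mul_comm])

noncomputable instance : MulAction LoopGroup FramedModuli where
  one_smul m := Quotient.inductionOn' (s₁ := framedSetoid) m fun p =>
    congrArg FramedModuli.mk (one_smul LoopGroup p)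
  mul_smul u v m := Quotient.inductionOn' (s₁ := framedSetoid) m fun p =>
    congrArg FramedModuli.mk (mul_smul u v p)

/-- Constant loops act trivially, so the action descends to the based loop group. -/
noncomputable def twistHom : BasedLoopGroup →* Equiv.Perm FramedModuli :=
  QuotientGroup.lift constantLoops (MulAction.toPermHom LoopGroup FramedModuli) (by
    rintro u ⟨z, hz⟩
    ext m
    refine Quotient.inductionOn' (s₁ := framedSetoid) m fun p => ?_
    refine (Quotient.sound (s := framedSetoid) ⟨1, 1, 0, z, one_pos, fun t => ?_, fun t => ?_⟩ :
      FramedModuli.mk p = FramedModuli.mk (u • p)).symm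
    · simp [rot_one, FramedLoop.smul_curve]
    · rw [FramedLoop.smul_framing, rot_one, hz t])

/-- The frame twisting action of the based loop group on `ℳ`:
`[e^{iα}] · [γ, V] = [e^{iα} · (γ, V)]`. -/
noncomputable instance : MulAction BasedLoopGroup FramedModuli :=
  MulAction.compHom FramedModuli twistHom

theorem FramedModuli.mk_smul_mk (u : LoopGroup) (p : FramedLoop) :
    (QuotientGroup.mk u : BasedLoopGroup) • FramedModuli.mk p = FramedModuli.mk (u • p) := rfl

/-! ## Anti-framings, Bishop framings and constant twist minimizing framings -/

/-- An anti-framed loop: an immersed smooth loop with a smooth unit normal field which closes up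
(to all orders) to its negative. -/
structure AntiFramedLoop where
  curve : SmoothLoop Vec3
  framing : ℝ → Vec3
  smooth : ContDiff ℝ ∞ framing
  antiperiodic : Function.Antiperiodic framing 2
  immersed : ∀ t, deriv (curve : ℝ → Vec3) t ≠ 0
  normal : IsUnitNormal curve framing

/-- Forgetting the framing. -/
def AntiFramedLoop.base (p : AntiFramedLoop) : ImmersedLoop := ⟨p.curve, p.immersed⟩

/-- The framed loop `e^{iπt/4} · (γ, V)` of an anti-framed loop `(γ, V)`. -/
noncomputable def AntiFramedLoop.toFramedLoop (p : AntiFramedLoop) : FramedLoop where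
  curve := p.curve
  framing := ⟨fun t => twistVec (unitTangent p.curve t) (p.framing t)
      (Circle.exp (Real.pi * t / 4)), by
    refine contDiff_twist p.curve.contDiff p.immersed p.smooth ?_
    simp only [Circle.coe_exp]
    have h0 : ContDiff ℝ ∞ (fun t : ℝ => Real.pi * t / 4) :=
      (contDiff_const.mul contDiff_id).div_const 4
    exact ((Complex.ofRealCLM.contDiff.comp h0).mul contDiff_const).cexp, fun t => by
    have h : ((Circle.exp (Real.pi * (t + 2) / 4) : Circle) : ℂ) ^ 2
        = -((Circle.exp (Real.pi * t / 4) : Circle) : ℂ) ^ 2 := by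
      rw [Circle.coe_exp, Circle.coe_exp, ← Complex.exp_nat_mul, ← Complex.exp_nat_mul,
        ← mul_neg_one, ← Complex.exp_pi_mul_I, ← Complex.exp_add]
      congr 1
      push_cast
      ring
    have hc : ∀ u v : Vec3, cross u (-v) = -cross u v := fun u v => by
      rw [← neg_one_smul ℝ v, cross_smul_right, neg_one_smul]
    simp only [unitTangent, twistVec]
    rw [periodic_deriv p.curve.periodic t, p.antiperiodic t, h, hc]
    simp⟩
  immersed := p.immersed
  normal := isUnitNormal_twist p.immersed p.normal fun t => Circle.norm_coe _

/-- The set `𝒰` of classes of loops which do not admit a closed Bishop framing (a framing of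
vanishing twist rate). -/
def noClosedBishop : Set LoopModuli :=
  {b | ¬ ∃ p : FramedLoop, LoopModuli.mk p.base = b ∧ ∀ t, twistRate p.curve p.framing t = 0}

/-- The set `𝒰'` of classes of loops which do not admit a Bishop framing `V` that closes up to its
negative, `V(2) = -V(0)`. -/
def noAntiBishop : Set LoopModuli :=
  {b | ¬ ∃ p : AntiFramedLoop, LoopModuli.mk p.base = b ∧
    ∀ t, twistRate p.curve p.framing t = 0}

/-- The field `V` has constant twist rate along `γ`, with total twist in `[0, 2)`. -/
def IsConstantTwistMinimizing (γ V : ℝ → Vec3) : Prop :=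
  (∃ c : ℝ, ∀ t, twistRate γ V t = c) ∧ totalTwist γ V ∈ Ico (0 : ℝ) 2

/-- `m = [γ, V]` for a constant twist minimizing framing `V` of `γ`. -/
def IsCTMF (m : FramedModuli) : Prop :=
  ∃ p : FramedLoop, FramedModuli.mk p = m ∧ IsConstantTwistMinimizing p.curve p.framing

/-- `m = [e^{iπt/4} · (γ, V)]` for a constant twist minimizing anti-framing `V` of `γ`. -/
def IsAntiCTMF (m : FramedModuli) : Prop :=
  ∃ p : AntiFramedLoop, FramedModuli.mk p.toFramedLoop = m ∧
    IsConstantTwistMinimizing p.curve p.framing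

/-!
# The moduli space of framed loops as a principal bundle

**Quotient manifolds.** Write `D` for the space of loops in a finite-dimensional space. The
superposition operator `f ↦ Φ ∘ f` of a smooth map `Φ` is smooth on `D`
(`SmoothLoop.frechetSmoothOn_superpose`): its derivative is the superposition operator of the
tangent map of `Φ`, so that an induction on the order of differentiability closes up. Together with
the linear operations (derivative, integral, evaluation) this makes all constructions of frames and
angles smooth. A manifold structure on a quotient is obtained from slices (`Slice`), that is,
invariant maps to a Fréchet space with smooth local sections. An immersed loop is put in normal
position by the similarity which sends `γ(0)` to the origin, `γ'(0)` to the first basis vector and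
`γ'(t₁)` to the upper half plane, for a `t₁` at which `γ'(t₁)` is not parallel to `γ'(0)`. A framing
near `V₀` is described by its angle relative to the normalised normal part of `V₀`, with value `0`
at `0`, and a loop in the circle by its angle relative to a nearby loop. Smoothness of a map between
the quotients then follows from a smooth lift (`smoothOn_of_lift`, `smoothOn₂_of_lift`).

**Components.** The frame `(T, V, T × V)` of a framed loop lifts to a path of spinors `q` in
`ℂ² ∖ 0` with `q(t + 2) = σ q(t)`, and the sign `σ = ± 1` is an invariant of the class in `ℳ`, the
parity. It is locally constant (`isClopen_parityClass`), and changing the framing by a relative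
rotation number `n` multiplies it by `(-1) ^ n` (`FramedLoop.HasSpinor.of_integral`). Conversely, the
spinor path of a framed loop of parity `σ` is, up to a path of phases depending only on `σ`, a loop
`Q = (z, w)` in `ℂ² ∖ 0`, and the curve closes up if and only if `z` and `w` are orthogonal in
`L²(S¹, ℂ)` and of equal norm. Loops with independent `z` and `w` are deformed into such loops by
the Gram–Schmidt process, and by a dimension count two spinor loops without zeros and with
independent components are joined, through a loop `(a, b e^{iπt})` with generic `a` and `b`, by a
path of spinor loops of this kind. So the
components of `ℳ` are the two parity classes (`exists_connectedComponent_eq`).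

**Sections.** Integrating the twist density, a framing `V` of `γ` can be rotated so that its twist
density becomes `c ‖γ'‖ + κπ/2`, where the constant `c` is determined by the total twist; the
rotation closes up if the totals differ by a multiple of `2π`, and it preserves the parity if they
differ by a multiple of `4π`. Hence each parity class contains exactly one framing, up to constant
twists, for which the total of `c ‖γ'‖` lies in `[0, 4π)` (`eq_twistSection_iff`). For `κ = 0` this
is the framing of constant twist rate and total twist in `[0, 2)`, for `κ = 1` the image of such an
anti-framing under `e^{iπt/4}`. It depends smoothly on `γ` as long as the total is not `0`
(`smoothOn_twistSection`), in particular over the open set of loops on which the total of the twist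
density is not `κπ` modulo `2π`. For `κ = 0` and `κ = 1` these sets are `𝒰` and `𝒰'`; they cover
`ℬ` because `0` and `π` are distinct modulo `2π`.

**The bundle.** Two framings of a curve of the same parity have an even relative rotation number, so
that half of the relative angle defines a loop in the circle (`exists_smul_eq`). This loop is unique
up to a constant because its square is, and it depends smoothly on the framings because the square
root of a unit complex number is smooth near `1`. So the two sections trivialise the parity class
over `𝒰` and `𝒰'` (`isFrechetPrincipalBundle_parityClass`).
-/

set_option linter.unusedSectionVars false

/-! ### Calculus in Fréchet spaces -/

section FrechetCalculus

variable {E F G : Type}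
  [AddCommGroup E] [Module ℝ E] [TopologicalSpace E] [IsFrechetSpace E]
  [AddCommGroup F] [Module ℝ F] [TopologicalSpace F] [IsFrechetSpace F]
  [AddCommGroup G] [Module ℝ G] [TopologicalSpace G] [IsFrechetSpace G]

/-- Mean value inclusion: if the derivative of a path stays in a closed convex set, so does the
increment of the path over the unit interval. -/
theorem sub_mem_of_slope_mem {K : Set F} (hK : Convex ℝ K) (hKc : IsClosed K) {φ φ' : ℝ → F}
    (h : ∀ s ∈ Icc (0 : ℝ) 1,
      Tendsto (fun ε : ℝ => ε⁻¹ • (φ (s + ε) - φ s)) (𝓝[≠] 0) (𝓝 (φ' s)))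
    (hmem : ∀ s ∈ Icc (0 : ℝ) 1, φ' s ∈ K) : φ 1 - φ 0 ∈ K := by
  by_contra hn
  -- a functional separating the increment from `K` contradicts the scalar mean value theorem
  obtain ⟨l, u, h1, h2⟩ := geometric_hahn_banach_point_closed hK hKc hn
  have hd : ∀ s ∈ Icc (0 : ℝ) 1, HasDerivAt (fun s => l (φ s)) (l (φ' s)) s := by
    intro s hs
    rw [hasDerivAt_iff_tendsto_slope_zero]
    have := (l.continuous.tendsto _).comp (h s hs)
    refine this.congr fun ε => ?_
    simp
  obtain ⟨c, hc, hc'⟩ := exists_hasDerivAt_eq_slope (fun s => l (φ s)) (fun s => l (φ' s))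
    one_pos (fun s hs => (hd s hs).continuousAt.continuousWithinAt)
    (fun s hs => hd s (Ioo_subset_Icc_self hs))
  have h3 := h2 _ (hmem c (Ioo_subset_Icc_self hc))
  simp only [sub_zero, div_one] at hc'
  rw [hc', ← map_sub] at h3
  exact lt_asymm h1 h3

theorem exists_closed_convex_nhds {y : F} {N : Set F} (hN : N ∈ 𝓝 y) :
    ∃ K ∈ 𝓝 y, IsClosed K ∧ Convex ℝ K ∧ K ⊆ N := by
  obtain ⟨N', hN', hc, hs⟩ := exists_mem_nhds_isClosed_subset hN
  obtain ⟨C, hC, hCc, hCs⟩ := (locallyConvexSpace_iff_exists_convex_subset ℝ F).1 inferInstance y N' hN'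
  exact ⟨closure C, mem_of_superset hC subset_closure, isClosed_closure, hCc.closure,
    (closure_minimal hCs hc).trans hs⟩

/-- The chain rule for directional derivatives, for an outer map with jointly continuous
directional derivative. -/
theorem tendsto_slope_comp {f : E → F} {g : F → G} {V : Set F} {dg : F × F → G}
    (hV : IsOpen V) {x v : E} {w : F} (hx : f x ∈ V)
    (hf : Tendsto (fun t : ℝ => t⁻¹ • (f (x + t • v) - f x)) (𝓝[≠] 0) (𝓝 w))
    (hg : ∀ y ∈ V, ∀ w : F,
      Tendsto (fun t : ℝ => t⁻¹ • (g (y + t • w) - g y)) (𝓝[≠] 0) (𝓝 (dg (y, w))))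
    (hdg : ContinuousOn dg (V ×ˢ univ)) :
    Tendsto (fun t : ℝ => t⁻¹ • (g (f (x + t • v)) - g (f x))) (𝓝[≠] 0) (𝓝 (dg (f x, w))) := by
  -- `wt` is the difference quotient of `f`, so that `f (x + t • v) = f x + t • wt t`
  set wt : ℝ → F := fun t => t⁻¹ • (f (x + t • v) - f x) with hwt
  rw [tendsto_iff_forall_eventually_mem]
  intro N hN
  obtain ⟨K, hK, hKc, hKconv, hKN⟩ := exists_closed_convex_nhds hN
  have hopen : IsOpen (V ×ˢ (univ : Set F)) := hV.prod isOpen_univ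
  have hKpre : dg ⁻¹' K ∩ (V ×ˢ univ) ∈ 𝓝 (f x, w) := by
    have hmem : (f x, w) ∈ V ×ˢ (univ : Set F) := ⟨hx, mem_univ _⟩
    exact inter_mem ((hdg.continuousAt (hopen.mem_nhds hmem)) hK) (hopen.mem_nhds hmem)
  -- the segment from `f x` to `f (x + t • v)` shrinks to `f x`, uniformly in its parameter
  have htend : Tendsto (fun p : ℝ × ℝ => (f x + (p.2 * p.1) • wt p.1, wt p.1))
      (𝓝[≠] 0 ×ˢ 𝓟 (Icc (0 : ℝ) 1)) (𝓝 (f x, w)) := by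
    have h1 : Tendsto (fun p : ℝ × ℝ => wt p.1) (𝓝[≠] 0 ×ˢ 𝓟 (Icc (0 : ℝ) 1)) (𝓝 w) :=
      hf.comp tendsto_fst
    have h2 : Tendsto (fun p : ℝ × ℝ => p.2 * p.1) (𝓝[≠] 0 ×ˢ 𝓟 (Icc (0 : ℝ) 1)) (𝓝 0) := by
      have h0 : Tendsto (fun p : ℝ × ℝ => |p.1|) (𝓝[≠] 0 ×ˢ 𝓟 (Icc (0 : ℝ) 1)) (𝓝 0) := by
        have : Tendsto (fun t : ℝ => |t|) (𝓝[≠] 0) (𝓝 0) := by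
          have := (continuous_abs.tendsto (0 : ℝ)).mono_left (nhdsWithin_le_nhds (s := {0}ᶜ))
          simpa using this
        exact this.comp tendsto_fst
      refine squeeze_zero_norm' ?_ h0
      rw [eventually_prod_principal_iff]
      refine Eventually.of_forall fun t s hs => ?_
      rw [norm_mul, Real.norm_eq_abs, Real.norm_eq_abs, abs_of_nonneg hs.1]
      exact mul_le_of_le_one_left (abs_nonneg _) hs.2
    have h3 := (h2.smul h1).const_add (f x)
    rw [zero_smul, add_zero] at h3
    exact h3.prodMk_nhds h1
  have hev := eventually_prod_principal_iff.1 (htend.eventually hKpre)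
  have hne : ∀ᶠ t : ℝ in 𝓝[≠] 0, t ≠ 0 := eventually_mem_nhdsWithin
  filter_upwards [hev, hne] with t ht ht0
  refine hKN ?_
  have hft : f (x + t • v) = f x + (1 * t) • wt t := by
    rw [hwt]
    simp only [one_mul]
    rw [smul_smul, mul_inv_cancel₀ ht0, one_smul, add_sub_cancel]
  -- mean value inclusion along this segment, on which the derivative of `g` stays in `K`
  have := sub_mem_of_slope_mem hKconv hKc (φ := fun s => t⁻¹ • g (f x + (s * t) • wt t))
    (φ' := fun s => dg (f x + (s * t) • wt t, wt t)) (fun s hs => ?_) (fun s hs => (ht s hs).1)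
  · simpa [hft, smul_sub] using this
  · have hy := hg _ (ht s hs).2.1 (wt t)
    have hc : Tendsto (fun ε : ℝ => ε * t) (𝓝[≠] 0) (𝓝[≠] 0) := by
      refine tendsto_nhdsWithin_iff.2 ⟨?_, ?_⟩
      · have := ((continuous_mul_const t).tendsto (0 : ℝ)).mono_left
          (nhdsWithin_le_nhds (s := {0}ᶜ))
        simpa using this
      · filter_upwards [eventually_mem_nhdsWithin] with ε hε using mul_ne_zero hε ht0
    refine (hy.comp hc).congr fun ε => ?_
    simp only [Function.comp, add_mul, add_smul, mul_inv, ← smul_sub, smul_smul, add_assoc]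

end FrechetCalculus

section Products

/-- A product of Fréchet spaces is a Fréchet space. -/
instance IsFrechetSpace.prod {E F : Type}
    [AddCommGroup E] [Module ℝ E] [TopologicalSpace E] [IsFrechetSpace E]
    [AddCommGroup F] [Module ℝ F] [TopologicalSpace F] [IsFrechetSpace F] :
    IsFrechetSpace (E × F) where
  metrizable := by
    have := IsFrechetSpace.metrizable (E := E)
    have := IsFrechetSpace.metrizable (E := F)
    infer_instance
  complete := by
    let _ := IsTopologicalAddGroup.rightUniformSpace E
    let _ := IsTopologicalAddGroup.rightUniformSpace F
    have : IsUniformAddGroup E := isUniformAddGroup_of_addCommGroup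
    have : IsUniformAddGroup F := isUniformAddGroup_of_addCommGroup
    have := IsFrechetSpace.complete (E := E)
    have := IsFrechetSpace.complete (E := F)
    have h : IsTopologicalAddGroup.rightUniformSpace (E × F) = instUniformSpaceProd :=
      IsUniformAddGroup.rightUniformSpace_eq
    rw [h]
    infer_instance

/-- A closed subspace of a Fréchet space is a Fréchet space. -/
theorem IsFrechetSpace.of_isClosed {E : Type}
    [AddCommGroup E] [Module ℝ E] [TopologicalSpace E] [IsFrechetSpace E] {K : Submodule ℝ E}
    (hK : IsClosed (K : Set E)) : IsFrechetSpace K where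
  toLocallyConvexSpace := LocallyConvexSpace.induced K.subtype
  metrizable := by
    have := IsFrechetSpace.metrizable (E := E)
    exact Topology.IsEmbedding.subtypeVal.metrizableSpace
  complete := by
    let _ := IsTopologicalAddGroup.rightUniformSpace E
    have : IsUniformAddGroup E := isUniformAddGroup_of_addCommGroup
    have := IsFrechetSpace.complete (E := E)
    have : IsUniformAddGroup K := IsUniformAddGroup.comap K.subtype
    have h : IsTopologicalAddGroup.rightUniformSpace K = instUniformSpaceSubtype :=
      IsUniformAddGroup.rightUniformSpace_eq
    rw [h]
    exact hK.completeSpace_coe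

end Products

section FrechetCalculus

variable {E F G H : Type}
  [AddCommGroup E] [Module ℝ E] [TopologicalSpace E] [IsFrechetSpace E]
  [AddCommGroup F] [Module ℝ F] [TopologicalSpace F] [IsFrechetSpace F]
  [AddCommGroup G] [Module ℝ G] [TopologicalSpace G] [IsFrechetSpace G]
  [AddCommGroup H] [Module ℝ H] [TopologicalSpace H] [IsFrechetSpace H]

theorem FrechetCn.continuousOn {n : ℕ} {f : E → F} {U : Set E} (h : FrechetCn n f U) :
    ContinuousOn f U := by
  cases n with
  | zero => exact h
  | succ n => exact h.1

theorem FrechetCn.of_succ {n : ℕ} : ∀ {E F : Type}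
    [AddCommGroup E] [Module ℝ E] [TopologicalSpace E]
    [AddCommGroup F] [Module ℝ F] [TopologicalSpace F] {f : E → F} {U : Set E},
    FrechetCn (n + 1) f U → FrechetCn n f U := by
  induction n with
  | zero => intro E F _ _ _ _ _ _ f U h; exact h.1
  | succ n ih =>
    intro E F _ _ _ _ _ _ f U h
    obtain ⟨h1, df, h2, h3⟩ := h
    exact ⟨h1, df, h2, ih h3⟩

theorem FrechetCn.mono {n : ℕ} : ∀ {E F : Type}
    [AddCommGroup E] [Module ℝ E] [TopologicalSpace E]
    [AddCommGroup F] [Module ℝ F] [TopologicalSpace F] {f : E → F} {U V : Set E},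
    FrechetCn n f U → V ⊆ U → FrechetCn n f V := by
  induction n with
  | zero => intro E F _ _ _ _ _ _ f U V h hV; exact ContinuousOn.mono h hV
  | succ n ih =>
    intro E F _ _ _ _ _ _ f U V h hV
    obtain ⟨h1, df, h2, h3⟩ := h
    exact ⟨h1.mono hV, df, fun x hx => h2 x (hV hx), ih h3 (prod_mono hV Subset.rfl)⟩

/-- Continuous linear maps are smooth. -/
theorem FrechetCn.of_linear {n : ℕ} : ∀ {E F : Type}
    [AddCommGroup E] [Module ℝ E] [TopologicalSpace E]
    [AddCommGroup F] [Module ℝ F] [TopologicalSpace F] (f : E →ₗ[ℝ] F) (_ : Continuous f)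
    (U : Set E), FrechetCn n f U := by
  induction n with
  | zero => intro E F _ _ _ _ _ _ f hf U; exact hf.continuousOn
  | succ n ih =>
    intro E F _ _ _ _ _ _ f hf U
    refine ⟨hf.continuousOn, f ∘ₗ LinearMap.snd ℝ E E, fun x _ v => ?_,
      ih (f ∘ₗ LinearMap.snd ℝ E E)
      (show Continuous (fun p : E × E => f p.2) from hf.comp continuous_snd) _⟩
    refine tendsto_const_nhds.congr' ?_
    filter_upwards [eventually_mem_nhdsWithin] with t ht
    simp [smul_smul, inv_mul_cancel₀ (show t ≠ 0 from ht)]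

theorem FrechetCn.const {n : ℕ} : ∀ {E F : Type}
    [AddCommGroup E] [Module ℝ E] [TopologicalSpace E]
    [AddCommGroup F] [Module ℝ F] [TopologicalSpace F] (c : F)
    (U : Set E), FrechetCn n (fun _ : E => c) U := by
  induction n with
  | zero => intro E F _ _ _ _ _ _ c U; exact continuousOn_const
  | succ n ih =>
    intro E F _ _ _ _ _ _ c U
    exact ⟨continuousOn_const, fun _ => 0, fun x _ v => by
      simpa using tendsto_const_nhds, ih 0 _⟩

theorem FrechetCn.prodMk {n : ℕ} : ∀ {E F G : Type}
    [AddCommGroup E] [Module ℝ E] [TopologicalSpace E]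
    [AddCommGroup F] [Module ℝ F] [TopologicalSpace F]
    [AddCommGroup G] [Module ℝ G] [TopologicalSpace G] {f : E → F} {g : E → G} {U : Set E},
    FrechetCn n f U → FrechetCn n g U → FrechetCn n (fun x => (f x, g x)) U := by
  induction n with
  | zero => intro E F G _ _ _ _ _ _ _ _ _ f g U hf hg; exact ContinuousOn.prodMk hf hg
  | succ n ih =>
    intro E F G _ _ _ _ _ _ _ _ _ f g U hf hg
    obtain ⟨h1, df, h2, h3⟩ := hf
    obtain ⟨k1, dg, k2, k3⟩ := hg
    exact ⟨h1.prodMk k1, fun p => (df p, dg p),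
      fun x hx v => (h2 x hx v).prodMk_nhds (k2 x hx v), ih h3 k3⟩

/-- The composition of maps of class `C^n` is of class `C^n`. -/
theorem FrechetCn.comp {n : ℕ} : ∀ {E F G : Type}
    [AddCommGroup E] [Module ℝ E] [TopologicalSpace E] [IsFrechetSpace E]
    [AddCommGroup F] [Module ℝ F] [TopologicalSpace F] [IsFrechetSpace F]
    [AddCommGroup G] [Module ℝ G] [TopologicalSpace G] [IsFrechetSpace G]
    {g : F → G} {f : E → F} {U : Set E} {V : Set F},
    IsOpen U → IsOpen V →
    FrechetCn n g V → FrechetCn n f U → MapsTo f U V → FrechetCn n (fun x => g (f x)) U := by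
  induction n with
  | zero =>
    intro E F G _ _ _ _ _ _ _ _ _ _ _ _ g f U V _ _ hg hf hUV
    exact ContinuousOn.comp hg hf hUV
  | succ n ih =>
    intro E F G _ _ _ _ _ _ _ _ _ _ _ _ g f U V hU hV hg hf hUV
    have hf' := hf.of_succ
    obtain ⟨h1, df, h2, h3⟩ := hf
    obtain ⟨k1, dg, k2, k3⟩ := hg
    refine ⟨k1.comp h1 hUV, fun p => dg (f p.1, df p), fun x hx v =>
      tendsto_slope_comp hV (hUV hx) (h2 x hx v) k2 k3.continuousOn, ?_⟩
    have hfst : FrechetCn n (fun p : E × E => f p.1) (U ×ˢ (univ : Set E)) :=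
      ih (hU.prod isOpen_univ) hU hf'
        (FrechetCn.of_linear (LinearMap.fst ℝ E E) continuous_fst _) (fun p hp => hp.1)
    exact ih (f := fun p : E × E => (f p.1, df p)) (hU.prod isOpen_univ) (hV.prod isOpen_univ) k3
      (hfst.prodMk h3) (fun p hp => ⟨hUV hp.1, mem_univ _⟩)

/-- On an open set, a map of class `C^n` for every `n` is smooth. -/
theorem FrechetSmoothOn.of_forall_frechetCn {f : E → F} {U : Set E} (hU : IsOpen U)
    (h : ∀ n, FrechetCn n f U) : FrechetSmoothOn f U :=
  fun _ hx => ⟨U, hU, hx, f, fun _ _ => rfl, h⟩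

theorem FrechetSmoothOn.mono {f : E → F} {S S' : Set E} (h : FrechetSmoothOn f S) (hS : S' ⊆ S) :
    FrechetSmoothOn f S' := by
  intro x hx
  obtain ⟨W, hW, hxW, g, hg, hgs⟩ := h x (hS hx)
  exact ⟨W, hW, hxW, g, hg.mono (inter_subset_inter_left _ hS), hgs⟩

theorem FrechetSmoothOn.congr {f f' : E → F} {S : Set E} (h : FrechetSmoothOn f S)
    (hf : EqOn f' f S) : FrechetSmoothOn f' S := by
  intro x hx
  obtain ⟨W, hW, hxW, g, hg, hgs⟩ := h x hx
  exact ⟨W, hW, hxW, g, (hf.mono inter_subset_left).trans hg, hgs⟩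

theorem FrechetSmoothOn.of_linear (f : E →ₗ[ℝ] F) (hf : Continuous f) (S : Set E) :
    FrechetSmoothOn f S :=
  fun _ _ => ⟨univ, isOpen_univ, mem_univ _, f, fun _ _ => rfl, fun _ => .of_linear f hf _⟩

theorem FrechetSmoothOn.const (c : F) (S : Set E) : FrechetSmoothOn (fun _ : E => c) S :=
  fun _ _ => ⟨univ, isOpen_univ, mem_univ _, _, fun _ _ => rfl, fun _ => .const c _⟩

theorem FrechetSmoothOn.id (S : Set E) : FrechetSmoothOn (fun x : E => x) S :=
  .of_linear LinearMap.id continuous_id S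

theorem FrechetSmoothOn.prodMk {f : E → F} {g : E → G} {S : Set E} (hf : FrechetSmoothOn f S)
    (hg : FrechetSmoothOn g S) : FrechetSmoothOn (fun x => (f x, g x)) S := by
  intro x hx
  obtain ⟨W, hW, hxW, f', hf', hfs⟩ := hf x hx
  obtain ⟨W', hW', hxW', g', hg', hgs⟩ := hg x hx
  refine ⟨W ∩ W', hW.inter hW', ⟨hxW, hxW'⟩, fun x => (f' x, g' x), fun y hy => ?_, fun n =>
    ((hfs n).mono inter_subset_left).prodMk ((hgs n).mono inter_subset_right)⟩
  exact Prod.ext (hf' ⟨hy.1, hy.2.1⟩) (hg' ⟨hy.1, hy.2.2⟩)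

theorem FrechetSmoothOn.comp {g : F → G} {f : E → F} {S : Set E} {T : Set F}
    (hg : FrechetSmoothOn g T) (hf : FrechetSmoothOn f S) (h : MapsTo f S T) :
    FrechetSmoothOn (fun x => g (f x)) S := by
  intro x hx
  obtain ⟨W, hW, hxW, f', hf', hfs⟩ := hf x hx
  obtain ⟨W', hW', hxW', g', hg', hgs⟩ := hg (f x) (h hx)
  have ho : IsOpen (W ∩ f' ⁻¹' W') := (hfs 0).continuousOn.isOpen_inter_preimage hW hW'
  refine ⟨W ∩ f' ⁻¹' W', ho, ⟨hxW, by rw [mem_preimage, ← hf' ⟨hx, hxW⟩]; exact hxW'⟩,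
    fun x => g' (f' x), fun y hy => ?_, fun n => ?_⟩
  · have h1 := hf' ⟨hy.1, hy.2.1⟩
    have h2 := hg' (x := f y) ⟨h hy.1, by rw [h1]; exact hy.2.2⟩
    exact h2.trans (congrArg g' h1)
  · exact FrechetCn.comp ho hW' (hgs n) ((hfs n).mono inter_subset_left) (fun y hy => hy.2)

theorem FrechetSmoothOn.continuousOn {f : E → F} {S : Set E} (hf : FrechetSmoothOn f S) :
    ContinuousOn f S := by
  intro x hx
  obtain ⟨W, hW, hxW, f', hf', hfs⟩ := hf x hx
  have h1 : ContinuousWithinAt f' (S ∩ W) x :=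
    (((hfs 0).continuousOn x hxW).continuousAt (hW.mem_nhds hxW)).continuousWithinAt
  have h2 := h1.congr (fun y hy => hf' hy) (hf' ⟨hx, hxW⟩)
  exact (continuousWithinAt_inter (hW.mem_nhds hxW)).1 h2

theorem FrechetSmoothOn.fst {f : E → F × G} {S : Set E} (hf : FrechetSmoothOn f S) :
    FrechetSmoothOn (fun x => (f x).1) S :=
  (FrechetSmoothOn.of_linear (LinearMap.fst ℝ F G) continuous_fst univ).comp hf (mapsTo_univ _ _)

theorem FrechetSmoothOn.snd {f : E → F × G} {S : Set E} (hf : FrechetSmoothOn f S) :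
    FrechetSmoothOn (fun x => (f x).2) S :=
  (FrechetSmoothOn.of_linear (LinearMap.snd ℝ F G) continuous_snd univ).comp hf (mapsTo_univ _ _)

theorem FrechetSmoothOn.add {f g : E → F} {S : Set E} (hf : FrechetSmoothOn f S)
    (hg : FrechetSmoothOn g S) : FrechetSmoothOn (fun x => f x + g x) S :=
  (FrechetSmoothOn.of_linear (LinearMap.fst ℝ F F + LinearMap.snd ℝ F F)
    (continuous_fst.add continuous_snd) univ).comp (hf.prodMk hg) (mapsTo_univ _ _)

theorem FrechetSmoothOn.sub {f g : E → F} {S : Set E} (hf : FrechetSmoothOn f S)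
    (hg : FrechetSmoothOn g S) : FrechetSmoothOn (fun x => f x - g x) S :=
  (FrechetSmoothOn.of_linear (LinearMap.fst ℝ F F - LinearMap.snd ℝ F F)
    (continuous_fst.sub continuous_snd) univ).comp (hf.prodMk hg) (mapsTo_univ _ _)

end FrechetCalculus

/-! ### The Fréchet space of smooth loops -/

namespace SmoothLoop

variable {F : Type} [NormedAddCommGroup F] [NormedSpace ℝ F]
  {F' : Type} [NormedAddCommGroup F'] [NormedSpace ℝ F']
  {X : Type} [TopologicalSpace X]

theorem ext {f g : SmoothLoop F} (h : ∀ t, f t = g t) : f = g := Subtype.ext (funext h)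

theorem add_apply (f g : SmoothLoop F) (t : ℝ) : (f + g) t = f t + g t := rfl
theorem sub_apply (f g : SmoothLoop F) (t : ℝ) : (f - g) t = f t - g t := rfl
theorem smul_apply (c : ℝ) (f : SmoothLoop F) (t : ℝ) : (c • f) t = c • f t := rfl
theorem zero_apply (t : ℝ) : (0 : SmoothLoop F) t = 0 := rfl

theorem contDiffAt_nat (f : SmoothLoop F) (k : ℕ) (t : ℝ) : ContDiffAt ℝ k (f : ℝ → F) t :=
  (f.contDiff.of_le (by exact_mod_cast le_top)).contDiffAt

theorem differentiable (f : SmoothLoop F) : Differentiable ℝ (f : ℝ → F) :=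
  f.contDiff.differentiable (by simp)

theorem continuous (f : SmoothLoop F) : Continuous (f : ℝ → F) := f.contDiff.continuous

/-- The jets of a loop, as a linear map to a product of spaces of continuous maps. -/
noncomputable def jets : SmoothLoop F →ₗ[ℝ] (ℕ → C(ℝ, F)) where
  toFun f k := f.jet k
  map_add' f g := by
    ext k t
    exact iteratedDeriv_add (f.contDiffAt_nat k t) (g.contDiffAt_nat k t)
  map_smul' c f := by
    ext k t
    exact iteratedDeriv_const_smul (f.contDiffAt_nat k t) c

theorem isInducing_jets : IsInducing (jets (F := F)) := ⟨rfl⟩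

theorem jets_injective : Function.Injective (jets (F := F)) := by
  intro f g h
  refine ext fun t => ?_
  have := DFunLike.congr_fun (congrFun h 0) t
  simpa [jets, jet] using this

theorem isEmbedding_jets : IsEmbedding (jets (F := F)) := ⟨isInducing_jets, jets_injective⟩

theorem continuous_eval_jet (k : ℕ) :
    Continuous fun p : SmoothLoop F × ℝ => iteratedDeriv k (p.1 : ℝ → F) p.2 := by
  have h : Continuous fun f : SmoothLoop F => f.jet k :=
    (continuous_apply k).comp isInducing_jets.continuous
  exact continuous_eval.comp (h.prodMap continuous_id)

theorem continuous_eval : Continuous fun p : SmoothLoop F × ℝ => p.1 p.2 := by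
  simpa using continuous_eval_jet (F := F) 0

/-- Continuity into the loop space is joint continuity of all derivatives. -/
theorem continuous_of_jets {A : X → SmoothLoop F}
    (h : ∀ k, Continuous fun p : X × ℝ => iteratedDeriv k (A p.1 : ℝ → F) p.2) :
    Continuous A := by
  refine isInducing_jets.continuous_iff.2 (continuous_pi fun k => ?_)
  exact ContinuousMap.continuous_of_continuous_uncurry _ (h k)

theorem continuousOn_of_jets {A : X → SmoothLoop F} {s : Set X}
    (h : ∀ k, ContinuousOn (fun p : X × ℝ => iteratedDeriv k (A p.1 : ℝ → F) p.2)
      (s ×ˢ univ)) : ContinuousOn A s := by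
  rw [continuousOn_iff_continuous_domRestrict]
  refine continuous_of_jets fun k => ?_
  exact (h k).comp_continuous (f := fun p : s × ℝ => ((p.1 : X), p.2)) (by fun_prop)
    (fun p => ⟨p.1.2, mem_univ _⟩)

/-- The sequences of derivatives of loops are the sequences in which every term is a primitive of
the next one and the first is periodic. These are closed conditions, whence completeness. -/
theorem range_jets [CompleteSpace F] : range (jets (F := F)) =
    {g | (∀ t, g 0 (t + 2) = g 0 t) ∧
      ∀ k t, g k t = g k 0 + ∫ s in (0 : ℝ)..t, g (k + 1) s} := by
  ext g
  constructor
  · rintro ⟨f, rfl⟩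
    refine ⟨fun t => by simpa [jets, jet] using f.periodic t, fun k t => ?_⟩
    have hd : ∀ s, HasDerivAt (iteratedDeriv k (f : ℝ → F)) (iteratedDeriv (k + 1) (f : ℝ → F) s) s := by
      intro s
      rw [iteratedDeriv_succ]
      exact ((f.contDiff.differentiable_iteratedDeriv k (by exact_mod_cast ENat.natCast_lt_top k)) s).hasDerivAt
    have := intervalIntegral.integral_eq_sub_of_hasDerivAt (a := 0) (b := t) (fun s _ => hd s)
      ((f.contDiff.continuous_iteratedDeriv (k + 1) (by exact_mod_cast le_top)).intervalIntegrable _ _)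
    change iteratedDeriv k (f : ℝ → F) t = iteratedDeriv k (f : ℝ → F) 0 +
      ∫ s in (0 : ℝ)..t, iteratedDeriv (k + 1) (f : ℝ → F) s
    rw [this, add_sub_cancel]
  · rintro ⟨hp, hd⟩
    have hderiv : ∀ k t, HasDerivAt (g k) (g (k + 1) t) t := by
      intro k t
      have h1 : HasDerivAt (fun t => ∫ s in (0 : ℝ)..t, g (k + 1) s) (g (k + 1) t) t :=
        intervalIntegral.integral_hasDerivAt_right
          ((g (k + 1)).continuous.intervalIntegrable _ _)
          (g (k + 1)).continuous.stronglyMeasurable.stronglyMeasurableAtFilter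
          (g (k + 1)).continuous.continuousAt
      have := h1.const_add (g k 0)
      rwa [show (g k : ℝ → F) = fun t => g k 0 + ∫ s in (0 : ℝ)..t, g (k + 1) s from
        funext (hd k)]
    have hit : ∀ k, iteratedDeriv k (g 0) = g k := by
      intro k
      induction k with
      | zero => simp
      | succ k ih => rw [iteratedDeriv_succ, ih]; exact funext fun t => (hderiv k t).deriv
    have hs : ContDiff ℝ ∞ (g 0) := by
      refine contDiff_of_differentiable_iteratedDeriv fun m _ => ?_
      rw [hit m]
      exact fun t => (hderiv m t).differentiableAt
    refine ⟨⟨g 0, hs, hp⟩, ?_⟩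
    ext k t
    exact congrFun (hit k) t

theorem isClosed_range_jets [CompleteSpace F] : IsClosed (range (jets (F := F))) := by
  rw [range_jets]
  have hev : ∀ k, ∀ t : ℝ, Continuous fun g : ℕ → C(ℝ, F) => g k t := fun k t =>
    (continuous_eval_const t).comp (continuous_apply k)
  have hint : ∀ k, ∀ t : ℝ, Continuous fun g : ℕ → C(ℝ, F) => ∫ s in (0 : ℝ)..t, g k s := by
    intro k t
    refine intervalIntegral.continuous_parametric_intervalIntegral_of_continuous
      (f := fun (g : ℕ → C(ℝ, F)) s => g k s) ?_ continuous_const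
    exact ContinuousEval.continuous_eval.comp (((continuous_apply k).comp continuous_fst).prodMk continuous_snd)
  simp only [ofPred_and, ofPred_forall]
  refine (isClosed_iInter fun t => isClosed_eq (hev _ _) (hev _ _)).inter
    (isClosed_iInter fun k => isClosed_iInter fun t => isClosed_eq (hev _ _)
      ((hev _ _).add (hint _ _)))

instance : IsTopologicalAddGroup (SmoothLoop F) := topologicalAddGroup_induced (jets (F := F))

theorem completeSpace [CompleteSpace F] :
    @CompleteSpace (SmoothLoop F) (IsTopologicalAddGroup.rightUniformSpace (SmoothLoop F)) := by
  have hg : IsUniformAddGroup C(ℝ, F) := by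
    have hu := (ContinuousMap.isUniformEmbedding_toUniformOnFunIsCompact
      (α := ℝ) (β := F)).isUniformInducing
    refine ⟨hu.uniformContinuous_iff.2 ?_⟩
    exact (uniformContinuous_sub (α := UniformOnFun ℝ F {K | IsCompact K})).comp
      (hu.uniformContinuous.prodMap hu.uniformContinuous)
  have : IsUniformAddGroup (ℕ → C(ℝ, F)) := inferInstance
  let u : UniformSpace (SmoothLoop F) := UniformSpace.comap jets inferInstance
  have : @IsUniformAddGroup (SmoothLoop F) u _ := IsUniformAddGroup.comap jets
  have h : IsTopologicalAddGroup.rightUniformSpace (SmoothLoop F) = u :=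
    IsUniformAddGroup.rightUniformSpace_eq
  rw [h]
  have hu : IsUniformInducing (jets (F := F)) := ⟨rfl⟩
  exact hu.completeSpace isClosed_range_jets.isComplete

/-- The loop space is a Fréchet space. -/
instance [CompleteSpace F] : IsFrechetSpace (SmoothLoop F) where
  toContinuousSMul := continuousSMul_induced (jets (F := F))
  toLocallyConvexSpace := LocallyConvexSpace.induced (jets (F := F))
  metrizable := isEmbedding_jets.metrizableSpace
  complete := completeSpace

/-! ### Linear operators on loops -/

theorem iteratedDeriv_prodMk {f : ℝ → F} {g : ℝ → F'} (hf : ContDiff ℝ ∞ f)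
    (hg : ContDiff ℝ ∞ g) (k : ℕ) :
    iteratedDeriv k (fun t => (f t, g t)) = fun t => (iteratedDeriv k f t, iteratedDeriv k g t) := by
  induction k with
  | zero => simp
  | succ k ih =>
    ext1 t
    rw [iteratedDeriv_succ, ih, iteratedDeriv_succ, iteratedDeriv_succ]
    exact ((hf.differentiable_iteratedDeriv k (by exact_mod_cast ENat.natCast_lt_top k) t).hasDerivAt.prodMk
      (hg.differentiable_iteratedDeriv k (by exact_mod_cast ENat.natCast_lt_top k) t).hasDerivAt).deriv

/-- The pairing of two loops. -/
def pair (f : SmoothLoop F) (g : SmoothLoop F') : SmoothLoop (F × F') :=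
  ⟨fun t => (f t, g t), f.contDiff.prodMk g.contDiff,
    fun t => Prod.ext (f.periodic t) (g.periodic t)⟩

theorem pair_apply (f : SmoothLoop F) (g : SmoothLoop F') (t : ℝ) : pair f g t = (f t, g t) := rfl

/-- The pairing, as a linear map. -/
noncomputable def pairₗ : SmoothLoop F × SmoothLoop F' →ₗ[ℝ] SmoothLoop (F × F') where
  toFun p := pair p.1 p.2
  map_add' _ _ := rfl
  map_smul' _ _ := rfl

theorem continuous_pairₗ : Continuous (pairₗ (F := F) (F' := F')) := by
  refine continuous_of_jets fun k => ?_
  have : (fun p : (SmoothLoop F × SmoothLoop F') × ℝ =>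
      iteratedDeriv k ((pairₗ p.1 : SmoothLoop (F × F')) : ℝ → F × F') p.2) = fun p =>
      (iteratedDeriv k (p.1.1 : ℝ → F) p.2, iteratedDeriv k (p.1.2 : ℝ → F') p.2) := by
    ext1 p
    exact congrFun (iteratedDeriv_prodMk p.1.1.contDiff p.1.2.contDiff k) p.2
  rw [this]
  exact ((continuous_eval_jet k).comp (continuous_fst.fst.prodMk continuous_snd)).prodMk
    ((continuous_eval_jet k).comp (continuous_fst.snd.prodMk continuous_snd))

/-- The derivative of loops. -/
noncomputable def derivₗ : SmoothLoop F →ₗ[ℝ] SmoothLoop F where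
  toFun f := ⟨deriv f, (contDiff_infty_iff_deriv.1 f.contDiff).2, fun t => by
    rw [← deriv_comp_add_const]
    exact congrArg (fun f => deriv f t) (funext f.periodic)⟩
  map_add' f g := ext fun t => deriv_add (f.differentiable t) (g.differentiable t)
  map_smul' c f := ext fun t => deriv_const_smul c (f.differentiable t)

theorem derivₗ_apply (f : SmoothLoop F) (t : ℝ) : derivₗ f t = deriv f t := rfl

theorem hasDerivAt (f : SmoothLoop F) (t : ℝ) : HasDerivAt (f : ℝ → F) (derivₗ f t) t :=
  (f.differentiable t).hasDerivAt

theorem continuous_derivₗ : Continuous (derivₗ (F := F)) := by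
  refine continuous_of_jets fun k => ?_
  refine (continuous_eval_jet (F := F) (k + 1)).congr fun p => ?_
  rw [iteratedDeriv_succ']
  rfl

/-- Constant loops. -/
noncomputable def const : F →ₗ[ℝ] SmoothLoop F where
  toFun c := ⟨fun _ => c, contDiff_const, fun _ => rfl⟩
  map_add' _ _ := rfl
  map_smul' _ _ := rfl

theorem const_apply (c : F) (t : ℝ) : const c t = c := rfl

theorem continuous_const : Continuous (const (F := F)) := by
  refine continuous_of_jets fun k => ?_
  change Continuous fun p : F × ℝ => iteratedDeriv k (fun _ => p.1) p.2
  simp only [iteratedDeriv_const]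
  split_ifs
  · exact continuous_fst
  · exact _root_.continuous_const

/-- Evaluation at a point, as a constant loop. -/
noncomputable def evalₗ (t₀ : ℝ) : SmoothLoop F →ₗ[ℝ] SmoothLoop F where
  toFun f := const (f t₀)
  map_add' _ _ := rfl
  map_smul' _ _ := rfl

theorem continuous_evalₗ (t₀ : ℝ) : Continuous (evalₗ (F := F) t₀) :=
  continuous_const.comp (continuous_eval.comp (continuous_id.prodMk _root_.continuous_const))

theorem intervalIntegrable (f : SmoothLoop F) (a b : ℝ) :
    IntervalIntegrable f MeasureTheory.volume a b := f.continuous.intervalIntegrable a b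

/-- The integral over one period, as a constant loop. -/
noncomputable def integralₗ : SmoothLoop F →ₗ[ℝ] SmoothLoop F where
  toFun f := const (∫ s in (0 : ℝ)..2, f s)
  map_add' f g := by
    rw [← map_add]
    congr 1
    exact intervalIntegral.integral_add (f.intervalIntegrable _ _) (g.intervalIntegrable _ _)
  map_smul' c f := by
    rw [RingHom.id_apply, ← map_smul]
    congr 1
    exact intervalIntegral.integral_smul c _

theorem integralₗ_apply (f : SmoothLoop F) (t : ℝ) : integralₗ f t = ∫ s in (0 : ℝ)..2, f s := rfl

theorem continuous_primitive :
    Continuous fun p : SmoothLoop F × ℝ => ∫ s in (0 : ℝ)..p.2, p.1 s := by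
  refine intervalIntegral.continuous_parametric_intervalIntegral_of_continuous
    (f := fun (p : SmoothLoop F × ℝ) s => p.1 s) ?_ continuous_snd
  exact continuous_eval.comp (continuous_fst.fst.prodMk continuous_snd)

theorem continuous_integral : Continuous fun f : SmoothLoop F => ∫ s in (0 : ℝ)..2, f s :=
  continuous_primitive.comp (continuous_id.prodMk _root_.continuous_const)

theorem continuous_integralₗ : Continuous (integralₗ (F := F)) :=
  continuous_const.comp continuous_integral

theorem integral_period (f : SmoothLoop F) (t : ℝ) :
    ∫ s in t..t + 2, f s = ∫ s in (0 : ℝ)..2, f s := by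
  simpa using f.periodic.intervalIntegral_add_eq t 0

variable [CompleteSpace F]

theorem hasDerivAt_primitive (f : SmoothLoop F) (t : ℝ) :
    HasDerivAt (fun t => ∫ s in (0 : ℝ)..t, f s) (f t) t :=
  intervalIntegral.integral_hasDerivAt_right (f.intervalIntegrable _ _)
    f.continuous.stronglyMeasurable.stronglyMeasurableAtFilter f.continuous.continuousAt

theorem contDiff_primitive (f : SmoothLoop F) :
    ContDiff ℝ ∞ (fun t => ∫ s in (0 : ℝ)..t, f s) := by
  rw [contDiff_infty_iff_deriv]
  refine ⟨fun t => (f.hasDerivAt_primitive t).differentiableAt, ?_⟩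
  rw [show deriv (fun t => ∫ s in (0 : ℝ)..t, f s) = f from
    funext fun t => (f.hasDerivAt_primitive t).deriv]
  exact f.contDiff

theorem primitive_add_two (f : SmoothLoop F) (t : ℝ) :
    ∫ s in (0 : ℝ)..t + 2, f s = (∫ s in (0 : ℝ)..t, f s) + ∫ s in (0 : ℝ)..2, f s := by
  rw [← f.integral_period t, intervalIntegral.integral_add_adjacent_intervals] <;>
    exact f.intervalIntegrable _ _

/-- The primitive, vanishing at `0`, of the loop minus its mean value. -/
noncomputable def primₗ : SmoothLoop F →ₗ[ℝ] SmoothLoop F where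
  toFun f := ⟨fun t => (∫ s in (0 : ℝ)..t, f s) - (t / 2) • ∫ s in (0 : ℝ)..2, f s,
    f.contDiff_primitive.sub ((contDiff_id.div_const 2).smul contDiff_const), fun t => by
      simp only [primitive_add_two, add_div, add_smul]
      rw [div_self two_ne_zero, one_smul]
      abel⟩
  map_add' f g := ext fun t => by
    have h : ∀ t, ∫ s in (0 : ℝ)..t, (f + g) s
        = (∫ s in (0 : ℝ)..t, f s) + ∫ s in (0 : ℝ)..t, g s := fun t =>
      intervalIntegral.integral_add (f.intervalIntegrable _ _) (g.intervalIntegrable _ _)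
    change (∫ s in (0 : ℝ)..t, (f + g) s) - (t / 2) • ∫ s in (0 : ℝ)..2, (f + g) s =
      ((∫ s in (0 : ℝ)..t, f s) - (t / 2) • ∫ s in (0 : ℝ)..2, f s) +
      ((∫ s in (0 : ℝ)..t, g s) - (t / 2) • ∫ s in (0 : ℝ)..2, g s)
    rw [h, h, smul_add]
    abel
  map_smul' c f := ext fun t => by
    have h : ∀ t, ∫ s in (0 : ℝ)..t, (c • f) s = c • ∫ s in (0 : ℝ)..t, f s := fun t =>
      intervalIntegral.integral_smul c _
    change (∫ s in (0 : ℝ)..t, (c • f) s) - (t / 2) • ∫ s in (0 : ℝ)..2, (c • f) s =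
      c • ((∫ s in (0 : ℝ)..t, f s) - (t / 2) • ∫ s in (0 : ℝ)..2, f s)
    rw [h, h, smul_sub, smul_comm]

theorem primₗ_apply (f : SmoothLoop F) (t : ℝ) :
    primₗ f t = (∫ s in (0 : ℝ)..t, f s) - (t / 2) • ∫ s in (0 : ℝ)..2, f s := rfl

theorem primₗ_zero (f : SmoothLoop F) : primₗ f 0 = 0 := by simp [primₗ_apply]

theorem derivₗ_primₗ (f : SmoothLoop F) :
    derivₗ (primₗ f) = f - (1 / 2 : ℝ) • integralₗ f := by
  refine ext fun t => ?_
  have h2 : HasDerivAt (fun t : ℝ => (t / 2) • ∫ s in (0 : ℝ)..2, f s)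
      ((1 / 2 : ℝ) • ∫ s in (0 : ℝ)..2, f s) t := ((hasDerivAt_id t).div_const 2).smul_const _
  exact ((f.hasDerivAt_primitive t).sub h2).deriv

theorem continuous_primₗ : Continuous (primₗ (F := F)) := by
  refine continuous_of_jets fun k => ?_
  cases k with
  | zero =>
    simp only [iteratedDeriv_zero, primₗ_apply]
    exact continuous_primitive.sub ((continuous_snd.div_const 2).smul
      (continuous_integral.comp continuous_fst))
  | succ k =>
    have h : Continuous fun f : SmoothLoop F => f - (1 / 2 : ℝ) • integralₗ f :=
      continuous_id.sub (continuous_integralₗ.const_smul (1 / 2 : ℝ))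
    refine ((continuous_eval_jet (F := F) k).comp (h.prodMap continuous_id)).congr fun p => ?_
    rw [iteratedDeriv_succ']
    change iteratedDeriv k ((p.1 - (1 / 2 : ℝ) • integralₗ p.1 : SmoothLoop F) : ℝ → F) p.2 =
      iteratedDeriv k (derivₗ (primₗ p.1) : ℝ → F) p.2
    rw [derivₗ_primₗ]

end SmoothLoop

/-! ### Superposition operators -/

namespace SmoothLoop

variable {F : Type} [NormedAddCommGroup F] [NormedSpace ℝ F]
  {F' : Type} [NormedAddCommGroup F'] [NormedSpace ℝ F']

/-- The loop given by a smooth function of period `2`. -/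
def mk (g : ℝ → F) (h : ContDiff ℝ ∞ g) (h' : Function.Periodic g 2) : SmoothLoop F := ⟨g, h, h'⟩

theorem mk_apply (g : ℝ → F) (h : ContDiff ℝ ∞ g) (h' : Function.Periodic g 2) (t : ℝ) :
    mk g h h' t = g t := rfl

open Classical in
/-- The loop with values `g t`, or `0` if `g` is not a smooth loop. -/
noncomputable def ofFun (g : ℝ → F) : SmoothLoop F := 
  if h : ContDiff ℝ ∞ g ∧ Function.Periodic g 2 then mk g h.1 h.2 else 0

theorem ofFun_apply {g : ℝ → F} (h : ContDiff ℝ ∞ g) (h' : Function.Periodic g 2) (t : ℝ) :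
    ofFun g t = g t := by
  have : ofFun g = mk g h h' := dif_pos ⟨h, h'⟩
  rw [this, mk_apply]

/-- The superposition operator `f ↦ Φ ∘ f`. -/
noncomputable def superpose (Φ : F → F') (f : SmoothLoop F) : SmoothLoop F' :=
  ofFun fun t => Φ (f t)

/-- The loops with values in `Ω`. -/
def valuedIn (Ω : Set F) : Set (SmoothLoop F) := {f | ∀ t, f t ∈ Ω}

theorem contDiff_comp {Φ : F → F'} {Ω : Set F} (hΩ : IsOpen Ω) (hΦ : ContDiffOn ℝ ∞ Φ Ω)
    {f : ℝ → F} (hf : ContDiff ℝ ∞ f) (hfΩ : ∀ t, f t ∈ Ω) : ContDiff ℝ ∞ fun t => Φ (f t) :=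
  contDiff_iff_contDiffAt.2 fun t =>
    (hΦ.contDiffAt (hΩ.mem_nhds (hfΩ t))).comp t hf.contDiffAt

theorem superpose_apply {Φ : F → F'} {Ω : Set F} (hΩ : IsOpen Ω) (hΦ : ContDiffOn ℝ ∞ Φ Ω)
    {f : SmoothLoop F} (hf : f ∈ valuedIn Ω) (t : ℝ) : superpose Φ f t = Φ (f t) :=
  ofFun_apply (contDiff_comp hΩ hΦ f.contDiff hf)
    (fun t => congrArg Φ (f.periodic t)) t

theorem mem_valuedIn_iff {Ω : Set F} {f : SmoothLoop F} :
    f ∈ valuedIn Ω ↔ ∀ t ∈ Icc (0 : ℝ) 2, f t ∈ Ω := by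
  refine ⟨fun h t _ => h t, fun h t => ?_⟩
  obtain ⟨s, hs, hst⟩ := f.periodic.exists_mem_Ico₀ two_pos t
  rw [hst]
  exact h s (Ico_subset_Icc_self hs)

theorem isOpen_valuedIn {Ω : Set F} (hΩ : IsOpen Ω) : IsOpen (valuedIn Ω) := by
  have h : Continuous fun f : SmoothLoop F => f.jet 0 :=
    (continuous_apply 0).comp isInducing_jets.continuous
  have : valuedIn Ω = (fun f : SmoothLoop F => f.jet 0) ⁻¹' {g | MapsTo g (Icc (0 : ℝ) 2) Ω} := by
    ext f
    rw [mem_valuedIn_iff]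
    simp [MapsTo, jet]
  rw [this]
  exact (ContinuousMap.isOpen_setOfPred_mapsTo isCompact_Icc hΩ).preimage h

/-- The second component `(x, v) ↦ dΦ(x) v` of the tangent map of `Φ`. -/
noncomputable def tangent (Φ : F → F') (p : F × F) : F' := fderiv ℝ Φ p.1 p.2

theorem contDiffOn_tangent {Φ : F → F'} {Ω : Set F} (hΩ : IsOpen Ω) (hΦ : ContDiffOn ℝ ∞ Φ Ω) :
    ContDiffOn ℝ ∞ (tangent Φ) (Ω ×ˢ univ) :=
  ((hΦ.fderiv_of_isOpen hΩ (m := ∞) (by simp)).comp contDiff_fst.contDiffOn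
    (fun _ hp => hp.1)).clm_apply contDiff_snd.contDiffOn

theorem fderiv_tangent {Φ : F → F'} {Ω : Set F} (hΩ : IsOpen Ω) (hΦ : ContDiffOn ℝ ∞ Φ Ω)
    {x : F} (hx : x ∈ Ω) (u v w : F) :
    fderiv ℝ (tangent Φ) (x, u) (v, w) = fderiv ℝ (fderiv ℝ Φ) x v u + fderiv ℝ Φ x w := by
  have h1 : HasFDerivAt (fderiv ℝ Φ) (fderiv ℝ (fderiv ℝ Φ) x) x :=
    (((hΦ.fderiv_of_isOpen hΩ (m := ∞) (by simp)).contDiffAt (hΩ.mem_nhds hx)).differentiableAt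
      (by simp)).hasFDerivAt
  have h2 : HasFDerivAt (fun p : F × F => fderiv ℝ Φ p.1)
      ((fderiv ℝ (fderiv ℝ Φ) x).comp (ContinuousLinearMap.fst ℝ F F)) (x, u) :=
    HasFDerivAt.comp (x, u) (f := Prod.fst) h1 hasFDerivAt_fst
  have h3 := h2.clm_apply (hasFDerivAt_snd (𝕜 := ℝ) (p := (x, u)))
  have h4 : fderiv ℝ (tangent Φ) (x, u) = _ := h3.fderiv
  rw [h4]
  simp [add_comm]

/-- Symmetry of second derivatives, for the iterated tangent map. -/
theorem fderiv_tangent_swap {Φ : F → F'} {Ω : Set F} (hΩ : IsOpen Ω) (hΦ : ContDiffOn ℝ ∞ Φ Ω)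
    {x : F} (hx : x ∈ Ω) (u v w : F) :
    fderiv ℝ (tangent Φ) (x, u) (v, w) = fderiv ℝ (tangent Φ) (x, v) (u, w) := by
  rw [fderiv_tangent hΩ hΦ hx, fderiv_tangent hΩ hΦ hx]
  have := (hΦ.contDiffAt (hΩ.mem_nhds hx)).isSymmSndFDerivAt
    (by simpa using (WithTop.coe_le_coe.2 le_top : ((2 : ℕ∞) : WithTop ℕ∞) ≤ ((⊤ : ℕ∞) : WithTop ℕ∞)))
  rw [this.eq]

theorem deriv_comp_eq_tangent {Φ : F → F'} {Ω : Set F} (hΩ : IsOpen Ω) (hΦ : ContDiffOn ℝ ∞ Φ Ω)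
    (f : SmoothLoop F) {t : ℝ} (hf : f t ∈ Ω) :
    deriv (fun t => Φ (f t)) t = tangent Φ (pair f (derivₗ f) t) :=
  (((hΦ.contDiffAt (hΩ.mem_nhds hf)).differentiableAt (by simp)).hasFDerivAt.comp_hasDerivAt t
    (f.hasDerivAt t)).deriv

theorem continuous_pair_derivₗ : Continuous fun f : SmoothLoop F => pair f (derivₗ f) :=
  continuous_pairₗ.comp (continuous_id.prodMk continuous_derivₗ)

/-- Joint continuity of the derivatives of `Φ ∘ f`, by induction on their order: the derivative of
`Φ ∘ f` is the composition of the tangent map of `Φ` with the loop `(f, f')`. -/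
theorem continuousOn_jet_comp (k : ℕ) :
    ∀ {F F' : Type} [NormedAddCommGroup F] [NormedSpace ℝ F] [NormedAddCommGroup F']
      [NormedSpace ℝ F'] {Φ : F → F'} {Ω : Set F} (_ : IsOpen Ω) (_ : ContDiffOn ℝ ∞ Φ Ω),
      ContinuousOn (fun p : SmoothLoop F × ℝ => iteratedDeriv k (fun t => Φ (p.1 t)) p.2)
        (valuedIn Ω ×ˢ univ) := by
  induction k with
  | zero =>
    intro F F' _ _ _ _ Φ Ω _ hΦ
    simp only [iteratedDeriv_zero]
    exact hΦ.continuousOn.comp continuous_eval.continuousOn (fun p hp => hp.1 _)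
  | succ k ih =>
    intro F F' _ _ _ _ Φ Ω hΩ hΦ
    have h1 := ih (hΩ.prod isOpen_univ) (contDiffOn_tangent hΩ hΦ)
    have h2 := h1.comp (f := fun p : SmoothLoop F × ℝ => (pair p.1 (derivₗ p.1), p.2))
      (s := valuedIn Ω ×ˢ univ)
      (continuous_pair_derivₗ.prodMap continuous_id).continuousOn
      (fun p hp => ⟨fun t => ⟨hp.1 t, mem_univ _⟩, mem_univ _⟩)
    refine h2.congr fun p hp => ?_
    rw [iteratedDeriv_succ', show deriv (fun t => Φ (p.1 t)) = _ from
      funext fun t => deriv_comp_eq_tangent hΩ hΦ p.1 (hp.1 t)]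
    rfl

theorem continuousOn_superpose {Φ : F → F'} {Ω : Set F} (hΩ : IsOpen Ω)
    (hΦ : ContDiffOn ℝ ∞ Φ Ω) : ContinuousOn (superpose Φ) (valuedIn Ω) := by
  refine continuousOn_of_jets fun k => (continuousOn_jet_comp k hΩ hΦ).congr fun p hp => ?_
  rw [show (superpose Φ p.1 : ℝ → F') = fun t => Φ (p.1 t) from
    funext fun t => superpose_apply hΩ hΦ hp.1 t]

/-- The difference quotient of a superposition operator, extended to parameter `0` by the derivative. -/
noncomputable def quot (Φ : F → F') (f v : SmoothLoop F) (s t : ℝ) : F' :=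
  if s = 0 then tangent Φ (f t, v t) else s⁻¹ • (Φ (f t + s • v t) - Φ (f t))

/-- Joint continuity of the difference quotient; at the parameter `0` it is the strict
differentiability of `Φ`. -/
theorem continuousOn_quot {Φ : F → F'} {Ω : Set F} (hΩ : IsOpen Ω)
    (hΦ : ContDiffOn ℝ ∞ Φ Ω) {f v : SmoothLoop F} (hf : f ∈ valuedIn Ω) :
    ContinuousOn (fun p : ℝ × ℝ => quot Φ f v p.1 p.2) ({s | f + s • v ∈ valuedIn Ω} ×ˢ univ) := by
  rintro ⟨s, t⟩ ⟨hs, -⟩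
  refine ContinuousAt.continuousWithinAt ?_
  have hcf : ContinuousAt (fun p : ℝ × ℝ => f p.2) (s, t) :=
    (f.continuous.comp continuous_snd).continuousAt
  have hcv : ContinuousAt (fun p : ℝ × ℝ => v p.2) (s, t) :=
    (v.continuous.comp continuous_snd).continuousAt
  have hcs : ContinuousAt (fun p : ℝ × ℝ => p.1) (s, t) := continuousAt_fst
  have hcfv : ContinuousAt (fun p : ℝ × ℝ => f p.2 + p.1 • v p.2) (s, t) :=
    hcf.add (hcs.smul hcv)
  by_cases h0 : s = 0
  · subst h0
    set x := f t with hx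
    have hΦx : ContDiffAt ℝ ∞ Φ x := hΦ.contDiffAt (hΩ.mem_nhds (hf t))
    have hstrict := hΦx.hasStrictFDerivAt (by simp)
    have htan : ContinuousAt (fun p : ℝ × ℝ => tangent Φ (f p.2, v p.2)) (0, t) :=
      ContinuousAt.comp (f := fun p : ℝ × ℝ => (f p.2, v p.2)) (g := tangent Φ)
        ((contDiffOn_tangent hΩ hΦ).continuousOn.continuousAt
          ((hΩ.prod isOpen_univ).mem_nhds ⟨hf t, mem_univ _⟩)) (hcf.prodMk hcv)
    have hval : quot Φ f v 0 t = tangent Φ (f t, v t) := by simp [quot]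
    have hdx : ContinuousAt (fun p : ℝ × ℝ => fderiv ℝ Φ x (v p.2)) (0, t) :=
      (fderiv ℝ Φ x).continuous.continuousAt.comp hcv
    have hR : Tendsto (fun p : ℝ × ℝ => (if p.1 = 0 then 0 else p.1⁻¹ • (Φ (f p.2 + p.1 • v p.2)
        - Φ (f p.2) - fderiv ℝ Φ x (p.1 • v p.2)))) (𝓝 (0, t)) (𝓝 0) := by
      have hpair : Tendsto (fun p : ℝ × ℝ => (f p.2 + p.1 • v p.2, f p.2)) (𝓝 (0, t))
          (𝓝 (x, x)) := by
        have := hcfv.tendsto.prodMk_nhds hcf.tendsto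
        simpa using this
      have hO := hstrict.isLittleO.comp_tendsto hpair
      rw [Metric.tendsto_nhds]
      intro ε hε
      set M := ‖v t‖ + 1 with hM
      have hMpos : 0 < M := by positivity
      have hvM : ∀ᶠ p : ℝ × ℝ in 𝓝 (0, t), ‖v p.2‖ < M :=
        hcv.norm.eventually_lt_const (by simp [hM])
      have hb := hO.bound (c := ε / (2 * M)) (by positivity)
      filter_upwards [hb, hvM] with p hp hp'
      simp only [Function.comp, add_sub_cancel_left] at hp
      rw [dist_zero_right]
      split_ifs with hp0
      · simpa using hε
      · rw [norm_smul, norm_inv]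
        have hpos : 0 < ‖p.1‖ := norm_pos_iff.2 hp0
        rw [norm_smul] at hp
        calc ‖p.1‖⁻¹ * _ ≤ ‖p.1‖⁻¹ * (ε / (2 * M) * (‖p.1‖ * ‖v p.2‖)) := by gcongr
          _ = ε / (2 * M) * ‖v p.2‖ := by field_simp
          _ ≤ ε / (2 * M) * M := by gcongr
          _ = ε / 2 := by field_simp
          _ < ε := by linarith
    have hsum : ∀ p : ℝ × ℝ, quot Φ f v p.1 p.2 =
        (if p.1 = 0 then 0 else p.1⁻¹ • (Φ (f p.2 + p.1 • v p.2)
          - Φ (f p.2) - fderiv ℝ Φ x (p.1 • v p.2))) +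
        (if p.1 = 0 then tangent Φ (f p.2, v p.2) else fderiv ℝ Φ x (v p.2)) := by
      intro p
      simp only [quot]
      split_ifs with h
      · simp
      · rw [map_smul, smul_sub _ _ (p.1 • _), smul_smul, inv_mul_cancel₀ h, one_smul,
          sub_add_cancel]
    have h2 : Tendsto (fun p : ℝ × ℝ => if p.1 = 0 then tangent Φ (f p.2, v p.2)
        else fderiv ℝ Φ x (v p.2)) (𝓝 (0, t)) (𝓝 (tangent Φ (f t, v t))) :=
      Tendsto.if' htan.tendsto hdx.tendsto
    have h3 := hR.add h2
    rw [zero_add] at h3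
    rw [ContinuousAt, hval]
    exact h3.congr fun p => (hsum p).symm
  · have hne : ∀ᶠ p : ℝ × ℝ in 𝓝 (s, t), p.1 ≠ 0 := hcs.eventually_ne h0
    have hc : ContinuousAt (fun p : ℝ × ℝ => p.1⁻¹ • (Φ (f p.2 + p.1 • v p.2) - Φ (f p.2))) (s, t) := by
      refine (hcs.inv₀ h0).smul (ContinuousAt.sub ?_ ?_)
      · exact ContinuousAt.comp (f := fun p : ℝ × ℝ => f p.2 + p.1 • v p.2) (g := Φ)
          (hΦ.continuousOn.continuousAt (hΩ.mem_nhds (hs t))) hcfv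
      · exact ContinuousAt.comp (f := fun p : ℝ × ℝ => f p.2) (g := Φ)
          (hΦ.continuousOn.continuousAt (hΩ.mem_nhds (hf t))) hcf
    refine hc.congr ?_
    filter_upwards [hne] with p hp
    simp [quot, hp]

/-- The derivative in `t` of a difference quotient is the difference quotient of the tangent map; at
the parameter `0` this is the symmetry of the second derivative. -/
theorem deriv_quot {Φ : F → F'} {Ω : Set F} (hΩ : IsOpen Ω)
    (hΦ : ContDiffOn ℝ ∞ Φ Ω) {f v : SmoothLoop F} (hf : f ∈ valuedIn Ω) {s : ℝ}
    (hs : f + s • v ∈ valuedIn Ω) :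
    deriv (quot Φ f v s) = quot (tangent Φ) (pair f (derivₗ f)) (pair v (derivₗ v)) s := by
  ext1 t
  by_cases h0 : s = 0
  · subst h0
    have h1 : quot Φ f v 0 = fun t => tangent Φ (pair f v t) := by
      ext1 t; simp [quot, pair_apply]
    rw [h1, deriv_comp_eq_tangent (hΩ.prod isOpen_univ) (contDiffOn_tangent hΩ hΦ) (pair f v)
      (show pair f v t ∈ Ω ×ˢ univ from ⟨hf t, mem_univ _⟩)]
    have h2 : derivₗ (pair f v) t = (derivₗ f t, derivₗ v t) :=
      ((f.hasDerivAt t).prodMk (v.hasDerivAt t)).deriv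
    simp only [quot, if_true, pair_apply, h2]
    exact fderiv_tangent_swap hΩ hΦ (hf t) _ _ _
  · have h1 : quot Φ f v s = fun t => s⁻¹ • (Φ ((f + s • v) t) - Φ (f t)) := by
      ext1 t; simp [quot, h0, add_apply, smul_apply]
    have hd : ∀ g ∈ valuedIn Ω, HasDerivAt (fun t => Φ (g t))
        (tangent Φ (pair g (derivₗ g) t)) t := fun g hg =>
      (((hΦ.contDiffAt (hΩ.mem_nhds (hg t))).differentiableAt (by simp)).hasFDerivAt.comp_hasDerivAt
        t (g.hasDerivAt t))
    rw [h1]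
    refine (((hd _ hs).sub (hd _ hf)).const_smul s⁻¹).deriv.trans ?_
    simp only [quot, h0, if_false, pair_apply, map_add, map_smul, add_apply, smul_apply,
      Prod.smul_mk, Prod.mk_add_mk]

theorem continuousOn_jet_quot (k : ℕ) :
    ∀ {F F' : Type} [NormedAddCommGroup F] [NormedSpace ℝ F] [NormedAddCommGroup F']
      [NormedSpace ℝ F'] {Φ : F → F'} {Ω : Set F} (_ : IsOpen Ω) (_ : ContDiffOn ℝ ∞ Φ Ω)
      {f v : SmoothLoop F} (_ : f ∈ valuedIn Ω),
      ContinuousOn (fun p : ℝ × ℝ => iteratedDeriv k (quot Φ f v p.1) p.2)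
        ({s | f + s • v ∈ valuedIn Ω} ×ˢ univ) := by
  induction k with
  | zero =>
    intro F F' _ _ _ _ Φ Ω hΩ hΦ f v hf
    simpa using continuousOn_quot hΩ hΦ hf
  | succ k ih =>
    intro F F' _ _ _ _ Φ Ω hΩ hΦ f v hf
    have h1 := ih (hΩ.prod isOpen_univ) (contDiffOn_tangent hΩ hΦ)
      (f := pair f (derivₗ f)) (v := pair v (derivₗ v)) (fun t => ⟨hf t, mem_univ _⟩)
    refine (h1.mono ?_).congr fun p hp => ?_
    · exact fun p hp => ⟨fun t => ⟨hp.1 t, mem_univ _⟩, mem_univ _⟩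
    · rw [iteratedDeriv_succ', deriv_quot hΩ hΦ hf hp.1]

variable [CompleteSpace F] [CompleteSpace F']

/-- The directional derivative of a superposition operator is the superposition with the tangent
map: the difference quotients converge with all derivatives in `t`, uniformly over a period. -/
theorem tendsto_slope_superpose {Φ : F → F'} {Ω : Set F} (hΩ : IsOpen Ω)
    (hΦ : ContDiffOn ℝ ∞ Φ Ω) {f : SmoothLoop F} (v : SmoothLoop F) (hf : f ∈ valuedIn Ω) :
    Tendsto (fun s : ℝ => s⁻¹ • (superpose Φ (f + s • v) - superpose Φ f)) (𝓝[≠] 0)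
      (𝓝 (superpose (tangent Φ) (pair f v))) := by
  set A : ℝ → SmoothLoop F' := fun s => if s = 0 then superpose (tangent Φ) (pair f v) else
    s⁻¹ • (superpose Φ (f + s • v) - superpose Φ f)
  have hA : ∀ s, f + s • v ∈ valuedIn Ω → (A s : ℝ → F') = quot Φ f v s := by
    intro s hs
    ext1 t
    simp only [A, quot]
    split_ifs with h
    · exact superpose_apply (hΩ.prod isOpen_univ) (contDiffOn_tangent hΩ hΦ)
        (fun t => ⟨hf t, mem_univ _⟩) t
    · rw [smul_apply, sub_apply, superpose_apply hΩ hΦ hs, superpose_apply hΩ hΦ hf]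
      rfl
  have hc : ContinuousOn A {s | f + s • v ∈ valuedIn Ω} :=
    continuousOn_of_jets fun k => (continuousOn_jet_quot k hΩ hΦ hf).congr fun p hp => by
      rw [hA _ hp.1]
  have ho : IsOpen {s : ℝ | f + s • v ∈ valuedIn Ω} :=
    (isOpen_valuedIn hΩ).preimage
      (_root_.continuous_const.add (continuous_id.smul _root_.continuous_const))
  have h0 : ContinuousAt A 0 := hc.continuousAt (ho.mem_nhds (by simpa using hf))
  have h1 := h0.tendsto.mono_left (nhdsWithin_le_nhds (s := {0}ᶜ))
  have h2 : A 0 = superpose (tangent Φ) (pair f v) := by simp [A]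
  rw [h2] at h1
  refine h1.congr' ?_
  filter_upwards [eventually_mem_nhdsWithin] with s hs
  simp only [A, if_neg (show s ≠ 0 from hs)]

/-- Superposition operators are smooth, by induction on the order: the directional derivative is
again a superposition operator. -/
theorem frechetCn_superpose (n : ℕ) :
    ∀ {F F' : Type} [NormedAddCommGroup F] [NormedSpace ℝ F] [NormedAddCommGroup F']
      [NormedSpace ℝ F'] [CompleteSpace F] [CompleteSpace F'] {Φ : F → F'} {Ω : Set F}
      (_ : IsOpen Ω) (_ : ContDiffOn ℝ ∞ Φ Ω), FrechetCn n (superpose Φ) (valuedIn Ω) := by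
  induction n with
  | zero => intro F F' _ _ _ _ _ _ Φ Ω hΩ hΦ; exact continuousOn_superpose hΩ hΦ
  | succ n ih =>
    intro F F' _ _ _ _ _ _ Φ Ω hΩ hΦ
    refine ⟨continuousOn_superpose hΩ hΦ, fun p => superpose (tangent Φ) (pairₗ p),
      fun f hf v => tendsto_slope_superpose hΩ hΦ v hf, ?_⟩
    exact FrechetCn.comp ((isOpen_valuedIn hΩ).prod isOpen_univ)
      (isOpen_valuedIn (hΩ.prod isOpen_univ))
      (ih (hΩ.prod isOpen_univ) (contDiffOn_tangent hΩ hΦ))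
      (FrechetCn.of_linear pairₗ continuous_pairₗ _)
      (fun p hp t => ⟨hp.1 t, mem_univ _⟩)

/-- Superposition with a smooth map is a smooth map of loop spaces. -/
theorem frechetSmoothOn_superpose {Φ : F → F'} {Ω : Set F} (hΩ : IsOpen Ω)
    (hΦ : ContDiffOn ℝ ∞ Φ Ω) : FrechetSmoothOn (superpose Φ) (valuedIn Ω) :=
  .of_forall_frechetCn (isOpen_valuedIn hΩ) fun n => frechetCn_superpose n hΩ hΦ

end SmoothLoop

/-! ### Quotient manifolds from slices -/

section LocalSmooth

variable {C E F G : Type}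
  [AddCommGroup C] [Module ℝ C] [TopologicalSpace C] [IsFrechetSpace C]
  [AddCommGroup E] [Module ℝ E] [TopologicalSpace E] [IsFrechetSpace E]
  [AddCommGroup F] [Module ℝ F] [TopologicalSpace F] [IsFrechetSpace F]
  [AddCommGroup G] [Module ℝ G] [TopologicalSpace G] [IsFrechetSpace G]

theorem FrechetSmoothOn.of_local {f : E → F} {S : Set E}
    (h : ∀ x ∈ S, ∃ O : Set E, IsOpen O ∧ x ∈ O ∧ ∃ k : E → F,
      FrechetSmoothOn k O ∧ EqOn f k (S ∩ O)) : FrechetSmoothOn f S := by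
  intro x hx
  obtain ⟨O, hO, hxO, k, hk, hfk⟩ := h x hx
  obtain ⟨W, hW, hxW, g, hg, hgs⟩ := hk x hxO
  refine ⟨O ∩ W, hO.inter hW, ⟨hxO, hxW⟩, g, fun y hy => ?_, fun n => (hgs n).mono inter_subset_right⟩
  exact (hfk ⟨hy.1, hy.2.1⟩).trans (hg hy.2)

/-- Smoothness near a point of a threefold composition whose pieces are only locally smooth. -/
theorem exists_smooth_comp₃ {σ : C → E} {h : E → F} {g : F → G} {W₀ : Set C} {W : Set E}
    {W' : Set F} (hW₀ : IsOpen W₀) (hW : IsOpen W) (hW' : IsOpen W')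
    (hσ : FrechetSmoothOn σ W₀) (hh : FrechetSmoothOn h W) (hg : FrechetSmoothOn g W')
    {y : C} (hy : y ∈ W₀) (hy1 : σ y ∈ W) (hy2 : h (σ y) ∈ W') :
    ∃ O : Set C, IsOpen O ∧ y ∈ O ∧ (∀ x ∈ O, x ∈ W₀ ∧ σ x ∈ W ∧ h (σ x) ∈ W') ∧
      FrechetSmoothOn (fun x => g (h (σ x))) O := by
  have h1 : IsOpen (W ∩ h ⁻¹' W') := hh.continuousOn.isOpen_inter_preimage hW hW'
  have h2 : IsOpen (W₀ ∩ σ ⁻¹' (W ∩ h ⁻¹' W')) := hσ.continuousOn.isOpen_inter_preimage hW₀ h1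
  refine ⟨_, h2, ⟨hy, hy1, hy2⟩, fun x hx => ⟨hx.1, hx.2.1, hx.2.2⟩, ?_⟩
  have h3 : FrechetSmoothOn (fun x => h (σ x)) (W₀ ∩ σ ⁻¹' (W ∩ h ⁻¹' W')) :=
    hh.comp (hσ.mono inter_subset_left) (fun x hx => hx.2.1)
  exact hg.comp h3 (fun x hx => hx.2.2)

end LocalSmooth

section Lifts

variable {S E M S' E' N S'' E'' P : Type}
  [AddCommGroup E] [Module ℝ E] [TopologicalSpace E] [IsFrechetSpace E]
  [AddCommGroup E'] [Module ℝ E'] [TopologicalSpace E'] [IsFrechetSpace E']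
  [AddCommGroup E''] [Module ℝ E''] [TopologicalSpace E''] [IsFrechetSpace E'']
  [TopologicalSpace S] [TopologicalSpace S'] [TopologicalSpace S'']
  [TopologicalSpace M] [TopologicalSpace N] [TopologicalSpace P]
  {ι : S → E} {q : S → M} {ι' : S' → E'} {q' : S' → N} {ι'' : S'' → E''} {q'' : S'' → P}
  {𝓜 : FrechetManifold M} {𝓝' : FrechetManifold N} {𝓠 : FrechetManifold P}

/-- A map with a continuous local lift is continuous. -/
theorem continuousAt_of_lift (hι : Continuous ι) (hι' : IsInducing ι') (hq' : Continuous q')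
    {f : S → N} {V : Set S} {p : S} (hp : p ∈ V) {W : Set E} (hW : IsOpen W) (hpW : ι p ∈ W)
    {h : E → E'} (hh : ContinuousOn h W)
    (H : ∀ p', ι p' ∈ W → p' ∈ V → ∃ r, ι' r = h (ι p') ∧ q' r = f p') :
    ContinuousWithinAt f V p := by
  have H' : ∀ p' : S, ∃ r, (ι p' ∈ W → p' ∈ V → ι' r = h (ι p') ∧ q' r = f p') := fun p' => by
    by_cases h1 : ι p' ∈ W ∧ p' ∈ V
    · obtain ⟨r, hr⟩ := H p' h1.1 h1.2
      exact ⟨r, fun _ _ => hr⟩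
    · obtain ⟨r, hr⟩ := H p hpW hp
      exact ⟨r, fun a b => absurd ⟨a, b⟩ h1⟩
  choose r hr using H'
  have hev : ∀ᶠ p' in 𝓝[V] p, ι p' ∈ W ∧ p' ∈ V :=
    (((hι.tendsto p).mono_left nhdsWithin_le_nhds).eventually (hW.mem_nhds hpW)).and
      eventually_mem_nhdsWithin
  have h1 : Tendsto r (𝓝[V] p) (𝓝 (r p)) := by
    rw [hι'.tendsto_nhds_iff]
    have h2 : Tendsto (fun p' => h (ι p')) (𝓝[V] p) (𝓝 (h (ι p))) :=
      ((hh.continuousAt (hW.mem_nhds hpW)).tendsto.comp (hι.tendsto p)).mono_left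
        nhdsWithin_le_nhds
    rw [← (hr p hpW hp).1] at h2
    refine h2.congr' ?_
    filter_upwards [hev] with p' hp'
    exact ((hr p' hp'.1 hp'.2).1).symm
  have h3 := (hq'.tendsto (r p)).comp h1
  rw [(hr p hpW hp).2] at h3
  refine h3.congr' ?_
  filter_upwards [hev] with p' hp'
  exact (hr p' hp'.1 hp'.2).2

/-- A map between quotient manifolds is smooth if it has local lifts to the total spaces which
extend smoothly to the ambient Fréchet spaces. -/
theorem smoothOn_of_lift (hM : IsQuotientManifold ι q 𝓜) (hN : IsQuotientManifold ι' q' 𝓝')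
    (hι : Continuous ι) (hι' : IsInducing ι') (hq : IsQuotientMap q) (hq' : Continuous q')
    {f : M → N} {U : Set M} (hU : IsOpen U)
    (H : ∀ p, q p ∈ U → ∃ W : Set E, IsOpen W ∧ ι p ∈ W ∧ ∃ h : E → E', FrechetSmoothOn h W ∧
      ∀ p', ι p' ∈ W → q p' ∈ U → ∃ r, ι' r = h (ι p') ∧ q' r = f (q p')) :
    𝓜.SmoothOn 𝓝' f U := by
  constructor
  · rw [hq.continuousOn_isOpen_iff hU]
    intro p hp
    obtain ⟨W, hW, hpW, h, hh, hl⟩ := H p hp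
    exact continuousAt_of_lift hι hι' hq' hp hW hpW hh.continuousOn hl
  · intro c hc c' hc'
    refine FrechetSmoothOn.of_local ?_
    rintro y ⟨hy, hyU, hyc'⟩
    obtain ⟨p, hp⟩ := hq.surjective (c.toHomeo.symm y)
    have hpc : q p ∈ c.toHomeo.source := by rw [hp]; exact c.toHomeo.map_target hy
    have hcy : c.toHomeo (q p) = y := by rw [hp, c.toHomeo.right_inv hy]
    obtain ⟨W₀, hW₀, hyW₀, hW₀t, s, hs0, hss, hsq⟩ := hM.sections c hc p hpc
    rw [hcy] at hyW₀ hs0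
    obtain ⟨W, hW, hpW, h, hh, hl⟩ := H p (by rw [hp]; exact hyU)
    obtain ⟨r, hr1, hr2⟩ := hl p hpW (by rw [hp]; exact hyU)
    obtain ⟨W', hW', hrW', g, hg, hgl⟩ := hN.smooth c' hc' r (by rw [hr2, hp]; exact hyc')
    obtain ⟨O, hO, hyO, hOm, hOs⟩ := exists_smooth_comp₃ hW₀ hW hW' hss hh hg hyW₀
      (by rw [hs0]; exact hpW) (by rw [hs0, ← hr1]; exact hrW')
    refine ⟨O, hO, hyO, _, hOs, fun x hx => ?_⟩
    obtain ⟨hx0, hx1, hx2⟩ := hOm x hx.2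
    obtain ⟨r', hr1', hr2'⟩ := hl (s x) hx1 (by rw [hsq x hx0]; exact hx.1.2.1)
    have := (hgl r' (by rw [hr1']; exact hx2)).2
    simp only
    rw [← hr1', this, hr2', hsq x hx0]

/-- The two-variable version of `smoothOn_of_lift`. -/
theorem smoothOn₂_of_lift (hM : IsQuotientManifold ι q 𝓜) (hN : IsQuotientManifold ι' q' 𝓝')
    (hP : IsQuotientManifold ι'' q'' 𝓠)
    (hι : Continuous ι) (hι' : Continuous ι') (hι'' : IsInducing ι'')
    (hq : IsOpenQuotientMap q) (hq' : IsOpenQuotientMap q') (hq'' : Continuous q'')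
    {f : M → N → P} {U : Set M} {V : Set N} (hU : IsOpen U) (hV : IsOpen V)
    (H : ∀ p p', q p ∈ U → q' p' ∈ V → ∃ W : Set (E × E'), IsOpen W ∧ (ι p, ι' p') ∈ W ∧
      ∃ h : E × E' → E'', FrechetSmoothOn h W ∧
      ∀ r r', (ι r, ι' r') ∈ W → q r ∈ U → q' r' ∈ V →
        ∃ t, ι'' t = h (ι r, ι' r') ∧ q'' t = f (q r) (q' r')) :
    𝓜.SmoothOn₂ 𝓝' 𝓠 f U V := by
  constructor
  · rw [(hq.prodMap hq').isQuotientMap.continuousOn_isOpen_iff (hU.prod hV)]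
    rintro ⟨p, p'⟩ hp
    obtain ⟨W, hW, hpW, h, hh, hl⟩ := H p p' hp.1 hp.2
    exact continuousAt_of_lift (ι := Prod.map ι ι') (hι.prodMap hι') hι'' hq'' hp hW hpW
      hh.continuousOn (fun r hr hr' => hl r.1 r.2 hr hr'.1 hr'.2)
  · intro c hc c' hc' c'' hc''
    refine FrechetSmoothOn.of_local ?_
    rintro ⟨y, y'⟩ ⟨⟨hy, hyU⟩, ⟨hy', hyV⟩, hyc''⟩
    simp only at hy hyU hy' hyV hyc''
    obtain ⟨p, hp⟩ := hq.surjective (c.toHomeo.symm y)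
    have hpc : q p ∈ c.toHomeo.source := by rw [hp]; exact c.toHomeo.map_target hy
    have hcy : c.toHomeo (q p) = y := by rw [hp, c.toHomeo.right_inv hy]
    obtain ⟨W₀, hW₀, hyW₀, hW₀t, s, hs0, hss, hsq⟩ := hM.sections c hc p hpc
    rw [hcy] at hyW₀ hs0
    obtain ⟨p', hp'⟩ := hq'.surjective (c'.toHomeo.symm y')
    have hpc' : q' p' ∈ c'.toHomeo.source := by rw [hp']; exact c'.toHomeo.map_target hy'
    have hcy' : c'.toHomeo (q' p') = y' := by rw [hp', c'.toHomeo.right_inv hy']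
    obtain ⟨W₀', hW₀', hyW₀', hW₀t', s', hs0', hss', hsq'⟩ := hN.sections c' hc' p' hpc'
    rw [hcy'] at hyW₀' hs0'
    obtain ⟨W, hW, hpW, h, hh, hl⟩ := H p p' (by rw [hp]; exact hyU) (by rw [hp']; exact hyV)
    obtain ⟨r, hr1, hr2⟩ := hl p p' hpW (by rw [hp]; exact hyU) (by rw [hp']; exact hyV)
    obtain ⟨W', hW', hrW', g, hg, hgl⟩ := hP.smooth c'' hc'' r
      (by rw [hr2, hp, hp']; exact hyc'')
    have hσ : FrechetSmoothOn (fun x : c.E × c'.E => (ι (s x.1), ι' (s' x.2))) (W₀ ×ˢ W₀') :=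
      (hss.comp (FrechetSmoothOn.id _).fst (fun x hx => hx.1)).prodMk
        (hss'.comp (FrechetSmoothOn.id _).snd (fun x hx => hx.2))
    obtain ⟨O, hO, hyO, hOm, hOs⟩ := exists_smooth_comp₃ (hW₀.prod hW₀') hW hW' hσ hh hg
      (y := (y, y')) ⟨hyW₀, hyW₀'⟩ (by simp only [hs0, hs0']; exact hpW)
      (by simp only [hs0, hs0', ← hr1]; exact hrW')
    refine ⟨O, hO, hyO, _, hOs, fun x hx => ?_⟩
    obtain ⟨hx0, hx1, hx2⟩ := hOm x hx.2
    obtain ⟨r', hr1', hr2'⟩ := hl (s x.1) (s' x.2) hx1 (by rw [hsq _ hx0.1]; exact hx.1.1.2)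
      (by rw [hsq' _ hx0.2]; exact hx.1.2.1.2)
    have := (hgl r' (by rw [hr1']; exact hx2)).2
    simp only
    rw [← hr1', this, hr2', hsq _ hx0.1, hsq' _ hx0.2]

end Lifts

/-- A slice for the quotient map `q : S → M`, where `ι` identifies `S` with a subset of a Fréchet
space: a smooth map `ρ` from a saturated open set `D ⊆ S` to an open subset `T` of a Fréchet
space whose fibers are those of `q`, with a smooth section through each point of `D`. -/
structure Slice {S E M : Type} [AddCommGroup E] [Module ℝ E] [TopologicalSpace E]
    (ι : S → E) (q : S → M) where
  C : Type
  [instAddCommGroup : AddCommGroup C]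
  [instModule : Module ℝ C]
  [instTopologicalSpace : TopologicalSpace C]
  [instFrechet : IsFrechetSpace C]
  D : Set S
  T : Set C
  ρ : S → C
  base : S
  base_mem : base ∈ D
  isOpen_T : IsOpen T
  mapsTo : ∀ p ∈ D, ρ p ∈ T
  smooth_ρ : ∀ p ∈ D, ∃ W : Set E, IsOpen W ∧ ι p ∈ W ∧ ∃ g : E → C, FrechetSmoothOn g W ∧
    ∀ p', ι p' ∈ W → p' ∈ D ∧ g (ι p') = ρ p'
  invariant : ∀ p ∈ D, ∀ p', q p = q p' → p' ∈ D ∧ ρ p = ρ p'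
  injective : ∀ p ∈ D, ∀ p' ∈ D, ρ p = ρ p' → q p = q p'
  exists_section : ∀ p ∈ D, ∃ s : C → S, s (ρ p) = p ∧ FrechetSmoothOn (fun y => ι (s y)) T ∧
    ∀ y ∈ T, s y ∈ D ∧ ρ (s y) = y

attribute [instance] Slice.instAddCommGroup Slice.instModule Slice.instTopologicalSpace
  Slice.instFrechet

namespace Slice

variable {S E M : Type} [AddCommGroup E] [Module ℝ E] [TopologicalSpace E] [IsFrechetSpace E]
  [TopologicalSpace S] [TopologicalSpace M] {ι : S → E} {q : S → M}

open Classical in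
/-- A smooth section of the slice map through the point `p`. -/
noncomputable def s (σ : Slice ι q) (p : S) : σ.C → S :=
  if h : p ∈ σ.D then (σ.exists_section p h).choose else fun _ => p

theorem s_spec (σ : Slice ι q) {p : S} (h : p ∈ σ.D) : σ.s p (σ.ρ p) = p ∧
    FrechetSmoothOn (fun y => ι (σ.s p y)) σ.T ∧ ∀ y ∈ σ.T, σ.s p y ∈ σ.D ∧ σ.ρ (σ.s p y) = y := by
  rw [s, dif_pos h]
  exact (σ.exists_section p h).choose_spec

theorem s_base (σ : Slice ι q) (p : S) (h : p ∈ σ.D) : σ.s p (σ.ρ p) = p := (σ.s_spec h).1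

theorem s_smooth (σ : Slice ι q) (p : S) (h : p ∈ σ.D) :
    FrechetSmoothOn (fun y => ι (σ.s p y)) σ.T := (σ.s_spec h).2.1

theorem s_mem (σ : Slice ι q) (p : S) (h : p ∈ σ.D) (y : σ.C) (hy : y ∈ σ.T) :
    σ.s p y ∈ σ.D := ((σ.s_spec h).2.2 y hy).1

theorem ρ_s (σ : Slice ι q) (p : S) (h : p ∈ σ.D) (y : σ.C) (hy : y ∈ σ.T) :
    σ.ρ (σ.s p y) = y := ((σ.s_spec h).2.2 y hy).2

theorem isOpen_D (σ : Slice ι q) (hι : Continuous ι) : IsOpen σ.D := by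
  rw [isOpen_iff_mem_nhds]
  intro p hp
  obtain ⟨W, hW, hpW, g, -, hg⟩ := σ.smooth_ρ p hp
  exact mem_of_superset ((hW.preimage hι).mem_nhds hpW) fun p' hp' => (hg p' hp').1

theorem continuousOn_ρ (σ : Slice ι q) (hι : Continuous ι) : ContinuousOn σ.ρ σ.D := by
  intro p hp
  obtain ⟨W, hW, hpW, g, hgs, hg⟩ := σ.smooth_ρ p hp
  have h1 : ContinuousAt (fun p => g (ι p)) p :=
    (hgs.continuousOn.continuousAt (hW.mem_nhds hpW)).comp hι.continuousAt
  refine (h1.congr ?_).continuousWithinAt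
  filter_upwards [(hW.preimage hι).mem_nhds hpW] with p' hp' using (hg p' hp').2

theorem continuousOn_s (σ : Slice ι q) (hι : IsInducing ι) {p : S} (hp : p ∈ σ.D) :
    ContinuousOn (σ.s p) σ.T :=
  hι.continuousOn_iff.2 (σ.s_smooth p hp).continuousOn

/-- If slices exist through all points, the quotient map is open. -/
theorem isOpenQuotientMap (hι : IsInducing ι) (hq : IsQuotientMap q)
    (h : ∀ p, ∃ σ : Slice ι q, p ∈ σ.D) : IsOpenQuotientMap q := by
  refine ⟨hq.surjective, hq.continuous, fun O hO => ?_⟩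
  rw [← hq.isOpen_preimage, isOpen_iff_mem_nhds]
  rintro p' ⟨p, hpO, hpp'⟩
  obtain ⟨σ, hσ⟩ := h p
  obtain ⟨hp', hρ⟩ := σ.invariant p hσ p' hpp'
  have h1 : ContinuousAt (fun r => σ.s p (σ.ρ r)) p' := by
    have hT : σ.T ∈ 𝓝 (σ.ρ p') := σ.isOpen_T.mem_nhds (σ.mapsTo p' hp')
    exact ContinuousAt.comp (f := σ.ρ) ((σ.continuousOn_s hι hσ).continuousAt hT)
      ((σ.continuousOn_ρ hι.continuous).continuousAt ((σ.isOpen_D hι.continuous).mem_nhds hp'))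
  have h2 : σ.s p (σ.ρ p') = p := by rw [← hρ, σ.s_base p hσ]
  have h3 : ∀ᶠ r in 𝓝 p', σ.s p (σ.ρ r) ∈ O :=
    h1.eventually (by simp only [h2]; exact hO.mem_nhds hpO)
  filter_upwards [h3, (σ.isOpen_D hι.continuous).mem_nhds hp'] with r hr hrD
  refine ⟨_, hr, σ.injective _ (σ.s_mem p hσ _ (σ.mapsTo r hrD)) r hrD ?_⟩
  exact σ.ρ_s p hσ _ (σ.mapsTo r hrD)

/-- The chart defined by a slice. -/
noncomputable def chart (σ : Slice ι q) (hι : IsInducing ι) (hq : IsQuotientMap q) :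
    FrechetChart M where
  E := σ.C
  toHomeo :=
    { toFun := fun m => σ.ρ (Function.surjInv hq.surjective m)
      invFun := fun y => q (σ.s σ.base y)
      source := q '' σ.D
      target := σ.T
      map_source' := by
        rintro _ ⟨p, hp, rfl⟩
        refine σ.mapsTo _ (σ.invariant p hp _ (Function.surjInv_eq hq.surjective _).symm).1
      map_target' := fun y hy => ⟨_, σ.s_mem _ σ.base_mem y hy, rfl⟩
      left_inv' := by
        rintro _ ⟨p, hp, rfl⟩
        have h := σ.invariant p hp (Function.surjInv hq.surjective (q p))
          (Function.surjInv_eq hq.surjective _).symm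
        rw [← h.2]
        exact σ.injective _ (σ.s_mem _ σ.base_mem _ (σ.mapsTo p hp)) p hp
          (σ.ρ_s _ σ.base_mem _ (σ.mapsTo p hp))
      right_inv' := fun y hy => by
        have h := σ.invariant _ (σ.s_mem _ σ.base_mem y hy)
          (Function.surjInv hq.surjective (q (σ.s σ.base y))) (Function.surjInv_eq hq.surjective _).symm
        rw [← h.2, σ.ρ_s _ σ.base_mem y hy]
      open_source := by
        rw [← hq.isOpen_preimage]
        have : q ⁻¹' (q '' σ.D) = σ.D := by
          refine Subset.antisymm ?_ (subset_preimage_image _ _)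
          rintro p' ⟨p, hp, h⟩
          exact (σ.invariant p hp p' h).1
        rw [this]
        exact σ.isOpen_D hι.continuous
      open_target := σ.isOpen_T
      continuousOn_toFun := by
        have hpre : q ⁻¹' (q '' σ.D) = σ.D := by
          refine Subset.antisymm ?_ (subset_preimage_image _ _)
          rintro p' ⟨p, hp, h⟩
          exact (σ.invariant p hp p' h).1
        have ho : IsOpen (q '' σ.D) := by
          rw [← hq.isOpen_preimage, hpre]
          exact σ.isOpen_D hι.continuous
        rw [hq.continuousOn_isOpen_iff ho, hpre]
        refine (σ.continuousOn_ρ hι.continuous).congr fun p hp => ?_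
        exact ((σ.invariant p hp _ (Function.surjInv_eq hq.surjective _).symm).2).symm
      continuousOn_invFun := hq.continuous.comp_continuousOn (σ.continuousOn_s hι σ.base_mem) }

variable (hι : IsInducing ι) (hq : IsQuotientMap q) (σ : Slice ι q)

theorem chart_mk {p : S} (hp : p ∈ σ.D) : (σ.chart hι hq).toHomeo (q p) = σ.ρ p :=
  ((σ.invariant p hp _ (Function.surjInv_eq hq.surjective _).symm).2).symm

theorem mem_chart_source {p : S} : q p ∈ (σ.chart hι hq).toHomeo.source ↔ p ∈ σ.D := by
  refine ⟨?_, fun h => ⟨p, h, rfl⟩⟩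
  rintro ⟨p', hp', h⟩
  exact (σ.invariant p' hp' p h).1

theorem chart_symm {p : S} (hp : p ∈ σ.D) {y : σ.C} (hy : y ∈ σ.T) :
    (σ.chart hι hq).toHomeo.symm y = q (σ.s p y) :=
  σ.injective _ (σ.s_mem _ σ.base_mem y hy) _ (σ.s_mem p hp y hy)
    (by rw [σ.ρ_s _ σ.base_mem y hy, σ.ρ_s p hp y hy])

/-- The quotient is Hausdorff if the orbit relation is closed. -/
theorem t2Space (hι : IsInducing ι) (hq : IsQuotientMap q) (h : ∀ p, ∃ σ : Slice ι q, p ∈ σ.D)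
    (hc : IsClosed {p : S × S | q p.1 = q p.2}) : T2Space M := by
  have ho := isOpenQuotientMap hι hq h
  rw [t2_iff_isClosed_diagonal, ← (ho.prodMap ho).isQuotientMap.isClosed_preimage]
  exact hc

/-- The manifold structure on the quotient given by all slices. -/
noncomputable def manifold (h : ∀ p, ∃ σ : Slice ι q, p ∈ σ.D)
    (hc : IsClosed {p : S × S | q p.1 = q p.2}) : FrechetManifold M where
  t2 := t2Space hι hq h hc
  atlas := range fun σ : Slice ι q => σ.chart hι hq
  covers m := by
    obtain ⟨p, rfl⟩ := hq.surjective m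
    obtain ⟨σ, hσ⟩ := h p
    exact ⟨_, ⟨σ, rfl⟩, (σ.mem_chart_source hι hq).2 hσ⟩
  compatible := by
    rintro _ ⟨σ, rfl⟩ _ ⟨σ', rfl⟩
    refine FrechetSmoothOn.of_local ?_
    rintro y ⟨hy, hy'⟩
    change y ∈ σ.T at hy
    have hs := σ.s_mem _ σ.base_mem y hy
    rw [chart_symm hι hq σ σ.base_mem hy, mem_chart_source] at hy'
    obtain ⟨W, hW, hpW, g, hgs, hg⟩ := σ'.smooth_ρ _ hy'
    have hsm := σ.s_smooth _ σ.base_mem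
    refine ⟨_, hsm.continuousOn.isOpen_inter_preimage σ.isOpen_T hW, ⟨hy, hpW⟩, _,
      hgs.comp (hsm.mono inter_subset_left) (fun x hx => hx.2), ?_⟩
    rintro x ⟨-, hx, hxW⟩
    obtain ⟨h1, h2⟩ := hg _ hxW
    simp only
    rw [h2, chart_symm hι hq σ σ.base_mem hx, chart_mk hι hq σ' h1]

theorem isQuotientManifold (h : ∀ p, ∃ σ : Slice ι q, p ∈ σ.D)
    (hc : IsClosed {p : S × S | q p.1 = q p.2}) :
    IsQuotientManifold ι q (manifold hι hq h hc) where
  smooth := by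
    rintro _ ⟨σ, rfl⟩ p hp
    rw [mem_chart_source] at hp
    obtain ⟨W, hW, hpW, g, hgs, hg⟩ := σ.smooth_ρ p hp
    refine ⟨W, hW, hpW, g, hgs, fun p' hp' => ?_⟩
    obtain ⟨h1, h2⟩ := hg p' hp'
    exact ⟨(σ.mem_chart_source hι hq).2 h1, by rw [h2, chart_mk hι hq σ h1]⟩
  sections := by
    rintro _ ⟨σ, rfl⟩ p hp
    rw [mem_chart_source] at hp
    refine ⟨σ.T, σ.isOpen_T, ?_, Subset.rfl, σ.s p, ?_, σ.s_smooth p hp, fun y hy =>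
      (chart_symm hι hq σ hp hy).symm⟩
    · rw [chart_mk hι hq σ hp]; exact σ.mapsTo p hp
    · rw [chart_mk hι hq σ hp, σ.s_base p hp]

end Slice

/-! ### Vectors, rotations and frames in 3-space -/

section Vectors

/-- The cross product as a continuous bilinear map. -/
noncomputable def crossL : Vec3 →L[ℝ] Vec3 →L[ℝ] Vec3 :=
  LinearMap.toContinuousBilinearMap
    (LinearMap.mk₂ ℝ cross (fun u v w => by simp [cross]) (fun c u v => by simp [cross])
      (fun u v w => by simp [cross]) (fun c u v => by simp [cross]))

theorem crossL_apply (u v : Vec3) : crossL u v = cross u v := rfl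

theorem ContDiffOn.cross {X : Type} [NormedAddCommGroup X] [NormedSpace ℝ X] {f g : X → Vec3}
    {s : Set X} (hf : ContDiffOn ℝ ∞ f s) (hg : ContDiffOn ℝ ∞ g s) :
    ContDiffOn ℝ ∞ (fun x => cross (f x) (g x)) s :=
  (crossL.isBoundedBilinearMap.contDiff (n := ∞)).comp_contDiffOn (hf.prodMk hg)

theorem continuous_cross : Continuous fun p : Vec3 × Vec3 => cross p.1 p.2 :=
  crossL.isBoundedBilinearMap.continuous

theorem cross_smul_left (c : ℝ) (u v : Vec3) : cross (c • u) v = c • cross u v := by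
  simp [cross]

theorem cross_neg_right (u v : Vec3) : cross u (-v) = -cross u v := by
  rw [← neg_one_smul ℝ v, cross_smul_right, neg_one_smul]

theorem cross_zero_right (u : Vec3) : cross u 0 = 0 := by simp [cross]

theorem cross_zero_left (u : Vec3) : cross 0 u = 0 := by simp [cross]

/-- For orthonormal `u`, `v` there is a rotation computing coordinates with respect to the
oriented orthonormal basis `u, v, u × v`. -/
theorem exists_rot_coords {u v : Vec3} (hu : ‖u‖ = 1) (hv : ‖v‖ = 1) (huv : inner ℝ v u = 0) :
    ∃ A : SO3, ∀ x, rot A x = !₂[inner ℝ u x, inner ℝ v x, inner ℝ (cross u v) x] := by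
  have h1 : inner ℝ u u = 1 := by rw [real_inner_self_eq_norm_sq, hu]; norm_num
  have h2 : inner ℝ v v = 1 := by rw [real_inner_self_eq_norm_sq, hv]; norm_num
  have h3 : inner ℝ (cross u v) (cross u v) = 1 := by
    rw [inner_cross_cross, hu, hv, huv]; norm_num
  have h4 := inner_cross_left u v
  have h5 := inner_cross_right u v
  simp only [inner_vec3, cross_zero, cross_one, cross_two] at h1 h2 h3 h4 h5 huv
  refine ⟨⟨!![u 0, u 1, u 2; v 0, v 1, v 2;
    u 1 * v 2 - u 2 * v 1, u 2 * v 0 - u 0 * v 2, u 0 * v 1 - u 1 * v 0], ?_⟩, fun x => ?_⟩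
  · rw [Matrix.mem_specialOrthogonalGroup_iff]
    constructor
    · rw [Matrix.mem_orthogonalGroup_iff]
      ext i j
      fin_cases i <;> fin_cases j <;>
        simp [Matrix.mul_apply, Fin.sum_univ_three] <;>
        linarith
    · rw [Matrix.det_fin_three]
      simp only [Matrix.of_apply, Matrix.cons_val', Matrix.cons_val]
      linarith
  · ext i
    fin_cases i <;>
      simp [rot, Matrix.toLpLin_apply, dotProduct, Fin.sum_univ_three, inner_vec3,
        cross_zero, cross_one, cross_two]

theorem rot_injective (A : SO3) : Function.Injective (rot A) := fun x y h => by
  rw [← rot_inv A x, h, rot_inv]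

theorem rot_zero (A : SO3) : rot A 0 = 0 := by simp [rot]

/-- A vector is determined by its coordinates in an oriented orthonormal basis. -/
theorem eq_of_coords {u v : Vec3} (hu : ‖u‖ = 1) (hv : ‖v‖ = 1) (huv : inner ℝ v u = 0)
    {x y : Vec3} (h1 : inner ℝ u x = inner ℝ u y) (h2 : inner ℝ v x = inner ℝ v y)
    (h3 : inner ℝ (cross u v) x = inner ℝ (cross u v) y) : x = y := by
  obtain ⟨A, hA⟩ := exists_rot_coords hu hv huv
  exact rot_injective A (by rw [hA, hA, h1, h2, h3])

theorem cross_eq_zero_imp {a b : Vec3} (ha : a ≠ 0) (h : cross a b = 0) :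
    b = ((inner ℝ b a) / ‖a‖ ^ 2) • a := by
  have h1 := cross_cross_self a b
  rw [h, cross_zero_right] at h1
  have h2 : ‖a‖ ^ 2 ≠ 0 := pow_ne_zero _ (norm_ne_zero_iff.2 ha)
  have h3 : (‖a‖ ^ 2) • b = (inner ℝ b a) • a := (sub_eq_zero.1 h1.symm).symm
  rw [div_eq_inv_mul, mul_smul, ← h3, smul_smul, inv_mul_cancel₀ h2, one_smul]

theorem left_ne_zero_of_cross {a b : Vec3} (h : cross a b ≠ 0) : a ≠ 0 := by
  rintro rfl; exact h (cross_zero_left _)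

theorem norm_cross_of_orthogonal {u v : Vec3} (huv : inner ℝ v u = 0) :
    ‖cross u v‖ = ‖u‖ * ‖v‖ := by
  have h := inner_cross_cross u v
  rw [real_inner_self_eq_norm_sq, huv] at h
  have h2 : ‖cross u v‖ ^ 2 = (‖u‖ * ‖v‖) ^ 2 := by rw [h]; ring
  exact (sq_eq_sq₀ (norm_nonneg _) (by positivity)).1 h2

/-- The expansion of a vector normal to `T` in the orthonormal basis `V, T × V` of the normal
plane. -/
theorem eq_add_of_normal {T V X : Vec3} (hT : ‖T‖ = 1) (hV : ‖V‖ = 1) (hVT : inner ℝ V T = 0)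
    (hX : inner ℝ X T = 0) :
    X = (inner ℝ X V) • V + (inner ℝ X (cross T V)) • cross T V := by
  have hW : ‖cross T V‖ = 1 := by rw [norm_cross_of_orthogonal hVT, hT, hV, one_mul]
  refine eq_of_coords hT hV hVT ?_ ?_ ?_
  · rw [inner_add_right, inner_smul_right, inner_smul_right, real_inner_comm X T,
      real_inner_comm V T, real_inner_comm (cross T V) T, hVT, hX,
      inner_cross_left]
    simp
  · rw [inner_add_right, inner_smul_right, inner_smul_right, real_inner_self_eq_norm_sq, hV,
      real_inner_comm (cross T V) V, inner_cross_right, real_inner_comm]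
    simp
  · rw [inner_add_right, inner_smul_right, inner_smul_right, real_inner_self_eq_norm_sq, hW,
      inner_cross_right, real_inner_comm]
    simp

theorem sq_add_sq_of_normal {T V X : Vec3} (hT : ‖T‖ = 1) (hV : ‖V‖ = 1)
    (hVT : inner ℝ V T = 0) (hX : inner ℝ X T = 0) :
    inner ℝ X V ^ 2 + inner ℝ X (cross T V) ^ 2 = ‖X‖ ^ 2 := by
  have h := eq_add_of_normal hT hV hVT hX
  set a := inner ℝ X V
  set b := inner ℝ X (cross T V)
  have hW : ‖cross T V‖ = 1 := by rw [norm_cross_of_orthogonal hVT, hT, hV, one_mul]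
  rw [← real_inner_self_eq_norm_sq X, h]
  simp only [inner_add_left, inner_add_right, inner_smul_left, inner_smul_right,
    inner_cross_right, real_inner_comm (cross T V) V, real_inner_self_eq_norm_sq, hV, hW]
  simp
  ring

end Vectors

/-! ### Angle functions -/

/-- A smooth map from the line to the circle has a smooth angle function. -/
theorem exists_angle {a b a' b' : ℝ → ℝ} (ha : ∀ t, HasDerivAt a (a' t) t)
    (hb : ∀ t, HasDerivAt b (b' t) t) (hc : ContDiff ℝ ∞ fun t => a t * b' t - b t * a' t)
    (hab : ∀ t, a t ^ 2 + b t ^ 2 = 1) :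
    ∃ θ : ℝ → ℝ, ContDiff ℝ ∞ θ ∧ (∀ t, a t = Real.cos (θ t)) ∧ (∀ t, b t = Real.sin (θ t)) ∧
      ∀ t, HasDerivAt θ (a t * b' t - b t * a' t) t := by
  obtain ⟨θ₀, h0⟩ : ∃ θ₀ : ℝ, a 0 = Real.cos θ₀ ∧ b 0 = Real.sin θ₀ := by
    refine ⟨Complex.arg ⟨a 0, b 0⟩, ?_⟩
    have hn : ‖(⟨a 0, b 0⟩ : ℂ)‖ = 1 := by
      have h1 : ‖(⟨a 0, b 0⟩ : ℂ)‖ ^ 2 = 1 := by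
        rw [← Complex.normSq_eq_norm_sq, Complex.normSq_mk]
        nlinarith [hab 0]
      exact (sq_eq_sq₀ (norm_nonneg _) zero_le_one).1 (by rw [h1]; norm_num)
    have hne : (⟨a 0, b 0⟩ : ℂ) ≠ 0 := by
      intro h; rw [h, norm_zero] at hn; exact zero_ne_one hn
    rw [Complex.cos_arg hne, Complex.sin_arg, hn]
    simp
  -- the angle is the primitive of the angular velocity
  set k : ℝ → ℝ := fun t => a t * b' t - b t * a' t with hk
  set θ : ℝ → ℝ := fun t => θ₀ + ∫ s in (0 : ℝ)..t, k s with hθ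
  have hθd : ∀ t, HasDerivAt θ (k t) t := fun t =>
    (intervalIntegral.integral_hasDerivAt_right (hc.continuous.intervalIntegrable _ _)
      hc.continuous.stronglyMeasurable.stronglyMeasurableAtFilter
      hc.continuous.continuousAt).const_add θ₀
  have hθs : ContDiff ℝ ∞ θ := by
    rw [contDiff_infty_iff_deriv]
    exact ⟨fun t => (hθd t).differentiableAt, by rwa [show deriv θ = k from
      funext fun t => (hθd t).deriv]⟩
  -- the inner product of `(a, b)` and `(cos θ, sin θ)` has derivative zero and is `1` at `0`
  have hf : ∀ t, a t * Real.cos (θ t) + b t * Real.sin (θ t) = 1 := by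
    have hd : ∀ t, HasDerivAt (fun t => a t * Real.cos (θ t) + b t * Real.sin (θ t)) 0 t := by
      intro t
      have h1 := ((ha t).mul (hθd t).cos).add ((hb t).mul (hθd t).sin)
      have h2 : a t * a' t + b t * b' t = 0 := by
        have h3 : HasDerivAt (fun t => a t ^ 2 + b t ^ 2) (2 * a t * a' t + 2 * b t * b' t) t := by
          refine (((ha t).pow 2).add ((hb t).pow 2)).congr_deriv ?_
          norm_num
        rw [funext hab] at h3
        have := h3.unique (hasDerivAt_const t (1 : ℝ))
        linarith
      refine h1.congr_deriv ?_
      simp only [hk]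
      have e1 : a' t = -b t * (a t * b' t - b t * a' t) := by
        linear_combination (a' t) * (-(hab t)) + (a t) * h2
      have e2 : b' t = a t * (a t * b' t - b t * a' t) := by
        linear_combination (b' t) * (-(hab t)) + (b t) * h2
      linear_combination (Real.cos (θ t)) * e1 + (Real.sin (θ t)) * e2
    intro t
    have h1 := is_const_of_deriv_eq_zero (fun t => (hd t).differentiableAt)
      (fun t => (hd t).deriv) t 0
    have hθ0 : θ 0 = θ₀ := by simp [hθ]
    rw [h1, hθ0, ← h0.1, ← h0.2]
    nlinarith [hab 0]
  have hsq : ∀ t, (a t - Real.cos (θ t)) ^ 2 + (b t - Real.sin (θ t)) ^ 2 = 0 := fun t => by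
    nlinarith [hf t, hab t, Real.sin_sq_add_cos_sq (θ t)]
  refine ⟨θ, hθs, fun t => ?_, fun t => ?_, hθd⟩
  · have : (a t - Real.cos (θ t)) ^ 2 = 0 := by
      nlinarith [hsq t, sq_nonneg (a t - Real.cos (θ t)), sq_nonneg (b t - Real.sin (θ t))]
    exact sub_eq_zero.1 (pow_eq_zero_iff two_ne_zero |>.1 this)
  · have : (b t - Real.sin (θ t)) ^ 2 = 0 := by
      nlinarith [hsq t, sq_nonneg (a t - Real.cos (θ t)), sq_nonneg (b t - Real.sin (θ t))]
    exact sub_eq_zero.1 (pow_eq_zero_iff two_ne_zero |>.1 this)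

theorem exists_int_of_cos_sin_eq {x y : ℝ} (hc : Real.cos x = Real.cos y)
    (hs : Real.sin x = Real.sin y) : ∃ n : ℤ, x = y + 2 * Real.pi * n := by
  have h := Real.Angle.cos_sin_inj hc hs
  rw [Real.Angle.angle_eq_iff_two_pi_dvd_sub] at h
  obtain ⟨n, hn⟩ := h
  exact ⟨n, by linarith⟩

/-! ### Unit normal fields -/

section NormalFields

/-- The twist rate with respect to the loop parameter. -/
noncomputable def twistDensity (γ V : ℝ → Vec3) (t : ℝ) : ℝ :=
  inner ℝ (deriv V t) (cross (unitTangent γ t) (V t))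

/-- The normal field `V` rotated by the angle `θ` about the tangent of `γ`. -/
noncomputable def rotField (γ V : ℝ → Vec3) (θ : ℝ → ℝ) (t : ℝ) : Vec3 :=
  Real.cos (θ t) • V t + Real.sin (θ t) • cross (unitTangent γ t) (V t)

variable {γ V V₁ V₂ : ℝ → Vec3}

theorem twistRate_eq (γ V : ℝ → Vec3) (t : ℝ) :
    twistRate γ V t = ‖deriv γ t‖⁻¹ * twistDensity γ V t := by
  rw [twistRate, twistDensity, inner_smul_left]
  simp

theorem twistRate_mul_speed {t : ℝ} (h : deriv γ t ≠ 0) :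
    twistRate γ V t * ‖deriv γ t‖ = twistDensity γ V t := by
  have := norm_ne_zero_iff.2 h
  rw [twistRate_eq]
  field_simp

theorem totalTwist_eq (h : ∀ t, deriv γ t ≠ 0) :
    totalTwist γ V = 1 / (2 * Real.pi) * ∫ t in (0 : ℝ)..2, twistDensity γ V t := by
  rw [totalTwist]
  congr 2
  ext t
  exact twistRate_mul_speed (h t)

theorem IsUnitNormal.norm_cross (h : ∀ t, deriv γ t ≠ 0) (hV : IsUnitNormal γ V) (t : ℝ) :
    ‖cross (unitTangent γ t) (V t)‖ = 1 := by
  rw [norm_cross_of_orthogonal (inner_unitTangent hV t), norm_unitTangent (h t), (hV t).1, one_mul]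

/-- Rotating a unit normal field by `θ` adds `θ'` to the twist density. -/
theorem twistDensity_rotField (hγ : ContDiff ℝ ∞ γ) (h : ∀ t, deriv γ t ≠ 0)
    (hV : IsUnitNormal γ V) (hVs : ContDiff ℝ ∞ V) {θ : ℝ → ℝ} {θ' t : ℝ}
    (hθ : HasDerivAt θ θ' t) :
    twistDensity γ (rotField γ V θ) t = θ' + twistDensity γ V t := by
  set T := unitTangent γ
  set W : ℝ → Vec3 := fun t => cross (T t) (V t) with hW
  have hWs : ContDiff ℝ ∞ W := contDiff_cross (contDiff_unitTangent hγ h) hVs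
  have hVd : HasDerivAt V (deriv V t) t := (hVs.differentiable (by simp) t).hasDerivAt
  have hWd : HasDerivAt W (deriv W t) t := (hWs.differentiable (by simp) t).hasDerivAt
  have hd : HasDerivAt (rotField γ V θ) ((Real.cos (θ t) • deriv V t + (-Real.sin (θ t) * θ') • V t)
      + (Real.sin (θ t) • deriv W t + (Real.cos (θ t) * θ') • W t)) t :=
    ((hθ.cos).smul hVd).add ((hθ.sin).smul hWd)
  have hVV : inner ℝ (deriv V t) (V t) = 0 := by
    have h1 := hVd.inner ℝ hVd
    rw [show (fun t => inner ℝ (V t) (V t)) = fun _ => (1 : ℝ) from funext fun t => by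
      rw [real_inner_self_eq_norm_sq, (hV t).1]; norm_num] at h1
    have := h1.unique (hasDerivAt_const t (1 : ℝ))
    rw [real_inner_comm] at this
    linarith
  have hWn : ∀ t, ‖W t‖ = 1 := hV.norm_cross h
  have hWW : inner ℝ (deriv W t) (W t) = 0 := by
    have h1 := hWd.inner ℝ hWd
    rw [show (fun t => inner ℝ (W t) (W t)) = fun _ => (1 : ℝ) from funext fun t => by
      rw [real_inner_self_eq_norm_sq, hWn]; norm_num] at h1
    have := h1.unique (hasDerivAt_const t (1 : ℝ))
    rw [real_inner_comm] at this
    linarith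
  have hWV0 : ∀ t, inner ℝ (W t) (V t) = 0 := fun t => inner_cross_right _ _
  have hWV : inner ℝ (deriv W t) (V t) = -inner ℝ (deriv V t) (W t) := by
    have h1 := hWd.inner ℝ hVd
    rw [show (fun t => inner ℝ (W t) (V t)) = fun _ => (0 : ℝ) from funext hWV0] at h1
    have := h1.unique (hasDerivAt_const t (0 : ℝ))
    rw [real_inner_comm] at this
    linarith
  have hcr : cross (T t) (rotField γ V θ t) = Real.cos (θ t) • W t - Real.sin (θ t) • V t := by
    rw [rotField, cross_add_right, cross_smul_right, cross_smul_right, cross_cross_self,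
      inner_unitTangent hV t, norm_unitTangent (h t)]
    simp [hW, T, sub_eq_add_neg]
  rw [twistDensity, hd.deriv, hcr]
  simp only [inner_add_left, inner_sub_right, inner_smul_left, inner_smul_right,
    real_inner_comm (W t) (V t), hVV, hWW, hWV, hWV0, real_inner_self_eq_norm_sq, (hV t).1, hWn,
    conj_trivial]
  rw [twistDensity]
  have := Real.sin_sq_add_cos_sq (θ t)
  linear_combination (θ' + inner ℝ (deriv V t) (W t)) * this

/-- Two unit normal fields differ by an angle function, whose derivative is the difference of the twist densities. -/
theorem exists_rotField (hγ : ContDiff ℝ ∞ γ) (h : ∀ t, deriv γ t ≠ 0)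
    (hV₁ : IsUnitNormal γ V₁) (hs₁ : ContDiff ℝ ∞ V₁)
    (hV₂ : IsUnitNormal γ V₂) (hs₂ : ContDiff ℝ ∞ V₂) :
    ∃ θ : ℝ → ℝ, ContDiff ℝ ∞ θ ∧ V₂ = rotField γ V₁ θ ∧
      ∀ t, HasDerivAt θ (twistDensity γ V₂ t - twistDensity γ V₁ t) t := by
  set W : ℝ → Vec3 := fun t => cross (unitTangent γ t) (V₁ t) with hW
  have hWs : ContDiff ℝ ∞ W := contDiff_cross (contDiff_unitTangent hγ h) hs₁
  have ha : ContDiff ℝ ∞ fun t => inner ℝ (V₂ t) (V₁ t) := hs₂.inner ℝ hs₁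
  have hb : ContDiff ℝ ∞ fun t => inner ℝ (V₂ t) (W t) := hs₂.inner ℝ hWs
  have ha' := contDiff_infty_iff_deriv.1 ha
  have hb' := contDiff_infty_iff_deriv.1 hb
  obtain ⟨θ, hθ, hc, hsn, hd⟩ := exists_angle (fun t => (ha'.1 t).hasDerivAt)
    (fun t => (hb'.1 t).hasDerivAt) ((ha.mul hb'.2).sub (hb.mul ha'.2)) (fun t => by
      rw [sq_add_sq_of_normal (norm_unitTangent (h t)) (hV₁ t).1 (inner_unitTangent hV₁ t)
        (inner_unitTangent hV₂ t), (hV₂ t).1]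
      norm_num)
  have hV : V₂ = rotField γ V₁ θ := by
    ext1 t
    rw [rotField, ← hc t, ← hsn t]
    exact eq_add_of_normal (norm_unitTangent (h t)) (hV₁ t).1 (inner_unitTangent hV₁ t)
      (inner_unitTangent hV₂ t)
  refine ⟨θ, hθ, hV, fun t => ?_⟩
  have h1 := twistDensity_rotField hγ h hV₁ hs₁ (hd t)
  rw [← hV] at h1
  rw [h1, add_sub_cancel_right]
  exact hd t

theorem twistVec_exp (T V : Vec3) (x : ℝ) :
    twistVec T V (Circle.exp (x / 2)) = Real.cos x • V + Real.sin x • cross T V := by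
  have h : ((Circle.exp (x / 2) : Circle) : ℂ) ^ 2 = Complex.exp (x * Complex.I) := by
    rw [Circle.coe_exp, ← Complex.exp_nat_mul]
    congr 1
    push_cast
    ring
  rw [twistVec, h, Complex.exp_ofReal_mul_I_re, Complex.exp_ofReal_mul_I_im]

theorem rotField_eq_twistVec (γ V : ℝ → Vec3) (θ : ℝ → ℝ) (t : ℝ) :
    rotField γ V θ t = twistVec (unitTangent γ t) (V t) (Circle.exp (θ t / 2)) :=
  (twistVec_exp _ _ _).symm

theorem isUnitNormal_rotField (h : ∀ t, deriv γ t ≠ 0) (hV : IsUnitNormal γ V) (θ : ℝ → ℝ) :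
    IsUnitNormal γ (rotField γ V θ) := by
  rw [funext (rotField_eq_twistVec γ V θ)]
  exact isUnitNormal_twist h hV fun t => Circle.norm_coe _

theorem contDiff_rotField (hγ : ContDiff ℝ ∞ γ) (h : ∀ t, deriv γ t ≠ 0) (hV : ContDiff ℝ ∞ V)
    {θ : ℝ → ℝ} (hθ : ContDiff ℝ ∞ θ) : ContDiff ℝ ∞ (rotField γ V θ) :=
  (hθ.cos.smul hV).add (hθ.sin.smul (contDiff_cross (contDiff_unitTangent hγ h) hV))

theorem rotField_rotField (h : ∀ t, deriv γ t ≠ 0) (hV : IsUnitNormal γ V) (θ φ : ℝ → ℝ) :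
    rotField γ (rotField γ V θ) φ = rotField γ V (fun t => φ t + θ t) := by
  ext1 t
  rw [rotField_eq_twistVec, rotField_eq_twistVec, rotField_eq_twistVec,
    twistVec_mul (norm_unitTangent (h t)) (inner_unitTangent hV t), ← Circle.coe_mul,
    ← Circle.exp_add, add_div]

/-- The rotation angle is determined modulo `2π`. -/
theorem cos_sin_eq_of_rotField_eq (h : ∀ t, deriv γ t ≠ 0) (hV : IsUnitNormal γ V) {θ φ : ℝ → ℝ}
    {t : ℝ} (he : rotField γ V θ t = rotField γ V φ t) :
    Real.cos (θ t) = Real.cos (φ t) ∧ Real.sin (θ t) = Real.sin (φ t) := by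
  have h1 : ∀ θ : ℝ → ℝ, inner ℝ (rotField γ V θ t) (V t) = Real.cos (θ t) := fun θ => by
    rw [rotField, inner_add_left, inner_smul_left, inner_smul_left, inner_cross_right,
      real_inner_self_eq_norm_sq, (hV t).1]
    simp
  have h2 : ∀ θ : ℝ → ℝ, inner ℝ (rotField γ V θ t) (cross (unitTangent γ t) (V t))
      = Real.sin (θ t) := fun θ => by
    rw [rotField, inner_add_left, inner_smul_left, inner_smul_left, real_inner_comm,
      inner_cross_right, real_inner_self_eq_norm_sq, hV.norm_cross h]
    simp
  exact ⟨by rw [← h1, he, h1], by rw [← h2, he, h2]⟩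

end NormalFields

/-! ### Smooth operations on loops -/

section Combinators

variable {E : Type} [AddCommGroup E] [Module ℝ E] [TopologicalSpace E] [IsFrechetSpace E]
  {F F' : Type} [NormedAddCommGroup F] [NormedSpace ℝ F] [CompleteSpace F]
  [NormedAddCommGroup F'] [NormedSpace ℝ F'] [CompleteSpace F'] {W : Set E}

theorem FrechetSmoothOn.linear_comp {E' E'' : Type}
    [AddCommGroup E'] [Module ℝ E'] [TopologicalSpace E'] [IsFrechetSpace E']
    [AddCommGroup E''] [Module ℝ E''] [TopologicalSpace E''] [IsFrechetSpace E'']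
    (L : E' →ₗ[ℝ] E'') (hL : Continuous L) {A : E → E'} (hA : FrechetSmoothOn A W) :
    FrechetSmoothOn (fun x => L (A x)) W :=
  (FrechetSmoothOn.of_linear L hL univ).comp hA (mapsTo_univ _ _)

theorem FrechetSmoothOn.superpose {A : E → SmoothLoop F} (hA : FrechetSmoothOn A W) {Φ : F → F'}
    {Ω : Set F} (hΩ : IsOpen Ω) (hΦ : ContDiffOn ℝ ∞ Φ Ω)
    (h : ∀ x ∈ W, A x ∈ SmoothLoop.valuedIn Ω) :
    FrechetSmoothOn (fun x => SmoothLoop.superpose Φ (A x)) W :=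
  (SmoothLoop.frechetSmoothOn_superpose hΩ hΦ).comp hA h

theorem FrechetSmoothOn.pair {A : E → SmoothLoop F} {B : E → SmoothLoop F'}
    (hA : FrechetSmoothOn A W) (hB : FrechetSmoothOn B W) :
    FrechetSmoothOn (fun x => SmoothLoop.pair (A x) (B x)) W :=
  (hA.prodMk hB).linear_comp SmoothLoop.pairₗ SmoothLoop.continuous_pairₗ

theorem FrechetSmoothOn.derivₗ {A : E → SmoothLoop F} (hA : FrechetSmoothOn A W) :
    FrechetSmoothOn (fun x => SmoothLoop.derivₗ (A x)) W :=
  hA.linear_comp _ SmoothLoop.continuous_derivₗ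

theorem FrechetSmoothOn.evalₗ {A : E → SmoothLoop F} (hA : FrechetSmoothOn A W) (t₀ : ℝ) :
    FrechetSmoothOn (fun x => SmoothLoop.evalₗ t₀ (A x)) W :=
  hA.linear_comp _ (SmoothLoop.continuous_evalₗ t₀)

theorem FrechetSmoothOn.integralₗ {A : E → SmoothLoop F} (hA : FrechetSmoothOn A W) :
    FrechetSmoothOn (fun x => SmoothLoop.integralₗ (A x)) W :=
  hA.linear_comp _ SmoothLoop.continuous_integralₗ

theorem FrechetSmoothOn.primₗ {A : E → SmoothLoop F} (hA : FrechetSmoothOn A W) :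
    FrechetSmoothOn (fun x => SmoothLoop.primₗ (A x)) W :=
  hA.linear_comp _ SmoothLoop.continuous_primₗ

end Combinators

section Corestrict

variable {E F : Type}
  [AddCommGroup E] [Module ℝ E] [TopologicalSpace E] [IsFrechetSpace E]
  [AddCommGroup F] [Module ℝ F] [TopologicalSpace F] [IsFrechetSpace F]

open Classical in
/-- The corestriction of a map to a subspace containing its relevant values. -/
noncomputable def corestrict (K : Submodule ℝ F) (x : F) : K := if h : x ∈ K then ⟨x, h⟩ else 0

theorem coe_corestrict {K : Submodule ℝ F} {x : F} (h : x ∈ K) : (corestrict K x : F) = x := by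
  rw [corestrict, dif_pos h]

theorem corestrict_coe {K : Submodule ℝ F} (x : K) : corestrict K (x : F) = x :=
  Subtype.ext (coe_corestrict x.2)

/-- A map into a closed subspace is as smooth as it is as a map into the ambient space: its
directional derivatives are limits of vectors of the subspace. -/
theorem frechetCn_corestrict {n : ℕ} : ∀ {E F : Type}
    [AddCommGroup E] [Module ℝ E] [TopologicalSpace E] [IsFrechetSpace E]
    [AddCommGroup F] [Module ℝ F] [TopologicalSpace F] [IsFrechetSpace F] {K : Submodule ℝ F}
    (_ : IsClosed (K : Set F)) {f : E → F} {U : Set E} (_ : IsOpen U) (_ : FrechetCn n f U)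
    (_ : ∀ x ∈ U, f x ∈ K), FrechetCn n (fun x => corestrict K (f x)) U := by
  have hcont : ∀ {E F : Type}
    [AddCommGroup E] [Module ℝ E] [TopologicalSpace E] [IsFrechetSpace E]
    [AddCommGroup F] [Module ℝ F] [TopologicalSpace F] [IsFrechetSpace F] {K : Submodule ℝ F}
    {f : E → F} {U : Set E} (_ : ContinuousOn f U)
    (_ : ∀ x ∈ U, f x ∈ K), ContinuousOn (fun x => corestrict K (f x)) U := by
    intro E F _ _ _ _ _ _ _ _ K f U hf hK
    refine IsInducing.subtypeVal.continuousOn_iff.2 (hf.congr fun x hx => ?_)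
    exact coe_corestrict (hK x hx)
  induction n with
  | zero => intro E F _ _ _ _ _ _ _ _ K _ f U _ hf hK; exact hcont hf hK
  | succ n ih =>
    intro E F _ _ _ _ _ _ _ _ K hKc f U hU hf hK
    obtain ⟨h1, df, h2, h3⟩ := hf
    have hev : ∀ x ∈ U, ∀ v : E, ∀ᶠ t : ℝ in 𝓝[≠] 0, x + t • v ∈ U := by
      intro x hx v
      have hc : Continuous fun t : ℝ => x + t • v := by fun_prop
      have := (hc.tendsto 0).mono_left (nhdsWithin_le_nhds (s := {0}ᶜ))
      rw [zero_smul, add_zero] at this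
      exact this.eventually (hU.mem_nhds hx)
    have hdf : ∀ x ∈ U, ∀ v, df (x, v) ∈ K := by
      intro x hx v
      refine hKc.mem_of_tendsto (h2 x hx v) ?_
      filter_upwards [hev x hx v] with t ht
      exact K.smul_mem _ (K.sub_mem (hK _ ht) (hK _ hx))
    refine ⟨hcont h1 hK, fun p => corestrict K (df p), fun x hx v => ?_, ?_⟩
    · rw [IsInducing.subtypeVal.tendsto_nhds_iff]
      rw [coe_corestrict (hdf x hx v)]
      refine (h2 x hx v).congr' ?_
      filter_upwards [hev x hx v] with t ht
      simp [coe_corestrict (hK _ ht), coe_corestrict (hK _ hx)]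
    · exact ih hKc (hU.prod isOpen_univ) h3 (fun p hp => hdf p.1 hp.1 p.2)

theorem FrechetSmoothOn.corestrict {K : Submodule ℝ F} [IsFrechetSpace K]
    (hKc : IsClosed (K : Set F)) {f : E → F} {U : Set E} (hU : IsOpen U)
    (hf : FrechetSmoothOn f U) (hK : ∀ x ∈ U, f x ∈ K) :
    FrechetSmoothOn (fun x => corestrict K (f x)) U := by
  intro x hx
  obtain ⟨W, hW, hxW, g, hg, hgs⟩ := hf x hx
  refine ⟨U ∩ W, hU.inter hW, ⟨hx, hxW⟩, fun y => _root_.corestrict K (g y), fun y hy => ?_,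
    fun n => ?_⟩
  · simp only [hg ⟨hy.1, hy.2.2⟩]
  · exact frechetCn_corestrict hKc (hU.inter hW) ((hgs n).mono inter_subset_right)
      (fun y hy => by rw [← hg hy]; exact hK y hy.1)

end Corestrict

namespace SmoothLoop

section

variable {F : Type} [NormedAddCommGroup F] [NormedSpace ℝ F]

theorem primₗ_derivₗ [CompleteSpace F] (f : SmoothLoop F) (t : ℝ) :
    primₗ (derivₗ f) t = f t - f 0 := by
  have h : ∀ t, ∫ s in (0 : ℝ)..t, derivₗ f s = f t - f 0 := fun t =>
    intervalIntegral.integral_eq_sub_of_hasDerivAt (fun s _ => f.hasDerivAt s)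
      ((derivₗ f).intervalIntegrable _ _)
  have h2 : f 2 = f 0 := by simpa using f.periodic 0
  rw [primₗ_apply, h, h, h2, sub_self, smul_zero, sub_zero]

theorem integral_derivₗ [CompleteSpace F] (f : SmoothLoop F) :
    ∫ s in (0 : ℝ)..2, derivₗ f s = 0 := by
  have h2 : f 2 = f 0 := by simpa using f.periodic 0
  rw [intervalIntegral.integral_eq_sub_of_hasDerivAt (fun s _ => f.hasDerivAt s)
      ((derivₗ f).intervalIntegrable _ _), h2, sub_self]

theorem derivₗ_primₗ_apply [CompleteSpace F] (f : SmoothLoop F)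
    (h : ∫ s in (0 : ℝ)..2, f s = 0) (t : ℝ) : derivₗ (primₗ f) t = f t := by
  rw [derivₗ_primₗ, sub_apply, smul_apply, integralₗ_apply, h, smul_zero, sub_zero]

end

/-- A loop is immersed if its velocity does not vanish. -/
def Immersed (γ : SmoothLoop Vec3) : Prop := ∀ t, deriv (γ : ℝ → Vec3) t ≠ 0

theorem isOpen_immersed : IsOpen {γ : SmoothLoop Vec3 | γ.Immersed} :=
  (isOpen_valuedIn isOpen_ne).preimage continuous_derivₗ

/-- The speed of a loop. -/
noncomputable def speed (γ : SmoothLoop Vec3) : SmoothLoop ℝ := superpose (fun a => ‖a‖) (derivₗ γ)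

/-- The twist density of a normal field along a loop, as a loop. -/
noncomputable def density (γ V : SmoothLoop Vec3) : SmoothLoop ℝ :=
  superpose (fun p : Vec3 × Vec3 × Vec3 => ‖p.1‖⁻¹ * inner ℝ p.2.2 (cross p.1 p.2.1))
    (pair (derivₗ γ) (pair V (derivₗ V)))

/-- The rotation of a normal field about the tangent by a periodic angle. -/
noncomputable def rotate (γ V : SmoothLoop Vec3) (θ : SmoothLoop ℝ) : SmoothLoop Vec3 :=
  superpose (fun p : Vec3 × Vec3 × ℝ =>
      Real.cos p.2.2 • p.2.1 + Real.sin p.2.2 • ‖p.1‖⁻¹ • cross p.1 p.2.1)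
    (pair (derivₗ γ) (pair V θ))

/-- The twist of a normal field about the tangent by a complex loop. -/
noncomputable def twist (γ V : SmoothLoop Vec3) (u : SmoothLoop ℂ) : SmoothLoop Vec3 :=
  superpose (fun p : Vec3 × Vec3 × ℂ =>
      (p.2.2 ^ 2).re • p.2.1 + (p.2.2 ^ 2).im • ‖p.1‖⁻¹ • cross p.1 p.2.1)
    (pair (derivₗ γ) (pair V u))

/-- The projection, up to a positive factor, of `v` to the plane orthogonal to `a`. -/
noncomputable def projPerp (a v : Vec3) : Vec3 := (inner ℝ a a : ℝ) • v - (inner ℝ v a : ℝ) • a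

/-- The unit normal field along a loop obtained from a nowhere tangential vector field by
orthogonal projection and normalisation. -/
noncomputable def normalPart (γ V : SmoothLoop Vec3) : SmoothLoop Vec3 :=
  superpose (fun p : Vec3 × Vec3 => ‖projPerp p.1 p.2‖⁻¹ • projPerp p.1 p.2) (pair (derivₗ γ) V)

/-- The vector field `V` is nowhere tangential to the loop `γ`. -/
def Transverse (γ V : SmoothLoop Vec3) : Prop := ∀ t, projPerp (derivₗ γ t) (V t) ≠ 0

theorem contDiff_projPerp : ContDiff ℝ ∞ fun p : Vec3 × Vec3 => projPerp p.1 p.2 := by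
  unfold projPerp
  exact ((contDiff_fst.inner ℝ contDiff_fst).smul contDiff_snd).sub
    ((contDiff_snd.inner ℝ contDiff_fst).smul contDiff_fst)

theorem projPerp_ne_zero_left {a v : Vec3} (h : projPerp a v ≠ 0) : a ≠ 0 := by
  rintro rfl; simp [projPerp] at h

theorem Transverse.immersed {γ V : SmoothLoop Vec3} (h : Transverse γ V) : γ.Immersed :=
  fun t => projPerp_ne_zero_left (h t)

theorem inner_projPerp (a v : Vec3) : inner ℝ (projPerp a v) a = 0 := by
  rw [projPerp, inner_sub_left, inner_smul_left, inner_smul_left]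
  simp
  ring

theorem isOpen_transverse : IsOpen {p : SmoothLoop Vec3 × SmoothLoop Vec3 | Transverse p.1 p.2} := by
  have h1 : IsOpen {p : Vec3 × Vec3 | projPerp p.1 p.2 ≠ 0} :=
    isOpen_ne.preimage contDiff_projPerp.continuous
  have h2 : Continuous fun p : SmoothLoop Vec3 × SmoothLoop Vec3 => pair (derivₗ p.1) p.2 :=
    continuous_pairₗ.comp ((continuous_derivₗ.comp continuous_fst).prodMk continuous_snd)
  exact (isOpen_valuedIn h1).preimage h2

theorem isOpen_fst_ne (F : Type) [NormedAddCommGroup F] :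
    IsOpen {p : Vec3 × F | p.1 ≠ 0} := isOpen_ne.preimage continuous_fst

theorem contDiffOn_inv_norm {F : Type} [NormedAddCommGroup F] [NormedSpace ℝ F] :
    ContDiffOn ℝ ∞ (fun p : Vec3 × F => ‖p.1‖⁻¹) {p | p.1 ≠ 0} :=
  (contDiff_fst.contDiffOn.norm ℝ (fun _ h => h)).inv (fun _ h => norm_ne_zero_iff.2 h)

theorem contDiffOn_speed : ContDiffOn ℝ ∞ (fun a : Vec3 => ‖a‖) {a | a ≠ 0} :=
  contDiffOn_id.norm ℝ (fun _ h => h)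

theorem contDiffOn_density : ContDiffOn ℝ ∞
    (fun p : Vec3 × Vec3 × Vec3 => ‖p.1‖⁻¹ * inner ℝ p.2.2 (cross p.1 p.2.1)) {p | p.1 ≠ 0} :=
  contDiffOn_inv_norm.mul (ContDiffOn.inner ℝ contDiff_snd.snd.contDiffOn
    (contDiff_fst.contDiffOn.cross contDiff_snd.fst.contDiffOn))

theorem contDiffOn_rotate : ContDiffOn ℝ ∞ (fun p : Vec3 × Vec3 × ℝ =>
      Real.cos p.2.2 • p.2.1 + Real.sin p.2.2 • ‖p.1‖⁻¹ • cross p.1 p.2.1) {p | p.1 ≠ 0} :=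
  (contDiff_snd.snd.cos.smul contDiff_snd.fst).contDiffOn.add
    (contDiff_snd.snd.sin.contDiffOn.smul (contDiffOn_inv_norm.smul
      (contDiff_fst.contDiffOn.cross contDiff_snd.fst.contDiffOn)))

theorem contDiffOn_twist : ContDiffOn ℝ ∞ (fun p : Vec3 × Vec3 × ℂ =>
      (p.2.2 ^ 2).re • p.2.1 + (p.2.2 ^ 2).im • ‖p.1‖⁻¹ • cross p.1 p.2.1) {p | p.1 ≠ 0} :=
  (((Complex.reCLM.contDiff.comp (contDiff_snd.snd.pow 2))).smul contDiff_snd.fst).contDiffOn.add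
    ((Complex.imCLM.contDiff.comp (contDiff_snd.snd.pow 2)).contDiffOn.smul (contDiffOn_inv_norm.smul
      (contDiff_fst.contDiffOn.cross contDiff_snd.fst.contDiffOn)))

theorem contDiffOn_normalPart : ContDiffOn ℝ ∞
    (fun p : Vec3 × Vec3 => ‖projPerp p.1 p.2‖⁻¹ • projPerp p.1 p.2) {p | projPerp p.1 p.2 ≠ 0} :=
  ((contDiff_projPerp.contDiffOn.norm ℝ (fun _ h => h)).inv
    (fun _ h => norm_ne_zero_iff.2 h)).smul contDiff_projPerp.contDiffOn

theorem isOpen_projPerp : IsOpen {p : Vec3 × Vec3 | projPerp p.1 p.2 ≠ 0} :=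
  isOpen_ne.preimage contDiff_projPerp.continuous

variable {γ V : SmoothLoop Vec3}

theorem speed_apply (h : γ.Immersed) (t : ℝ) : speed γ t = ‖deriv (γ : ℝ → Vec3) t‖ :=
  superpose_apply isOpen_ne contDiffOn_speed h t

theorem density_apply (h : γ.Immersed) (V : SmoothLoop Vec3) (t : ℝ) :
    density γ V t = twistDensity γ V t := by
  have := superpose_apply (isOpen_fst_ne _) contDiffOn_density
    (f := pair (derivₗ γ) (pair V (derivₗ V))) (fun t => h t) t
  refine this.trans ?_
  simp only [pair_apply, derivₗ_apply]
  rw [twistDensity, unitTangent, cross_smul_left, inner_smul_right]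

theorem rotate_apply (h : γ.Immersed) (V : SmoothLoop Vec3) (θ : SmoothLoop ℝ) (t : ℝ) :
    rotate γ V θ t = rotField γ V θ t := by
  have := superpose_apply (isOpen_fst_ne _) contDiffOn_rotate
    (f := pair (derivₗ γ) (pair V θ)) (fun t => h t) t
  refine this.trans ?_
  simp only [pair_apply, derivₗ_apply]
  rw [rotField, unitTangent, cross_smul_left]

theorem twist_apply (h : γ.Immersed) (V : SmoothLoop Vec3) (u : SmoothLoop ℂ) (t : ℝ) :
    twist γ V u t = twistVec (unitTangent γ t) (V t) (u t) := by
  have := superpose_apply (isOpen_fst_ne _) contDiffOn_twist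
    (f := pair (derivₗ γ) (pair V u)) (fun t => h t) t
  refine this.trans ?_
  simp only [pair_apply, derivₗ_apply]
  rw [twistVec, unitTangent, cross_smul_left]

theorem normalPart_apply (h : Transverse γ V) (t : ℝ) : normalPart γ V t =
    ‖projPerp (derivₗ γ t) (V t)‖⁻¹ • projPerp (derivₗ γ t) (V t) :=
  superpose_apply isOpen_projPerp contDiffOn_normalPart (f := pair (derivₗ γ) V) (fun t => h t) t

theorem isUnitNormal_normalPart (h : Transverse γ V) : IsUnitNormal γ (normalPart γ V) := by
  intro t
  rw [normalPart_apply h, norm_smul, norm_inv, norm_norm, inv_mul_cancel₀ (norm_ne_zero_iff.2 (h t)),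
    inner_smul_left]
  have := inner_projPerp (derivₗ γ t) (V t)
  rw [derivₗ_apply] at this
  exact ⟨rfl, by rw [derivₗ_apply, this, mul_zero]⟩

theorem projPerp_of_normal {a v : Vec3} (h : inner ℝ v a = 0) : projPerp a v = (‖a‖ ^ 2) • v := by
  rw [projPerp, h, zero_smul, sub_zero, real_inner_self_eq_norm_sq]

theorem transverse_of_isUnitNormal (h : γ.Immersed) (hV : IsUnitNormal γ V) : Transverse γ V := by
  intro t
  rw [derivₗ_apply, projPerp_of_normal (hV t).2]
  refine smul_ne_zero (pow_ne_zero _ (norm_ne_zero_iff.2 (h t))) ?_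
  rw [← norm_ne_zero_iff, (hV t).1]
  exact one_ne_zero

theorem normalPart_of_isUnitNormal (h : γ.Immersed) (hV : IsUnitNormal γ V) :
    normalPart γ V = V := by
  refine ext fun t => ?_
  have h1 : ‖deriv (γ : ℝ → Vec3) t‖ ≠ 0 := norm_ne_zero_iff.2 (h t)
  rw [normalPart_apply (transverse_of_isUnitNormal h hV), derivₗ_apply, projPerp_of_normal (hV t).2,
    norm_smul, (hV t).1, mul_one, norm_pow, norm_norm, smul_smul, inv_mul_cancel₀ (pow_ne_zero _ h1),
    one_smul]

end SmoothLoop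

section SmoothOps

open SmoothLoop

variable {E : Type} [AddCommGroup E] [Module ℝ E] [TopologicalSpace E] [IsFrechetSpace E]
  {W : Set E} {γ V : E → SmoothLoop Vec3}

theorem FrechetSmoothOn.speed (hγ : FrechetSmoothOn γ W) (h : ∀ x ∈ W, (γ x).Immersed) :
    FrechetSmoothOn (fun x => SmoothLoop.speed (γ x)) W :=
  hγ.derivₗ.superpose isOpen_ne contDiffOn_speed h

theorem FrechetSmoothOn.density (hγ : FrechetSmoothOn γ W) (hV : FrechetSmoothOn V W)
    (h : ∀ x ∈ W, (γ x).Immersed) : FrechetSmoothOn (fun x => SmoothLoop.density (γ x) (V x)) W :=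
  (hγ.derivₗ.pair (hV.pair hV.derivₗ)).superpose (isOpen_fst_ne _) contDiffOn_density h

theorem FrechetSmoothOn.rotate {θ : E → SmoothLoop ℝ} (hγ : FrechetSmoothOn γ W)
    (hV : FrechetSmoothOn V W) (hθ : FrechetSmoothOn θ W) (h : ∀ x ∈ W, (γ x).Immersed) :
    FrechetSmoothOn (fun x => SmoothLoop.rotate (γ x) (V x) (θ x)) W :=
  (hγ.derivₗ.pair (hV.pair hθ)).superpose (isOpen_fst_ne _) contDiffOn_rotate h

theorem FrechetSmoothOn.twist {u : E → SmoothLoop ℂ} (hγ : FrechetSmoothOn γ W)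
    (hV : FrechetSmoothOn V W) (hu : FrechetSmoothOn u W) (h : ∀ x ∈ W, (γ x).Immersed) :
    FrechetSmoothOn (fun x => SmoothLoop.twist (γ x) (V x) (u x)) W :=
  (hγ.derivₗ.pair (hV.pair hu)).superpose (isOpen_fst_ne _) contDiffOn_twist h

theorem FrechetSmoothOn.normalPart (hγ : FrechetSmoothOn γ W) (hV : FrechetSmoothOn V W)
    (h : ∀ x ∈ W, Transverse (γ x) (V x)) :
    FrechetSmoothOn (fun x => SmoothLoop.normalPart (γ x) (V x)) W :=
  (hγ.derivₗ.pair hV).superpose isOpen_projPerp contDiffOn_normalPart h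

end SmoothOps

/-! ### Normalisation of curves by similarities -/

/-- The coordinates of `x` in the oriented orthonormal basis obtained from `a`, `b` by the
Gram–Schmidt process. -/
noncomputable def frameCoords (a b x : Vec3) : Vec3 :=
  !₂[‖a‖⁻¹ * inner ℝ a x, ‖cross (cross a b) a‖⁻¹ * inner ℝ (cross (cross a b) a) x,
    ‖cross a b‖⁻¹ * inner ℝ (cross a b) x]

theorem norm_cross_cross (a b : Vec3) : ‖cross (cross a b) a‖ = ‖cross a b‖ * ‖a‖ :=
  norm_cross_of_orthogonal (by rw [real_inner_comm]; exact inner_cross_left a b)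

theorem cross_cross_ne_zero {a b : Vec3} (h : cross a b ≠ 0) : cross (cross a b) a ≠ 0 := by
  rw [← norm_ne_zero_iff, norm_cross_cross]
  exact mul_ne_zero (norm_ne_zero_iff.2 h) (norm_ne_zero_iff.2 (left_ne_zero_of_cross h))

theorem exists_frameCoords_eq_rot {a b : Vec3} (h : cross a b ≠ 0) :
    ∃ A : SO3, ∀ x, frameCoords a b x = rot A x := by
  have ha := norm_ne_zero_iff.2 (left_ne_zero_of_cross h)
  have hc := norm_ne_zero_iff.2 h
  have hd := norm_ne_zero_iff.2 (cross_cross_ne_zero h)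
  set c := cross a b with hcdef
  set d := cross c a with hddef
  have hcross : cross (‖a‖⁻¹ • a) (‖d‖⁻¹ • d) = ‖c‖⁻¹ • c := by
    have h1 : cross a d = (‖a‖ ^ 2) • c := by
      have h2 : d = -cross a c := by
        rw [hddef]
        ext i
        fin_cases i <;> simp [cross_zero, cross_one, cross_two] <;> ring
      rw [h2, cross_neg_right, cross_cross_self, hcdef, inner_cross_left]
      simp
    rw [cross_smul_left, cross_smul_right, h1, smul_smul, smul_smul, norm_cross_cross]
    congr 1
    rw [← hcdef]
    field_simp
  obtain ⟨A, hA⟩ := exists_rot_coords (u := ‖a‖⁻¹ • a) (v := ‖d‖⁻¹ • d)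
    (by rw [norm_smul, norm_inv, norm_norm, inv_mul_cancel₀ ha])
    (by rw [norm_smul, norm_inv, norm_norm, inv_mul_cancel₀ hd])
    (by rw [inner_smul_left, inner_smul_right, hddef, inner_cross_right]; simp)
  refine ⟨A, fun x => ?_⟩
  rw [hA, hcross, inner_smul_left, inner_smul_left, inner_smul_left]
  rfl

theorem frameCoords_sim {a b : Vec3} {r : ℝ} (hr : 0 < r) (A : SO3) (x : Vec3) :
    frameCoords (r • rot A a) (r • rot A b) (rot A x) = frameCoords a b x := by
  simp only [frameCoords, cross_smul_left, cross_smul_right, cross_rot, norm_smul, norm_rot,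
    inner_smul_left, inner_rot, Real.norm_eq_abs, abs_of_pos hr, conj_trivial, mul_inv]
  congr 1
  ext i
  fin_cases i <;> simp <;> field_simp

theorem frameCoords_smul (a b : Vec3) (c : ℝ) (x : Vec3) :
    frameCoords a b (c • x) = c • frameCoords a b x := by
  ext i
  fin_cases i <;> simp [frameCoords, inner_smul_right] <;> ring

theorem frameCoords_left (a b : Vec3) : frameCoords a b a = !₂[‖a‖, 0, 0] := by
  have h1 : inner ℝ (cross (cross a b) a) a = 0 := inner_cross_right _ _
  have h2 : inner ℝ (cross a b) a = 0 := inner_cross_left a b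
  rw [frameCoords, h1, h2, real_inner_self_eq_norm_sq, mul_zero, mul_zero]
  by_cases h : ‖a‖ = 0
  · simp [h]
  · rw [sq, ← mul_assoc, inv_mul_cancel₀ h, one_mul]

theorem frameCoords_right_two (a b : Vec3) : frameCoords a b b 2 = 0 := by
  simp [frameCoords, inner_cross_right]

theorem frameCoords_right_one {a b : Vec3} (h : cross a b ≠ 0) : 0 < frameCoords a b b 1 := by
  have h1 : inner ℝ (cross (cross a b) a) b = ‖cross a b‖ ^ 2 := by
    rw [← real_inner_self_eq_norm_sq]
    simp only [inner_vec3, cross_zero, cross_one, cross_two]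
    ring
  have h2 : frameCoords a b b 1 = ‖cross (cross a b) a‖⁻¹ * ‖cross a b‖ ^ 2 := by
    simp [frameCoords, h1]
  rw [h2]
  have := norm_pos_iff.2 h
  have := norm_pos_iff.2 (cross_cross_ne_zero h)
  positivity

theorem norm_eq_of_sq {v : Vec3} {c : ℝ} (hc : 0 ≤ c) (h : v 0 * v 0 + v 1 * v 1 + v 2 * v 2 = c ^ 2) :
    ‖v‖ = c := by
  rw [← inner_vec3, real_inner_self_eq_norm_sq] at h
  exact (sq_eq_sq₀ (norm_nonneg _) hc).1 h

/-- For vectors in normal position the coordinates are the standard ones. -/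
theorem frameCoords_normalized {a b : Vec3} (ha : a = !₂[1, 0, 0]) (h1 : 0 < b 1) (h2 : b 2 = 0)
    (x : Vec3) : frameCoords a b x = x := by
  have hc : cross a b = !₂[0, 0, b 1] := by
    ext i
    fin_cases i <;> simp [cross_zero, cross_one, cross_two, ha, h2]
  have hd : cross (cross a b) a = !₂[0, b 1, 0] := by
    rw [hc]
    ext i
    fin_cases i <;> simp [cross_zero, cross_one, cross_two, ha]
  have na : ‖a‖ = 1 := norm_eq_of_sq zero_le_one (by simp [ha])
  have nc : ‖cross a b‖ = b 1 := norm_eq_of_sq h1.le (by rw [hc]; simp; ring)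
  have nd : ‖cross (cross a b) a‖ = b 1 := norm_eq_of_sq h1.le (by rw [hd]; simp; ring)
  rw [frameCoords, na, nc, nd, hd, hc, ha]
  ext i
  fin_cases i <;> simp [inner_vec3] <;> field_simp

theorem cross_ne_zero_of_normalized {a b : Vec3} (ha : a = !₂[1, 0, 0]) (h1 : 0 < b 1) :
    cross a b ≠ 0 := by
  intro h
  have : cross a b 2 = b 1 := by simp [cross_two, ha]
  rw [h] at this
  simp at this
  exact h1.ne this

theorem contDiffOn_frameCoords : ContDiffOn ℝ ∞
    (fun p : Vec3 × Vec3 × Vec3 => frameCoords p.2.1 p.2.2 p.1) {p | cross p.2.1 p.2.2 ≠ 0} := by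
  have ha : ContDiffOn ℝ ∞ (fun p : Vec3 × Vec3 × Vec3 => p.2.1) {p | cross p.2.1 p.2.2 ≠ 0} :=
    contDiff_snd.fst.contDiffOn
  have hb : ContDiffOn ℝ ∞ (fun p : Vec3 × Vec3 × Vec3 => p.2.2) {p | cross p.2.1 p.2.2 ≠ 0} :=
    contDiff_snd.snd.contDiffOn
  have hx : ContDiffOn ℝ ∞ (fun p : Vec3 × Vec3 × Vec3 => p.1) {p | cross p.2.1 p.2.2 ≠ 0} :=
    contDiff_fst.contDiffOn
  have hc := ha.cross hb
  have hd := hc.cross ha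
  rw [contDiffOn_euclidean]
  intro i
  fin_cases i
  · exact ((ha.norm ℝ fun p hp => left_ne_zero_of_cross hp).inv fun p hp =>
      norm_ne_zero_iff.2 (left_ne_zero_of_cross hp)).mul (ha.inner ℝ hx)
  · exact ((hd.norm ℝ fun p hp => cross_cross_ne_zero hp).inv fun p hp =>
      norm_ne_zero_iff.2 (cross_cross_ne_zero hp)).mul (hd.inner ℝ hx)
  · exact ((hc.norm ℝ fun p hp => hp).inv fun p hp =>
      norm_ne_zero_iff.2 hp).mul (hc.inner ℝ hx)

theorem isOpen_cross_ne {X : Type} [TopologicalSpace X] {f g : X → Vec3} (hf : Continuous f)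
    (hg : Continuous g) : IsOpen {x | cross (f x) (g x) ≠ 0} :=
  isOpen_ne.preimage (continuous_cross.comp (hf.prodMk hg))

namespace SmoothLoop

/-- The velocities of `γ` at the parameters `0` and `t₁` are linearly independent. -/
def Spread (t₁ : ℝ) (γ : SmoothLoop Vec3) : Prop := cross (derivₗ γ 0) (derivₗ γ t₁) ≠ 0

theorem continuous_eval_at {F : Type} [NormedAddCommGroup F] [NormedSpace ℝ F] (t : ℝ) :
    Continuous fun f : SmoothLoop F => f t :=
  continuous_eval.comp (continuous_id.prodMk _root_.continuous_const)

theorem isOpen_spread (t₁ : ℝ) : IsOpen {γ : SmoothLoop Vec3 | Spread t₁ γ} :=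
  isOpen_cross_ne ((continuous_eval_at 0).comp continuous_derivₗ)
    ((continuous_eval_at t₁).comp continuous_derivₗ)

/-- A normal field, in the coordinates in which `γ` is in normal position. -/
noncomputable def normalizeField (t₁ : ℝ) (γ V : SmoothLoop Vec3) : SmoothLoop Vec3 :=
  superpose (fun p : Vec3 × Vec3 × Vec3 => frameCoords p.2.1 p.2.2 p.1)
    (pair V (pair (evalₗ 0 (derivₗ γ)) (evalₗ t₁ (derivₗ γ))))

/-- The curve similar to `γ` which is in normal position: it starts at the origin with velocity
`e₁`, and its velocity at the parameter `t₁` lies in the upper half of the `e₁e₂`-plane. -/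
noncomputable def normalizeCurve (t₁ : ℝ) (γ : SmoothLoop Vec3) : SmoothLoop Vec3 :=
  superpose (fun p : Vec3 × Vec3 × Vec3 => ‖p.2.1‖⁻¹ • frameCoords p.2.1 p.2.2 p.1)
    (pair (γ - evalₗ 0 γ) (pair (evalₗ 0 (derivₗ γ)) (evalₗ t₁ (derivₗ γ))))

theorem isOpen_cross_ne' : IsOpen {p : Vec3 × Vec3 × Vec3 | cross p.2.1 p.2.2 ≠ 0} :=
  isOpen_cross_ne continuous_snd.fst continuous_snd.snd

theorem contDiffOn_normalizeCurve : ContDiffOn ℝ ∞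
    (fun p : Vec3 × Vec3 × Vec3 => ‖p.2.1‖⁻¹ • frameCoords p.2.1 p.2.2 p.1)
    {p | cross p.2.1 p.2.2 ≠ 0} :=
  ((contDiff_snd.fst.contDiffOn.norm ℝ fun _ hp => left_ne_zero_of_cross hp).inv fun _ hp =>
      norm_ne_zero_iff.2 (left_ne_zero_of_cross hp)).smul contDiffOn_frameCoords

variable {t₁ : ℝ} {γ V : SmoothLoop Vec3}

theorem normalizeField_apply (h : Spread t₁ γ) (V : SmoothLoop Vec3) (t : ℝ) :
    normalizeField t₁ γ V t = frameCoords (derivₗ γ 0) (derivₗ γ t₁) (V t) :=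
  superpose_apply isOpen_cross_ne' contDiffOn_frameCoords
    (f := pair V (pair (evalₗ 0 (derivₗ γ)) (evalₗ t₁ (derivₗ γ)))) (fun _ => h) t

theorem normalizeCurve_apply (h : Spread t₁ γ) (t : ℝ) : normalizeCurve t₁ γ t =
    ‖derivₗ γ 0‖⁻¹ • frameCoords (derivₗ γ 0) (derivₗ γ t₁) (γ t - γ 0) :=
  superpose_apply isOpen_cross_ne' contDiffOn_normalizeCurve
    (f := pair (γ - evalₗ 0 γ) (pair (evalₗ 0 (derivₗ γ)) (evalₗ t₁ (derivₗ γ)))) (fun _ => h) t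

/-- The image of a curve under a similarity. -/
noncomputable def sim (r : ℝ) (A : SO3) (b : Vec3) (γ : SmoothLoop Vec3) : SmoothLoop Vec3 :=
  superpose (fun x => r • rot A x + b) γ

theorem contDiff_rot (A : SO3) : ContDiff ℝ ∞ (rot A) :=
  (LinearMap.toContinuousLinearMap (Matrix.toEuclideanLin A.1)).contDiff

theorem contDiff_sim (r : ℝ) (A : SO3) (b : Vec3) : ContDiff ℝ ∞ fun x => r • rot A x + b :=
  ((contDiff_rot A).const_smul r).add contDiff_const

theorem sim_apply (r : ℝ) (A : SO3) (b : Vec3) (γ : SmoothLoop Vec3) (t : ℝ) :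
    sim r A b γ t = r • rot A (γ t) + b :=
  superpose_apply isOpen_univ (contDiff_sim r A b).contDiffOn (fun _ => mem_univ _) t

theorem _root_.HasDerivAt.rot {f : ℝ → Vec3} {f' : Vec3} {t : ℝ} (hf : HasDerivAt f f' t) (A : SO3) :
    HasDerivAt (fun t => rot A (f t)) (rot A f') t :=
  (LinearMap.toContinuousLinearMap (Matrix.toEuclideanLin A.1)).hasFDerivAt.comp_hasDerivAt t hf

theorem derivₗ_of_sim {γ γ' : SmoothLoop Vec3} {r : ℝ} {A : SO3} {b : Vec3}
    (h : ∀ t, γ' t = r • rot A (γ t) + b) (t : ℝ) : derivₗ γ' t = r • rot A (derivₗ γ t) := by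
  have h1 : HasDerivAt (γ' : ℝ → Vec3) (r • rot A (derivₗ γ t)) t := by
    rw [show (γ' : ℝ → Vec3) = fun t => r • rot A (γ t) + b from funext h]
    exact (((γ.hasDerivAt t).rot A).const_smul r).add_const b
  exact h1.deriv

theorem immersed_of_sim {γ γ' : SmoothLoop Vec3} {r : ℝ} (hr : 0 < r) {A : SO3} {b : Vec3}
    (h : ∀ t, γ' t = r • rot A (γ t) + b) (hγ : γ.Immersed) : γ'.Immersed := by
  intro t
  rw [← derivₗ_apply, derivₗ_of_sim h]
  refine smul_ne_zero hr.ne' fun h0 => hγ t ?_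
  exact rot_injective A (by rw [rot_zero]; exact h0)

theorem spread_of_sim {γ γ' : SmoothLoop Vec3} {r : ℝ} (hr : 0 < r) {A : SO3} {b : Vec3}
    (h : ∀ t, γ' t = r • rot A (γ t) + b) (hγ : Spread t₁ γ) : Spread t₁ γ' := by
  rw [Spread, derivₗ_of_sim h, derivₗ_of_sim h, cross_smul_left, cross_smul_right, cross_rot]
  refine smul_ne_zero hr.ne' (smul_ne_zero hr.ne' fun h0 => hγ ?_)
  exact rot_injective A (by rw [rot_zero]; exact h0)

theorem normalizeCurve_of_sim {γ γ' : SmoothLoop Vec3} {r : ℝ} (hr : 0 < r) {A : SO3} {b : Vec3}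
    (h : ∀ t, γ' t = r • rot A (γ t) + b) (hγ : Spread t₁ γ) :
    normalizeCurve t₁ γ' = normalizeCurve t₁ γ := by
  refine ext fun t => ?_
  rw [normalizeCurve_apply (spread_of_sim hr h hγ), normalizeCurve_apply hγ, derivₗ_of_sim h,
    derivₗ_of_sim h, h t, h 0, add_sub_add_right_eq_sub, ← smul_sub, ← rot_sub, frameCoords_smul,
    frameCoords_sim hr, norm_smul, norm_rot, Real.norm_eq_abs, abs_of_pos hr, smul_smul, mul_inv]
  congr 1
  field_simp

theorem exists_sim_normalizeCurve (h : Spread t₁ γ) : ∃ (r : ℝ) (A : SO3) (b : Vec3), 0 < r ∧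
    (∀ t, normalizeCurve t₁ γ t = r • rot A (γ t) + b) ∧
    ∀ V : SmoothLoop Vec3, ∀ t, normalizeField t₁ γ V t = rot A (V t) := by
  obtain ⟨A, hA⟩ := exists_frameCoords_eq_rot h
  refine ⟨‖derivₗ γ 0‖⁻¹, A, -(‖derivₗ γ 0‖⁻¹ • rot A (γ 0)), inv_pos.2
    (norm_pos_iff.2 (left_ne_zero_of_cross h)), fun t => ?_, fun V t => ?_⟩
  · rw [normalizeCurve_apply h, hA, rot_sub, smul_sub, sub_eq_add_neg]
  · rw [normalizeField_apply h, hA]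

/-- A curve in normal position. -/
structure IsNormalized (t₁ : ℝ) (γ : SmoothLoop Vec3) : Prop where
  zero : γ 0 = 0
  deriv_zero : derivₗ γ 0 = !₂[1, 0, 0]
  deriv_one : 0 < derivₗ γ t₁ 1
  deriv_two : derivₗ γ t₁ 2 = 0

theorem IsNormalized.spread (h : IsNormalized t₁ γ) : Spread t₁ γ :=
  cross_ne_zero_of_normalized h.deriv_zero h.deriv_one

theorem IsNormalized.normalizeCurve (h : IsNormalized t₁ γ) : normalizeCurve t₁ γ = γ := by
  refine ext fun t => ?_
  have h1 : ‖derivₗ γ 0‖ = 1 := norm_eq_of_sq zero_le_one (by simp [h.deriv_zero])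
  rw [normalizeCurve_apply h.spread, h1, frameCoords_normalized h.deriv_zero h.deriv_one h.deriv_two,
    h.zero, sub_zero, inv_one, one_smul]

theorem IsNormalized.normalizeField (h : IsNormalized t₁ γ) (V : SmoothLoop Vec3) :
    normalizeField t₁ γ V = V := by
  refine ext fun t => ?_
  rw [normalizeField_apply h.spread, frameCoords_normalized h.deriv_zero h.deriv_one h.deriv_two]

theorem isNormalized_normalizeCurve (h : Spread t₁ γ) : IsNormalized t₁ (normalizeCurve t₁ γ) := by
  obtain ⟨A, hA⟩ := exists_frameCoords_eq_rot h
  have hr : 0 < ‖derivₗ γ 0‖⁻¹ := inv_pos.2 (norm_pos_iff.2 (left_ne_zero_of_cross h))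
  have hs : ∀ t, normalizeCurve t₁ γ t = ‖derivₗ γ 0‖⁻¹ • rot A (γ t) +
      -(‖derivₗ γ 0‖⁻¹ • rot A (γ 0)) := fun t => by
    rw [normalizeCurve_apply h, hA, rot_sub, smul_sub, sub_eq_add_neg]
  have hd : ∀ t, derivₗ (normalizeCurve t₁ γ) t = ‖derivₗ γ 0‖⁻¹ •
      frameCoords (derivₗ γ 0) (derivₗ γ t₁) (derivₗ γ t) := fun t => by
    rw [derivₗ_of_sim hs, hA]
  refine ⟨?_, ?_, ?_, ?_⟩
  · rw [hs, add_neg_cancel]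
  · rw [hd, frameCoords_left]
    have := inv_pos.1 hr
    ext i
    fin_cases i <;> simp
    field_simp
  · rw [hd, PiLp.smul_apply, smul_eq_mul]
    exact mul_pos hr (frameCoords_right_one h)
  · rw [hd, PiLp.smul_apply, frameCoords_right_two, smul_zero]

/-- Every immersed loop is spread for some parameter: a closed immersed curve is not contained in a line. -/
theorem Immersed.exists_spread (h : γ.Immersed) : ∃ t₁, Spread t₁ γ := by
  by_contra hn
  simp only [Spread, not_exists, not_not] at hn
  set a := derivₗ γ 0 with ha
  have ha0 : a ≠ 0 := h 0
  -- the velocity is a multiple of `a`, with a factor which does not change sign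
  have h1 : ∀ t, inner ℝ (derivₗ γ t) a ≠ 0 := by
    intro t h0
    have := cross_eq_zero_imp ha0 (hn t)
    rw [h0, zero_div, zero_smul] at this
    exact h t this
  have hc : Continuous fun t => inner ℝ (derivₗ γ t) a :=
    (derivₗ γ).continuous.inner _root_.continuous_const
  have hpos : ∀ t, 0 < inner ℝ (derivₗ γ t) a := by
    intro t
    by_contra hneg
    have h0 : 0 ≤ inner ℝ (derivₗ γ 0) a := by rw [← ha]; exact real_inner_self_nonneg
    obtain ⟨s, -, hs⟩ := (isPreconnected_univ (α := ℝ)).intermediate_value (mem_univ t)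
      (mem_univ 0) hc.continuousOn ⟨not_lt.1 hneg, h0⟩
    exact h1 s hs
  -- but its integral over a period vanishes
  have hint : ∫ t in (0 : ℝ)..2, inner ℝ (derivₗ γ t) a = 0 := by
    have hd : ∀ t, HasDerivAt (fun t => inner ℝ (γ t) a) (inner ℝ (derivₗ γ t) a) t := fun t => by
      simpa using (γ.hasDerivAt t).inner ℝ (hasDerivAt_const t a)
    rw [intervalIntegral.integral_eq_sub_of_hasDerivAt (fun t _ => hd t)
      (hc.intervalIntegrable _ _)]
    have : γ 2 = γ 0 := by simpa using γ.periodic 0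
    rw [this, sub_self]
  have := intervalIntegral.intervalIntegral_pos_of_pos (hc.intervalIntegrable 0 2) hpos two_pos
  exact this.ne' hint

end SmoothLoop

open SmoothLoop in
theorem FrechetSmoothOn.normalizeField {E : Type} [AddCommGroup E] [Module ℝ E] [TopologicalSpace E]
    [IsFrechetSpace E] {W : Set E} {γ V : E → SmoothLoop Vec3} {t₁ : ℝ} (hγ : FrechetSmoothOn γ W)
    (hV : FrechetSmoothOn V W) (h : ∀ x ∈ W, Spread t₁ (γ x)) :
    FrechetSmoothOn (fun x => SmoothLoop.normalizeField t₁ (γ x) (V x)) W :=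
  (hV.pair ((hγ.derivₗ.evalₗ 0).pair (hγ.derivₗ.evalₗ t₁))).superpose isOpen_cross_ne'
    contDiffOn_frameCoords (fun x hx _ => h x hx)

open SmoothLoop in
theorem FrechetSmoothOn.normalizeCurve {E : Type} [AddCommGroup E] [Module ℝ E] [TopologicalSpace E]
    [IsFrechetSpace E] {W : Set E} {γ : E → SmoothLoop Vec3} {t₁ : ℝ} (hγ : FrechetSmoothOn γ W)
    (h : ∀ x ∈ W, Spread t₁ (γ x)) :
    FrechetSmoothOn (fun x => SmoothLoop.normalizeCurve t₁ (γ x)) W :=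
  ((hγ.sub (hγ.evalₗ 0)).pair ((hγ.derivₗ.evalₗ 0).pair (hγ.derivₗ.evalₗ t₁))).superpose
    isOpen_cross_ne' contDiffOn_normalizeCurve (fun x hx _ => h x hx)

theorem FrechetSmoothOn.sim {E : Type} [AddCommGroup E] [Module ℝ E] [TopologicalSpace E]
    [IsFrechetSpace E] {W : Set E} {γ : E → SmoothLoop Vec3} (hγ : FrechetSmoothOn γ W)
    (r : ℝ) (A : SO3) (b : Vec3) : FrechetSmoothOn (fun x => SmoothLoop.sim r A b (γ x)) W :=
  hγ.superpose isOpen_univ (SmoothLoop.contDiff_sim r A b).contDiffOn (fun _ _ _ => mem_univ _)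

/-! ### Closed orbit relations -/

instance : CompactSpace SO3 := by
  refine (isCompact_iff_compactSpace (s := ((Matrix.specialOrthogonalGroup (Fin 3) ℝ : Submonoid _) : Set (Matrix (Fin 3) (Fin 3) ℝ)))).1 ?_
  have hK : IsCompact (Set.pi univ fun _ : Fin 3 => Set.pi univ fun _ : Fin 3 => Icc (-1 : ℝ) 1) :=
    isCompact_univ_pi fun _ => isCompact_univ_pi fun _ => isCompact_Icc
  refine hK.of_isClosed_subset ?_ ?_
  · have : ((Matrix.specialOrthogonalGroup (Fin 3) ℝ : Submonoid _) : Set (Matrix (Fin 3) (Fin 3) ℝ))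
        = {A | A * Aᵀ = 1} ∩ {A | A.det = 1} := by
      ext A
      rw [SetLike.mem_coe, Matrix.mem_specialOrthogonalGroup_iff, Matrix.mem_orthogonalGroup_iff]
      rfl
    rw [this]
    exact (isClosed_eq (continuous_id.matrix_mul continuous_id.matrix_transpose) _root_.continuous_const).inter
      (isClosed_eq continuous_id.matrix_det _root_.continuous_const)
  · intro A hA i _ j _
    have h := entry_norm_bound_of_unitary (𝕜 := ℝ) (Matrix.mem_specialOrthogonalGroup_iff.1 hA).1 i j
    exact abs_le.1 h

theorem continuous_rot : Continuous fun p : SO3 × Vec3 => rot p.1 p.2 := by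
  have h : Continuous fun p : SO3 × Vec3 => (p.1.1 *ᵥ p.2.ofLp) :=
    (continuous_subtype_val.comp continuous_fst).matrix_mulVec
      ((PiLp.continuous_ofLp 2 _).comp continuous_snd)
  exact (PiLp.continuous_toLp 2 _).comp h

theorem Continuous.rot {X : Type*} [TopologicalSpace X] {f : X → SO3} {g : X → Vec3}
    (hf : Continuous f) (hg : Continuous g) : Continuous fun x => rot (f x) (g x) :=
  continuous_rot.comp (hf.prodMk hg)

/-- A closed condition with a parameter in a compact space remains closed when the parameter is
quantified existentially. -/
theorem isClosed_exists {X K : Type} [TopologicalSpace X] [TopologicalSpace K] [CompactSpace K]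
    {P : X × K → Prop} (h : IsClosed {x | P x}) : IsClosed {x : X | ∃ k, P (x, k)} := by
  have := isClosedMap_fst_of_compactSpace _ h
  convert this using 1
  ext x
  simp

namespace SmoothLoop

theorem continuous_deriv_at (t : ℝ) : Continuous fun γ : SmoothLoop Vec3 => derivₗ γ t :=
  (continuous_eval_at t).comp continuous_derivₗ

/-- Similarity of two immersed loops in terms of their velocities. -/
theorem exists_sim_iff {γ γ' : SmoothLoop Vec3} (h : γ.Immersed) (h' : γ'.Immersed) (A : SO3) :
    (∃ (r : ℝ) (b : Vec3), 0 < r ∧ ∀ t, γ' t = r • rot A (γ t) + b) ↔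
      ∀ t, ‖derivₗ γ 0‖ • derivₗ γ' t = ‖derivₗ γ' 0‖ • rot A (derivₗ γ t) := by
  constructor
  · rintro ⟨r, b, hr, hs⟩ t
    rw [derivₗ_of_sim hs, derivₗ_of_sim hs, norm_smul, norm_rot, Real.norm_eq_abs, abs_of_pos hr,
      smul_smul, mul_comm]
  · intro hs
    have h0 : 0 < ‖derivₗ γ 0‖ := norm_pos_iff.2 (h 0)
    have h0' : 0 < ‖derivₗ γ' 0‖ := norm_pos_iff.2 (h' 0)
    set r := ‖derivₗ γ 0‖⁻¹ * ‖derivₗ γ' 0‖ with hr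
    have hd : ∀ t, derivₗ γ' t = r • rot A (derivₗ γ t) := fun t => by
      rw [hr, mul_smul, ← hs t, smul_smul, inv_mul_cancel₀ h0.ne', one_smul]
    refine ⟨r, γ' 0 - r • rot A (γ 0), by positivity, fun t => ?_⟩
    have hz : ∀ t, HasDerivAt (fun t => γ' t - r • rot A (γ t)) 0 t := fun t => by
      have := (γ'.hasDerivAt t).sub (((γ.hasDerivAt t).rot A).const_smul r)
      rwa [hd t, sub_self] at this
    have := is_const_of_deriv_eq_zero (fun t => (hz t).differentiableAt) (fun t => (hz t).deriv) t 0
    rw [← this]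
    abel

end SmoothLoop

open SmoothLoop hiding add_apply sub_apply smul_apply zero_apply continuous_const ext mk const const_apply

theorem LoopModuli.mk_eq_iff {γ γ' : ImmersedLoop} : LoopModuli.mk γ = LoopModuli.mk γ' ↔
    ∃ (r : ℝ) (A : SO3) (b : Vec3), 0 < r ∧ ∀ t, γ'.1 t = r • rot A (γ.1 t) + b :=
  Quotient.eq (r := loopSetoid)

theorem FramedModuli.mk_eq_iff {p q : FramedLoop} : FramedModuli.mk p = FramedModuli.mk q ↔
    ∃ (r : ℝ) (A : SO3) (b : Vec3) (z : Circle), 0 < r ∧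
    (∀ t, q.curve t = r • rot A (p.curve t) + b) ∧
    (∀ t, q.framing t = rot A (twistVec (unitTangent p.curve t) (p.framing t) z)) :=
  Quotient.eq (r := framedSetoid)

theorem isQuotientMap_loopModuli : IsQuotientMap LoopModuli.mk :=
  isQuotientMap_quot_mk (r := loopSetoid.r)

theorem isQuotientMap_framedModuli : IsQuotientMap FramedModuli.mk :=
  isQuotientMap_quot_mk (r := framedSetoid.r)

theorem isQuotientMap_basedLoopGroup :
    IsQuotientMap fun u : LoopGroup => (QuotientGroup.mk u : BasedLoopGroup) :=
  isQuotientMap_quotient_mk'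

theorem isInducing_immersedLoop : IsInducing fun γ : ImmersedLoop => γ.1 := IsInducing.subtypeVal

theorem isInducing_incl : IsInducing FramedLoop.incl := ⟨rfl⟩

theorem isInducing_toLoop : IsInducing LoopGroup.toLoop := ⟨rfl⟩

theorem FramedLoop.continuous_curve : Continuous FramedLoop.curve :=
  continuous_fst.comp isInducing_incl.continuous

theorem FramedLoop.continuous_framing : Continuous FramedLoop.framing :=
  continuous_snd.comp isInducing_incl.continuous

/-- Similarity of immersed loops is a closed relation: in terms of the velocities, normalised by the
speed at time `0`, it only involves a parameter in the compact group of rotations. -/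
theorem isClosed_loopRel :
    IsClosed {p : ImmersedLoop × ImmersedLoop | LoopModuli.mk p.1 = LoopModuli.mk p.2} := by
  have h : {p : ImmersedLoop × ImmersedLoop | LoopModuli.mk p.1 = LoopModuli.mk p.2} =
      {p | ∃ A : SO3, ∀ t, ‖derivₗ p.1.1 0‖ • derivₗ p.2.1 t =
        ‖derivₗ p.2.1 0‖ • rot A (derivₗ p.1.1 t)} := by
    ext p
    rw [mem_ofPred_eq, mem_ofPred_eq, LoopModuli.mk_eq_iff, exists_comm]
    exact exists_congr fun A => exists_sim_iff p.1.2 p.2.2 A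
  rw [h]
  refine isClosed_exists (P := fun x : (ImmersedLoop × ImmersedLoop) × SO3 =>
    ∀ t, ‖derivₗ x.1.1.1 0‖ • derivₗ x.1.2.1 t = ‖derivₗ x.1.2.1 0‖ • rot x.2 (derivₗ x.1.1.1 t)) ?_
  have h1 : ∀ t, Continuous fun x : (ImmersedLoop × ImmersedLoop) × SO3 => derivₗ x.1.1.1 t :=
    fun t => (continuous_deriv_at t).comp (continuous_subtype_val.comp continuous_fst.fst)
  have h2 : ∀ t, Continuous fun x : (ImmersedLoop × ImmersedLoop) × SO3 => derivₗ x.1.2.1 t :=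
    fun t => (continuous_deriv_at t).comp (continuous_subtype_val.comp continuous_fst.snd)
  rw [ofPred_forall]
  exact isClosed_iInter fun t => isClosed_eq ((h1 0).norm.smul (h2 t))
    ((h2 0).norm.smul (continuous_rot.comp (continuous_snd.prodMk (h1 t))))

theorem continuous_twistVec : Continuous fun p : Vec3 × Vec3 × ℂ => twistVec p.1 p.2.1 p.2.2 := by
  unfold twistVec
  have h1 : Continuous fun p : Vec3 × Vec3 × ℂ => p.2.2 ^ 2 := continuous_snd.snd.pow 2
  exact ((Complex.continuous_re.comp h1).smul continuous_snd.fst).add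
    ((Complex.continuous_im.comp h1).smul
      (continuous_cross.comp (continuous_fst.prodMk continuous_snd.fst)))

theorem isClosed_framedRel :
    IsClosed {p : FramedLoop × FramedLoop | FramedModuli.mk p.1 = FramedModuli.mk p.2} := by
  have h : {p : FramedLoop × FramedLoop | FramedModuli.mk p.1 = FramedModuli.mk p.2} =
      {p | ∃ k : SO3 × Circle, (∀ t, ‖derivₗ p.1.curve 0‖ • derivₗ p.2.curve t =
        ‖derivₗ p.2.curve 0‖ • rot k.1 (derivₗ p.1.curve t)) ∧
        ∀ t, p.2.framing t = rot k.1 (twistVec (unitTangent p.1.curve t) (p.1.framing t) k.2)} := by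
    ext p
    rw [mem_ofPred_eq, mem_ofPred_eq, FramedModuli.mk_eq_iff]
    constructor
    · rintro ⟨r, A, b, z, hr, h1, h2⟩
      exact ⟨(A, z), (exists_sim_iff p.1.immersed p.2.immersed A).1 ⟨r, b, hr, h1⟩, h2⟩
    · rintro ⟨⟨A, z⟩, h1, h2⟩
      obtain ⟨r, b, hr, h1⟩ := (exists_sim_iff p.1.immersed p.2.immersed A).2 h1
      exact ⟨r, A, b, z, hr, h1, h2⟩
  rw [h]
  refine isClosed_exists (P := fun x : (FramedLoop × FramedLoop) × (SO3 × Circle) =>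
    (∀ t, ‖derivₗ x.1.1.curve 0‖ • derivₗ x.1.2.curve t =
        ‖derivₗ x.1.2.curve 0‖ • rot x.2.1 (derivₗ x.1.1.curve t)) ∧
        ∀ t, x.1.2.framing t =
          rot x.2.1 (twistVec (unitTangent x.1.1.curve t) (x.1.1.framing t) x.2.2)) ?_
  have h1 : ∀ t, Continuous fun x : (FramedLoop × FramedLoop) × (SO3 × Circle) =>
      derivₗ x.1.1.curve t :=
    fun t => (continuous_deriv_at t).comp (FramedLoop.continuous_curve.comp continuous_fst.fst)
  have h2 : ∀ t, Continuous fun x : (FramedLoop × FramedLoop) × (SO3 × Circle) =>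
      derivₗ x.1.2.curve t :=
    fun t => (continuous_deriv_at t).comp (FramedLoop.continuous_curve.comp continuous_fst.snd)
  have hT : ∀ t, Continuous fun x : (FramedLoop × FramedLoop) × (SO3 × Circle) =>
      unitTangent x.1.1.curve t :=
    fun t => ((h1 t).norm.inv₀ fun x => norm_ne_zero_iff.2 (x.1.1.immersed t)).smul (h1 t)
  have hV : ∀ t, Continuous fun x : (FramedLoop × FramedLoop) × (SO3 × Circle) =>
      x.1.1.framing t :=
    fun t => (continuous_eval_at t).comp (FramedLoop.continuous_framing.comp continuous_fst.fst)
  have hV' : ∀ t, Continuous fun x : (FramedLoop × FramedLoop) × (SO3 × Circle) =>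
      x.1.2.framing t :=
    fun t => (continuous_eval_at t).comp (FramedLoop.continuous_framing.comp continuous_fst.snd)
  have hz : Continuous fun x : (FramedLoop × FramedLoop) × (SO3 × Circle) => (x.2.2 : ℂ) :=
    continuous_subtype_val.comp continuous_snd.snd
  rw [ofPred_and, ofPred_forall, ofPred_forall]
  refine (isClosed_iInter fun t => isClosed_eq ((h1 0).norm.smul (h2 t))
    ((h2 0).norm.smul (continuous_rot.comp (continuous_snd.fst.prodMk (h1 t))))).inter
    (isClosed_iInter fun t => isClosed_eq (hV' t) ?_)
  have ht : Continuous fun x : (FramedLoop × FramedLoop) × (SO3 × Circle) =>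
      twistVec (unitTangent x.1.1.curve t) (x.1.1.framing t) x.2.2 :=
    continuous_twistVec.comp (g := fun p : Vec3 × Vec3 × ℂ => twistVec p.1 p.2.1 p.2.2)
      (f := fun x : (FramedLoop × FramedLoop) × (SO3 × Circle) =>
        (unitTangent x.1.1.curve t, x.1.1.framing t, (x.2.2 : ℂ)))
      ((hT t).prodMk ((hV t).prodMk hz))
  have hA : Continuous fun x : (FramedLoop × FramedLoop) × (SO3 × Circle) => x.2.1 :=
    continuous_snd.fst
  exact hA.rot ht

theorem BasedLoopGroup.mk_eq_iff {u v : LoopGroup} :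
    (QuotientGroup.mk u : BasedLoopGroup) = QuotientGroup.mk v ↔
      ∃ z : Circle, ∀ t, v t = u t * z := by
  rw [QuotientGroup.eq]
  refine exists_congr fun z => forall_congr' fun t => ?_
  change (u t)⁻¹ * v t = z ↔ _
  rw [inv_mul_eq_iff_eq_mul]

theorem LoopGroup.toLoop_apply (u : LoopGroup) (t : ℝ) : u.toLoop t = (u t : ℂ) := rfl

theorem isClosed_groupRel : IsClosed {p : LoopGroup × LoopGroup |
    (QuotientGroup.mk p.1 : BasedLoopGroup) = QuotientGroup.mk p.2} := by
  have h : {p : LoopGroup × LoopGroup | (QuotientGroup.mk p.1 : BasedLoopGroup) = QuotientGroup.mk p.2}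
      = {p | ∃ z : Circle, ∀ t, p.2.toLoop t = p.1.toLoop t * (z : ℂ)} := by
    ext p
    rw [mem_ofPred_eq, mem_ofPred_eq, BasedLoopGroup.mk_eq_iff]
    refine exists_congr fun z => forall_congr' fun t => ?_
    exact Circle.ext_iff
  rw [h]
  refine isClosed_exists (P := fun x : (LoopGroup × LoopGroup) × Circle =>
    ∀ t, x.1.2.toLoop t = x.1.1.toLoop t * (x.2 : ℂ)) ?_
  rw [ofPred_forall]
  refine isClosed_iInter fun t => isClosed_eq ?_ (Continuous.mul ?_ ?_)
  · exact (continuous_eval_at t).comp (isInducing_toLoop.continuous.comp continuous_fst.snd)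
  · exact (continuous_eval_at t).comp (isInducing_toLoop.continuous.comp continuous_fst.fst)
  · exact continuous_subtype_val.comp continuous_snd

/-! ### Slices for immersed loops -/

/-- The model space of the moduli space of loops. -/
noncomputable def normalSpace (t₁ : ℝ) : Submodule ℝ (SmoothLoop Vec3) where
  carrier := {f | f 0 = 0 ∧ derivₗ f 0 = 0 ∧ derivₗ f t₁ 2 = 0}
  add_mem' := by
    rintro f g ⟨h1, h2, h3⟩ ⟨k1, k2, k3⟩
    refine ⟨?_, ?_, ?_⟩
    · rw [SmoothLoop.add_apply, h1, k1, add_zero]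
    · rw [map_add, SmoothLoop.add_apply, h2, k2, add_zero]
    · rw [map_add, SmoothLoop.add_apply, PiLp.add_apply, h3, k3, add_zero]
  zero_mem' := by
    refine ⟨rfl, ?_, ?_⟩ <;> rw [map_zero, SmoothLoop.zero_apply]
    rfl
  smul_mem' := by
    rintro c f ⟨h1, h2, h3⟩
    refine ⟨?_, ?_, ?_⟩
    · rw [SmoothLoop.smul_apply, h1, smul_zero]
    · rw [map_smul, SmoothLoop.smul_apply, h2, smul_zero]
    · rw [map_smul, SmoothLoop.smul_apply, PiLp.smul_apply, h3, smul_zero]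

theorem continuous_coord (i : Fin 3) : Continuous fun v : Vec3 => v i :=
  (continuous_apply i).comp (PiLp.continuous_ofLp 2 _)

theorem isClosed_normalSpace (t₁ : ℝ) : IsClosed (normalSpace t₁ : Set (SmoothLoop Vec3)) :=
  (isClosed_eq (continuous_eval_at 0) continuous_const).inter
    ((isClosed_eq (continuous_deriv_at 0) continuous_const).inter
      (isClosed_eq ((continuous_coord 2).comp (continuous_deriv_at t₁)) continuous_const))

instance (t₁ : ℝ) : IsFrechetSpace (normalSpace t₁) := .of_isClosed (isClosed_normalSpace t₁)

/-- A reference loop with initial velocity `e₁`. -/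
noncomputable def refCurve : SmoothLoop Vec3 :=
  SmoothLoop.mk (fun t => (Real.sin (Real.pi * t) / Real.pi) • (!₂[1, 0, 0] : Vec3))
    (((contDiff_const.mul contDiff_id).sin.div_const _).smul contDiff_const) (fun t => by
      have : Real.pi * (t + 2) = Real.pi * t + 2 * Real.pi := by ring
      simp only [this, Real.sin_add_two_pi])

theorem refCurve_zero : refCurve 0 = 0 := by
  change (Real.sin (Real.pi * 0) / Real.pi) • (!₂[1, 0, 0] : Vec3) = 0
  simp

theorem derivₗ_refCurve (t : ℝ) : derivₗ refCurve t = Real.cos (Real.pi * t) • (!₂[1, 0, 0] : Vec3) := by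
  have h1 : HasDerivAt (fun t : ℝ => Real.pi * t) Real.pi t := by
    simpa using (hasDerivAt_id t).const_mul Real.pi
  have h2 := ((h1.sin).div_const Real.pi).smul_const (!₂[1, 0, 0] : Vec3)
  refine h2.deriv.trans ?_
  rw [mul_div_assoc, div_self Real.pi_ne_zero, mul_one]

theorem isNormalized_refCurve_add {t₁ : ℝ} {f : SmoothLoop Vec3} (hf : f ∈ normalSpace t₁)
    (h1 : 0 < derivₗ f t₁ 1) : IsNormalized t₁ (refCurve + f) := by
  obtain ⟨h0, hd, h2⟩ := hf
  refine ⟨?_, ?_, ?_, ?_⟩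
  · rw [SmoothLoop.add_apply, refCurve_zero, h0, add_zero]
  · rw [map_add, SmoothLoop.add_apply, hd, derivₗ_refCurve, add_zero, mul_zero, Real.cos_zero, one_smul]
  · rw [map_add, SmoothLoop.add_apply, PiLp.add_apply, derivₗ_refCurve]
    simpa using h1
  · rw [map_add, SmoothLoop.add_apply, PiLp.add_apply, derivₗ_refCurve, h2]
    simp

theorem IsNormalized.sub_refCurve {t₁ : ℝ} {γ : SmoothLoop Vec3} (h : IsNormalized t₁ γ) :
    γ - refCurve ∈ normalSpace t₁ ∧ 0 < derivₗ (γ - refCurve) t₁ 1 := by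
  refine ⟨⟨?_, ?_, ?_⟩, ?_⟩
  · rw [SmoothLoop.sub_apply, refCurve_zero, h.zero, sub_zero]
  · rw [map_sub, SmoothLoop.sub_apply, derivₗ_refCurve, h.deriv_zero, mul_zero, Real.cos_zero, one_smul, sub_self]
  · rw [map_sub, SmoothLoop.sub_apply, PiLp.sub_apply, derivₗ_refCurve, h.deriv_two]
    simp
  · rw [map_sub, SmoothLoop.sub_apply, PiLp.sub_apply, derivₗ_refCurve]
    simpa using h.deriv_one

theorem exists_sim_back {t₁ : ℝ} {γ : SmoothLoop Vec3} (h : Spread t₁ γ) :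
    ∃ (r : ℝ) (A : SO3) (b : Vec3), 0 < r ∧ sim r A b (normalizeCurve t₁ γ) = γ ∧
      ∀ V : SmoothLoop Vec3, sim 1 A 0 (normalizeField t₁ γ V) = V := by
  obtain ⟨r, A, b, hr, h1, h2⟩ := exists_sim_normalizeCurve h
  refine ⟨r⁻¹, A⁻¹, -(r⁻¹ • rot A⁻¹ b), inv_pos.2 hr, SmoothLoop.ext fun t => ?_,
    fun V => SmoothLoop.ext fun t => ?_⟩
  · rw [sim_apply, h1, rot_add, rot_smul, rot_inv, smul_add, smul_smul, inv_mul_cancel₀ hr.ne',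
      one_smul]
    abel
  · rw [sim_apply, h2, rot_inv, one_smul, add_zero]

/-- The coordinates of a loop in normal position, in the model space. -/
noncomputable def loopCoord (t₁ : ℝ) (γ : SmoothLoop Vec3) : normalSpace t₁ :=
  corestrict (normalSpace t₁) (normalizeCurve t₁ γ - refCurve)

theorem refCurve_add_loopCoord {t₁ : ℝ} {γ : SmoothLoop Vec3} (h : Spread t₁ γ) :
    refCurve + (loopCoord t₁ γ : SmoothLoop Vec3) = normalizeCurve t₁ γ := by
  rw [loopCoord, coe_corestrict (IsNormalized.sub_refCurve (isNormalized_normalizeCurve h)).1,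
    add_sub_cancel]

theorem loopCoord_refCurve_add {t₁ : ℝ} {f : normalSpace t₁} (h1 : 0 < derivₗ f.1 t₁ 1) :
    loopCoord t₁ (refCurve + f.1) = f := by
  rw [loopCoord, (isNormalized_refCurve_add f.2 h1).normalizeCurve, add_sub_cancel_left,
    corestrict_coe]

theorem frechetSmoothOn_loopCoord (t₁ : ℝ) :
    FrechetSmoothOn (loopCoord t₁) {γ | Spread t₁ γ} := by
  refine FrechetSmoothOn.corestrict (isClosed_normalSpace t₁) (isOpen_spread t₁)
    (((FrechetSmoothOn.id _).normalizeCurve fun γ h => h).sub (.const _ _)) fun γ h => ?_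
  exact (IsNormalized.sub_refCurve (isNormalized_normalizeCurve h)).1

theorem frechetSmoothOn_refCurve_add {t₁ : ℝ} (T : Set (normalSpace t₁)) :
    FrechetSmoothOn (fun f : normalSpace t₁ => refCurve + (f : SmoothLoop Vec3)) T :=
  (FrechetSmoothOn.const _ _).add (.of_linear (normalSpace t₁).subtype continuous_subtype_val _)

/-- The points of the model space which are coordinates of immersed loops. -/
def loopTarget (t₁ : ℝ) : Set (normalSpace t₁) :=
  {f | (refCurve + (f : SmoothLoop Vec3)).Immersed ∧ 0 < derivₗ (f : SmoothLoop Vec3) t₁ 1}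

theorem continuous_refCurve_add (t₁ : ℝ) :
    Continuous fun f : normalSpace t₁ => refCurve + (f : SmoothLoop Vec3) :=
  continuous_const.add continuous_subtype_val

theorem isOpen_loopTarget (t₁ : ℝ) : IsOpen (loopTarget t₁) :=
  (isOpen_immersed.preimage (continuous_refCurve_add t₁)).inter
    (isOpen_lt continuous_const ((continuous_coord 1).comp
      ((continuous_deriv_at t₁).comp continuous_subtype_val)))

theorem immersed_normalizeCurve {t₁ : ℝ} {γ : SmoothLoop Vec3} (h : Spread t₁ γ)
    (hγ : γ.Immersed) : (normalizeCurve t₁ γ).Immersed := by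
  obtain ⟨r, A, b, hr, h1, -⟩ := exists_sim_normalizeCurve h
  exact immersed_of_sim hr h1 hγ

theorem loopCoord_mem {t₁ : ℝ} {γ : SmoothLoop Vec3} (h : Spread t₁ γ)
    (hγ : γ.Immersed) : loopCoord t₁ γ ∈ loopTarget t₁ := by
  refine ⟨by rw [refCurve_add_loopCoord h]; exact immersed_normalizeCurve h hγ, ?_⟩
  have h1 := IsNormalized.sub_refCurve (isNormalized_normalizeCurve h)
  rw [loopCoord, coe_corestrict h1.1]
  exact h1.2

theorem loopCoord_of_sim {t₁ : ℝ} {γ γ' : SmoothLoop Vec3} {r : ℝ} (hr : 0 < r) {A : SO3}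
    {b : Vec3} (h : ∀ t, γ' t = r • rot A (γ t) + b) (hγ : Spread t₁ γ) :
    loopCoord t₁ γ' = loopCoord t₁ γ := by
  rw [loopCoord, normalizeCurve_of_sim hr h hγ, loopCoord]

theorem normalizeCurve_eq_of_loopCoord_eq {t₁ : ℝ} {γ γ' : SmoothLoop Vec3} (h : Spread t₁ γ)
    (h' : Spread t₁ γ') (he : loopCoord t₁ γ = loopCoord t₁ γ') :
    normalizeCurve t₁ γ = normalizeCurve t₁ γ' := by
  rw [← refCurve_add_loopCoord h, ← refCurve_add_loopCoord h', he]

/-- The slice for immersed loops modulo similarities given by the normal position. -/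
noncomputable def loopSlice (t₁ : ℝ) (γ₀ : ImmersedLoop) (h₀ : Spread t₁ γ₀.1) :
    Slice (fun γ : ImmersedLoop => γ.1) LoopModuli.mk where
  C := normalSpace t₁
  D := {γ | Spread t₁ γ.1}
  T := loopTarget t₁
  ρ γ := loopCoord t₁ γ.1
  base := γ₀
  base_mem := h₀
  isOpen_T := isOpen_loopTarget t₁
  mapsTo γ h := loopCoord_mem h γ.2
  smooth_ρ γ h := ⟨_, isOpen_spread t₁, h, _, frechetSmoothOn_loopCoord t₁,
    fun γ' h' => ⟨h', rfl⟩⟩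
  invariant γ h γ' he := by
    obtain ⟨r, A, b, hr, hs⟩ := LoopModuli.mk_eq_iff.1 he
    exact ⟨spread_of_sim hr hs h, (loopCoord_of_sim hr hs h).symm⟩
  injective γ h γ' h' he := by
    obtain ⟨r, A, b, hr, hs, -⟩ := exists_sim_normalizeCurve h
    obtain ⟨r', A', b', hr', hs', -⟩ := exists_sim_normalizeCurve h'
    rw [← normalizeCurve_eq_of_loopCoord_eq h h' he] at hs'
    let n : ImmersedLoop := ⟨normalizeCurve t₁ γ.1, immersed_normalizeCurve h γ.2⟩
    have h1 : LoopModuli.mk γ = LoopModuli.mk n := LoopModuli.mk_eq_iff.2 ⟨r, A, b, hr, hs⟩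
    have h2 : LoopModuli.mk γ' = LoopModuli.mk n := LoopModuli.mk_eq_iff.2 ⟨r', A', b', hr', hs'⟩
    rw [h1, h2]
  exists_section γ h := by
    classical
    obtain ⟨r, A, b, hr, hs, -⟩ := exists_sim_back h
    have hi : ∀ f ∈ loopTarget t₁, (sim r A b (refCurve + f.1)).Immersed := fun f hf =>
      immersed_of_sim hr (sim_apply r A b _) hf.1
    set s : normalSpace t₁ → ImmersedLoop := fun f =>
      if hf : (sim r A b (refCurve + f.1)).Immersed then ⟨_, hf⟩ else γ with hsdef
    have hsv : ∀ f ∈ loopTarget t₁, (s f).1 = sim r A b (refCurve + f.1) := fun f hf => by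
      rw [hsdef]
      simp only
      rw [dif_pos (hi f hf)]
    refine ⟨s, ?_, ?_, fun f hf => ?_⟩
    · refine Subtype.ext ?_
      rw [hsv _ (loopCoord_mem h γ.2), refCurve_add_loopCoord h, hs]
    · exact ((frechetSmoothOn_refCurve_add _).sim r A b).congr hsv
    · have hn := isNormalized_refCurve_add f.2 hf.2
      simp only [mem_ofPred_eq]
      rw [hsv f hf]
      exact ⟨spread_of_sim hr (sim_apply r A b _) hn.spread,
        by rw [loopCoord_of_sim hr (sim_apply r A b _) hn.spread, loopCoord_refCurve_add hf.2]⟩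

theorem exists_loopSlice (γ : ImmersedLoop) :
    ∃ σ : Slice (fun γ : ImmersedLoop => γ.1) LoopModuli.mk, γ ∈ σ.D := by
  obtain ⟨t₁, h⟩ := Immersed.exists_spread γ.2
  exact ⟨loopSlice t₁ γ h, h⟩

/-! ### Slices for the based loop group -/

section Univ

variable {E F F' : Type} [AddCommGroup E] [Module ℝ E] [TopologicalSpace E] [IsFrechetSpace E]
  [NormedAddCommGroup F] [NormedSpace ℝ F] [CompleteSpace F]
  [NormedAddCommGroup F'] [NormedSpace ℝ F'] [CompleteSpace F']

theorem SmoothLoop.superpose_apply_univ {Φ : F → F'} (hΦ : ContDiff ℝ ∞ Φ) (f : SmoothLoop F)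
    (t : ℝ) : superpose Φ f t = Φ (f t) :=
  superpose_apply isOpen_univ hΦ.contDiffOn (fun _ => mem_univ _) t

theorem FrechetSmoothOn.superpose_univ {W : Set E} {A : E → SmoothLoop F}
    (hA : FrechetSmoothOn A W) {Φ : F → F'} (hΦ : ContDiff ℝ ∞ Φ) :
    FrechetSmoothOn (fun x => SmoothLoop.superpose Φ (A x)) W :=
  hA.superpose isOpen_univ hΦ.contDiffOn fun _ _ _ => mem_univ _

end Univ

namespace SmoothLoop

/-- Pointwise product of complex loops. -/
noncomputable def mul (f g : SmoothLoop ℂ) : SmoothLoop ℂ :=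
  superpose (fun p : ℂ × ℂ => p.1 * p.2) (pair f g)

/-- Pointwise complex conjugation. -/
noncomputable def conj (f : SmoothLoop ℂ) : SmoothLoop ℂ := superpose (starRingEnd ℂ) f

/-- The loop `e^{iθ}`. -/
noncomputable def expI (θ : SmoothLoop ℝ) : SmoothLoop ℂ :=
  superpose (fun x : ℝ => Complex.exp (x * Complex.I)) θ

/-- The angular velocity `Im (conj f * f')` of a complex loop. -/
noncomputable def angSpeed (f : SmoothLoop ℂ) : SmoothLoop ℝ :=
  superpose (fun p : ℂ × ℂ => p.1.re * p.2.im - p.1.im * p.2.re) (pair f (derivₗ f))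

theorem contDiff_mul_complex : ContDiff ℝ ∞ fun p : ℂ × ℂ => p.1 * p.2 := contDiff_fst.mul contDiff_snd

theorem contDiff_expI : ContDiff ℝ ∞ fun x : ℝ => Complex.exp (x * Complex.I) :=
  (Complex.ofRealCLM.contDiff.mul contDiff_const).cexp

theorem contDiff_angSpeed :
    ContDiff ℝ ∞ fun p : ℂ × ℂ => p.1.re * p.2.im - p.1.im * p.2.re :=
  ((Complex.reCLM.contDiff.comp contDiff_fst).mul (Complex.imCLM.contDiff.comp contDiff_snd)).sub
    ((Complex.imCLM.contDiff.comp contDiff_fst).mul (Complex.reCLM.contDiff.comp contDiff_snd))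

theorem mul_apply (f g : SmoothLoop ℂ) (t : ℝ) : mul f g t = f t * g t :=
  superpose_apply_univ contDiff_mul_complex _ t

theorem conj_apply (f : SmoothLoop ℂ) (t : ℝ) : conj f t = starRingEnd ℂ (f t) :=
  superpose_apply_univ Complex.conjCLE.contDiff _ t

theorem expI_apply (θ : SmoothLoop ℝ) (t : ℝ) : expI θ t = Circle.exp (θ t) :=
  (superpose_apply_univ contDiff_expI _ t).trans (Circle.coe_exp _).symm

theorem angSpeed_apply (f : SmoothLoop ℂ) (t : ℝ) : angSpeed f t =
    (f t).re * (derivₗ f t).im - (f t).im * (derivₗ f t).re :=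
  superpose_apply_univ contDiff_angSpeed _ t

variable {E : Type} [AddCommGroup E] [Module ℝ E] [TopologicalSpace E] [IsFrechetSpace E]
  {W : Set E}

theorem _root_.FrechetSmoothOn.mul {f g : E → SmoothLoop ℂ} (hf : FrechetSmoothOn f W)
    (hg : FrechetSmoothOn g W) : FrechetSmoothOn (fun x => SmoothLoop.mul (f x) (g x)) W :=
  (hf.pair hg).superpose_univ contDiff_mul_complex

theorem _root_.FrechetSmoothOn.conj {f : E → SmoothLoop ℂ} (hf : FrechetSmoothOn f W) :
    FrechetSmoothOn (fun x => SmoothLoop.conj (f x)) W :=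
  hf.superpose_univ Complex.conjCLE.contDiff

theorem _root_.FrechetSmoothOn.expI {f : E → SmoothLoop ℝ} (hf : FrechetSmoothOn f W) :
    FrechetSmoothOn (fun x => SmoothLoop.expI (f x)) W :=
  hf.superpose_univ contDiff_expI

theorem _root_.FrechetSmoothOn.angSpeed {f : E → SmoothLoop ℂ} (hf : FrechetSmoothOn f W) :
    FrechetSmoothOn (fun x => SmoothLoop.angSpeed (f x)) W :=
  (hf.pair hf.derivₗ).superpose_univ contDiff_angSpeed

theorem hasDerivAt_re (f : SmoothLoop ℂ) (t : ℝ) :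
    HasDerivAt (fun t => (f t).re) (derivₗ f t).re t :=
  Complex.reCLM.hasFDerivAt.comp_hasDerivAt t (f.hasDerivAt t)

theorem hasDerivAt_im (f : SmoothLoop ℂ) (t : ℝ) :
    HasDerivAt (fun t => (f t).im) (derivₗ f t).im t :=
  Complex.imCLM.hasFDerivAt.comp_hasDerivAt t (f.hasDerivAt t)

theorem integral_eq_of_hasDerivAt {θ : ℝ → ℝ} {f : SmoothLoop ℝ} (h : ∀ t, HasDerivAt θ (f t) t)
    (t : ℝ) : ∫ s in (0 : ℝ)..t, f s = θ t - θ 0 :=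
  intervalIntegral.integral_eq_sub_of_hasDerivAt (fun s _ => h s) (f.intervalIntegrable _ _)

theorem eq_primₗ_of_hasDerivAt {θ : ℝ → ℝ} {f : SmoothLoop ℝ} (h : ∀ t, HasDerivAt θ (f t) t)
    (h0 : ∫ s in (0 : ℝ)..2, f s = 0) (t : ℝ) : θ t = primₗ f t + θ 0 := by
  rw [primₗ_apply, h0, integral_eq_of_hasDerivAt h, smul_zero]
  ring

end SmoothLoop

theorem eq_zero_of_abs_lt_two_pi {x : ℝ} {n : ℤ} (h : x = 2 * Real.pi * n)
    (hx : |x| < 2 * Real.pi) : x = 0 := by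
  have hn : n = 0 := by
    rw [h, abs_mul, abs_of_pos Real.two_pi_pos] at hx
    have : |(n : ℝ)| < 1 := by
      by_contra hc
      push Not at hc
      nlinarith [Real.pi_pos]
    rw [← Int.cast_abs, ← Int.cast_one, Int.cast_lt, Int.abs_lt_one_iff] at this
    exact this
  rw [h, hn]
  simp

namespace LoopGroup

theorem sq_add_sq (u : LoopGroup) (t : ℝ) : (u.toLoop t).re ^ 2 + (u.toLoop t).im ^ 2 = 1 := by
  have h := Circle.normSq_coe (u t)
  rw [Complex.normSq_apply] at h
  rw [toLoop_apply, pow_two, pow_two, h]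

theorem periodic (u : LoopGroup) : Function.Periodic u 2 := u.2.2

theorem ext {u v : LoopGroup} (h : ∀ t, u t = v t) : u = v := Subtype.ext (funext h)

/-- Two loops in the circle differ by a smooth angle function. -/
theorem exists_angle (u v : LoopGroup) : ∃ θ : ℝ → ℝ, (∀ t, u t = v t * Circle.exp (θ t)) ∧
    ∀ t, HasDerivAt θ ((angSpeed u.toLoop - angSpeed v.toLoop) t) t := by
  have hu := u.sq_add_sq
  have hv := v.sq_add_sq
  set f := u.toLoop with hf
  set g := v.toLoop with hg
  have key : ∀ t, ((f t).re * (g t).re + (f t).im * (g t).im) *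
      (((derivₗ f t).im * (g t).re + (f t).im * (derivₗ g t).re) -
        ((derivₗ f t).re * (g t).im + (f t).re * (derivₗ g t).im)) -
      ((f t).im * (g t).re - (f t).re * (g t).im) *
      (((derivₗ f t).re * (g t).re + (f t).re * (derivₗ g t).re) +
        ((derivₗ f t).im * (g t).im + (f t).im * (derivₗ g t).im)) =
      (angSpeed f - angSpeed g) t := fun t => by
    rw [SmoothLoop.sub_apply, angSpeed_apply, angSpeed_apply]
    linear_combination ((f t).re * (derivₗ f t).im - (f t).im * (derivₗ f t).re) * hv t -
      ((g t).re * (derivₗ g t).im - (g t).im * (derivₗ g t).re) * hu t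
  -- the components of `u` times the conjugate of `v`
  obtain ⟨θ, -, hc, hs, hd⟩ := _root_.exists_angle
    (fun t => ((f.hasDerivAt_re t).fun_mul (g.hasDerivAt_re t)).fun_add
      ((f.hasDerivAt_im t).fun_mul (g.hasDerivAt_im t)))
    (fun t => ((f.hasDerivAt_im t).fun_mul (g.hasDerivAt_re t)).fun_sub
      ((f.hasDerivAt_re t).fun_mul (g.hasDerivAt_im t)))
    (by rw [funext key]; exact (angSpeed f - angSpeed g).contDiff)
    (fun t => by
      linear_combination ((g t).re ^ 2 + (g t).im ^ 2) * hu t + hv t)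
  refine ⟨θ, fun t => Circle.ext ?_, fun t => ?_⟩
  · rw [Circle.coe_mul, Circle.coe_exp, Complex.exp_mul_I, ← Complex.ofReal_cos,
      ← Complex.ofReal_sin, ← hc, ← hs]
    change f t = g t * _
    apply Complex.ext <;> simp
    · linear_combination -(f t).re * hv t
    · linear_combination -(f t).im * hv t
  · rw [← key t]
    exact hd t

theorem exists_int_integral (u v : LoopGroup) : ∃ n : ℤ,
    ∫ s in (0 : ℝ)..2, (angSpeed u.toLoop - angSpeed v.toLoop) s = 2 * Real.pi * n := by
  obtain ⟨θ, h, hd⟩ := exists_angle u v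
  rw [integral_eq_of_hasDerivAt hd]
  have h0 := h 0
  have h2 := h 2
  rw [← zero_add (2 : ℝ), u.periodic, v.periodic, h0, mul_right_inj, zero_add] at h2
  obtain ⟨n, hn⟩ := Circle.exp_eq_exp.1 h2.symm
  exact ⟨n, by rw [hn]; ring⟩

theorem eq_mul_exp (u v : LoopGroup)
    (h : |∫ s in (0 : ℝ)..2, (angSpeed u.toLoop - angSpeed v.toLoop) s| < 2 * Real.pi) :
    ∫ s in (0 : ℝ)..2, (angSpeed u.toLoop - angSpeed v.toLoop) s = 0 ∧
    ∃ c, ∀ t, u t = v t * Circle.exp (primₗ (angSpeed u.toLoop - angSpeed v.toLoop) t + c) := by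
  obtain ⟨n, hn⟩ := exists_int_integral u v
  have h0 := eq_zero_of_abs_lt_two_pi hn h
  obtain ⟨θ, h, hd⟩ := exists_angle u v
  exact ⟨h0, θ 0, fun t => by rw [h t, eq_primₗ_of_hasDerivAt hd h0]⟩

/-- The loop `e^{iθ}` in the circle. -/
noncomputable def exp (θ : SmoothLoop ℝ) : LoopGroup :=
  ⟨fun t => Circle.exp (θ t), by
    simp only [Circle.coe_exp]
    exact contDiff_expI.comp θ.contDiff, fun t => by
    simp only
    rw [θ.periodic]⟩

theorem exp_apply (θ : SmoothLoop ℝ) (t : ℝ) : exp θ t = Circle.exp (θ t) := rfl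

theorem toLoop_exp (θ : SmoothLoop ℝ) : (exp θ).toLoop = expI θ :=
  SmoothLoop.ext fun t => (expI_apply θ t).symm

theorem mul_apply (u v : LoopGroup) (t : ℝ) : (u * v) t = u t * v t := rfl

theorem toLoop_mul (u v : LoopGroup) : (u * v).toLoop = SmoothLoop.mul u.toLoop v.toLoop :=
  SmoothLoop.ext fun t => by
    rw [SmoothLoop.mul_apply]
    rfl

theorem toLoop_inv (u : LoopGroup) : u⁻¹.toLoop = SmoothLoop.conj u.toLoop :=
  SmoothLoop.ext fun t => ((SmoothLoop.conj_apply _ t).trans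
    (Circle.coe_inv_eq_conj (u t)).symm).symm

/-- If `u = v e^{iθ}`, the angular velocities of `u` and `v` differ by `θ'`. -/
theorem angSpeed_mul_exp (u v : LoopGroup) (θ : SmoothLoop ℝ) (c : ℝ)
    (h : ∀ t, u t = v t * Circle.exp (θ t + c)) :
    angSpeed u.toLoop - angSpeed v.toLoop = derivₗ θ := by
  have hu : ∀ t, u.toLoop t = v.toLoop t * Complex.exp ((θ t + c : ℝ) * Complex.I) := fun t => by
    rw [toLoop_apply, h t, Circle.coe_mul, Circle.coe_exp]
    rfl
  have hd : ∀ t, derivₗ u.toLoop t = derivₗ v.toLoop t * Complex.exp ((θ t + c : ℝ) * Complex.I) +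
      v.toLoop t * (Complex.exp ((θ t + c : ℝ) * Complex.I) * ((derivₗ θ t : ℝ) * Complex.I)) :=
    fun t => by
    have h1 := (v.toLoop.hasDerivAt t).mul
      ((((θ.hasDerivAt t).add_const c).ofReal_comp.mul_const Complex.I).cexp)
    exact (u.toLoop.hasDerivAt t).unique (h1.congr_of_eventuallyEq (.of_forall hu))
  refine SmoothLoop.ext fun t => ?_
  rw [SmoothLoop.sub_apply, angSpeed_apply, angSpeed_apply, hu t, hd t, Complex.exp_mul_I,
    ← Complex.ofReal_cos, ← Complex.ofReal_sin]
  have h1 := v.sq_add_sq t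
  have h2 := Real.cos_sq_add_sin_sq (θ t + c)
  simp only [Complex.mul_re, Complex.mul_im, Complex.add_re, Complex.add_im, Complex.ofReal_re,
    Complex.ofReal_im, Complex.I_re, Complex.I_im]
  generalize Real.cos (θ t + c) = C at *
  generalize Real.sin (θ t + c) = S at *
  generalize (v.toLoop t).re = a at *
  generalize (v.toLoop t).im = b at *
  generalize (derivₗ v.toLoop t).re = a' at *
  generalize (derivₗ v.toLoop t).im = b' at *
  generalize derivₗ θ t = d at *
  linear_combination (a * b' - b * a' + d * (a ^ 2 + b ^ 2)) * h2 + d * h1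

end LoopGroup

/-- Real loops vanishing at the base point: the model space of the based loop group. -/
noncomputable def angleSpace : Submodule ℝ (SmoothLoop ℝ) where
  carrier := {f | f 0 = 0}
  add_mem' := by
    rintro f g h1 k1
    change (f + g) 0 = 0
    rw [SmoothLoop.add_apply, h1, k1, add_zero]
  zero_mem' := rfl
  smul_mem' := by
    rintro c f h1
    change (c • f) 0 = 0
    rw [SmoothLoop.smul_apply, h1, smul_zero]

theorem mem_angleSpace {f : SmoothLoop ℝ} : f ∈ angleSpace ↔ f 0 = 0 := Iff.rfl

theorem isClosed_angleSpace : IsClosed (angleSpace : Set (SmoothLoop ℝ)) :=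
  isClosed_eq (continuous_eval_at 0) continuous_const

instance : IsFrechetSpace angleSpace := .of_isClosed isClosed_angleSpace

/-- The normalized primitive of a loop, in `angleSpace`. -/
noncomputable def angleCoord (f : SmoothLoop ℝ) : angleSpace := corestrict angleSpace (primₗ f)

theorem coe_angleCoord (f : SmoothLoop ℝ) : (angleCoord f : SmoothLoop ℝ) = primₗ f :=
  coe_corestrict (primₗ_zero f)

theorem angleCoord_derivₗ (θ : angleSpace) : angleCoord (derivₗ (θ : SmoothLoop ℝ)) = θ := by
  refine Subtype.ext ?_
  rw [coe_angleCoord]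
  refine SmoothLoop.ext fun t => ?_
  rw [primₗ_derivₗ, mem_angleSpace.1 θ.2, sub_zero]

theorem FrechetSmoothOn.angleCoord {E : Type} [AddCommGroup E] [Module ℝ E] [TopologicalSpace E]
    [IsFrechetSpace E] {W : Set E} (hW : IsOpen W) {A : E → SmoothLoop ℝ}
    (hA : FrechetSmoothOn A W) : FrechetSmoothOn (fun x => _root_.angleCoord (A x)) W :=
  hA.primₗ.corestrict isClosed_angleSpace hW fun _ _ => primₗ_zero _

/-- The slice of the loop group, modulo constant loops, around `u₀`: the coordinate of
`u = u₀ e^{iα}` is `α - α(0)`. -/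
noncomputable def groupSlice (u₀ : LoopGroup) :
    Slice LoopGroup.toLoop (fun u : LoopGroup => (QuotientGroup.mk u : BasedLoopGroup)) where
  C := angleSpace
  D := {u | |∫ s in (0 : ℝ)..2, (angSpeed u.toLoop - angSpeed u₀.toLoop) s| < 2 * Real.pi}
  T := univ
  ρ u := angleCoord (angSpeed u.toLoop - angSpeed u₀.toLoop)
  base := u₀
  base_mem := by
    change |∫ s in (0 : ℝ)..2, (angSpeed u₀.toLoop - angSpeed u₀.toLoop) s| < 2 * Real.pi
    rw [sub_self]
    simpa [SmoothLoop.zero_apply] using Real.pi_pos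
  isOpen_T := isOpen_univ
  mapsTo _ _ := mem_univ _
  smooth_ρ u hu := by
    have hs : FrechetSmoothOn (fun z : SmoothLoop ℂ => angSpeed z - angSpeed u₀.toLoop) univ :=
      (FrechetSmoothOn.id _).angSpeed.sub (.const _ _)
    have hW : IsOpen {z : SmoothLoop ℂ |
        |∫ s in (0 : ℝ)..2, (angSpeed z - angSpeed u₀.toLoop) s| < 2 * Real.pi} :=
      isOpen_lt (continuous_integral.comp (continuousOn_univ.1 hs.continuousOn)).abs
        continuous_const
    exact ⟨_, hW, hu, _, (hs.mono (subset_univ _)).angleCoord hW, fun u' hu' => ⟨hu', rfl⟩⟩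
  invariant u hu u' he := by
    obtain ⟨z, hz⟩ := BasedLoopGroup.mk_eq_iff.1 he
    obtain ⟨c, hc⟩ := Circle.exp_surjective z
    have h := LoopGroup.angSpeed_mul_exp u' u 0 c fun t => by
      rw [hz, ← hc, SmoothLoop.zero_apply, zero_add]
    rw [map_zero, sub_eq_zero] at h
    rw [mem_ofPred_eq, h]
    exact ⟨hu, rfl⟩
  injective u hu u' hu' he := by
    obtain ⟨-, c, hc⟩ := LoopGroup.eq_mul_exp _ _ hu
    obtain ⟨-, c', hc'⟩ := LoopGroup.eq_mul_exp _ _ hu'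
    have he' := congrArg (fun f : angleSpace => (f : SmoothLoop ℝ)) he
    simp only [coe_angleCoord] at he'
    refine BasedLoopGroup.mk_eq_iff.2 ⟨Circle.exp (c' - c), fun t => ?_⟩
    rw [hc, hc', he', mul_assoc, ← Circle.exp_add]
    congr 2
    ring
  exists_section u hu := by
    obtain ⟨h0, -, -⟩ := LoopGroup.eq_mul_exp _ _ hu
    set β := angSpeed u.toLoop - angSpeed u₀.toLoop with hβ
    refine ⟨fun y => u * LoopGroup.exp (y - primₗ β), ?_, ?_, fun y _ => ?_⟩
    · refine LoopGroup.ext fun t => ?_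
      rw [LoopGroup.mul_apply, LoopGroup.exp_apply, coe_angleCoord, sub_self,
        SmoothLoop.zero_apply, Circle.exp_zero, mul_one]
    · simp only [LoopGroup.toLoop_mul, LoopGroup.toLoop_exp]
      exact (FrechetSmoothOn.const _ _).mul
        ((FrechetSmoothOn.of_linear angleSpace.subtype continuous_subtype_val _).sub
          (.const _ _)).expI
    · have h1 := LoopGroup.angSpeed_mul_exp (u * LoopGroup.exp (y - primₗ β)) u (y - primₗ β) 0
        fun t => by rw [LoopGroup.mul_apply, LoopGroup.exp_apply, add_zero]
      have h2 : angSpeed (u * LoopGroup.exp (y - primₗ β)).toLoop - angSpeed u₀.toLoop =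
          derivₗ (y : SmoothLoop ℝ) := by
        have h3 : derivₗ (primₗ β) = β := SmoothLoop.ext (derivₗ_primₗ_apply β h0)
        rw [map_sub derivₗ (y : SmoothLoop ℝ), h3] at h1
        rw [← sub_add_sub_cancel _ (angSpeed u.toLoop), h1, ← hβ, sub_add_cancel]
      rw [mem_ofPred_eq, h2, integral_derivₗ, angleCoord_derivₗ, abs_zero]
      exact ⟨Real.two_pi_pos, rfl⟩

theorem exists_groupSlice (u : LoopGroup) : ∃ σ : Slice LoopGroup.toLoop
    (fun u : LoopGroup => (QuotientGroup.mk u : BasedLoopGroup)), u ∈ σ.D :=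
  ⟨groupSlice u, (groupSlice u).base_mem⟩

/-! ### Slices for framed loops -/

namespace SmoothLoop

variable {γ U V : SmoothLoop Vec3}

theorem isUnitNormal_rotate (h : γ.Immersed) (hV : IsUnitNormal γ V) (θ : SmoothLoop ℝ) :
    IsUnitNormal γ (rotate γ V θ) := by
  rw [show (rotate γ V θ : ℝ → Vec3) = rotField γ V θ from funext (rotate_apply h V θ)]
  exact isUnitNormal_rotField h hV θ

theorem density_rotate (h : γ.Immersed) (hV : IsUnitNormal γ V) (θ : SmoothLoop ℝ) :
    density γ (rotate γ V θ) = derivₗ θ + density γ V := by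
  refine ext fun t => ?_
  rw [density_apply h, add_apply, density_apply h,
    show (rotate γ V θ : ℝ → Vec3) = rotField γ V θ from funext (rotate_apply h V θ)]
  exact twistDensity_rotField γ.contDiff h hV V.contDiff (θ.hasDerivAt t)

theorem rotate_rotate (h : γ.Immersed) (hV : IsUnitNormal γ V) (θ φ : SmoothLoop ℝ) :
    rotate γ (rotate γ V θ) φ = rotate γ V (φ + θ) := by
  refine ext fun t => ?_
  rw [rotate_apply h, rotate_apply h,
    show (rotate γ V θ : ℝ → Vec3) = rotField γ V θ from funext (rotate_apply h V θ)]
  exact congrFun (rotField_rotField h hV θ φ) t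

theorem rotate_eq_twistVec (h : γ.Immersed) (V : SmoothLoop Vec3) (θ : SmoothLoop ℝ) (t : ℝ) :
    rotate γ V θ t = twistVec (unitTangent γ t) (V t) (Circle.exp (θ t / 2)) := by
  rw [rotate_apply h, rotField_eq_twistVec]

theorem rotate_zero (h : γ.Immersed) (V : SmoothLoop Vec3) : rotate γ V 0 = V := by
  refine ext fun t => ?_
  rw [rotate_eq_twistVec h, zero_apply, zero_div, Circle.exp_zero, Circle.coe_one, twistVec_one]

/-- Two framings of a loop differ by a smooth angle function. -/
theorem exists_rotation (h : γ.Immersed) (hV : IsUnitNormal γ V) (hU : IsUnitNormal γ U) :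
    ∃ θ : ℝ → ℝ, (∀ t, V t = rotField γ U θ t) ∧
      ∀ t, HasDerivAt θ ((density γ V - density γ U) t) t := by
  obtain ⟨θ, -, h1, h2⟩ := exists_rotField γ.contDiff h hU U.contDiff hV V.contDiff
  refine ⟨θ, congrFun h1, fun t => ?_⟩
  rw [sub_apply, density_apply h, density_apply h]
  exact h2 t

theorem exists_int_integral_density (h : γ.Immersed) (hV : IsUnitNormal γ V)
    (hU : IsUnitNormal γ U) : ∃ n : ℤ,
    ∫ s in (0 : ℝ)..2, (density γ V - density γ U) s = 2 * Real.pi * n := by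
  obtain ⟨θ, h1, hd⟩ := exists_rotation h hV hU
  rw [integral_eq_of_hasDerivAt hd]
  have hp : rotField γ U θ 2 = rotField γ U (fun _ => θ 0) 2 := by
    have h2 : unitTangent γ 2 = unitTangent γ 0 := by
      rw [unitTangent, unitTangent, (periodic_deriv γ.periodic).eq]
    have h3 : U 2 = U 0 := U.periodic.eq
    rw [← h1 2, V.periodic.eq, h1 0, rotField, rotField, h2, h3]
  obtain ⟨hc, hs⟩ := cos_sin_eq_of_rotField_eq h hU hp
  obtain ⟨n, hn⟩ := exists_int_of_cos_sin_eq hc hs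
  exact ⟨n, by rw [hn]; ring⟩

theorem eq_rotate_of_integral_eq_zero (h : γ.Immersed) (hV : IsUnitNormal γ V)
    (hU : IsUnitNormal γ U) (h0 : ∫ s in (0 : ℝ)..2, (density γ V - density γ U) s = 0) :
    ∃ c, V = rotate γ U (primₗ (density γ V - density γ U) + const c) := by
  obtain ⟨θ, h1, hd⟩ := exists_rotation h hV hU
  refine ⟨θ 0, ext fun t => ?_⟩
  rw [h1, rotate_apply h, rotField, rotField, eq_primₗ_of_hasDerivAt hd h0, add_apply, const_apply]

theorem integral_density_eq_zero (h : γ.Immersed) (hV : IsUnitNormal γ V) (hU : IsUnitNormal γ U)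
    (hlt : |∫ s in (0 : ℝ)..2, (density γ V - density γ U) s| < 2 * Real.pi) :
    ∫ s in (0 : ℝ)..2, (density γ V - density γ U) s = 0 := by
  obtain ⟨n, hn⟩ := exists_int_integral_density h hV hU
  exact eq_zero_of_abs_lt_two_pi hn hlt

theorem normalizeField_of_sim {t₁ r : ℝ} {γ γ' V V' : SmoothLoop Vec3} (hr : 0 < r) {A : SO3}
    {b : Vec3} (h : ∀ t, γ' t = r • rot A (γ t) + b) (hV : ∀ t, V' t = rot A (V t))
    (hγ : Spread t₁ γ) : normalizeField t₁ γ' V' = normalizeField t₁ γ V := by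
  refine ext fun t => ?_
  rw [normalizeField_apply (spread_of_sim hr h hγ), normalizeField_apply hγ, derivₗ_of_sim h,
    derivₗ_of_sim h, hV, frameCoords_sim hr]

theorem isUnitNormal_of_sim {r : ℝ} {γ γ' V V' : SmoothLoop Vec3} {A : SO3}
    {b : Vec3} (h : ∀ t, γ' t = r • rot A (γ t) + b) (hV : ∀ t, V' t = rot A (V t))
    (hn : IsUnitNormal γ V) : IsUnitNormal γ' V' := by
  intro t
  have h1 := derivₗ_of_sim h t
  rw [derivₗ_apply, derivₗ_apply] at h1
  rw [hV, norm_rot, h1, inner_smul_right, inner_rot, (hn t).2, mul_zero]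
  exact ⟨(hn t).1, rfl⟩

theorem isUnitNormal_normalizeField {t₁ : ℝ} (h : Spread t₁ γ) (hV : IsUnitNormal γ V) :
    IsUnitNormal (normalizeCurve t₁ γ) (normalizeField t₁ γ V) := by
  obtain ⟨r, A, b, -, h1, h2⟩ := exists_sim_normalizeCurve h
  exact isUnitNormal_of_sim h1 (h2 V) hV

/-- The density, in normal position, of a framing relative to the framing induced by `V₀`. -/
noncomputable def relDensity (t₁ : ℝ) (V₀ : SmoothLoop Vec3) (p : SmoothLoop Vec3 × SmoothLoop Vec3) :
    SmoothLoop ℝ :=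
  density (normalizeCurve t₁ p.1) (normalizeField t₁ p.1 p.2) -
    density (normalizeCurve t₁ p.1) (normalPart (normalizeCurve t₁ p.1) V₀)

theorem frechetSmoothOn_relDensity (t₁ : ℝ) (V₀ : SmoothLoop Vec3) :
    FrechetSmoothOn (relDensity t₁ V₀)
      {p | Spread t₁ p.1 ∧ Transverse (normalizeCurve t₁ p.1) V₀} := by
  have h1 : FrechetSmoothOn (fun p : SmoothLoop Vec3 × SmoothLoop Vec3 => normalizeCurve t₁ p.1)
      {p | Spread t₁ p.1 ∧ Transverse (normalizeCurve t₁ p.1) V₀} :=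
    (FrechetSmoothOn.id _).fst.normalizeCurve fun p hp => hp.1
  refine (h1.density ((FrechetSmoothOn.id _).fst.normalizeField (FrechetSmoothOn.id _).snd
    fun p hp => hp.1) fun p hp => hp.2.immersed).sub (h1.density (h1.normalPart (.const _ _)
    fun p hp => hp.2) fun p hp => hp.2.immersed)

theorem isOpen_relDensity (t₁ : ℝ) (V₀ : SmoothLoop Vec3) :
    IsOpen {p : SmoothLoop Vec3 × SmoothLoop Vec3 |
      (Spread t₁ p.1 ∧ Transverse (normalizeCurve t₁ p.1) V₀) ∧
      |∫ s in (0 : ℝ)..2, relDensity t₁ V₀ p s| < 2 * Real.pi} := by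
  have h1 : IsOpen {p : SmoothLoop Vec3 × SmoothLoop Vec3 | Spread t₁ p.1} :=
    (isOpen_spread t₁).preimage continuous_fst
  have h2 : IsOpen {p : SmoothLoop Vec3 × SmoothLoop Vec3 |
      Spread t₁ p.1 ∧ Transverse (normalizeCurve t₁ p.1) V₀} := by
    have hs := (((FrechetSmoothOn.id {p : SmoothLoop Vec3 × SmoothLoop Vec3 |
      Spread t₁ p.1}).fst.normalizeCurve fun p hp => hp).prodMk
        (FrechetSmoothOn.const V₀ _)).continuousOn
    exact hs.isOpen_inter_preimage h1 isOpen_transverse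
  exact (continuous_integral.comp_continuousOn
    (frechetSmoothOn_relDensity t₁ V₀).continuousOn).abs.isOpen_inter_preimage h2
    (isOpen_Iio (a := 2 * Real.pi))

end SmoothLoop

theorem FramedLoop.immersed' (p : FramedLoop) : p.curve.Immersed := p.immersed

theorem FramedLoop.ext {p q : FramedLoop} (h : p.curve = q.curve) (h' : p.framing = q.framing) :
    p = q := FramedLoop.ext' h fun t => by rw [h']

/-- The domain of the slice of framed loops given by `t₁` and `V₀`. -/
def framedDomain (t₁ : ℝ) (V₀ : SmoothLoop Vec3) : Set FramedLoop :=
  {p | (Spread t₁ p.curve ∧ Transverse (normalizeCurve t₁ p.curve) V₀) ∧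
      |∫ s in (0 : ℝ)..2, relDensity t₁ V₀ p.incl s| < 2 * Real.pi}

/-- The coordinates of a framed loop in a slice. -/
noncomputable def framedCoord (t₁ : ℝ) (V₀ : SmoothLoop Vec3) (p : FramedLoop) :
    normalSpace t₁ × angleSpace :=
  (loopCoord t₁ p.curve, angleCoord (relDensity t₁ V₀ p.incl))

section FramedSlice

variable {t₁ : ℝ} {V₀ : SmoothLoop Vec3}

theorem framedDomain_spec {p : FramedLoop} (h : p ∈ framedDomain t₁ V₀) :
    ∫ s in (0 : ℝ)..2, relDensity t₁ V₀ p.incl s = 0 ∧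
    ∃ c, normalizeField t₁ p.curve p.framing =
      rotate (normalizeCurve t₁ p.curve) (normalPart (normalizeCurve t₁ p.curve) V₀)
        ((angleCoord (relDensity t₁ V₀ p.incl) : SmoothLoop ℝ) + SmoothLoop.const c) := by
  have hV := isUnitNormal_normalizeField h.1.1 p.normal
  have hU := isUnitNormal_normalPart h.1.2
  have h0 := integral_density_eq_zero h.1.2.immersed hV hU h.2
  refine ⟨h0, ?_⟩
  rw [coe_angleCoord]
  exact eq_rotate_of_integral_eq_zero h.1.2.immersed hV hU h0

/-- A framed loop in normal position. -/
noncomputable def FramedLoop.normalize (p : FramedLoop) (h : Spread t₁ p.curve) : FramedLoop :=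
  ⟨normalizeCurve t₁ p.curve, normalizeField t₁ p.curve p.framing,
    immersed_normalizeCurve h p.immersed, isUnitNormal_normalizeField h p.normal⟩

theorem FramedLoop.mk_normalize (p : FramedLoop) (h : Spread t₁ p.curve) :
    FramedModuli.mk (p.normalize h) = FramedModuli.mk p := by
  obtain ⟨r, A, b, hr, h1, h2⟩ := exists_sim_normalizeCurve h
  exact (FramedModuli.mk_eq_iff.2 ⟨r, A, b, 1, hr, h1, fun t => by
    rw [Circle.coe_one, twistVec_one]; exact h2 p.framing t⟩).symm

/-- Framed loops with the same class have the same normal position, up to a constant rotation of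
the framing. -/
theorem normalize_eq_of_mk_eq {p q : FramedLoop} (he : FramedModuli.mk p = FramedModuli.mk q)
    (h : Spread t₁ p.curve) : Spread t₁ q.curve ∧
      normalizeCurve t₁ q.curve = normalizeCurve t₁ p.curve ∧
      ∃ c, normalizeField t₁ q.curve q.framing = rotate (normalizeCurve t₁ p.curve)
        (normalizeField t₁ p.curve p.framing) (SmoothLoop.const c) := by
  obtain ⟨r, A, b, z, hr, h1, h2⟩ := FramedModuli.mk_eq_iff.1 he
  obtain ⟨c, hc⟩ := Circle.exp_surjective z
  refine ⟨spread_of_sim hr h1 h, normalizeCurve_of_sim hr h1 h, 2 * c, ?_⟩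
  have h3 : ∀ t, q.framing t =
      rot A (rotate p.curve p.framing (SmoothLoop.const (2 * c)) t) := fun t => by
    rw [h2, rotate_eq_twistVec p.immersed', SmoothLoop.const_apply, mul_div_cancel_left₀ _ two_ne_zero, hc]
  rw [normalizeField_of_sim hr h1 h3 h]
  obtain ⟨r', A', b', hr', k1, k2⟩ := exists_sim_normalizeCurve h
  refine SmoothLoop.ext fun t => ?_
  rw [k2, rotate_eq_twistVec p.immersed', rotate_eq_twistVec (immersed_normalizeCurve h p.immersed),
    k2, unitTangent_sim hr' A' b' p.curve.contDiff k1, twistVec_rot]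

theorem mk_eq_of_rotate {γ U V V' : SmoothLoop Vec3} {hγ hγ' hV hV'} {φ : SmoothLoop ℝ} {c c' : ℝ}
    (hU : IsUnitNormal γ U) (h : V = rotate γ U (φ + SmoothLoop.const c))
    (h' : V' = rotate γ U (φ + SmoothLoop.const c')) :
    FramedModuli.mk ⟨γ, V, hγ, hV⟩ = FramedModuli.mk ⟨γ, V', hγ', hV'⟩ := by
  refine FramedModuli.mk_eq_iff.2 ⟨1, 1, 0, Circle.exp ((c' - c) / 2), one_pos, fun t => ?_,
    fun t => ?_⟩
  · rw [rot_one, one_smul, add_zero]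
  · rw [rot_one]
    have h1 : V' = rotate γ V (SmoothLoop.const (c' - c)) := by
      rw [h, rotate_rotate hγ hU, h']
      congr 1
      rw [map_sub]
      abel
    have h2 := rotate_eq_twistVec hγ V (SmoothLoop.const (c' - c)) t
    rw [← h1] at h2
    exact h2

theorem relDensity_congr {p q : FramedLoop} (h : p.curve.Immersed)
    (h1 : normalizeCurve t₁ q.curve = normalizeCurve t₁ p.curve)
    {c : ℝ} (hs : Spread t₁ p.curve)
    (h2 : normalizeField t₁ q.curve q.framing = rotate (normalizeCurve t₁ p.curve)
        (normalizeField t₁ p.curve p.framing) (SmoothLoop.const c)) :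
    relDensity t₁ V₀ q.incl = relDensity t₁ V₀ p.incl := by
  have h3 : derivₗ (SmoothLoop.const c) = 0 := SmoothLoop.ext fun t => by
    rw [derivₗ_apply]
    exact deriv_const t c
  change density (normalizeCurve t₁ q.curve) (normalizeField t₁ q.curve q.framing) -
    density (normalizeCurve t₁ q.curve) (normalPart (normalizeCurve t₁ q.curve) V₀) = _
  rw [h1, h2, density_rotate (immersed_normalizeCurve hs h) (isUnitNormal_normalizeField hs p.normal),
    h3, zero_add]
  rfl

/-- The slice for framed loops modulo similarities and constant twists: a framed loop
`(γ, V)`, put in normal position, is determined up to a constant twist by `γ` and the angle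
between `V` and the framing obtained from `V₀` by projecting orthogonally to `γ'`. -/
noncomputable def framedSlice (p₀ : FramedLoop) (h₀ : p₀ ∈ framedDomain t₁ V₀) :
    Slice FramedLoop.incl FramedModuli.mk where
  C := normalSpace t₁ × angleSpace
  D := framedDomain t₁ V₀
  T := {y | y.1 ∈ loopTarget t₁ ∧ Transverse (refCurve + y.1.1) V₀}
  ρ := framedCoord t₁ V₀
  base := p₀
  base_mem := h₀
  isOpen_T := ((isOpen_loopTarget t₁).preimage continuous_fst).inter
    (isOpen_transverse.preimage (((continuous_refCurve_add t₁).comp continuous_fst).prodMk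
      continuous_const))
  mapsTo p hp := by
    refine ⟨loopCoord_mem hp.1.1 p.immersed, ?_⟩
    change Transverse (refCurve + (loopCoord t₁ p.curve : SmoothLoop Vec3)) V₀
    rw [refCurve_add_loopCoord hp.1.1]
    exact hp.1.2
  smooth_ρ p hp := by
    refine ⟨_, isOpen_relDensity t₁ V₀, hp, fun x => (loopCoord t₁ x.1,
      angleCoord (relDensity t₁ V₀ x)), ?_, fun p' h' => ⟨h', rfl⟩⟩
    exact ((frechetSmoothOn_loopCoord t₁).comp (FrechetSmoothOn.id _).fst
      fun x hx => hx.1.1).prodMk (FrechetSmoothOn.angleCoord (isOpen_relDensity t₁ V₀)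
        ((frechetSmoothOn_relDensity t₁ V₀).mono fun x hx => hx.1))
  invariant p hp q he := by
    obtain ⟨hs, h1, c, h2⟩ := normalize_eq_of_mk_eq he hp.1.1
    have h3 := relDensity_congr (V₀ := V₀) p.immersed h1 hp.1.1 h2
    refine ⟨⟨⟨hs, by rw [h1]; exact hp.1.2⟩, by rw [h3]; exact hp.2⟩, ?_⟩
    rw [framedCoord, framedCoord, h3, loopCoord, loopCoord, h1]
  injective p hp q hq he := by
    have e1 : loopCoord t₁ p.curve = loopCoord t₁ q.curve := congrArg Prod.fst he
    have e2 : angleCoord (relDensity t₁ V₀ p.incl) = angleCoord (relDensity t₁ V₀ q.incl) :=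
      congrArg Prod.snd he
    have e3 := normalizeCurve_eq_of_loopCoord_eq hp.1.1 hq.1.1 e1
    obtain ⟨-, c, hc⟩ := framedDomain_spec hp
    obtain ⟨-, c', hc'⟩ := framedDomain_spec hq
    rw [← e2, ← e3] at hc'
    rw [← p.mk_normalize hp.1.1, ← q.mk_normalize hq.1.1]
    have e4 : q.normalize hq.1.1 = ⟨normalizeCurve t₁ p.curve,
        normalizeField t₁ q.curve q.framing, immersed_normalizeCurve hp.1.1 p.immersed, by
          rw [e3]; exact isUnitNormal_normalizeField hq.1.1 q.normal⟩ :=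
      FramedLoop.ext e3.symm rfl
    rw [e4]
    exact mk_eq_of_rotate (isUnitNormal_normalPart hp.1.2) hc hc'
  -- the similarity and the constant twist which normalise `p`, undone on the model
  exists_section p hp := by
    classical
    obtain ⟨r, A, b, hr, hs, hsV⟩ := exists_sim_back hp.1.1
    obtain ⟨-, c, hc⟩ := framedDomain_spec hp
    set T : Set (normalSpace t₁ × angleSpace) :=
      {y | y.1 ∈ loopTarget t₁ ∧ Transverse (refCurve + y.1.1) V₀} with hT
    -- the curve and the framing of the section, in normal position
    set g : normalSpace t₁ × angleSpace → SmoothLoop Vec3 := fun y => refCurve + y.1.1 with hg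
    set F : normalSpace t₁ × angleSpace → SmoothLoop Vec3 := fun y =>
      rotate (g y) (normalPart (g y) V₀) (y.2.1 + SmoothLoop.const c) with hF
    have hgi : ∀ y ∈ T, (g y).Immersed := fun y hy => hy.1.1
    have hFn : ∀ y ∈ T, IsUnitNormal (g y) (F y) := fun y hy =>
      isUnitNormal_rotate (hgi y hy) (isUnitNormal_normalPart hy.2) _
    have hsF : ∀ (V : SmoothLoop Vec3) (t : ℝ), sim 1 A 0 V t = rot A (V t) := fun V t => by
      rw [sim_apply, one_smul, add_zero]
    have hi : ∀ y ∈ T, (sim r A b (g y)).Immersed := fun y hy =>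
      immersed_of_sim hr (sim_apply r A b _) (hgi y hy)
    have hn : ∀ y ∈ T, IsUnitNormal (sim r A b (g y)) (sim 1 A 0 (F y)) := fun y hy =>
      isUnitNormal_of_sim (sim_apply r A b _) (hsF _) (hFn y hy)
    set s : normalSpace t₁ × angleSpace → FramedLoop := fun y =>
      if h : (sim r A b (g y)).Immersed ∧ IsUnitNormal (sim r A b (g y)) (sim 1 A 0 (F y)) then
        ⟨sim r A b (g y), sim 1 A 0 (F y), h.1, h.2⟩ else p with hsdef
    have hsv : ∀ y (hy : y ∈ T), s y = ⟨sim r A b (g y), sim 1 A 0 (F y), hi y hy, hn y hy⟩ :=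
      fun y hy => by
        rw [hsdef]
        simp only
        rw [dif_pos ⟨hi y hy, hn y hy⟩]
    have hgs : FrechetSmoothOn g T := (frechetSmoothOn_refCurve_add univ).comp
      (FrechetSmoothOn.id T).fst fun _ _ => mem_univ _
    have hFs : FrechetSmoothOn F T := hgs.rotate (hgs.normalPart (.const _ _) fun y hy => hy.2)
      ((((FrechetSmoothOn.id T).snd).linear_comp angleSpace.subtype continuous_subtype_val).add
        (.const _ _)) hgi
    refine ⟨s, ?_, ?_, fun y hy => ?_⟩
    · have hm : framedCoord t₁ V₀ p ∈ T := by
        refine ⟨loopCoord_mem hp.1.1 p.immersed, ?_⟩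
        change Transverse (refCurve + (loopCoord t₁ p.curve : SmoothLoop Vec3)) V₀
        rw [refCurve_add_loopCoord hp.1.1]
        exact hp.1.2
      have hg0 : g (framedCoord t₁ V₀ p) = normalizeCurve t₁ p.curve :=
        refCurve_add_loopCoord hp.1.1
      have hF0 : F (framedCoord t₁ V₀ p) = normalizeField t₁ p.curve p.framing := by
        rw [hF]
        simp only
        rw [hg0, hc]
        rfl
      rw [hsv _ hm]
      refine FramedLoop.ext ?_ ?_
      · simp only
        rw [hg0, hs]
      · simp only
        rw [hF0, hsV]
    · exact ((hgs.sim r A b).prodMk (hFs.sim 1 A 0)).congr fun y hy => by rw [hsv y hy]; rfl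
    · have hnorm := isNormalized_refCurve_add y.1.2 hy.1.2
      have e1 : normalizeCurve t₁ (sim r A b (g y)) = g y := by
        rw [normalizeCurve_of_sim hr (sim_apply r A b _) hnorm.spread, hnorm.normalizeCurve]
      have e2 : normalizeField t₁ (sim r A b (g y)) (sim 1 A 0 (F y)) = F y := by
        rw [normalizeField_of_sim hr (sim_apply r A b _) (hsF _) hnorm.spread, hnorm.normalizeField]
      have hd : derivₗ (SmoothLoop.const c) = 0 := SmoothLoop.ext fun t => by
        rw [derivₗ_apply]
        exact deriv_const t c
      have e3 : relDensity t₁ V₀ (s y).incl = derivₗ y.2.1 := by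
        rw [hsv y hy]
        change density (normalizeCurve t₁ (sim r A b (g y)))
            (normalizeField t₁ (sim r A b (g y)) (sim 1 A 0 (F y))) -
          density (normalizeCurve t₁ (sim r A b (g y)))
            (normalPart (normalizeCurve t₁ (sim r A b (g y))) V₀) = _
        rw [e1, e2, hF]
        simp only
        rw [density_rotate (hgi y hy) (isUnitNormal_normalPart hy.2), map_add derivₗ y.2.1, hd, add_zero,
          add_sub_cancel_right]
      refine ⟨⟨⟨?_, ?_⟩, ?_⟩, ?_⟩
      · rw [hsv y hy]
        exact spread_of_sim hr (sim_apply r A b _) hnorm.spread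
      · rw [hsv y hy]
        simp only
        rw [e1]
        exact hy.2
      · rw [e3, integral_derivₗ, abs_zero]
        exact Real.two_pi_pos
      · rw [framedCoord, e3, angleCoord_derivₗ, hsv y hy]
        simp only
        rw [loopCoord_of_sim hr (sim_apply r A b _) hnorm.spread, loopCoord_refCurve_add hy.1.2]

theorem exists_framedSlice (p : FramedLoop) :
    ∃ σ : Slice FramedLoop.incl FramedModuli.mk, p ∈ σ.D := by
  obtain ⟨t₁, h⟩ := Immersed.exists_spread p.immersed'
  have h1 := immersed_normalizeCurve h p.immersed
  have h2 := isUnitNormal_normalizeField h p.normal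
  have hp : p ∈ framedDomain t₁ (normalizeField t₁ p.curve p.framing) := by
    refine ⟨⟨h, transverse_of_isUnitNormal h1 h2⟩, ?_⟩
    have h3 : relDensity t₁ (normalizeField t₁ p.curve p.framing) p.incl = 0 := by
      change density _ (normalizeField t₁ p.curve p.framing) -
        density _ (normalPart (normalizeCurve t₁ p.curve) (normalizeField t₁ p.curve p.framing)) = 0
      rw [normalPart_of_isUnitNormal h1 h2, sub_self]
    rw [h3]
    simpa [SmoothLoop.zero_apply] using Real.pi_pos
  exact ⟨framedSlice p hp, hp⟩

end FramedSlice

/-! ### The three quotient manifolds -/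

/-- The Fréchet manifold `ℬ`. -/
noncomputable def loopManifold : FrechetManifold LoopModuli :=
  Slice.manifold isInducing_immersedLoop isQuotientMap_loopModuli exists_loopSlice isClosed_loopRel

/-- The Fréchet manifold `ℳ`. -/
noncomputable def framedManifold : FrechetManifold FramedModuli :=
  Slice.manifold isInducing_incl isQuotientMap_framedModuli exists_framedSlice isClosed_framedRel

/-- The Fréchet manifold of the based loop group. -/
noncomputable def groupManifold : FrechetManifold BasedLoopGroup :=
  Slice.manifold isInducing_toLoop isQuotientMap_basedLoopGroup exists_groupSlice isClosed_groupRel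

theorem isQuotientManifold_loop :
    IsQuotientManifold (fun γ : ImmersedLoop => γ.1) LoopModuli.mk loopManifold :=
  Slice.isQuotientManifold _ _ _ _

theorem isQuotientManifold_framed :
    IsQuotientManifold FramedLoop.incl FramedModuli.mk framedManifold :=
  Slice.isQuotientManifold _ _ _ _

theorem isQuotientManifold_group : IsQuotientManifold LoopGroup.toLoop
    (fun u : LoopGroup => (QuotientGroup.mk u : BasedLoopGroup)) groupManifold :=
  Slice.isQuotientManifold _ _ _ _

theorem isOpenQuotientMap_loop : IsOpenQuotientMap LoopModuli.mk :=
  Slice.isOpenQuotientMap isInducing_immersedLoop isQuotientMap_loopModuli exists_loopSlice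

theorem isOpenQuotientMap_framed : IsOpenQuotientMap FramedModuli.mk :=
  Slice.isOpenQuotientMap isInducing_incl isQuotientMap_framedModuli exists_framedSlice

theorem isOpenQuotientMap_group :
    IsOpenQuotientMap (fun u : LoopGroup => (QuotientGroup.mk u : BasedLoopGroup)) :=
  Slice.isOpenQuotientMap isInducing_toLoop isQuotientMap_basedLoopGroup exists_groupSlice

/-! ### Spinors of orthonormal frames -/

/-- The squared norm of a spinor. -/
noncomputable def spinN (q : ℂ × ℂ) : ℝ := q.1.re ^ 2 + q.1.im ^ 2 + q.2.re ^ 2 + q.2.im ^ 2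

/-- The first vector of the frame of a spinor, scaled by `spinN` (the Hopf map). -/
noncomputable def spinH (q : ℂ × ℂ) : Vec3 :=
  !₂[q.1.re ^ 2 + q.1.im ^ 2 - q.2.re ^ 2 - q.2.im ^ 2,
    2 * (q.1.im * q.2.re - q.1.re * q.2.im), -2 * (q.1.re * q.2.re + q.1.im * q.2.im)]

/-- The second vector of the frame of a spinor, scaled by `spinN`. -/
noncomputable def spinK (q : ℂ × ℂ) : Vec3 :=
  !₂[2 * (q.1.re * q.2.im + q.1.im * q.2.re),
    q.1.re ^ 2 - q.1.im ^ 2 + q.2.re ^ 2 - q.2.im ^ 2,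
    2 * (q.1.re * q.1.im - q.2.re * q.2.im)]

/-- The third vector of the frame of a spinor, scaled by `spinN`. -/
noncomputable def spinE (q : ℂ × ℂ) : Vec3 :=
  !₂[2 * (q.1.re * q.2.re - q.1.im * q.2.im), -2 * (q.1.re * q.1.im + q.2.re * q.2.im),
    q.1.re ^ 2 - q.1.im ^ 2 - q.2.re ^ 2 + q.2.im ^ 2]

theorem vec3_ext {u v : Vec3} (h0 : u 0 = v 0) (h1 : u 1 = v 1) (h2 : u 2 = v 2) : u = v := by
  ext i
  fin_cases i <;> assumption

section Components

variable (q : ℂ × ℂ)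

theorem spinH_zero : spinH q 0 = q.1.re ^ 2 + q.1.im ^ 2 - q.2.re ^ 2 - q.2.im ^ 2 := rfl
theorem spinH_one : spinH q 1 = 2 * (q.1.im * q.2.re - q.1.re * q.2.im) := rfl
theorem spinH_two : spinH q 2 = -2 * (q.1.re * q.2.re + q.1.im * q.2.im) := rfl
theorem spinK_zero : spinK q 0 = 2 * (q.1.re * q.2.im + q.1.im * q.2.re) := rfl
theorem spinK_one : spinK q 1 = q.1.re ^ 2 - q.1.im ^ 2 + q.2.re ^ 2 - q.2.im ^ 2 := rfl
theorem spinK_two : spinK q 2 = 2 * (q.1.re * q.1.im - q.2.re * q.2.im) := rfl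
theorem spinE_zero : spinE q 0 = 2 * (q.1.re * q.2.re - q.1.im * q.2.im) := rfl
theorem spinE_one : spinE q 1 = -2 * (q.1.re * q.1.im + q.2.re * q.2.im) := rfl
theorem spinE_two : spinE q 2 = q.1.re ^ 2 - q.1.im ^ 2 - q.2.re ^ 2 + q.2.im ^ 2 := rfl

end Components

theorem spinN_pos {q : ℂ × ℂ} (h : q ≠ 0) : 0 < spinN q := by
  rw [spinN]
  rcases (show q.1.re ≠ 0 ∨ q.1.im ≠ 0 ∨ q.2.re ≠ 0 ∨ q.2.im ≠ 0 by
    by_contra hc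
    push Not at hc
    exact h (Prod.ext (Complex.ext hc.1 hc.2.1) (Complex.ext hc.2.2.1 hc.2.2.2))) with
    h | h | h | h <;> positivity

theorem cross_spinH_spinK (q : ℂ × ℂ) : cross (spinH q) (spinK q) = spinN q • spinE q := by
  apply vec3_ext <;> simp only [cross_zero, cross_one, cross_two, PiLp.smul_apply, smul_eq_mul,
    spinH_zero, spinH_one, spinH_two, spinK_zero, spinK_one, spinK_two, spinE_zero, spinE_one,
    spinE_two, spinN] <;> ring

theorem inner_spinH (q : ℂ × ℂ) : inner ℝ (spinH q) (spinH q) = spinN q ^ 2 := by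
  simp only [inner_vec3, spinH_zero, spinH_one, spinH_two, spinN]
  ring

theorem inner_spinK (q : ℂ × ℂ) : inner ℝ (spinK q) (spinK q) = spinN q ^ 2 := by
  simp only [inner_vec3, spinK_zero, spinK_one, spinK_two, spinN]
  ring

theorem inner_spinE (q : ℂ × ℂ) : inner ℝ (spinE q) (spinE q) = spinN q ^ 2 := by
  simp only [inner_vec3, spinE_zero, spinE_one, spinE_two, spinN]
  ring

theorem inner_spinK_spinH (q : ℂ × ℂ) : inner ℝ (spinK q) (spinH q) = 0 := by
  simp only [inner_vec3, spinK_zero, spinK_one, spinK_two, spinH_zero, spinH_one, spinH_two]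
  ring

theorem inner_spinE_spinH (q : ℂ × ℂ) : inner ℝ (spinE q) (spinH q) = 0 := by
  simp only [inner_vec3, spinE_zero, spinE_one, spinE_two, spinH_zero, spinH_one, spinH_two]
  ring

theorem inner_spinK_spinE (q : ℂ × ℂ) : inner ℝ (spinK q) (spinE q) = 0 := by
  simp only [inner_vec3, spinE_zero, spinE_one, spinE_two, spinK_zero, spinK_one, spinK_two]
  ring

theorem spinN_smul (z : ℂ) (q : ℂ × ℂ) : spinN (z • q) = Complex.normSq z * spinN q := by
  simp only [spinN, Prod.smul_fst, Prod.smul_snd, smul_eq_mul, Complex.mul_re, Complex.mul_im,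
    Complex.normSq_apply]
  ring

theorem spinH_smul (z : ℂ) (q : ℂ × ℂ) : spinH (z • q) = Complex.normSq z • spinH q := by
  apply vec3_ext <;> simp only [PiLp.smul_apply, smul_eq_mul, spinH_zero, spinH_one, spinH_two,
    Prod.smul_fst, Prod.smul_snd, Complex.mul_re, Complex.mul_im, Complex.normSq_apply] <;> ring

theorem spinK_smul (z : ℂ) (q : ℂ × ℂ) :
    spinK (z • q) = (z ^ 2).re • spinK q + (z ^ 2).im • spinE q := by
  apply vec3_ext <;> simp only [PiLp.smul_apply, PiLp.add_apply, smul_eq_mul, spinK_zero, spinK_one,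
    spinK_two, spinE_zero, spinE_one, spinE_two, pow_two z,
    Prod.smul_fst, Prod.smul_snd, Complex.mul_re, Complex.mul_im] <;> ring

/-- `q` is a spinor of the frame `(T, V, T × V)`: its frame has the direction of that frame. -/
structure SpinorOver (T V : Vec3) (q : ℂ × ℂ) : Prop where
  ne_zero : q ≠ 0
  tangent : spinH q = spinN q • T
  normal : spinK q = spinN q • V

namespace SpinorOver

variable {T V : Vec3} {q r : ℂ × ℂ}

theorem cross (h : SpinorOver T V q) : spinE q = spinN q • _root_.cross T V := by
  have h1 := cross_spinH_spinK q
  rw [h.tangent, h.normal, cross_smul_left, cross_smul_right] at h1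
  exact (smul_right_injective _ (spinN_pos h.ne_zero).ne' h1).symm

/-- Multiplying a spinor by a complex number twists the frame by twice its argument. -/
theorem smul (h : SpinorOver T V q) {z : ℂ} (hz : ‖z‖ = 1) :
    SpinorOver T (twistVec T V z) (z • q) := by
  have h1 : Complex.normSq z = 1 := by rw [Complex.normSq_eq_norm_sq, hz, one_pow]
  refine ⟨smul_ne_zero (norm_ne_zero_iff.1 (by rw [hz]; exact one_ne_zero)) h.ne_zero, ?_, ?_⟩
  · rw [spinH_smul, spinN_smul, h1, one_smul, one_mul, h.tangent]
  · rw [spinK_smul, spinN_smul, h1, one_mul, h.normal, h.cross, twistVec, smul_add, smul_comm,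
      smul_comm (z ^ 2).im]

theorem real_smul (h : SpinorOver T V q) {c : ℝ} (hc : c ≠ 0) : SpinorOver T V (c • q) := by
  have h0 : c • q = (c : ℂ) • q := (Complex.coe_smul c q).symm
  have h1 : Complex.normSq (c : ℂ) = c ^ 2 := by rw [Complex.normSq_ofReal, pow_two]
  have h2 : ((c : ℂ) ^ 2).re = c ^ 2 ∧ ((c : ℂ) ^ 2).im = 0 := by
    rw [← Complex.ofReal_pow]
    exact ⟨Complex.ofReal_re _, Complex.ofReal_im _⟩
  refine ⟨smul_ne_zero hc h.ne_zero, ?_, ?_⟩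
  · rw [h0, spinH_smul, spinN_smul, h1, h.tangent, smul_smul]
  · rw [h0, spinK_smul, spinN_smul, h1, h2.1, h2.2, zero_smul, add_zero, h.normal, smul_smul]

end SpinorOver

/-! #### Existence of spinors -/

/-- The projection of a spinor to the line of spinors over `T`, up to the factor `2`. -/
noncomputable def spinProj (T : Vec3) (q : ℂ × ℂ) : ℂ × ℂ :=
  (q.1 + T 0 * q.1 + (T 1 * Complex.I - T 2) * q.2, q.2 - T 0 * q.2 - (T 1 * Complex.I + T 2) * q.1)

theorem spinN_spinProj {T : Vec3} (hT : ‖T‖ = 1) (q : ℂ × ℂ) :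
    spinN (spinProj T q) = 2 * (spinN q + inner ℝ T (spinH q)) := by
  have h : T 0 * T 0 + T 1 * T 1 + T 2 * T 2 = 1 := by
    rw [← inner_vec3, real_inner_self_eq_norm_sq, hT, one_pow]
  simp only [spinN, inner_vec3, spinH_zero, spinH_one, spinH_two, spinProj, Complex.add_re,
    Complex.add_im, Complex.sub_re, Complex.sub_im, Complex.mul_re, Complex.mul_im,
    Complex.ofReal_re, Complex.ofReal_im, Complex.I_re, Complex.I_im]
  linear_combination (q.1.re ^ 2 + q.1.im ^ 2 + q.2.re ^ 2 + q.2.im ^ 2) * h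

theorem spinH_spinProj {T : Vec3} (hT : ‖T‖ = 1) (q : ℂ × ℂ) :
    spinH (spinProj T q) = spinN (spinProj T q) • T := by
  have h : T 0 * T 0 + T 1 * T 1 + T 2 * T 2 = 1 := by
    rw [← inner_vec3, real_inner_self_eq_norm_sq, hT, one_pow]
  apply vec3_ext <;>
  simp only [PiLp.smul_apply, smul_eq_mul, spinN, spinH_zero, spinH_one, spinH_two, spinProj,
    Complex.add_re, Complex.add_im, Complex.sub_re, Complex.sub_im, Complex.mul_re, Complex.mul_im,
    Complex.ofReal_re, Complex.ofReal_im, Complex.I_re, Complex.I_im]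
  · linear_combination -((q.1.re ^ 2 + q.1.im ^ 2 - q.2.re ^ 2 - q.2.im ^ 2) +
      T 0 * (q.1.re ^ 2 + q.1.im ^ 2 + q.2.re ^ 2 + q.2.im ^ 2)) * h
  · linear_combination -((2 * (q.1.im * q.2.re - q.1.re * q.2.im)) +
      T 1 * (q.1.re ^ 2 + q.1.im ^ 2 + q.2.re ^ 2 + q.2.im ^ 2)) * h
  · linear_combination -((-2 * (q.1.re * q.2.re + q.1.im * q.2.im)) +
      T 2 * (q.1.re ^ 2 + q.1.im ^ 2 + q.2.re ^ 2 + q.2.im ^ 2)) * h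

theorem spinN_zero : spinN 0 = 0 := by simp [spinN]

theorem exists_spinH_eq {T : Vec3} (hT : ‖T‖ = 1) : ∃ q, q ≠ 0 ∧ spinH q = spinN q • T := by
  have h : T 0 * T 0 + T 1 * T 1 + T 2 * T 2 = 1 := by
    rw [← inner_vec3, real_inner_self_eq_norm_sq, hT, one_pow]
  have h0 : ∀ q, spinN (spinProj T q) ≠ 0 → ∃ q, q ≠ 0 ∧ spinH q = spinN q • T := fun q hq =>
    ⟨spinProj T q, fun h0 => hq (by rw [h0, spinN_zero]), spinH_spinProj hT q⟩
  by_cases hc : 1 + T 0 = 0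
  · refine h0 (0, 1) ?_
    rw [spinN_spinProj hT]
    simp only [spinN, inner_vec3, spinH_zero, spinH_one, spinH_two, Complex.zero_re,
      Complex.zero_im, Complex.one_re, Complex.one_im]
    intro h1
    linarith
  · refine h0 (1, 0) ?_
    rw [spinN_spinProj hT]
    simp only [spinN, inner_vec3, spinH_zero, spinH_one, spinH_two, Complex.zero_re,
      Complex.zero_im, Complex.one_re, Complex.one_im]
    intro h1
    apply hc
    linarith

theorem spinorOver_of_spinH {T : Vec3} {q : ℂ × ℂ} (h0 : q ≠ 0)
    (h : spinH q = spinN q • T) : ‖(spinN q)⁻¹ • spinK q‖ = 1 ∧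
      inner ℝ ((spinN q)⁻¹ • spinK q) T = 0 ∧ SpinorOver T ((spinN q)⁻¹ • spinK q) q := by
  have hn := spinN_pos h0
  refine ⟨?_, ?_, h0, h, ?_⟩
  · have h1 := inner_spinK q
    rw [real_inner_self_eq_norm_sq, sq_eq_sq₀ (norm_nonneg _) hn.le] at h1
    rw [norm_smul, h1, norm_inv, Real.norm_eq_abs, abs_of_pos hn, inv_mul_cancel₀ hn.ne']
  · have h1 := inner_spinK_spinH q
    rw [h, inner_smul_right] at h1
    rw [inner_smul_left, (mul_eq_zero.1 h1).resolve_left hn.ne', mul_zero]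
  · rw [smul_smul, mul_inv_cancel₀ hn.ne', one_smul]

theorem exists_spinorOver {T V : Vec3} (hT : ‖T‖ = 1) (hV : ‖V‖ = 1) (h : inner ℝ V T = 0) :
    ∃ q, SpinorOver T V q := by
  obtain ⟨q, hq0, hq⟩ := exists_spinH_eq hT
  obtain ⟨h1, h2, h3⟩ := spinorOver_of_spinH hq0 hq
  set U := (spinN q)⁻¹ • spinK q
  have h4 := eq_add_of_normal hT h1 h2 h
  have h5 := sq_add_sq_of_normal hT h1 h2 h
  rw [hV, one_pow] at h5
  set z : ℂ := ⟨inner ℝ V U, inner ℝ V (cross T U)⟩ with hz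
  have hz1 : ‖z‖ = 1 := by
    rw [← sq_eq_sq₀ (norm_nonneg _) zero_le_one, ← Complex.normSq_eq_norm_sq,
      Complex.normSq_apply, ← pow_two, ← pow_two, one_pow]
    exact h5
  have hx := Complex.norm_mul_exp_arg_mul_I z
  rw [hz1, Complex.ofReal_one, one_mul] at hx
  have hc : Real.cos z.arg = inner ℝ V U := by rw [← Complex.exp_ofReal_mul_I_re, hx]
  have hs : Real.sin z.arg = inner ℝ V (cross T U) := by rw [← Complex.exp_ofReal_mul_I_im, hx]
  have h6 := h3.smul (z := Circle.exp (z.arg / 2)) (Circle.norm_coe _)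
  rw [twistVec_exp, hc, hs, ← h4] at h6
  exact ⟨_, h6⟩

/-! #### Spinors of nearby frames -/

/-- The symmetric matrix `4 r rᵀ`, where `r` is a unit spinor of the frame `(T, V, W)`, applied to
`q`.  Its entries are linear in the frame. -/
noncomputable def frameProj (n : ℝ) (T V W : Vec3) (q : ℂ × ℂ) : ℂ × ℂ :=
  (((n + T 0 + V 1 + W 2) * q.1.re + (V 2 - W 1) * q.1.im + (W 0 - T 2) * q.2.re +
      (V 0 - T 1) * q.2.im : ℝ) +
    ((V 2 - W 1) * q.1.re + (n + T 0 - V 1 - W 2) * q.1.im + (T 1 + V 0) * q.2.re -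
      (T 2 + W 0) * q.2.im : ℝ) * Complex.I,
  ((W 0 - T 2) * q.1.re + (T 1 + V 0) * q.1.im + (n - T 0 + V 1 - W 2) * q.2.re -
      (V 2 + W 1) * q.2.im : ℝ) +
    ((V 0 - T 1) * q.1.re - (T 2 + W 0) * q.1.im - (V 2 + W 1) * q.2.re +
      (n - T 0 - V 1 + W 2) * q.2.im : ℝ) * Complex.I)

/-- The real inner product of spinors. -/
noncomputable def spinInner (q r : ℂ × ℂ) : ℝ :=
  q.1.re * r.1.re + q.1.im * r.1.im + q.2.re * r.2.re + q.2.im * r.2.im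

theorem spinInner_self (q : ℂ × ℂ) : spinInner q q = spinN q := by
  rw [spinInner, spinN]
  ring

/-- For the frame of a spinor `r`, the operator `frameProj` is, up to a factor, the real orthogonal
projection to the line of `r`. -/
theorem frameProj_spin (r q : ℂ × ℂ) : frameProj (spinN r) (spinH r) (spinK r) (spinE r) q =
    (4 * spinInner r q) • r := by
  refine Prod.ext (Complex.ext ?_ ?_) (Complex.ext ?_ ?_) <;>
  simp only [frameProj, spinInner, spinN, spinH_zero, spinH_one, spinH_two, spinK_zero, spinK_one,
    spinK_two, spinE_zero, spinE_one, spinE_two, Prod.smul_fst, Prod.smul_snd, Complex.smul_re,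
    Complex.smul_im, smul_eq_mul, Complex.add_re, Complex.add_im, Complex.mul_re, Complex.mul_im,
    Complex.ofReal_re, Complex.ofReal_im, Complex.I_re, Complex.I_im] <;> ring

theorem frameProj_smul (c : ℝ) (T V W : Vec3) (q : ℂ × ℂ) :
    frameProj c (c • T) (c • V) (c • W) q = c • frameProj 1 T V W q := by
  refine Prod.ext (Complex.ext ?_ ?_) (Complex.ext ?_ ?_) <;>
  simp only [frameProj, PiLp.smul_apply, Prod.smul_fst, Prod.smul_snd, Complex.smul_re,
    Complex.smul_im, smul_eq_mul, Complex.add_re, Complex.add_im, Complex.mul_re, Complex.mul_im,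
    Complex.ofReal_re, Complex.ofReal_im, Complex.I_re, Complex.I_im] <;> ring

theorem spinInner_frameProj (T V W : Vec3) (q : ℂ × ℂ) : spinInner q (frameProj 1 T V W q) =
    spinN q + inner ℝ T (spinH q) + inner ℝ V (spinK q) + inner ℝ W (spinE q) := by
  simp only [frameProj, spinInner, spinN, inner_vec3, spinH_zero, spinH_one, spinH_two, spinK_zero,
    spinK_one, spinK_two, spinE_zero, spinE_one, spinE_two, Complex.add_re, Complex.add_im,
    Complex.mul_re, Complex.mul_im, Complex.ofReal_re, Complex.ofReal_im, Complex.I_re,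
    Complex.I_im]
  ring

namespace SpinorOver

variable {T V T₀ V₀ : Vec3} {q r : ℂ × ℂ}

theorem frameProj_eq (h : SpinorOver T V r) (q : ℂ × ℂ) :
    frameProj 1 T V (_root_.cross T V) q = (4 * spinInner r q / spinN r) • r := by
  have hn := (spinN_pos h.ne_zero).ne'
  have h1 := frameProj_spin r q
  rw [h.tangent, h.normal, h.cross, frameProj_smul] at h1
  rw [div_eq_inv_mul, mul_smul, ← h1, smul_smul, inv_mul_cancel₀ hn, one_smul]

/-- A spinor of a frame is unique up to a real factor. -/
theorem eq_smul (hq : SpinorOver T V q) (hr : SpinorOver T V r) :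
    r = (spinInner q r / spinN q) • q := by
  have h1 := hr.frameProj_eq r
  rw [hq.frameProj_eq r, spinInner_self, mul_div_cancel_right₀ _ (spinN_pos hr.ne_zero).ne',
    mul_div_assoc, mul_smul] at h1
  exact (smul_right_injective _ (four_ne_zero (α := ℝ)) h1).symm

theorem frameProj (hT : ‖T‖ = 1) (hV : ‖V‖ = 1) (h : inner ℝ V T = 0)
    (hq : SpinorOver T₀ V₀ q)
    (hpos : 0 < 1 + inner ℝ T T₀ + inner ℝ V V₀ + inner ℝ (_root_.cross T V) (_root_.cross T₀ V₀)) :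
    SpinorOver T V (_root_.frameProj 1 T V (_root_.cross T V) q) := by
  obtain ⟨r, hr⟩ := exists_spinorOver hT hV h
  have h1 := spinInner_frameProj T V (_root_.cross T V) q
  have h2 := hr.frameProj_eq q
  rw [h2]
  refine hr.real_smul fun h0 => ?_
  rw [h2, h0, zero_smul, hq.tangent, hq.normal, hq.cross, inner_smul_right, inner_smul_right,
    inner_smul_right] at h1
  have h3 : spinInner q 0 = 0 := by simp [spinInner]
  have h4 := mul_pos (spinN_pos hq.ne_zero) hpos
  rw [h3] at h1
  linarith

end SpinorOver

/-! #### The action of rotations on spinors -/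

/-- The quaternionic product of spinors. -/
noncomputable def spinMul (r q : ℂ × ℂ) : ℂ × ℂ :=
  (r.1 * q.1 - starRingEnd ℂ r.2 * q.2, r.2 * q.1 + starRingEnd ℂ r.1 * q.2)

theorem spinN_spinMul (r q : ℂ × ℂ) : spinN (spinMul r q) = spinN r * spinN q := by
  simp only [spinN, spinMul, Complex.add_re, Complex.add_im, Complex.sub_re, Complex.sub_im,
    Complex.mul_re, Complex.mul_im, Complex.conj_re, Complex.conj_im]
  ring

theorem spinH_spinMul (r q : ℂ × ℂ) : spinH (spinMul r q) =
    spinH q 0 • spinH r + spinH q 1 • spinK r + spinH q 2 • spinE r := by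
  apply vec3_ext <;>
  simp only [spinMul, PiLp.add_apply, PiLp.smul_apply, smul_eq_mul, spinH_zero, spinH_one,
    spinH_two, spinK_zero, spinK_one, spinK_two, spinE_zero, spinE_one, spinE_two, Complex.add_re,
    Complex.add_im, Complex.sub_re, Complex.sub_im, Complex.mul_re, Complex.mul_im,
    Complex.conj_re, Complex.conj_im] <;> ring

theorem spinK_spinMul (r q : ℂ × ℂ) : spinK (spinMul r q) =
    spinK q 0 • spinH r + spinK q 1 • spinK r + spinK q 2 • spinE r := by
  apply vec3_ext <;>
  simp only [spinMul, PiLp.add_apply, PiLp.smul_apply, smul_eq_mul, spinH_zero, spinH_one,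
    spinH_two, spinK_zero, spinK_one, spinK_two, spinE_zero, spinE_one, spinE_two, Complex.add_re,
    Complex.add_im, Complex.sub_re, Complex.sub_im, Complex.mul_re, Complex.mul_im,
    Complex.conj_re, Complex.conj_im] <;> ring

theorem cross_basis : cross !₂[1, 0, 0] !₂[0, 1, 0] = !₂[0, 0, 1] := by
  apply vec3_ext <;> simp [cross_zero, cross_one, cross_two]

theorem rot_eq_of_basis (A : SO3) (x : Vec3) : rot A x =
    x 0 • rot A !₂[1, 0, 0] + x 1 • rot A !₂[0, 1, 0] + x 2 • rot A !₂[0, 0, 1] := by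
  rw [← rot_smul, ← rot_smul, ← rot_smul, ← rot_add, ← rot_add]
  congr 1
  apply vec3_ext <;> simp

/-- Every rotation lifts to a linear map of spinors. -/
theorem exists_spin_rot (A : SO3) : ∃ r : ℂ × ℂ, ∀ {T V : Vec3} {q : ℂ × ℂ},
    SpinorOver T V q → SpinorOver (rot A T) (rot A V) (spinMul r q) := by
  have e1 : ‖(!₂[1, 0, 0] : Vec3)‖ = 1 := norm_eq_of_sq zero_le_one (by simp)
  have e2 : ‖(!₂[0, 1, 0] : Vec3)‖ = 1 := norm_eq_of_sq zero_le_one (by simp)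
  have e3 : inner ℝ (!₂[0, 1, 0] : Vec3) !₂[1, 0, 0] = 0 := by rw [inner_vec3]; simp
  obtain ⟨r, hr⟩ := exists_spinorOver (T := rot A !₂[1, 0, 0]) (V := rot A !₂[0, 1, 0])
    (by rw [norm_rot, e1]) (by rw [norm_rot, e2]) (by rw [inner_rot, e3])
  have hE := hr.cross
  rw [cross_rot, cross_basis] at hE
  refine ⟨r, fun {T V q} hq => ⟨fun h0 => ?_, ?_, ?_⟩⟩
  · have := spinN_spinMul r q
    rw [h0, spinN_zero] at this
    exact (mul_pos (spinN_pos hr.ne_zero) (spinN_pos hq.ne_zero)).ne this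
  · rw [spinH_spinMul, hr.tangent, hr.normal, hE, hq.tangent, spinN_spinMul, rot_eq_of_basis A T]
    simp only [PiLp.smul_apply, smul_eq_mul]
    module
  · rw [spinK_spinMul, hr.tangent, hr.normal, hE, hq.normal, spinN_spinMul, rot_eq_of_basis A V]
    simp only [PiLp.smul_apply, smul_eq_mul]
    module

/-! ### The parity of a framed loop -/

/-- The frame of `p` lifts to a smooth path of spinors with monodromy `σ`. Only `σ = 1` and
`σ = -1` are possible; the sign is the parity of the framed loop. -/
def FramedLoop.HasSpinor (σ : ℝ) (p : FramedLoop) : Prop :=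
  ∃ q : ℝ → ℂ × ℂ, ContDiff ℝ ∞ q ∧ (∀ t, q (t + 2) = σ • q t) ∧
    ∀ t, SpinorOver (unitTangent p.curve t) (p.framing t) (q t)

theorem contDiff_spinMul (r : ℂ × ℂ) {q : ℝ → ℂ × ℂ} (hq : ContDiff ℝ ∞ q) :
    ContDiff ℝ ∞ fun t => spinMul r (q t) :=
  ((contDiff_const.mul hq.fst).sub (contDiff_const.mul hq.snd)).prodMk
    ((contDiff_const.mul hq.fst).add (contDiff_const.mul hq.snd))

theorem spinMul_smul (r q : ℂ × ℂ) (c : ℝ) : spinMul r (c • q) = c • spinMul r q := by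
  refine Prod.ext ?_ ?_ <;>
  simp only [spinMul, Prod.smul_fst, Prod.smul_snd, Complex.real_smul] <;> ring

theorem FramedLoop.HasSpinor.of_mk_eq {σ : ℝ} {p p' : FramedLoop} (h : p.HasSpinor σ)
    (he : FramedModuli.mk p = FramedModuli.mk p') : p'.HasSpinor σ := by
  obtain ⟨r, A, b, z, hr, h1, h2⟩ := FramedModuli.mk_eq_iff.1 he
  obtain ⟨q, hq, hσ, hs⟩ := h
  obtain ⟨a, ha⟩ := exists_spin_rot A
  refine ⟨fun t => spinMul a ((z : ℂ) • q t), contDiff_spinMul a (hq.const_smul (z : ℂ)),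
    fun t => ?_, fun t => ?_⟩
  · simp only
    rw [hσ, smul_comm, spinMul_smul]
  · rw [unitTangent_sim hr A b p.curve.contDiff h1, h2]
    exact ha ((hs t).smul (Circle.norm_coe z))

theorem frameProj_smul_right (c n : ℝ) (T V W : Vec3) (q : ℂ × ℂ) :
    frameProj n T V W (c • q) = c • frameProj n T V W q := by
  refine Prod.ext (Complex.ext ?_ ?_) (Complex.ext ?_ ?_) <;>
  simp only [frameProj, Prod.smul_fst, Prod.smul_snd, Complex.smul_re,
    Complex.smul_im, smul_eq_mul, Complex.add_re, Complex.add_im, Complex.mul_re, Complex.mul_im,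
    Complex.ofReal_re, Complex.ofReal_im, Complex.I_re, Complex.I_im] <;> ring

theorem contDiff_complex_mk {f g : ℝ → ℝ} (hf : ContDiff ℝ ∞ f) (hg : ContDiff ℝ ∞ g) :
    ContDiff ℝ ∞ fun t => (f t : ℂ) + (g t : ℂ) * Complex.I :=
  (Complex.ofRealCLM.contDiff.comp hf).add ((Complex.ofRealCLM.contDiff.comp hg).mul contDiff_const)

theorem contDiff_frameProj {T V W : ℝ → Vec3} {q : ℝ → ℂ × ℂ} (hT : ContDiff ℝ ∞ T)
    (hV : ContDiff ℝ ∞ V) (hW : ContDiff ℝ ∞ W) (hq : ContDiff ℝ ∞ q) :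
    ContDiff ℝ ∞ fun t => frameProj 1 (T t) (V t) (W t) (q t) := by
  rw [contDiff_euclidean] at hT hV hW
  have hT0 := hT 0
  have hT1 := hT 1
  have hT2 := hT 2
  have hV0 := hV 0
  have hV1 := hV 1
  have hV2 := hV 2
  have hW0 := hW 0
  have hW1 := hW 1
  have hW2 := hW 2
  have ha : ContDiff ℝ ∞ fun t => (q t).1.re := Complex.reCLM.contDiff.comp hq.fst
  have hb : ContDiff ℝ ∞ fun t => (q t).1.im := Complex.imCLM.contDiff.comp hq.fst
  have hc : ContDiff ℝ ∞ fun t => (q t).2.re := Complex.reCLM.contDiff.comp hq.snd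
  have hd : ContDiff ℝ ∞ fun t => (q t).2.im := Complex.imCLM.contDiff.comp hq.snd
  exact ContDiff.prodMk (contDiff_complex_mk (by fun_prop) (by fun_prop))
    (contDiff_complex_mk (by fun_prop) (by fun_prop))

theorem ContinuousOn.cross {X : Type*} [TopologicalSpace X] {f g : X → Vec3} {s : Set X}
    (hf : ContinuousOn f s) (hg : ContinuousOn g s) : ContinuousOn (fun x => cross (f x) (g x)) s :=
  continuous_cross.comp_continuousOn (hf.prodMk hg)

/-- For unit tangent vectors and unit normals this is the trace, plus one, of the rotation
relating two frames. -/
noncomputable def frameTrace (x : (Vec3 × Vec3) × (Vec3 × Vec3)) : ℝ :=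
  1 + inner ℝ (‖x.1.1‖⁻¹ • x.1.1) (‖x.2.1‖⁻¹ • x.2.1) + inner ℝ x.1.2 x.2.2 +
    inner ℝ (cross (‖x.1.1‖⁻¹ • x.1.1) x.1.2) (cross (‖x.2.1‖⁻¹ • x.2.1) x.2.2)

theorem isOpen_frameTrace_pos : IsOpen {x : (Vec3 × Vec3) × (Vec3 × Vec3) |
    (x.1.1 ≠ 0 ∧ x.2.1 ≠ 0) ∧ 0 < frameTrace x} := by
  have h0 : IsOpen {x : (Vec3 × Vec3) × (Vec3 × Vec3) | x.1.1 ≠ 0 ∧ x.2.1 ≠ 0} :=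
    (isOpen_ne_fun continuous_fst.fst continuous_const).inter
      (isOpen_ne_fun continuous_snd.fst continuous_const)
  have hT : ContinuousOn (fun x : (Vec3 × Vec3) × (Vec3 × Vec3) => ‖x.1.1‖⁻¹ • x.1.1)
      {x | x.1.1 ≠ 0 ∧ x.2.1 ≠ 0} :=
    (continuous_fst.fst.norm.continuousOn.inv₀ fun x hx => norm_ne_zero_iff.2 hx.1).smul
      continuous_fst.fst.continuousOn
  have hT' : ContinuousOn (fun x : (Vec3 × Vec3) × (Vec3 × Vec3) => ‖x.2.1‖⁻¹ • x.2.1)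
      {x | x.1.1 ≠ 0 ∧ x.2.1 ≠ 0} :=
    (continuous_snd.fst.norm.continuousOn.inv₀ fun x hx => norm_ne_zero_iff.2 hx.2).smul
      continuous_snd.fst.continuousOn
  have hV : ContinuousOn (fun x : (Vec3 × Vec3) × (Vec3 × Vec3) => x.1.2)
      {x | x.1.1 ≠ 0 ∧ x.2.1 ≠ 0} := continuous_fst.snd.continuousOn
  have hV' : ContinuousOn (fun x : (Vec3 × Vec3) × (Vec3 × Vec3) => x.2.2)
      {x | x.1.1 ≠ 0 ∧ x.2.1 ≠ 0} := continuous_snd.snd.continuousOn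
  have h1 : ContinuousOn (fun x : (Vec3 × Vec3) × (Vec3 × Vec3) =>
      inner ℝ (‖x.1.1‖⁻¹ • x.1.1) (‖x.2.1‖⁻¹ • x.2.1)) {x | x.1.1 ≠ 0 ∧ x.2.1 ≠ 0} := hT.inner hT'
  have h2 : ContinuousOn (fun x : (Vec3 × Vec3) × (Vec3 × Vec3) => inner ℝ x.1.2 x.2.2)
      {x | x.1.1 ≠ 0 ∧ x.2.1 ≠ 0} := hV.inner hV'
  have h3 : ContinuousOn (fun x : (Vec3 × Vec3) × (Vec3 × Vec3) =>
      cross (‖x.1.1‖⁻¹ • x.1.1) x.1.2) {x | x.1.1 ≠ 0 ∧ x.2.1 ≠ 0} :=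
    hT.cross hV
  have h4 : ContinuousOn (fun x : (Vec3 × Vec3) × (Vec3 × Vec3) =>
      cross (‖x.2.1‖⁻¹ • x.2.1) x.2.2) {x | x.1.1 ≠ 0 ∧ x.2.1 ≠ 0} :=
    hT'.cross hV'
  have h5 : ContinuousOn frameTrace {x | x.1.1 ≠ 0 ∧ x.2.1 ≠ 0} :=
    ((continuousOn_const.add h1).add h2).add (h3.inner h4)
  exact h5.isOpen_inter_preimage h0 isOpen_Ioi

/-- The parity is locally constant: the spinors of a framed loop are projected to spinors of
nearby framed loops. -/
theorem FramedLoop.isOpen_hasSpinor (σ : ℝ) : IsOpen {p : FramedLoop | p.HasSpinor σ} := by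
  rw [isOpen_iff_mem_nhds]
  rintro p₀ ⟨q, hq, hσ, hs⟩
  set D : FramedLoop → SmoothLoop (Vec3 × Vec3) := fun p => pair (derivₗ p.curve) p.framing with hD
  have hDc : Continuous D := continuous_pairₗ.comp
    ((continuous_derivₗ.comp continuous_curve).prodMk continuous_framing)
  have hDc' : Continuous fun p => pair (D p) (D p₀) :=
    continuous_pairₗ.comp (hDc.prodMk continuous_const)
  have ho := (isOpen_valuedIn isOpen_frameTrace_pos).preimage hDc'
  refine Filter.mem_of_superset (ho.mem_nhds ?_) ?_
  · intro t
    refine ⟨⟨p₀.immersed t, p₀.immersed t⟩, ?_⟩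
    have h1 := norm_unitTangent (p₀.immersed t)
    have h2 := inner_unitTangent p₀.normal t
    change 0 < 1 + inner ℝ (unitTangent p₀.curve t) (unitTangent p₀.curve t) +
      inner ℝ (p₀.framing t) (p₀.framing t) +
      inner ℝ (cross (unitTangent p₀.curve t) (p₀.framing t))
        (cross (unitTangent p₀.curve t) (p₀.framing t))
    rw [inner_cross_cross, real_inner_self_eq_norm_sq, real_inner_self_eq_norm_sq, h1, h2,
      (p₀.normal t).1]
    norm_num
  · intro p hp
    have hT := contDiff_unitTangent p.curve.contDiff p.immersed
    refine ⟨fun t => frameProj 1 (unitTangent p.curve t) (p.framing t)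
      (cross (unitTangent p.curve t) (p.framing t)) (q t),
      contDiff_frameProj hT p.framing.contDiff (contDiff_cross hT p.framing.contDiff) hq,
      fun t => ?_, fun t => ?_⟩
    · have h1 : unitTangent p.curve (t + 2) = unitTangent p.curve t := by
        rw [unitTangent, unitTangent, periodic_deriv p.curve.periodic t]
      simp only
      rw [hσ, h1, p.framing.periodic t, frameProj_smul_right]
    · exact SpinorOver.frameProj (norm_unitTangent (p.immersed t)) (p.normal t).1
        (inner_unitTangent p.normal t) (hs t) (hp t).2

/-- The parities exclude each other: the inner product of a closed and of an anti-periodic path of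
spinors changes sign over a period, but spinors over the same frame are real multiples of each
other, so that it has no zero. -/
theorem FramedLoop.not_hasSpinor_of_hasSpinor {p : FramedLoop} (h : p.HasSpinor 1) :
    ¬ p.HasSpinor (-1) := by
  rintro ⟨r, hr, hr2, hrs⟩
  obtain ⟨q, hq, hq2, hqs⟩ := h
  set g : ℝ → ℝ := fun t => spinInner (q t) (r t) with hg
  have hgc : Continuous g := by
    have h1 := hq.continuous
    have h2 := hr.continuous
    simp only [hg, spinInner]
    fun_prop
  have hg0 : ∀ t, g t ≠ 0 := fun t h0 => by
    have := (hqs t).eq_smul (hrs t)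
    rw [show spinInner (q t) (r t) = 0 from h0, zero_div, zero_smul] at this
    exact (hrs t).ne_zero this
  have hg2 : g 2 = -g 0 := by
    have h1 := hq2 0
    have h2 := hr2 0
    rw [zero_add] at h1 h2
    simp only [hg]
    rw [h1, h2, one_smul, neg_smul, one_smul]
    simp only [spinInner, Prod.fst_neg, Prod.snd_neg, Complex.neg_re, Complex.neg_im]
    ring
  have hr : (0 : ℝ) ∈ range g := by
    rcases le_total 0 (g 0) with h | h
    · exact mem_range_of_exists_le_of_exists_ge hgc ⟨2, by rw [hg2]; linarith⟩ ⟨0, h⟩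
    · exact mem_range_of_exists_le_of_exists_ge hgc ⟨0, h⟩ ⟨2, by rw [hg2]; linarith⟩
  obtain ⟨t, ht⟩ := hr
  exact hg0 t ht

theorem exp_mul_pi (x : ℝ) (n : ℤ) :
    Complex.exp (((x + 2 * Real.pi * n) / 2 : ℝ) * Complex.I) =
      ((-1 : ℝ) ^ n : ℝ) * Complex.exp ((x / 2 : ℝ) * Complex.I) := by
  have h : (((x + 2 * Real.pi * n) / 2 : ℝ) : ℂ) * Complex.I =
      n * (Real.pi * Complex.I) + (x / 2 : ℝ) * Complex.I := by
    push_cast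
    ring
  rw [h, Complex.exp_add, Complex.exp_int_mul, Complex.exp_pi_mul_I]
  push_cast
  rfl

/-- The parity of a framing of a given loop is determined by the relative winding number. -/
theorem FramedLoop.HasSpinor.of_integral {σ : ℝ} {p p' : FramedLoop} (h : p.HasSpinor σ)
    (hc : p'.curve = p.curve) {n : ℤ}
    (hn : ∫ s in (0 : ℝ)..2, (density p.curve p'.framing - density p.curve p.framing) s =
      2 * Real.pi * n) : p'.HasSpinor ((-1) ^ n * σ) := by
  have hV : IsUnitNormal p.curve p'.framing := hc ▸ p'.normal
  obtain ⟨θ, hθ, hd⟩ := exists_rotation p.immersed' hV p.normal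
  set f := density p.curve p'.framing - density p.curve p.framing with hf
  have hθ' : ∀ t, θ t = (∫ s in (0 : ℝ)..t, f s) + θ 0 := fun t => by
    rw [integral_eq_of_hasDerivAt hd]
    ring
  have hs : ContDiff ℝ ∞ θ := by
    rw [funext hθ']
    exact f.contDiff_primitive.add contDiff_const
  obtain ⟨q, hq, hσ, hsp⟩ := h
  refine ⟨fun t => Complex.exp ((θ t / 2 : ℝ) * Complex.I) • q t, ?_, fun t => ?_, fun t => ?_⟩
  · exact (contDiff_expI.comp (hs.div_const 2)).smul hq
  · simp only
    rw [hθ' (t + 2), primitive_add_two, hn, add_right_comm, ← hθ', exp_mul_pi, hσ, mul_smul,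
      mul_smul, smul_comm σ, Complex.coe_smul]
  · have h1 := (hsp t).smul (z := Circle.exp (θ t / 2)) (Circle.norm_coe _)
    rw [← rotField_eq_twistVec, ← hθ t, Circle.coe_exp] at h1
    rw [hc]
    exact h1

theorem FramedLoop.exists_int_integral {p p' : FramedLoop} (hc : p'.curve = p.curve) : ∃ n : ℤ,
    ∫ s in (0 : ℝ)..2, (density p.curve p'.framing - density p.curve p.framing) s =
      2 * Real.pi * n :=
  exists_int_integral_density p.immersed' (hc ▸ p'.normal) p.normal

theorem neg_one_zpow_cases (n : ℤ) : (-1 : ℝ) ^ n = 1 ∨ (-1 : ℝ) ^ n = -1 := by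
  rcases Int.even_or_odd n with h | h
  · exact .inl h.neg_one_zpow
  · exact .inr h.neg_one_zpow

theorem contDiff_spinProj {T : ℝ → Vec3} (hT : ContDiff ℝ ∞ T) (q : ℂ × ℂ) :
    ContDiff ℝ ∞ fun t => spinProj (T t) q := by
  rw [contDiff_euclidean] at hT
  have h : ∀ i, ContDiff ℝ ∞ fun t => (T t i : ℂ) := fun i =>
    Complex.ofRealCLM.contDiff.comp (hT i)
  have h0 := h 0
  have h1 := h 1
  have h2 := h 2
  refine ContDiff.prodMk ?_ ?_ <;> fun_prop

section Components

variable {X : Type} [NormedAddCommGroup X] [NormedSpace ℝ X] {q : X → ℂ × ℂ}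

theorem contDiff_spinN_comp (hq : ContDiff ℝ ∞ q) : ContDiff ℝ ∞ fun x => spinN (q x) := by
  have ha : ContDiff ℝ ∞ fun t => (q t).1.re := Complex.reCLM.contDiff.comp hq.fst
  have hb : ContDiff ℝ ∞ fun t => (q t).1.im := Complex.imCLM.contDiff.comp hq.fst
  have hc : ContDiff ℝ ∞ fun t => (q t).2.re := Complex.reCLM.contDiff.comp hq.snd
  have hd : ContDiff ℝ ∞ fun t => (q t).2.im := Complex.imCLM.contDiff.comp hq.snd
  unfold spinN
  fun_prop

theorem contDiff_spinH_comp (hq : ContDiff ℝ ∞ q) : ContDiff ℝ ∞ fun x => spinH (q x) := by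
  have ha : ContDiff ℝ ∞ fun t => (q t).1.re := Complex.reCLM.contDiff.comp hq.fst
  have hb : ContDiff ℝ ∞ fun t => (q t).1.im := Complex.imCLM.contDiff.comp hq.fst
  have hc : ContDiff ℝ ∞ fun t => (q t).2.re := Complex.reCLM.contDiff.comp hq.snd
  have hd : ContDiff ℝ ∞ fun t => (q t).2.im := Complex.imCLM.contDiff.comp hq.snd
  rw [contDiff_euclidean]
  intro i
  fin_cases i
  · change ContDiff ℝ ∞ fun t => (q t).1.re ^ 2 + (q t).1.im ^ 2 - (q t).2.re ^ 2 - (q t).2.im ^ 2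
    fun_prop
  · change ContDiff ℝ ∞ fun t => 2 * ((q t).1.im * (q t).2.re - (q t).1.re * (q t).2.im)
    fun_prop
  · change ContDiff ℝ ∞ fun t => -2 * ((q t).1.re * (q t).2.re + (q t).1.im * (q t).2.im)
    fun_prop

theorem contDiff_spinK_comp (hq : ContDiff ℝ ∞ q) : ContDiff ℝ ∞ fun x => spinK (q x) := by
  have ha : ContDiff ℝ ∞ fun t => (q t).1.re := Complex.reCLM.contDiff.comp hq.fst
  have hb : ContDiff ℝ ∞ fun t => (q t).1.im := Complex.imCLM.contDiff.comp hq.fst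
  have hc : ContDiff ℝ ∞ fun t => (q t).2.re := Complex.reCLM.contDiff.comp hq.snd
  have hd : ContDiff ℝ ∞ fun t => (q t).2.im := Complex.imCLM.contDiff.comp hq.snd
  rw [contDiff_euclidean]
  intro i
  fin_cases i
  · change ContDiff ℝ ∞ fun t => 2 * ((q t).1.re * (q t).2.im + (q t).1.im * (q t).2.re)
    fun_prop
  · change ContDiff ℝ ∞ fun t => (q t).1.re ^ 2 - (q t).1.im ^ 2 + (q t).2.re ^ 2 - (q t).2.im ^ 2
    fun_prop
  · change ContDiff ℝ ∞ fun t => 2 * ((q t).1.re * (q t).1.im - (q t).2.re * (q t).2.im)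
    fun_prop

theorem contDiff_spinE_comp (hq : ContDiff ℝ ∞ q) : ContDiff ℝ ∞ fun x => spinE (q x) := by
  have ha : ContDiff ℝ ∞ fun t => (q t).1.re := Complex.reCLM.contDiff.comp hq.fst
  have hb : ContDiff ℝ ∞ fun t => (q t).1.im := Complex.imCLM.contDiff.comp hq.fst
  have hc : ContDiff ℝ ∞ fun t => (q t).2.re := Complex.reCLM.contDiff.comp hq.snd
  have hd : ContDiff ℝ ∞ fun t => (q t).2.im := Complex.imCLM.contDiff.comp hq.snd
  rw [contDiff_euclidean]
  intro i
  fin_cases i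
  · change ContDiff ℝ ∞ fun t => 2 * ((q t).1.re * (q t).2.re - (q t).1.im * (q t).2.im)
    fun_prop
  · change ContDiff ℝ ∞ fun t => -2 * ((q t).1.re * (q t).1.im + (q t).2.re * (q t).2.im)
    fun_prop
  · change ContDiff ℝ ∞ fun t => (q t).1.re ^ 2 - (q t).1.im ^ 2 - (q t).2.re ^ 2 + (q t).2.im ^ 2
    fun_prop

end Components

/-- By dimension, the unit tangent of a smooth curve omits a direction. -/
theorem exists_direction {T : ℝ → Vec3} (hT : ContDiff ℝ ∞ T) :
    ∃ v : Vec3, ‖v‖ = 1 ∧ ∀ t, T t ≠ -v := by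
  have hf : ContDiff ℝ 1 fun x : ℝ × ℝ => x.1 • T x.2 :=
    (contDiff_fst.smul ((hT.of_le (by simp)).comp contDiff_snd))
  have hd := hf.dense_compl_range_of_finrank_lt_finrank (by simp)
  obtain ⟨w, hw⟩ := hd.nonempty
  have hw0 : w ≠ 0 := fun h0 => hw ⟨(0, 0), by simp [h0]⟩
  refine ⟨‖w‖⁻¹ • w, ?_, fun t ht => hw ⟨(-‖w‖, t), ?_⟩⟩
  · rw [norm_smul, norm_inv, norm_norm, inv_mul_cancel₀ (norm_ne_zero_iff.2 hw0)]
  · simp only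
    rw [ht, neg_smul_neg, smul_smul, mul_inv_cancel₀ (norm_ne_zero_iff.2 hw0), one_smul]

theorem eq_neg_of_inner {u v : Vec3} (hu : ‖u‖ = 1) (hv : ‖v‖ = 1) (h : 1 + inner ℝ u v = 0) :
    u = -v := by
  have : ‖u + v‖ ^ 2 = 0 := by
    rw [norm_add_sq_real, hu, hv]
    linarith
  exact eq_neg_of_add_eq_zero_left (norm_eq_zero.1 (by simpa using this))

/-- Every immersed loop has a framing with a closed path of spinors. -/
theorem FramedLoop.exists_hasSpinor_one {γ : SmoothLoop Vec3} (h : γ.Immersed) :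
    ∃ p : FramedLoop, p.curve = γ ∧ p.HasSpinor 1 := by
  have hT := contDiff_unitTangent γ.contDiff h
  have hT1 : ∀ t, ‖unitTangent γ t‖ = 1 := fun t => norm_unitTangent (h t)
  have hTp : Function.Periodic (unitTangent γ) 2 := fun t => by
    rw [unitTangent, unitTangent, periodic_deriv γ.periodic t]
  -- a direction avoided by `-T`, so that the projections of one fixed spinor have no zero
  obtain ⟨v, hv, hvT⟩ := exists_direction hT
  obtain ⟨q₀, hq₀, hq₀v⟩ := exists_spinH_eq hv
  set q : ℝ → ℂ × ℂ := fun t => spinProj (unitTangent γ t) q₀ with hq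
  have hqs : ContDiff ℝ ∞ q := contDiff_spinProj hT q₀
  have hqp : ∀ t, q (t + 2) = q t := fun t => by
    simp only [hq]
    rw [hTp t]
  have hq0 : ∀ t, q t ≠ 0 := fun t h0 => by
    have h1 := spinN_spinProj (hT1 t) q₀
    rw [show spinProj (unitTangent γ t) q₀ = 0 from h0, spinN_zero, hq₀v, inner_smul_right] at h1
    have h2 : spinN q₀ * (1 + inner ℝ (unitTangent γ t) v) = 0 := by linarith
    exact hvT t (eq_neg_of_inner (hT1 t) hv
      ((mul_eq_zero.1 h2).resolve_left (spinN_pos hq₀).ne'))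
  have hsp : ∀ t, _ := fun t => spinorOver_of_spinH (hq0 t) (spinH_spinProj (hT1 t) q₀)
  have hVs : ContDiff ℝ ∞ fun t => (spinN (q t))⁻¹ • spinK (q t) :=
    ((contDiff_spinN_comp hqs).inv fun t => (spinN_pos (hq0 t)).ne').smul (contDiff_spinK_comp hqs)
  let V : SmoothLoop Vec3 := SmoothLoop.mk (fun t => (spinN (q t))⁻¹ • spinK (q t)) hVs
    (fun t => by simp only [hqp])
  have hV : IsUnitNormal γ V := fun t => by
    refine ⟨(hsp t).1, ?_⟩
    have h1 := (hsp t).2.1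
    rw [unitTangent, inner_smul_right] at h1
    exact (mul_eq_zero.1 h1).resolve_left (inv_ne_zero (norm_ne_zero_iff.2 (h t)))
  exact ⟨⟨γ, V, h, hV⟩, rfl, q, hqs, fun t => by rw [hqp, one_smul], fun t => (hsp t).2.2⟩

theorem FramedLoop.hasSpinor_cases (p : FramedLoop) : p.HasSpinor 1 ∨ p.HasSpinor (-1) := by
  obtain ⟨p₀, hc, h₀⟩ := exists_hasSpinor_one p.immersed'
  obtain ⟨n, hn⟩ := exists_int_integral hc.symm
  have h := h₀.of_integral hc.symm hn
  rw [mul_one] at h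
  rcases neg_one_zpow_cases n with h1 | h1
  · exact .inl (h1 ▸ h)
  · exact .inr (h1 ▸ h)

/-- The set of classes of framed loops of parity `σ`. -/
def parityClass (σ : ℝ) : Set FramedModuli := {m | ∃ p, FramedModuli.mk p = m ∧ p.HasSpinor σ}

theorem mk_mem_parityClass {σ : ℝ} {p : FramedLoop} :
    FramedModuli.mk p ∈ parityClass σ ↔ p.HasSpinor σ :=
  ⟨fun ⟨_, he, h⟩ => h.of_mk_eq he, fun h => ⟨p, rfl, h⟩⟩

theorem isOpen_parityClass (σ : ℝ) : IsOpen (parityClass σ) := by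
  rw [← isQuotientMap_framedModuli.isOpen_preimage]
  convert FramedLoop.isOpen_hasSpinor σ using 1
  ext p
  exact mk_mem_parityClass

theorem isClopen_parityClass {σ : ℝ} (hσ : σ = 1 ∨ σ = -1) : IsClopen (parityClass σ) := by
  refine ⟨⟨?_⟩, isOpen_parityClass σ⟩
  convert isOpen_parityClass (-σ) using 1
  ext m
  obtain ⟨p, rfl⟩ := isQuotientMap_framedModuli.surjective m
  rw [mem_compl_iff, mk_mem_parityClass, mk_mem_parityClass]
  have h1 := p.hasSpinor_cases
  have h2 := FramedLoop.not_hasSpinor_of_hasSpinor (p := p)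
  rcases hσ with rfl | rfl
  · tauto
  · rw [neg_neg]
    tauto

/-! ### Framed loops of the same parity are connected -/

theorem SmoothLoop.continuous_superpose {F F' : Type} [NormedAddCommGroup F] [NormedSpace ℝ F]
    [CompleteSpace F] [NormedAddCommGroup F'] [NormedSpace ℝ F'] [CompleteSpace F'] {Φ : F → F'}
    (hΦ : ContDiff ℝ ∞ Φ) : Continuous (superpose Φ) := by
  have h := continuousOn_superpose isOpen_univ hΦ.contDiffOn
  have : valuedIn (univ : Set F) = univ := eq_univ_of_forall fun f t => mem_univ _
  rwa [this, continuousOn_univ] at h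

/-- The integral of a loop over a period. -/
noncomputable def SmoothLoop.totalₗ : SmoothLoop ℝ →ₗ[ℝ] ℝ where
  toFun f := ∫ s in (0 : ℝ)..2, f s
  map_add' f g := intervalIntegral.integral_add (f.intervalIntegrable _ _) (g.intervalIntegrable _ _)
  map_smul' c _ := intervalIntegral.integral_smul c _

theorem SmoothLoop.totalₗ_apply (f : SmoothLoop ℝ) : totalₗ f = ∫ s in (0 : ℝ)..2, f s := rfl

theorem SmoothLoop.continuous_totalₗ : Continuous totalₗ := continuous_integral

theorem SmoothLoop.totalₗ_pos {f : SmoothLoop ℝ} (h : ∀ t, 0 ≤ f t)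
    (h' : ∃ t ∈ Icc (0 : ℝ) 2, 0 < f t) : 0 < totalₗ f :=
  intervalIntegral.integral_pos two_pos f.continuous.continuousOn (fun t _ => h t) h'

/-! #### The framed loop of a closed spinor loop -/

/-- The second vector of the frame of the spinor `q`, rotated by the argument of `u`. -/
noncomputable def spinFrame (x : (ℂ × ℂ) × ℂ) : Vec3 :=
  (spinN x.1)⁻¹ • (x.2.re • spinK x.1 + x.2.im • spinE x.1)

theorem contDiffOn_spinFrame : ContDiffOn ℝ ∞ spinFrame {x | x.1 ≠ 0} := by
  have h := contDiff_fst (𝕜 := ℝ) (E := ℂ × ℂ) (F := ℂ) (n := ∞)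
  refine ((contDiff_spinN_comp h).contDiffOn.inv fun x hx => (spinN_pos hx).ne').smul ?_
  exact ((Complex.reCLM.contDiff.comp contDiff_snd).smul (contDiff_spinK_comp h)).contDiffOn.add
    ((Complex.imCLM.contDiff.comp contDiff_snd).smul (contDiff_spinE_comp h)).contDiffOn

theorem isOpen_spinor_ne : IsOpen {x : (ℂ × ℂ) × ℂ | x.1 ≠ 0} :=
  isOpen_ne_fun continuous_fst continuous_const

theorem spinFrame_spec {q : ℂ × ℂ} {u : ℂ} (hq : q ≠ 0) (hu : ‖u‖ = 1) :
    ‖spinFrame (q, u)‖ = 1 ∧ inner ℝ (spinFrame (q, u)) (spinH q) = 0 := by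
  have hn := spinN_pos hq
  have hu' : u.re * u.re + u.im * u.im = 1 := by
    rw [← Complex.normSq_apply, Complex.normSq_eq_norm_sq, hu, one_pow]
  constructor
  · rw [← sq_eq_sq₀ (norm_nonneg _) zero_le_one, ← real_inner_self_eq_norm_sq]
    simp only [spinFrame, inner_smul_left, inner_smul_right, inner_add_left, inner_add_right,
      inner_spinK, inner_spinE, inner_spinK_spinE, real_inner_comm (spinK q) (spinE q),
      conj_trivial]
    field_simp
    linear_combination spinN q ^ 2 * hu'
  · simp only [spinFrame, inner_smul_left, inner_add_left, inner_spinK_spinH, inner_spinE_spinH]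
    simp

theorem spinFrame_smul {c : ℝ} (hc : c ≠ 0) (q : ℂ × ℂ) (u : ℂ) :
    spinFrame (c • q, u) = spinFrame (q, u) := by
  have h1 : spinN (c • q) = c ^ 2 * spinN q := by
    simp only [spinN, Prod.smul_fst, Prod.smul_snd, Complex.smul_re, Complex.smul_im, smul_eq_mul]
    ring
  have h2 : spinK (c • q) = c ^ 2 • spinK q := by
    apply vec3_ext <;> simp only [PiLp.smul_apply, spinK_zero, spinK_one, spinK_two, Prod.smul_fst,
      Prod.smul_snd, Complex.smul_re, Complex.smul_im, smul_eq_mul] <;> ring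
  have h3 : spinE (c • q) = c ^ 2 • spinE q := by
    apply vec3_ext <;> simp only [PiLp.smul_apply, spinE_zero, spinE_one, spinE_two, Prod.smul_fst,
      Prod.smul_snd, Complex.smul_re, Complex.smul_im, smul_eq_mul] <;> ring
  simp only [spinFrame, h1, h2, h3]
  rw [smul_comm u.re, smul_comm u.im, ← smul_add, smul_smul, mul_inv, mul_right_comm,
    inv_mul_cancel₀ (pow_ne_zero 2 hc), one_mul]

theorem spinH_real_smul (c : ℝ) (q : ℂ × ℂ) : spinH (c • q) = c ^ 2 • spinH q := by
  apply vec3_ext <;> simp only [PiLp.smul_apply, spinH_zero, spinH_one, spinH_two, Prod.smul_fst,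
    Prod.smul_snd, Complex.smul_re, Complex.smul_im, smul_eq_mul] <;> ring

/-- Spinor loops without zeros whose Hopf image integrates to zero. -/
def closedSpinors : Set (SmoothLoop (ℂ × ℂ)) :=
  {R | (∀ t, R t ≠ 0) ∧ ∫ s in (0 : ℝ)..2, superpose spinH R s = 0}

theorem contDiff_spinH : ContDiff ℝ ∞ spinH := contDiff_spinH_comp contDiff_id

theorem derivₗ_spinCurve {R : SmoothLoop (ℂ × ℂ)} (hR : R ∈ closedSpinors) (t : ℝ) :
    derivₗ (primₗ (superpose spinH R)) t = spinH (R t) := by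
  rw [derivₗ_primₗ_apply _ hR.2, superpose_apply_univ contDiff_spinH]

theorem spinH_ne_zero {q : ℂ × ℂ} (h : q ≠ 0) : spinH q ≠ 0 := fun h0 => by
  have h1 := inner_spinH q
  rw [h0, inner_zero_left] at h1
  exact (pow_pos (spinN_pos h) 2).ne h1

theorem superpose_spinFrame_apply {R : SmoothLoop (ℂ × ℂ)} (hR : ∀ t, R t ≠ 0) (u : SmoothLoop ℂ)
    (t : ℝ) : superpose spinFrame (pair R u) t = spinFrame (R t, u t) :=
  superpose_apply isOpen_spinor_ne contDiffOn_spinFrame (f := pair R u) (fun t => hR t) t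

/-- The framed loop of a closed spinor loop, with its framing rotated by the unit loop `u`. -/
noncomputable def spinFramed (u : SmoothLoop ℂ) (hu : ∀ t, ‖u t‖ = 1) (R : closedSpinors) :
    FramedLoop where
  curve := primₗ (superpose spinH R.1)
  framing := superpose spinFrame (pair R.1 u)
  immersed t := by
    rw [← derivₗ_apply, derivₗ_spinCurve R.2]
    exact spinH_ne_zero (R.2.1 t)
  normal t := by
    rw [← derivₗ_apply, derivₗ_spinCurve R.2, superpose_spinFrame_apply R.2.1]
    exact spinFrame_spec (R.2.1 t) (hu t)

theorem continuous_spinFramed (u : SmoothLoop ℂ) (hu : ∀ t, ‖u t‖ = 1) :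
    Continuous (spinFramed u hu) := by
  rw [isInducing_incl.continuous_iff]
  have h1 : Continuous fun R : closedSpinors => primₗ (superpose spinH R.1) :=
    continuous_primₗ.comp ((continuous_superpose contDiff_spinH).comp continuous_subtype_val)
  have h2 : Continuous fun R : closedSpinors => pair R.1 u :=
    continuous_pairₗ.comp (continuous_subtype_val.prodMk continuous_const)
  have h3 : Continuous fun R : closedSpinors => superpose spinFrame (pair R.1 u) :=
    (continuousOn_superpose isOpen_spinor_ne contDiffOn_spinFrame).comp_continuous h2
      fun R t => R.2.1 t
  exact h1.prodMk h3

/-! #### Closing spinor loops by orthonormalization -/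

/-- Squared absolute value of the first component. -/
noncomputable def gramA (Q : SmoothLoop (ℂ × ℂ)) : SmoothLoop ℝ :=
  superpose (fun q : ℂ × ℂ => q.1.re ^ 2 + q.1.im ^ 2) Q

/-- Squared absolute value of the second component. -/
noncomputable def gramC (Q : SmoothLoop (ℂ × ℂ)) : SmoothLoop ℝ :=
  superpose (fun q : ℂ × ℂ => q.2.re ^ 2 + q.2.im ^ 2) Q

/-- Real part of the hermitian product of the components. -/
noncomputable def gramX (Q : SmoothLoop (ℂ × ℂ)) : SmoothLoop ℝ :=
  superpose (fun q : ℂ × ℂ => q.1.re * q.2.re + q.1.im * q.2.im) Q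

/-- Imaginary part of the hermitian product of the components. -/
noncomputable def gramY (Q : SmoothLoop (ℂ × ℂ)) : SmoothLoop ℝ :=
  superpose (fun q : ℂ × ℂ => q.1.re * q.2.im - q.1.im * q.2.re) Q

section Gram

theorem contDiff_components : ContDiff ℝ ∞ (fun q : ℂ × ℂ => q.1.re) ∧
    ContDiff ℝ ∞ (fun q : ℂ × ℂ => q.1.im) ∧ ContDiff ℝ ∞ (fun q : ℂ × ℂ => q.2.re) ∧
    ContDiff ℝ ∞ (fun q : ℂ × ℂ => q.2.im) :=
  ⟨Complex.reCLM.contDiff.comp contDiff_fst, Complex.imCLM.contDiff.comp contDiff_fst,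
    Complex.reCLM.contDiff.comp contDiff_snd, Complex.imCLM.contDiff.comp contDiff_snd⟩

theorem contDiff_gramA : ContDiff ℝ ∞ fun q : ℂ × ℂ => q.1.re ^ 2 + q.1.im ^ 2 := by
  obtain ⟨h1, h2, h3, h4⟩ := contDiff_components
  fun_prop

theorem contDiff_gramC : ContDiff ℝ ∞ fun q : ℂ × ℂ => q.2.re ^ 2 + q.2.im ^ 2 := by
  obtain ⟨h1, h2, h3, h4⟩ := contDiff_components
  fun_prop

theorem contDiff_gramX : ContDiff ℝ ∞ fun q : ℂ × ℂ => q.1.re * q.2.re + q.1.im * q.2.im := by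
  obtain ⟨h1, h2, h3, h4⟩ := contDiff_components
  fun_prop

theorem contDiff_gramY : ContDiff ℝ ∞ fun q : ℂ × ℂ => q.1.re * q.2.im - q.1.im * q.2.re := by
  obtain ⟨h1, h2, h3, h4⟩ := contDiff_components
  fun_prop

variable (Q : SmoothLoop (ℂ × ℂ)) (t : ℝ)

theorem gramA_apply : gramA Q t = (Q t).1.re ^ 2 + (Q t).1.im ^ 2 :=
  superpose_apply_univ contDiff_gramA Q t

theorem gramC_apply : gramC Q t = (Q t).2.re ^ 2 + (Q t).2.im ^ 2 :=
  superpose_apply_univ contDiff_gramC Q t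

theorem gramX_apply : gramX Q t = (Q t).1.re * (Q t).2.re + (Q t).1.im * (Q t).2.im :=
  superpose_apply_univ contDiff_gramX Q t

theorem gramY_apply : gramY Q t = (Q t).1.re * (Q t).2.im - (Q t).1.im * (Q t).2.re :=
  superpose_apply_univ contDiff_gramY Q t

end Gram

/-- The integral of the Hopf image in terms of the Gram matrix of the components. -/
theorem integral_spinH (Q : SmoothLoop (ℂ × ℂ)) : ∫ s in (0 : ℝ)..2, superpose spinH Q s =
    !₂[totalₗ (gramA Q) - totalₗ (gramC Q), -2 * totalₗ (gramY Q), -2 * totalₗ (gramX Q)] := by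
  have h : ∀ i, (∫ s in (0 : ℝ)..2, superpose spinH Q s) i =
      ∫ s in (0 : ℝ)..2, spinH (Q s) i := fun i => by
    have := ContinuousLinearMap.intervalIntegral_comp_comm (𝕜 := ℝ)
      (EuclideanSpace.proj i : Vec3 →L[ℝ] ℝ) ((superpose spinH Q).intervalIntegrable 0 2)
    refine this.symm.trans (intervalIntegral.integral_congr fun s _ => ?_)
    simp only
    rw [superpose_apply_univ contDiff_spinH]
    rfl
  apply vec3_ext
  · rw [h]
    change _ = totalₗ (gramA Q) - totalₗ (gramC Q)
    rw [← map_sub]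
    refine intervalIntegral.integral_congr fun s _ => ?_
    simp only
    rw [SmoothLoop.sub_apply, gramA_apply, gramC_apply, spinH_zero]
    ring
  · rw [h]
    change _ = -2 * totalₗ (gramY Q)
    rw [← smul_eq_mul, ← map_smul]
    refine intervalIntegral.integral_congr fun s _ => ?_
    simp only
    rw [SmoothLoop.smul_apply, gramY_apply, spinH_one, smul_eq_mul]
    ring
  · rw [h]
    change _ = -2 * totalₗ (gramX Q)
    rw [← smul_eq_mul, ← map_smul]
    refine intervalIntegral.integral_congr fun s _ => ?_
    simp only
    rw [SmoothLoop.smul_apply, gramX_apply, spinH_two, smul_eq_mul]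

/-- The Gram determinant of the components. -/
noncomputable def gramDet (Q : SmoothLoop (ℂ × ℂ)) : ℝ :=
  totalₗ (gramA Q) * totalₗ (gramC Q) - totalₗ (gramX Q) ^ 2 - totalₗ (gramY Q) ^ 2

/-- The pointwise linear map `(z, w) ↦ (δ z, a w - (x + i y) z)`. -/
noncomputable def shear (p : (ℂ × ℂ) × (ℝ × ℝ × ℝ × ℝ)) : ℂ × ℂ :=
  ((p.2.1 : ℂ) * p.1.1, (p.2.2.1 : ℂ) * p.1.2 - (p.2.2.2.1 + p.2.2.2.2 * Complex.I) * p.1.1)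

theorem contDiff_shear : ContDiff ℝ ∞ shear := by
  have h : ∀ {f : (ℂ × ℂ) × (ℝ × ℝ × ℝ × ℝ) → ℝ}, ContDiff ℝ ∞ f →
      ContDiff ℝ ∞ fun x => (f x : ℂ) := fun hf => Complex.ofRealCLM.contDiff.comp hf
  have h1 := h (contDiff_fst.comp contDiff_snd)
  have h2 := h (contDiff_fst.comp (contDiff_snd.comp contDiff_snd))
  have h3 := h (contDiff_fst.comp (contDiff_snd.comp (contDiff_snd.comp contDiff_snd)))
  have h4 := h (contDiff_snd.comp (contDiff_snd.comp (contDiff_snd.comp contDiff_snd)))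
  exact (h1.mul contDiff_fst.fst).prodMk ((h2.mul contDiff_fst.snd).sub
    ((h3.add (h4.mul contDiff_const)).mul contDiff_fst.fst))

/-- The components of a spinor loop made orthogonal and of equal norm by the Gram-Schmidt
process. -/
noncomputable def gramSchmidt (Q : SmoothLoop (ℂ × ℂ)) : SmoothLoop (ℂ × ℂ) :=
  superpose shear (pair Q (SmoothLoop.const
    (√(gramDet Q), totalₗ (gramA Q), totalₗ (gramX Q), totalₗ (gramY Q))))

theorem gramSchmidt_apply (Q : SmoothLoop (ℂ × ℂ)) (t : ℝ) : gramSchmidt Q t =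
    shear (Q t, √(gramDet Q), totalₗ (gramA Q), totalₗ (gramX Q), totalₗ (gramY Q)) :=
  superpose_apply_univ contDiff_shear _ t

theorem continuous_gramSchmidt : Continuous gramSchmidt := by
  have hA : Continuous fun Q => totalₗ (gramA Q) :=
    continuous_totalₗ.comp (continuous_superpose contDiff_gramA)
  have hC : Continuous fun Q => totalₗ (gramC Q) :=
    continuous_totalₗ.comp (continuous_superpose contDiff_gramC)
  have hX : Continuous fun Q => totalₗ (gramX Q) :=
    continuous_totalₗ.comp (continuous_superpose contDiff_gramX)
  have hY : Continuous fun Q => totalₗ (gramY Q) :=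
    continuous_totalₗ.comp (continuous_superpose contDiff_gramY)
  have hD : Continuous gramDet := ((hA.mul hC).sub (hX.pow 2)).sub (hY.pow 2)
  exact (continuous_superpose contDiff_shear).comp (continuous_pairₗ.comp (continuous_id.prodMk
    (SmoothLoop.continuous_const.comp
      ((Real.continuous_sqrt.comp hD).prodMk (hA.prodMk (hX.prodMk hY))))))

/-- Spinor loops without zeros and with linearly independent components. -/
def goodSpinors : Set (SmoothLoop (ℂ × ℂ)) :=
  {Q | (∀ t, Q t ≠ 0) ∧ 0 < totalₗ (gramA Q) ∧ 0 < gramDet Q}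

/-- The Gram–Schmidt process makes the components orthogonal and of equal norm, which says that the
Hopf image has integral zero. -/
theorem gramSchmidt_mem {Q : SmoothLoop (ℂ × ℂ)} (h : Q ∈ goodSpinors) :
    gramSchmidt Q ∈ closedSpinors := by
  obtain ⟨h0, hA, hD⟩ := h
  have hs := Real.sqrt_pos.2 hD
  have hsq := Real.sq_sqrt hD.le
  set δ := √(gramDet Q) with hδ
  set a := totalₗ (gramA Q) with ha
  set x := totalₗ (gramX Q) with hx
  set y := totalₗ (gramY Q) with hy
  have hv := gramSchmidt_apply Q
  rw [← hδ, ← ha, ← hx, ← hy] at hv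
  have re1 : ∀ t, (gramSchmidt Q t).1.re = δ * (Q t).1.re := fun t => by
    rw [hv]; simp [shear]
  have im1 : ∀ t, (gramSchmidt Q t).1.im = δ * (Q t).1.im := fun t => by
    rw [hv]; simp [shear]
  have re2 : ∀ t, (gramSchmidt Q t).2.re = a * (Q t).2.re - (x * (Q t).1.re - y * (Q t).1.im) :=
    fun t => by rw [hv]; simp [shear]
  have im2 : ∀ t, (gramSchmidt Q t).2.im = a * (Q t).2.im - (x * (Q t).1.im + y * (Q t).1.re) :=
    fun t => by rw [hv]; simp [shear]
  -- the Gram matrix of the result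
  have gA : gramA (gramSchmidt Q) = δ ^ 2 • gramA Q := SmoothLoop.ext fun t => by
    rw [SmoothLoop.smul_apply, gramA_apply, gramA_apply, re1, im1, smul_eq_mul]
    ring
  have gC : gramC (gramSchmidt Q) = a ^ 2 • gramC Q - (2 * a * x) • gramX Q -
      (2 * a * y) • gramY Q + (x ^ 2 + y ^ 2) • gramA Q := SmoothLoop.ext fun t => by
    simp only [SmoothLoop.smul_apply, SmoothLoop.add_apply, SmoothLoop.sub_apply, gramA_apply,
      gramC_apply, gramX_apply, gramY_apply, re2, im2, smul_eq_mul]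
    ring
  have gX : gramX (gramSchmidt Q) = (δ * a) • gramX Q - (δ * x) • gramA Q :=
    SmoothLoop.ext fun t => by
    simp only [SmoothLoop.smul_apply, SmoothLoop.sub_apply, gramA_apply,
      gramX_apply, re1, im1, re2, im2, smul_eq_mul]
    ring
  have gY : gramY (gramSchmidt Q) = (δ * a) • gramY Q - (δ * y) • gramA Q :=
    SmoothLoop.ext fun t => by
    simp only [SmoothLoop.smul_apply, SmoothLoop.sub_apply, gramA_apply,
      gramY_apply, re1, im1, re2, im2, smul_eq_mul]
    ring
  refine ⟨fun t ht => h0 t ?_, ?_⟩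
  · have k1 := re1 t
    have k2 := im1 t
    have k3 := re2 t
    have k4 := im2 t
    rw [ht] at k1 k2 k3 k4
    simp only [Prod.fst_zero, Prod.snd_zero, Complex.zero_re, Complex.zero_im] at k1 k2 k3 k4
    have r1 : (Q t).1.re = 0 := (mul_eq_zero.1 k1.symm).resolve_left hs.ne'
    have r2 : (Q t).1.im = 0 := (mul_eq_zero.1 k2.symm).resolve_left hs.ne'
    rw [r1, r2] at k3 k4
    have r3 : (Q t).2.re = 0 := (mul_eq_zero.1 (show a * (Q t).2.re = 0 by linarith)).resolve_left hA.ne'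
    have r4 : (Q t).2.im = 0 := (mul_eq_zero.1 (show a * (Q t).2.im = 0 by linarith)).resolve_left hA.ne'
    exact Prod.ext (Complex.ext r1 r2) (Complex.ext r3 r4)
  · rw [integral_spinH, gA, gC, gX, gY]
    simp only [map_add, map_sub, map_smul, smul_eq_mul, ← ha, ← hx, ← hy]
    have e0 : δ ^ 2 * a - (a ^ 2 * totalₗ (gramC Q) - 2 * a * x * x - 2 * a * y * y +
        (x ^ 2 + y ^ 2) * a) = 0 := by
      rw [hsq, gramDet, ← ha, ← hx, ← hy]
      ring
    have e1 : -2 * (δ * a * y - δ * y * a) = 0 := by ring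
    have e2 : -2 * (δ * a * x - δ * x * a) = 0 := by ring
    rw [e0, e1, e2]
    apply vec3_ext <;> rfl

/-- On closed spinors the Gram–Schmidt process is multiplication by a positive number. -/
theorem gramSchmidt_of_closed {Q : SmoothLoop (ℂ × ℂ)} (h : Q ∈ closedSpinors) :
    Q ∈ goodSpinors ∧ ∀ t, gramSchmidt Q t = totalₗ (gramA Q) • Q t := by
  obtain ⟨h0, hi⟩ := h
  rw [integral_spinH] at hi
  have i0 : totalₗ (gramA Q) - totalₗ (gramC Q) = 0 := congrArg (fun v : Vec3 => v 0) hi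
  have i1 : -2 * totalₗ (gramY Q) = 0 := congrArg (fun v : Vec3 => v 1) hi
  have i2 : -2 * totalₗ (gramX Q) = 0 := congrArg (fun v : Vec3 => v 2) hi
  have hX : totalₗ (gramX Q) = 0 := by linarith
  have hY : totalₗ (gramY Q) = 0 := by linarith
  have hC : totalₗ (gramC Q) = totalₗ (gramA Q) := by linarith
  have hpos : 0 < totalₗ (gramA Q + gramC Q) := by
    have hN : ∀ t, (gramA Q + gramC Q) t = spinN (Q t) := fun t => by
      rw [SmoothLoop.add_apply, gramA_apply, gramC_apply, spinN]
      ring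
    refine totalₗ_pos (fun t => ?_) ⟨0, by norm_num, ?_⟩
    · rw [hN]
      exact (spinN_pos (h0 t)).le
    · rw [hN]
      exact spinN_pos (h0 0)
  have hA : 0 < totalₗ (gramA Q) := by
    rw [map_add, hC] at hpos
    linarith
  have hD : gramDet Q = totalₗ (gramA Q) ^ 2 := by
    rw [gramDet, hX, hY, hC]
    ring
  refine ⟨⟨h0, hA, by rw [hD]; positivity⟩, fun t => ?_⟩
  rw [gramSchmidt_apply, hD, hX, hY, Real.sqrt_sq hA.le]
  refine Prod.ext ?_ ?_ <;> simp [shear]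

/-- A nonzero determinant of values of the components ensures their linear independence. -/
theorem mem_goodSpinors {Q : SmoothLoop (ℂ × ℂ)} (h0 : ∀ t, Q t ≠ 0)
    (hd : ((Q 0).1 + (Q 1).1) * ((Q 0).2 - (Q 1).2) -
      ((Q 0).1 - (Q 1).1) * ((Q 0).2 + (Q 1).2) ≠ 0) : Q ∈ goodSpinors := by
  have hp : ∀ z : ℂ, 0 ≤ z.re ^ 2 + z.im ^ 2 := fun z => by positivity
  have hp' : ∀ z : ℂ, z ≠ 0 → 0 < z.re ^ 2 + z.im ^ 2 := fun z hz => by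
    rw [pow_two, pow_two, ← Complex.normSq_apply]
    exact Complex.normSq_pos.2 hz
  have hA : 0 < totalₗ (gramA Q) := by
    refine totalₗ_pos (fun t => by rw [gramA_apply]; exact hp _) ?_
    by_cases h1 : (Q 0).1 = 0
    · refine ⟨1, by norm_num, ?_⟩
      rw [gramA_apply]
      exact hp' _ fun h2 => hd (by rw [h1, h2]; ring)
    · refine ⟨0, by norm_num, ?_⟩
      rw [gramA_apply]
      exact hp' _ h1
  refine ⟨h0, hA, ?_⟩
  set a := totalₗ (gramA Q) with ha
  set x := totalₗ (gramX Q) with hx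
  set y := totalₗ (gramY Q) with hy
  -- the squared modulus of `a w - (x + i y) z` for `Q = (z, w)`, with integral `a * gramDet Q`
  set f : SmoothLoop ℝ := a ^ 2 • gramC Q - (2 * a * x) • gramX Q -
      (2 * a * y) • gramY Q + (x ^ 2 + y ^ 2) • gramA Q with hf
  have hfv : ∀ t, f t = ((a : ℂ) * (Q t).2 - (x + y * Complex.I) * (Q t).1).re ^ 2 +
      ((a : ℂ) * (Q t).2 - (x + y * Complex.I) * (Q t).1).im ^ 2 := fun t => by
    simp only [hf, SmoothLoop.smul_apply, SmoothLoop.add_apply, SmoothLoop.sub_apply, gramA_apply,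
      gramC_apply, gramX_apply, gramY_apply, smul_eq_mul, Complex.sub_re, Complex.sub_im,
      Complex.mul_re, Complex.mul_im, Complex.add_re, Complex.add_im, Complex.ofReal_re,
      Complex.ofReal_im, Complex.I_re, Complex.I_im]
    ring
  have hpos : 0 < totalₗ f := by
    refine totalₗ_pos (fun t => by rw [hfv]; exact hp _) ?_
    by_cases h1 : (a : ℂ) * (Q 0).2 - (x + y * Complex.I) * (Q 0).1 = 0
    · refine ⟨1, by norm_num, ?_⟩
      rw [hfv]
      refine hp' _ fun h2 => hd ?_
      have h3 : (a : ℂ) * (((Q 0).1 + (Q 1).1) * ((Q 0).2 - (Q 1).2) -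
          ((Q 0).1 - (Q 1).1) * ((Q 0).2 + (Q 1).2)) = 0 := by
        linear_combination (2 * (Q 1).1) * h1 - 2 * (Q 0).1 * h2
      exact (mul_eq_zero.1 h3).resolve_left (by exact_mod_cast hA.ne')
    · refine ⟨0, by norm_num, ?_⟩
      rw [hfv]
      exact hp' _ h1
  have hfd : totalₗ f = a * gramDet Q := by
    simp only [hf, map_add, map_sub, map_smul, smul_eq_mul, ← ha, ← hx, ← hy, gramDet]
    ring
  rw [hfd] at hpos
  exact (mul_pos_iff_of_pos_left hA).1 hpos

/-! #### Generic paths of spinor loops -/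

/-- The spinor loop `t ↦ (a, b e^{iπt})`. -/
noncomputable def basicSpinor (x : ℂ × ℂ) : SmoothLoop (ℂ × ℂ) :=
  SmoothLoop.mk (fun t => (x.1, x.2 * Complex.exp ((Real.pi * t : ℝ) * Complex.I)))
    (contDiff_const.prodMk (contDiff_const.mul
      (contDiff_expI.comp (contDiff_const.mul contDiff_id)))) (fun t => by
      have h : ((Real.pi * (t + 2) : ℝ) : ℂ) * Complex.I =
          (Real.pi * t : ℝ) * Complex.I + 2 * Real.pi * Complex.I := by
        push_cast
        ring
      simp only [h, Complex.exp_add, Complex.exp_two_pi_mul_I, mul_one])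

theorem basicSpinor_apply (x : ℂ × ℂ) (t : ℝ) : basicSpinor x t =
    (x.1, x.2 * Complex.exp ((Real.pi * t : ℝ) * Complex.I)) := rfl

/-- The union of the ranges of three smooth maps from spaces of dimension at most three, which
contains the coefficients `(a, b)` for which `(a, b e^{iπt})` lies in a bad position with
respect to `Q`. -/
def badCoeffs (Q : SmoothLoop (ℂ × ℂ)) : Set (ℂ × ℂ) :=
  range (fun x : ℝ × ℝ => (x.1 * (Q x.2).1,
    x.1 * ((Q x.2).2 * Complex.exp ((-(Real.pi * x.2) : ℝ) * Complex.I))) : ℝ × ℝ → ℂ × ℂ) ∪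
  (range (fun x : ℂ × ℝ => ((Complex.exp x.1 - x.2 * ((Q 0).1 + (Q 1).1)) / 2,
    (x.2 * x.2 * (((Q 0).1 - (Q 1).1) * ((Q 0).2 + (Q 1).2)) * Complex.exp (-x.1) -
      x.2 * ((Q 0).2 - (Q 1).2)) / 2) : ℂ × ℝ → ℂ × ℂ) ∪
  range (fun x : ℂ × ℝ => (-(x.2 * ((Q 0).1 + (Q 1).1)) / 2, x.1) : ℂ × ℝ → ℂ × ℂ))

theorem dimH_badCoeffs (Q : SmoothLoop (ℂ × ℂ)) : dimH (badCoeffs Q) ≤ 3 := by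
  have hr : ∀ {X : Type} [NormedAddCommGroup X] [NormedSpace ℝ X] {f : X → ℝ}, ContDiff ℝ 1 f →
      ContDiff ℝ 1 fun x => (f x : ℂ) := fun hf => Complex.ofRealCLM.contDiff.comp hf
  have hQ : ContDiff ℝ 1 (Q : ℝ → ℂ × ℂ) := Q.contDiff.of_le (by simp)
  rw [badCoeffs, dimH_union, dimH_union]
  refine max_le ?_ (max_le ?_ ?_)
  · refine (ContDiff.dimH_range_le (ContDiff.prodMk ?_ ?_)).trans ?_
    · exact (hr contDiff_fst).mul (hQ.comp contDiff_snd).fst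
    · exact (hr contDiff_fst).mul ((hQ.comp contDiff_snd).snd.mul
        ((hr (contDiff_const.mul contDiff_snd).neg).mul contDiff_const).cexp)
    · simp
      norm_num
  · refine (ContDiff.dimH_range_le (ContDiff.prodMk ?_ ?_)).trans ?_
    · exact (contDiff_fst.cexp.sub ((hr contDiff_snd).mul contDiff_const)).div_const 2
    · exact (((((hr contDiff_snd).mul (hr contDiff_snd)).mul contDiff_const).mul
        contDiff_fst.neg.cexp).sub ((hr contDiff_snd).mul contDiff_const)).div_const 2
    · simp
  · refine (ContDiff.dimH_range_le (ContDiff.prodMk ?_ ?_)).trans ?_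
    · exact ((hr contDiff_snd).mul contDiff_const).neg.div_const 2
    · exact contDiff_fst
    · simp

theorem exists_notMem_badCoeffs (Q R : SmoothLoop (ℂ × ℂ)) :
    ∃ x, x ∉ badCoeffs Q ∧ x ∉ badCoeffs R := by
  have h : dimH (badCoeffs Q ∪ badCoeffs R) < Module.finrank ℝ (ℂ × ℂ) := by
    rw [dimH_union]
    refine (max_le (dimH_badCoeffs Q) (dimH_badCoeffs R)).trans_lt ?_
    simp
    norm_num
  obtain ⟨x, hx⟩ := (dense_compl_of_dimH_lt_finrank h).nonempty
  exact ⟨x, fun h => hx (.inl h), fun h => hx (.inr h)⟩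

/-- For coefficients which are not bad, the segment from `Q` to the basic spinor loop consists of good
spinor loops, apart from the end `Q`: both failures of the criterion `mem_goodSpinors` put the
coefficients in the bad set. -/
theorem smul_add_basicSpinor_mem {Q : SmoothLoop (ℂ × ℂ)} {x : ℂ × ℂ} (hx : x ∉ badCoeffs Q)
    (c : ℝ) {s : ℝ} (hs : s ≠ 0) : c • Q + s • basicSpinor x ∈ goodSpinors := by
  obtain ⟨l, rfl⟩ : ∃ l, c = s * l := ⟨s⁻¹ * c, by rw [mul_inv_cancel_left₀ hs]⟩
  have hs' : (s : ℂ) ≠ 0 := by exact_mod_cast hs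
  have hv : ∀ t, ((s * l) • Q + s • basicSpinor x) t = ((s : ℂ) * (l * (Q t).1 + x.1),
      (s : ℂ) * (l * (Q t).2 + x.2 * Complex.exp ((Real.pi * t : ℝ) * Complex.I))) := fun t => by
    rw [SmoothLoop.add_apply, SmoothLoop.smul_apply, SmoothLoop.smul_apply, basicSpinor_apply]
    refine Prod.ext ?_ ?_ <;> simp <;> ring
  refine mem_goodSpinors (fun t ht => hx (.inl ⟨(-l, t), ?_⟩)) fun hd => ?_
  · rw [hv] at ht
    have h1 := (mul_eq_zero.1 (congrArg Prod.fst ht)).resolve_left hs'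
    have h2 := (mul_eq_zero.1 (congrArg Prod.snd ht)).resolve_left hs'
    have h3 : Complex.exp ((Real.pi * t : ℝ) * Complex.I) *
        Complex.exp ((-(Real.pi * t) : ℝ) * Complex.I) = 1 := by
      rw [← Complex.exp_add, ← add_mul, ← Complex.ofReal_add, add_neg_cancel, Complex.ofReal_zero,
        zero_mul, Complex.exp_zero]
    refine Prod.ext ?_ ?_
    · simp only [Complex.ofReal_neg]
      linear_combination -h1
    · simp only [Complex.ofReal_neg (l)]
      linear_combination -(Complex.exp ((-(Real.pi * t) : ℝ) * Complex.I)) * h2 + x.2 * h3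
  · rw [hv, hv, mul_zero, Complex.ofReal_zero, zero_mul, Complex.exp_zero, mul_one,
      mul_one Real.pi, Complex.exp_pi_mul_I] at hd
    have hd' : (2 * x.1 + l * ((Q 0).1 + (Q 1).1)) * (2 * x.2 + l * ((Q 0).2 - (Q 1).2)) =
        l * l * (((Q 0).1 - (Q 1).1) * ((Q 0).2 + (Q 1).2)) := by
      refine mul_left_cancel₀ (mul_ne_zero hs' hs') ?_
      linear_combination hd
    by_cases hμ : 2 * x.1 + l * ((Q 0).1 + (Q 1).1) = 0
    · refine hx (.inr (.inr ⟨(x.2, l), Prod.ext ?_ rfl⟩))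
      simp only
      linear_combination -hμ / 2
    · refine hx (.inr (.inl ⟨(Complex.log (2 * x.1 + l * ((Q 0).1 + (Q 1).1)), l),
        Prod.ext ?_ ?_⟩))
      · simp only
        rw [Complex.exp_log hμ]
        ring
      · simp only
        rw [Complex.exp_neg, Complex.exp_log hμ, ← hd']
        field_simp
        ring

/-! #### Connectedness -/

/-- The framed loop of a good spinor loop. -/
noncomputable def goodFramed (u : SmoothLoop ℂ) (hu : ∀ t, ‖u t‖ = 1) (Q : goodSpinors) :
    FramedLoop := spinFramed u hu ⟨gramSchmidt Q.1, gramSchmidt_mem Q.2⟩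

theorem continuous_goodFramed (u : SmoothLoop ℂ) (hu : ∀ t, ‖u t‖ = 1) :
    Continuous (goodFramed u hu) :=
  (continuous_spinFramed u hu).comp
    ((continuous_gramSchmidt.comp continuous_subtype_val).subtype_mk _)

/-- The segment of spinor loops from `Q` to a basic one gives a path of framed loops. -/
theorem mem_connectedComponent_of_notMem_badCoeffs (u : SmoothLoop ℂ) (hu : ∀ t, ‖u t‖ = 1)
    {Q : SmoothLoop (ℂ × ℂ)} (hQ : Q ∈ goodSpinors) {x : ℂ × ℂ} (hx : x ∉ badCoeffs Q)
    (hP : basicSpinor x ∈ goodSpinors) :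
    FramedModuli.mk (goodFramed u hu ⟨Q, hQ⟩) ∈
      connectedComponent (FramedModuli.mk (goodFramed u hu ⟨basicSpinor x, hP⟩)) := by
  have hm : ∀ s : unitInterval, (1 - s.1) • Q + s.1 • basicSpinor x ∈ goodSpinors := fun s => by
    by_cases hs : s.1 = 0
    · rw [hs, sub_zero, one_smul, zero_smul, add_zero]
      exact hQ
    · exact smul_add_basicSpinor_mem hx _ hs
  have hc : Continuous fun s : unitInterval =>
      FramedModuli.mk (goodFramed u hu ⟨(1 - s.1) • Q + s.1 • basicSpinor x, hm s⟩) := by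
    refine isQuotientMap_framedModuli.continuous.comp ((continuous_goodFramed u hu).comp
      (Continuous.subtype_mk ?_ _))
    exact ((continuous_const.sub continuous_subtype_val).smul continuous_const).add
      (continuous_subtype_val.smul continuous_const)
  have he : ∀ {Q₁ Q₂ : SmoothLoop (ℂ × ℂ)} (h₁ : Q₁ ∈ goodSpinors) (h₂ : Q₂ ∈ goodSpinors),
      Q₁ = Q₂ → FramedModuli.mk (goodFramed u hu ⟨Q₁, h₁⟩) =
        FramedModuli.mk (goodFramed u hu ⟨Q₂, h₂⟩) := by
    rintro Q₁ Q₂ h₁ h₂ rfl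
    rfl
  have h1 : FramedModuli.mk (goodFramed u hu ⟨basicSpinor x, hP⟩) ∈ range fun s : unitInterval =>
      FramedModuli.mk (goodFramed u hu ⟨(1 - s.1) • Q + s.1 • basicSpinor x, hm s⟩) := by
    refine ⟨1, he _ hP ?_⟩
    rw [show ((1 : unitInterval) : ℝ) = 1 from rfl, sub_self, zero_smul, one_smul, zero_add]
  refine (isPreconnected_range hc).subset_connectedComponent h1 ⟨0, he _ hQ ?_⟩
  rw [show ((0 : unitInterval) : ℝ) = 0 from rfl, sub_zero, zero_smul, one_smul, add_zero]

/-- A framed loop is recovered, up to similarity, from a closed spinor loop lifting it. -/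
theorem mk_goodFramed {u : SmoothLoop ℂ} {hu : ∀ t, ‖u t‖ = 1} {p : FramedLoop}
    {Q : SmoothLoop (ℂ × ℂ)} (hQ : Q ∈ closedSpinors) (hg : Q ∈ goodSpinors)
    (hγ : ∀ t, spinH (Q t) = derivₗ p.curve t) (hV : ∀ t, p.framing t = spinFrame (Q t, u t)) :
    FramedModuli.mk p = FramedModuli.mk (goodFramed u hu ⟨Q, hg⟩) := by
  obtain ⟨-, he⟩ := gramSchmidt_of_closed hQ
  have hA := hg.2.1
  set a := totalₗ (gramA Q) with ha
  have hd : ∀ t, derivₗ (goodFramed u hu ⟨Q, hg⟩).curve t = a ^ 2 • derivₗ p.curve t := fun t => by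
    refine (derivₗ_spinCurve (gramSchmidt_mem hg) t).trans ?_
    rw [he, spinH_real_smul, hγ]
  obtain ⟨r, b, hr, h1⟩ := (exists_sim_iff p.immersed' (goodFramed u hu ⟨Q, hg⟩).immersed' 1).2
    fun t => by
      rw [hd, hd, rot_one, norm_smul, Real.norm_eq_abs, abs_of_pos (by positivity), smul_smul,
        mul_comm]
  refine FramedModuli.mk_eq_iff.2 ⟨r, 1, b, 1, hr, h1, fun t => ?_⟩
  rw [rot_one, Circle.coe_one, twistVec_one, hV]
  refine (superpose_spinFrame_apply (gramSchmidt_mem hg).1 u t).trans ?_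
  rw [he, spinFrame_smul hA.ne']

/-- The loop `e^{2ict}` for `e^{2ic} = σ = ± 1`. -/
noncomputable def phaseLoop (c : ℝ) (h : Complex.exp ((c * 2 : ℝ) * Complex.I) ^ 2 = 1) :
    SmoothLoop ℂ :=
  SmoothLoop.mk (fun t => Complex.exp ((c * t : ℝ) * Complex.I) ^ 2)
    ((contDiff_expI.comp (contDiff_const.mul contDiff_id)).pow 2) (fun t => by
      have h1 : ((c * (t + 2) : ℝ) : ℂ) * Complex.I =
          (c * t : ℝ) * Complex.I + (c * 2 : ℝ) * Complex.I := by
        push_cast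
        ring
      simp only [h1, Complex.exp_add, mul_pow, h, mul_one])

theorem norm_phaseLoop {c : ℝ} (h : Complex.exp ((c * 2 : ℝ) * Complex.I) ^ 2 = 1) (t : ℝ) :
    ‖phaseLoop c h t‖ = 1 := by
  change ‖Complex.exp ((c * t : ℝ) * Complex.I) ^ 2‖ = 1
  rw [norm_pow, Complex.norm_exp_ofReal_mul_I, one_pow]

/-- A framed loop of parity `σ` is given by a closed spinor loop without zeros. -/
theorem FramedLoop.HasSpinor.exists_closedSpinor {σ c : ℝ} {p : FramedLoop} (hp : p.HasSpinor σ)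
    (hc : Complex.exp ((c * 2 : ℝ) * Complex.I) = σ)
    (h : Complex.exp ((c * 2 : ℝ) * Complex.I) ^ 2 = 1) :
    ∃ Q ∈ closedSpinors, (∀ t, spinH (Q t) = derivₗ p.curve t) ∧
      ∀ t, p.framing t = spinFrame (Q t, phaseLoop c h t) := by
  obtain ⟨q, hq, hσ, hs⟩ := hp
  set v : ℝ → ℂ := fun t => Complex.exp ((c * t : ℝ) * Complex.I) with hv
  have hσ0 : (σ : ℂ) ≠ 0 := by rw [← hc]; exact Complex.exp_ne_zero _
  have hv0 : ∀ t, v t ≠ 0 := fun t => Complex.exp_ne_zero _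
  have hvs : ContDiff ℝ ∞ v := contDiff_expI.comp (contDiff_const.mul contDiff_id)
  have hvn : ∀ t, ‖v t‖ = 1 := fun t => Complex.norm_exp_ofReal_mul_I _
  have hv2 : ∀ t, v (t + 2) = σ * v t := fun t => by
    have h1 : ((c * (t + 2) : ℝ) : ℂ) * Complex.I =
        (c * 2 : ℝ) * Complex.I + (c * t : ℝ) * Complex.I := by
      push_cast
      ring
    simp only [hv]
    rw [h1, Complex.exp_add, hc]
  -- the positive factor which makes the Hopf image equal to the velocity
  set m : ℝ → ℝ := fun t => √(speed p.curve t / spinN (q t)) with hm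
  have hsp : ∀ t, 0 < speed p.curve t := fun t => by
    rw [speed_apply p.immersed']
    exact norm_pos_iff.2 (p.immersed t)
  have hN : ∀ t, 0 < spinN (q t) := fun t => spinN_pos (hs t).ne_zero
  have hm0 : ∀ t, 0 < m t := fun t => Real.sqrt_pos.2 (div_pos (hsp t) (hN t))
  have hmm : ∀ t, m t ^ 2 = speed p.curve t / spinN (q t) := fun t =>
    Real.sq_sqrt (div_pos (hsp t) (hN t)).le
  have hms : ContDiff ℝ ∞ m := ((speed p.curve).contDiff.div (contDiff_spinN_comp hq)
    fun t => (hN t).ne').sqrt fun t => (div_pos (hsp t) (hN t)).ne'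
  have hσN : ∀ t, spinN (q (t + 2)) = spinN (q t) := fun t => by
    have h1 : σ ^ 2 = 1 := by
      rw [hc] at h
      exact_mod_cast h
    rw [hσ]
    simp only [spinN, Prod.smul_fst, Prod.smul_snd, Complex.smul_re, Complex.smul_im, smul_eq_mul]
    linear_combination ((q t).1.re ^ 2 + (q t).1.im ^ 2 + (q t).2.re ^ 2 + (q t).2.im ^ 2) * h1
  have hmp : ∀ t, m (t + 2) = m t := fun t => by
    simp only [hm]
    rw [hσN, (speed p.curve).periodic t]
  let Q : SmoothLoop (ℂ × ℂ) := SmoothLoop.mk (fun t => m t • (v t)⁻¹ • q t)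
    (hms.smul ((hvs.inv hv0).smul hq)) (fun t => by
      simp only
      rw [hmp, hσ, hv2, mul_inv, ← Complex.coe_smul σ (q t), smul_smul _ (σ : ℂ), mul_right_comm,
        inv_mul_cancel₀ hσ0, one_mul])
  have hQ : ∀ t, Q t = m t • (v t)⁻¹ • q t := fun t => rfl
  have hQ' : ∀ t, (v t)⁻¹ • q t = (m t)⁻¹ • Q t := fun t => by
    rw [hQ, smul_smul, inv_mul_cancel₀ (hm0 t).ne', one_smul]
  have hH : ∀ t, spinH (Q t) = derivₗ p.curve t := fun t => by
    have hn1 : Complex.normSq (v t)⁻¹ = 1 := by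
      rw [Complex.normSq_eq_norm_sq, norm_inv, hvn, inv_one, one_pow]
    rw [hQ, spinH_real_smul, spinH_smul, hn1, one_smul, (hs t).tangent, smul_smul, hmm,
      div_mul_cancel₀ _ (hN t).ne', speed_apply p.immersed', unitTangent, smul_smul,
      mul_inv_cancel₀ (norm_ne_zero_iff.2 (p.immersed t)), one_smul]
    rfl
  refine ⟨Q, ⟨fun t h0 => ?_, ?_⟩, hH, fun t => ?_⟩
  · refine p.immersed t ?_
    rw [← derivₗ_apply, ← hH, h0]
    apply vec3_ext <;> simp [spinH_zero, spinH_one, spinH_two]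
  · have h1 : superpose spinH Q = derivₗ p.curve := SmoothLoop.ext fun t => by
      rw [superpose_apply_univ contDiff_spinH, hH]
    rw [h1, integral_derivₗ]
  · have h1 : q t = v t • (v t)⁻¹ • q t := by rw [smul_smul, mul_inv_cancel₀ (hv0 t), one_smul]
    have hn1 : Complex.normSq (v t) = 1 := by rw [Complex.normSq_eq_norm_sq, hvn, one_pow]
    have h2 : p.framing t = (spinN (q t))⁻¹ • spinK (q t) := by
      rw [(hs t).normal, smul_smul, inv_mul_cancel₀ (hN t).ne', one_smul]
    rw [h2, h1, spinN_smul, spinK_smul, hn1, one_mul, hQ t, spinFrame_smul (hm0 t).ne']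
    rfl

/-- Framed loops of the same parity lie in the same component: both are joined to the framed loop of
one basic spinor, whose coefficients avoid the bad ones of both. -/
theorem mem_connectedComponent_of_hasSpinor {σ : ℝ} (hσ : σ = 1 ∨ σ = -1) {p p' : FramedLoop}
    (hp : p.HasSpinor σ) (hp' : p'.HasSpinor σ) :
    FramedModuli.mk p' ∈ connectedComponent (FramedModuli.mk p) := by
  -- dividing by `e^{ict}` turns paths of spinors with multiplier `σ` into loops
  obtain ⟨c, hc⟩ : ∃ c : ℝ, Complex.exp ((c * 2 : ℝ) * Complex.I) = σ := by
    rcases hσ with rfl | rfl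
    · exact ⟨0, by simp⟩
    · refine ⟨Real.pi / 2, ?_⟩
      rw [div_mul_cancel₀ _ two_ne_zero, Complex.exp_pi_mul_I]
      simp
  have h : Complex.exp ((c * 2 : ℝ) * Complex.I) ^ 2 = 1 := by
    rw [hc]
    rcases hσ with rfl | rfl <;> simp
  obtain ⟨Q, hQ, hγ, hV⟩ := hp.exists_closedSpinor hc h
  obtain ⟨Q', hQ', hγ', hV'⟩ := hp'.exists_closedSpinor hc h
  obtain ⟨x, hx, hx'⟩ := exists_notMem_badCoeffs Q Q'
  have hg := (gramSchmidt_of_closed hQ).1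
  have hg' := (gramSchmidt_of_closed hQ').1
  have hP : basicSpinor x ∈ goodSpinors := by
    have := smul_add_basicSpinor_mem hx 0 one_ne_zero
    rwa [zero_smul, one_smul, zero_add] at this
  rw [mk_goodFramed (hu := norm_phaseLoop h) hQ hg hγ hV,
    mk_goodFramed (hu := norm_phaseLoop h) hQ' hg' hγ' hV',
    ← connectedComponent_eq
      (mem_connectedComponent_of_notMem_badCoeffs _ (norm_phaseLoop h) hg hx hP)]
  exact mem_connectedComponent_of_notMem_badCoeffs _ (norm_phaseLoop h) hg' hx' hP

/-- The connected components of `ℳ` are the two parity classes. -/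
theorem exists_connectedComponent_eq (x : FramedModuli) :
    ∃ σ : ℝ, (σ = 1 ∨ σ = -1) ∧ connectedComponent x = parityClass σ := by
  obtain ⟨p, rfl⟩ := isQuotientMap_framedModuli.surjective x
  obtain ⟨σ, hσ, hp⟩ : ∃ σ : ℝ, (σ = 1 ∨ σ = -1) ∧ p.HasSpinor σ := by
    rcases p.hasSpinor_cases with h | h
    · exact ⟨1, .inl rfl, h⟩
    · exact ⟨-1, .inr rfl, h⟩
  refine ⟨σ, hσ, Subset.antisymm
    ((isClopen_parityClass hσ).connectedComponent_subset (mk_mem_parityClass.2 hp)) ?_⟩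
  rintro _ ⟨p', rfl, hp'⟩
  exact mem_connectedComponent_of_hasSpinor hσ hp hp'

/-! ### Framings with prescribed twist density -/

theorem SmoothLoop.totalₗ_speed_pos {γ : SmoothLoop Vec3} (h : γ.Immersed) : 0 < totalₗ (speed γ) := by
  have hp : ∀ t, 0 < speed γ t := fun t => by
    rw [speed_apply h]
    exact norm_pos_iff.2 (h t)
  exact totalₗ_pos (fun t => (hp t).le) ⟨0, ⟨le_rfl, zero_le_two⟩, hp 0⟩

theorem SmoothLoop.totalₗ_const (c : ℝ) : totalₗ (SmoothLoop.const c) = 2 * c := by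
  rw [totalₗ_apply]
  simp only [SmoothLoop.const_apply]
  rw [intervalIntegral.integral_const, sub_zero, smul_eq_mul]

/-- The twist density of a framed loop depends only on its class in `ℳ`, and the speed only up to a
positive factor. -/
theorem density_eq_of_mk_eq {p q : FramedLoop} (h : FramedModuli.mk p = FramedModuli.mk q) :
    density q.curve q.framing = density p.curve p.framing ∧
      ∃ r : ℝ, 0 < r ∧ speed q.curve = r • speed p.curve := by
  obtain ⟨r, A, b, z, hr, hγ, hV⟩ := FramedModuli.mk_eq_iff.1 h
  have hd : ∀ t, deriv (q.curve : ℝ → Vec3) t = r • rot A (deriv (p.curve : ℝ → Vec3) t) :=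
    fun t => by
      have := derivₗ_of_sim hγ t
      rwa [derivₗ_apply, derivₗ_apply] at this
  refine ⟨SmoothLoop.ext fun t => ?_, r, hr, SmoothLoop.ext fun t => ?_⟩
  · rw [density_apply q.immersed', density_apply p.immersed']
    set φ := 2 * Complex.arg z with hφ
    have hz : ((Circle.exp (φ / 2) : Circle) : ℂ) = z := by
      rw [hφ, mul_div_cancel_left₀ _ two_ne_zero, Circle.exp_arg]
    have hV' : (q.framing : ℝ → Vec3) =
        fun t => rot A (rotField p.curve p.framing (fun _ => φ) t) := funext fun t => by
      rw [hV, rotField_eq_twistVec, hz]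
    have hs : ContDiff ℝ ∞ (rotField p.curve p.framing fun _ => φ) :=
      contDiff_rotField p.curve.contDiff p.immersed p.framing.contDiff contDiff_const
    have h1 := (((hs.differentiable (by simp)) t).hasDerivAt).rot A
    rw [twistDensity, hV', h1.deriv, unitTangent_sim hr A b p.curve.contDiff hγ, cross_rot,
      inner_rot]
    exact (twistDensity_rotField p.curve.contDiff p.immersed p.normal p.framing.contDiff
      (hasDerivAt_const t φ)).trans (zero_add _)
  · rw [SmoothLoop.smul_apply, speed_apply q.immersed', speed_apply p.immersed', hd, norm_smul,
      norm_rot, Real.norm_eq_abs, abs_of_pos hr, smul_eq_mul]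

theorem forgetFraming_mk (p : FramedLoop) :
    forgetFraming (FramedModuli.mk p) = LoopModuli.mk p.base := rfl

/-- A class of framed loops is represented by a framing of any prescribed representative of the
underlying class of loops. -/
theorem FramedLoop.exists_mk_eq_curve {p : FramedLoop} {γ : ImmersedLoop}
    (h : LoopModuli.mk p.base = LoopModuli.mk γ) :
    ∃ p' : FramedLoop, FramedModuli.mk p' = FramedModuli.mk p ∧ p'.curve = γ.1 := by
  obtain ⟨r, A, b, hr, hγ⟩ := LoopModuli.mk_eq_iff.1 h
  have hV : ∀ t, sim 1 A 0 p.framing t = rot A (p.framing t) := fun t => by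
    rw [sim_apply, one_smul, add_zero]
  refine ⟨⟨γ.1, sim 1 A 0 p.framing, γ.2, isUnitNormal_of_sim hγ hV p.normal⟩, ?_, rfl⟩
  refine (FramedModuli.mk_eq_iff.2 ⟨r, A, b, 1, hr, hγ, fun t => ?_⟩).symm
  rw [Circle.coe_one, twistVec_one]
  exact hV t

theorem rotField_periodic (γ V : SmoothLoop Vec3) {θ : ℝ → ℝ} {n : ℤ}
    (h : ∀ t, θ (t + 2) = θ t + 2 * Real.pi * n) : Function.Periodic (rotField γ V θ) 2 := by
  intro t
  have h1 : θ t + 2 * Real.pi * n = θ t + n * (2 * Real.pi) := by ring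
  rw [rotField, rotField, h, h1, Real.cos_add_int_mul_two_pi, Real.sin_add_int_mul_two_pi,
    V.periodic, unitTangent, unitTangent, periodic_deriv γ.periodic]

/-- The twist density of a framing can be changed by any function whose integral is a multiple
of `2π`. -/
theorem FramedLoop.exists_density_eq (p : FramedLoop) (f : SmoothLoop ℝ) {n : ℤ}
    (hf : totalₗ f = 2 * Real.pi * n) : ∃ p' : FramedLoop, p'.curve = p.curve ∧
      density p.curve p'.framing = f + density p.curve p.framing := by
  set θ : ℝ → ℝ := fun t => ∫ s in (0 : ℝ)..t, f s with hθ
  have hθp : ∀ t, θ (t + 2) = θ t + 2 * Real.pi * n := fun t => by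
    rw [← hf]
    exact primitive_add_two f t
  let V : SmoothLoop Vec3 := SmoothLoop.mk (rotField p.curve p.framing θ)
    (contDiff_rotField p.curve.contDiff p.immersed p.framing.contDiff f.contDiff_primitive)
    (rotField_periodic p.curve p.framing hθp)
  refine ⟨⟨p.curve, V, p.immersed, isUnitNormal_rotField p.immersed p.normal θ⟩, rfl,
    SmoothLoop.ext fun t => ?_⟩
  rw [SmoothLoop.add_apply, density_apply p.immersed', density_apply p.immersed']
  exact twistDensity_rotField p.curve.contDiff p.immersed p.normal p.framing.contDiff
    (f.hasDerivAt_primitive t)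

/-- Framings of equal curves with equal twist densities differ by a constant twist. -/
theorem mk_eq_of_density_eq {p q : FramedLoop} (hc : q.curve = p.curve)
    (h : density p.curve q.framing = density p.curve p.framing) :
    FramedModuli.mk p = FramedModuli.mk q := by
  obtain ⟨γ, V, hγ, hV⟩ := p
  obtain ⟨γ', V', hγ', hV'⟩ := q
  obtain rfl : γ' = γ := hc
  simp only at h
  have h0 : ∫ s in (0 : ℝ)..2, (density γ' V' - density γ' V) s = 0 := by
    rw [h, sub_self, ← totalₗ_apply, map_zero]
  obtain ⟨c, hcV⟩ := eq_rotate_of_integral_eq_zero hγ hV' hV h0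
  rw [h, sub_self, map_zero] at hcV
  refine mk_eq_of_rotate (c := 0) hV ?_ hcV
  rw [map_zero, add_zero, rotate_zero hγ]

/-! ### Framings of minimal twist relative to a phase -/

/-- The twist density of `p` is a multiple of the speed plus the constant `κπ/2`, where the
total of the multiple lies in `[0, 4π)`. For `κ = 0` these are the framings of constant
twist rate and total twist in `[0, 2)`; for `κ = 1` they are the images of such anti-framings under
`e^{iπt/4}`. -/
def FramedLoop.IsTwistMin (κ : ℝ) (p : FramedLoop) : Prop :=
  ∃ c : ℝ, density p.curve p.framing = c • speed p.curve + SmoothLoop.const (κ * Real.pi / 2) ∧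
    c * totalₗ (speed p.curve) ∈ Ico 0 (4 * Real.pi)

theorem FramedLoop.IsTwistMin.of_mk_eq {κ : ℝ} {p q : FramedLoop} (hp : p.IsTwistMin κ)
    (h : FramedModuli.mk p = FramedModuli.mk q) : q.IsTwistMin κ := by
  obtain ⟨hd, r, hr, hs⟩ := density_eq_of_mk_eq h
  obtain ⟨c, hc, hcm⟩ := hp
  have h1 : speed p.curve = r⁻¹ • speed q.curve := by
    rw [hs, smul_smul, inv_mul_cancel₀ hr.ne', one_smul]
  refine ⟨c * r⁻¹, by rw [hd, hc, h1, smul_smul], ?_⟩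
  rwa [h1, map_smul, smul_eq_mul, ← mul_assoc] at hcm

theorem abs_lt_of_mem_Ico {a x y : ℝ} (hx : x ∈ Ico 0 a) (hy : y ∈ Ico 0 a) : |x - y| < a :=
  abs_lt.2 ⟨by linarith [hx.1, hy.2], by linarith [hx.2, hy.1]⟩

theorem mk_eq_of_isTwistMin {κ σ : ℝ} (hσ : σ = 1 ∨ σ = -1) {p q : FramedLoop}
    (hp : p.IsTwistMin κ) (hq : q.IsTwistMin κ) (hps : p.HasSpinor σ) (hqs : q.HasSpinor σ)
    (h : LoopModuli.mk p.base = LoopModuli.mk q.base) :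
    FramedModuli.mk p = FramedModuli.mk q := by
  obtain ⟨p', hp', hc⟩ := FramedLoop.exists_mk_eq_curve h
  have hc : p'.curve = q.curve := hc
  rw [← hp']
  replace hp := hp.of_mk_eq hp'.symm
  replace hps := hps.of_mk_eq hp'.symm
  obtain ⟨n, hn⟩ := FramedLoop.exists_int_integral hc.symm
  have hsp := hps.of_integral hc.symm hn
  obtain ⟨c, hd, hm⟩ := hp
  obtain ⟨c', hd', hm'⟩ := hq
  rw [← hc] at hd' hm'
  have hL := totalₗ_speed_pos p'.immersed'
  -- the difference of the total twists is an even integer, of absolute value less than two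
  have hn' : (c' - c) * totalₗ (speed p'.curve) = 2 * Real.pi * n := by
    rw [← hn, ← totalₗ_apply, hd, hd', add_sub_add_right_eq_sub, ← sub_smul, map_smul, smul_eq_mul]
  have hodd : Even n := by
    by_contra h1
    rw [Int.not_even_iff_odd] at h1
    rw [h1.neg_one_zpow, neg_one_mul] at hsp
    rcases hσ with rfl | rfl
    · exact FramedLoop.not_hasSpinor_of_hasSpinor hqs hsp
    · rw [neg_neg] at hsp
      exact FramedLoop.not_hasSpinor_of_hasSpinor hsp hqs
  obtain ⟨m, rfl⟩ := hodd
  have hlt := abs_lt_of_mem_Ico hm' hm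
  rw [← sub_mul, hn'] at hlt
  have h0 : (2 * Real.pi * ((m + m : ℤ) : ℝ)) = 0 := by
    have h1 : (2 * Real.pi * ((m + m : ℤ) : ℝ)) = 2 * (2 * Real.pi * m) := by
      push_cast
      ring
    rw [h1, abs_mul, abs_two] at hlt
    rw [h1, eq_zero_of_abs_lt_two_pi (x := 2 * Real.pi * m) rfl (by linarith), mul_zero]
  have hcc : c' = c := by
    rw [h0] at hn'
    exact sub_eq_zero.1 ((mul_eq_zero.1 hn').resolve_right hL.ne')
  exact mk_eq_of_density_eq hc.symm (by rw [hd, hd', hcc])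

theorem exists_isTwistMin (κ : ℝ) {σ : ℝ} (hσ : σ = 1 ∨ σ = -1) {γ : SmoothLoop Vec3}
    (h : γ.Immersed) : ∃ p : FramedLoop, p.curve = γ ∧ p.HasSpinor σ ∧ p.IsTwistMin κ := by
  obtain ⟨p, rfl, hp⟩ := FramedLoop.exists_hasSpinor_one h
  obtain ⟨e, he⟩ : ∃ e : ℤ, (-1 : ℝ) ^ e = σ := by
    rcases hσ with rfl | rfl
    · exact ⟨0, zpow_zero _⟩
    · exact ⟨1, zpow_one _⟩
  have hL := totalₗ_speed_pos h
  set L := totalₗ (speed p.curve) with hLdef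
  set D := totalₗ (density p.curve p.framing) with hD
  have hpi : (0 : ℝ) < 4 * Real.pi := by positivity
  obtain ⟨m, hm, -⟩ := existsUnique_add_zsmul_mem_Ico hpi (2 * Real.pi * e + D - κ * Real.pi) 0
  rw [zero_add, zsmul_eq_mul] at hm
  set x := 2 * Real.pi * e + D - κ * Real.pi + m * (4 * Real.pi) with hx
  set f : SmoothLoop ℝ := (x / L) • speed p.curve + SmoothLoop.const (κ * Real.pi / 2) -
    density p.curve p.framing with hf
  have hft : totalₗ f = 2 * Real.pi * ((e + 2 * m : ℤ) : ℝ) := by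
    rw [hf, map_sub, map_add, map_smul, totalₗ_const, ← hLdef, ← hD, smul_eq_mul,
      div_mul_cancel₀ _ hL.ne', hx]
    push_cast
    ring
  obtain ⟨p', hc, hd⟩ := p.exists_density_eq f hft
  refine ⟨p', hc, ?_, x / L, ?_, ?_⟩
  · have h1 := hp.of_integral hc (n := e + 2 * m) (by rw [hd, add_sub_cancel_right]; exact hft)
    rwa [zpow_add₀ (by norm_num), zpow_mul, mul_one, he, show (-1 : ℝ) ^ (2 : ℤ) = 1 by norm_num,
      one_zpow, mul_one] at h1
  · rw [hc, hd, hf, sub_add_cancel]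
  · rw [hc, ← hLdef, div_mul_cancel₀ _ hL.ne']
    exact hm

/-- The classes of loops without a framing of constant twist density `κπ/2`. -/
def noConstDensity (κ : ℝ) : Set LoopModuli :=
  {b | ¬ ∃ p : FramedLoop, LoopModuli.mk p.base = b ∧
    density p.curve p.framing = SmoothLoop.const (κ * Real.pi / 2)}

theorem mem_noConstDensity_iff {κ : ℝ} (p : FramedLoop) :
    LoopModuli.mk p.base ∈ noConstDensity κ ↔
      ∀ n : ℤ, totalₗ (density p.curve p.framing) - κ * Real.pi ≠ 2 * Real.pi * n := by
  rw [noConstDensity, mem_ofPred_eq, ← not_exists, not_iff_not]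
  constructor
  · rintro ⟨q, hq, hd⟩
    obtain ⟨q', hq', hc⟩ := FramedLoop.exists_mk_eq_curve hq
    have hc : p.curve = q'.curve := hc.symm
    obtain ⟨n, hn⟩ := FramedLoop.exists_int_integral hc
    refine ⟨n, ?_⟩
    rw [(density_eq_of_mk_eq hq').1] at hd
    rw [← hn, ← totalₗ_apply, map_sub, hd, totalₗ_const, hc]
    ring
  · rintro ⟨n, hn⟩
    obtain ⟨p', hc, hd⟩ := p.exists_density_eq
      (SmoothLoop.const (κ * Real.pi / 2) - density p.curve p.framing) (n := -n) (by
        rw [map_sub, totalₗ_const]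
        push_cast
        linarith)
    refine ⟨p', congrArg LoopModuli.mk (Subtype.ext hc), ?_⟩
    rw [hc, hd, sub_add_cancel]

theorem noConstDensity_union : noConstDensity 0 ∪ noConstDensity 1 = univ := by
  refine eq_univ_of_forall fun b => ?_
  obtain ⟨γ, rfl⟩ := isQuotientMap_loopModuli.surjective b
  obtain ⟨p, hp, -⟩ := FramedLoop.exists_hasSpinor_one γ.2
  obtain rfl : p.base = γ := Subtype.ext hp
  by_contra h
  simp only [mem_union, mem_noConstDensity_iff, not_or, not_forall, not_not] at h
  obtain ⟨⟨n, hn⟩, m, hm⟩ := h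
  have h1 : Real.pi * (1 - 2 * (n - m)) = 0 := by linarith
  have h2 := (mul_eq_zero.1 h1).resolve_left Real.pi_ne_zero
  have h3 : (1 - 2 * (n - m) : ℤ) = 0 := by exact_mod_cast h2
  omega

/-! ### Smoothness of the sections -/

/-- The difference from `g` of the multiple of `s` with the same total as `g`, integrated. -/
noncomputable def balance (g s : SmoothLoop ℝ) : SmoothLoop ℝ :=
  primₗ (superpose (fun p : ℝ × ℝ × ℝ => p.1 / p.2.1 * p.2.2)
    (pair (integralₗ g) (pair (integralₗ s) s)) - g)

theorem isOpen_snd_fst_ne : IsOpen {p : ℝ × ℝ × ℝ | p.2.1 ≠ 0} :=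
  isOpen_ne_fun (continuous_fst.comp continuous_snd) continuous_const

theorem contDiffOn_balance :
    ContDiffOn ℝ ∞ (fun p : ℝ × ℝ × ℝ => p.1 / p.2.1 * p.2.2) {p | p.2.1 ≠ 0} :=
  (contDiff_fst.contDiffOn.div contDiff_snd.fst.contDiffOn fun _ h => h).mul
    contDiff_snd.snd.contDiffOn

theorem pair_mem_of_totalₗ_ne {g s : SmoothLoop ℝ} (h : totalₗ s ≠ 0) :
    pair (integralₗ g) (pair (integralₗ s) s) ∈ valuedIn {p : ℝ × ℝ × ℝ | p.2.1 ≠ 0} := fun _ => h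

theorem balance_eq {g s : SmoothLoop ℝ} (h : totalₗ s ≠ 0) :
    balance g s = primₗ ((totalₗ g / totalₗ s) • s - g) := by
  rw [balance]
  congr 2
  refine SmoothLoop.ext fun t => ?_
  rw [superpose_apply isOpen_snd_fst_ne contDiffOn_balance (pair_mem_of_totalₗ_ne h)]
  rfl

theorem derivₗ_balance {g s : SmoothLoop ℝ} (h : totalₗ s ≠ 0) :
    derivₗ (balance g s) = (totalₗ g / totalₗ s) • s - g := by
  refine SmoothLoop.ext fun t => ?_
  rw [balance_eq h]
  refine derivₗ_primₗ_apply _ ?_ t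
  rw [← totalₗ_apply, map_sub, map_smul, smul_eq_mul, div_mul_cancel₀ _ h, sub_self]

theorem FrechetSmoothOn.balance {E : Type} [AddCommGroup E] [Module ℝ E] [TopologicalSpace E]
    [IsFrechetSpace E] {W : Set E} {g s : E → SmoothLoop ℝ} (hg : FrechetSmoothOn g W)
    (hs : FrechetSmoothOn s W) (h : ∀ x ∈ W, totalₗ (s x) ≠ 0) :
    FrechetSmoothOn (fun x => balance (g x) (s x)) W :=
  (((hg.integralₗ.pair (hs.integralₗ.pair hs)).superpose isOpen_snd_fst_ne contDiffOn_balance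
    fun x hx => pair_mem_of_totalₗ_ne (h x hx)).sub hg).primₗ

/-- The twist density of the framing induced by `V₀`, relative to the phase `κ`. -/
noncomputable def phaseDensity (κ : ℝ) (V₀ γ : SmoothLoop Vec3) : SmoothLoop ℝ :=
  density γ (normalPart γ V₀) - SmoothLoop.const (κ * Real.pi / 2)

/-- The framing of twist density a multiple of the speed plus `κπ/2`, obtained by rotating the
framing induced by `V₀`. -/
noncomputable def balancedField (κ : ℝ) (V₀ γ : SmoothLoop Vec3) : SmoothLoop Vec3 :=
  rotate γ (normalPart γ V₀) (balance (phaseDensity κ V₀ γ) (speed γ))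

section Balanced

variable {κ : ℝ} {V₀ γ : SmoothLoop Vec3}

theorem frechetSmoothOn_phaseDensity (κ : ℝ) (V₀ : SmoothLoop Vec3) :
    FrechetSmoothOn (phaseDensity κ V₀) {γ | Transverse γ V₀} :=
  ((FrechetSmoothOn.id _).density ((FrechetSmoothOn.id _).normalPart (FrechetSmoothOn.const V₀ _)
    fun _ h => h) fun _ h => Transverse.immersed h).sub (FrechetSmoothOn.const _ _)

theorem frechetSmoothOn_balancedField (κ : ℝ) (V₀ : SmoothLoop Vec3) :
    FrechetSmoothOn (balancedField κ V₀) {γ | Transverse γ V₀} :=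
  (FrechetSmoothOn.id _).rotate ((FrechetSmoothOn.id _).normalPart (FrechetSmoothOn.const V₀ _)
    fun _ h => h) ((frechetSmoothOn_phaseDensity κ V₀).balance
      ((FrechetSmoothOn.id _).speed fun _ h => h.immersed)
      fun _ h => (totalₗ_speed_pos h.immersed).ne') fun _ h => h.immersed

theorem isUnitNormal_balancedField (h : Transverse γ V₀) :
    IsUnitNormal γ (balancedField κ V₀ γ) :=
  isUnitNormal_rotate h.immersed (isUnitNormal_normalPart h) _

theorem density_balancedField (h : Transverse γ V₀) : density γ (balancedField κ V₀ γ) =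
    (totalₗ (phaseDensity κ V₀ γ) / totalₗ (speed γ)) • speed γ +
      SmoothLoop.const (κ * Real.pi / 2) := by
  rw [balancedField, density_rotate h.immersed (isUnitNormal_normalPart h),
    derivₗ_balance (totalₗ_speed_pos h.immersed).ne', phaseDensity]
  abel

theorem balancedField_of_isTwistMin {p : FramedLoop} (h : p.IsTwistMin κ) :
    balancedField κ p.framing p.curve = p.framing := by
  obtain ⟨c, hc, -⟩ := h
  have hL := (totalₗ_speed_pos p.immersed').ne'
  have h1 : phaseDensity κ p.framing p.curve = c • speed p.curve := by
    rw [phaseDensity, normalPart_of_isUnitNormal p.immersed' p.normal, hc, add_sub_cancel_right]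
  rw [balancedField, h1, balance_eq hL, map_smul, smul_eq_mul, mul_div_cancel_right₀ _ hL, sub_self,
    map_zero, rotate_zero p.immersed', normalPart_of_isUnitNormal p.immersed' p.normal]

theorem isOpen_transverse_fst (V₀ : SmoothLoop Vec3) : IsOpen {γ | Transverse γ V₀} :=
  isOpen_transverse.preimage (continuous_id.prodMk continuous_const)

end Balanced

theorem isOpen_noConstDensity (κ : ℝ) : IsOpen (noConstDensity κ) := by
  rw [← isQuotientMap_loopModuli.isOpen_preimage, isOpen_iff_mem_nhds]
  intro γ hγ
  obtain ⟨p, hp, -⟩ := FramedLoop.exists_hasSpinor_one γ.2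
  obtain rfl : p.base = γ := Subtype.ext hp
  set N : Set ℝ := {x | ∀ n : ℤ, x ≠ 2 * Real.pi * n} with hN
  have hNo : IsOpen N := by
    have h1 : N = (fun x => x / (2 * Real.pi)) ⁻¹' (range ((↑) : ℤ → ℝ))ᶜ := by
      ext x
      simp only [hN, mem_ofPred_eq, mem_preimage, mem_compl_iff, mem_range, not_exists]
      refine forall_congr' fun n => not_congr ?_
      rw [eq_div_iff (by positivity), eq_comm, mul_comm]
    rw [h1]
    exact Int.isClosedEmbedding_coe_real.isClosed_range.isOpen_compl.preimage
      (continuous_id.div_const _)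
  have hc := continuous_totalₗ.comp_continuousOn (frechetSmoothOn_phaseDensity κ p.framing).continuousOn
  have ho := hc.isOpen_inter_preimage (isOpen_transverse_fst p.framing) hNo
  have hmem : ∀ γ' : ImmersedLoop, Transverse γ'.1 p.framing →
      (γ'.1 ∈ totalₗ ∘ phaseDensity κ p.framing ⁻¹' N ↔ LoopModuli.mk γ' ∈ noConstDensity κ) := by
    intro γ' h'
    refine Iff.trans ?_ (mem_noConstDensity_iff
      ⟨γ'.1, normalPart γ'.1 p.framing, γ'.2, isUnitNormal_normalPart h'⟩).symm
    have h1 : totalₗ (phaseDensity κ p.framing γ'.1) =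
        totalₗ (density γ'.1 (normalPart γ'.1 p.framing)) - κ * Real.pi := by
      rw [phaseDensity, map_sub, totalₗ_const]
      ring
    rw [mem_preimage, Function.comp_apply, h1]
    rfl
  refine mem_of_superset ((ho.preimage continuous_subtype_val).mem_nhds (x := p.base) ⟨?_, ?_⟩) ?_
  · exact transverse_of_isUnitNormal p.immersed' p.normal
  · exact (hmem p.base (transverse_of_isUnitNormal p.immersed' p.normal)).2 hγ
  · exact fun γ' h' => (hmem γ' h'.1).1 h'.2

/-- For `b` in `ℬ`, the point of the parity class `σ` over `b` of minimal twist relative to `κ`. -/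
theorem exists_twistSection (κ : ℝ) {σ : ℝ} (hσ : σ = 1 ∨ σ = -1) (b : LoopModuli) :
    ∃ m ∈ parityClass σ, forgetFraming m = b ∧ ∃ p, FramedModuli.mk p = m ∧ p.IsTwistMin κ := by
  obtain ⟨γ, rfl⟩ := isQuotientMap_loopModuli.surjective b
  obtain ⟨p, hp, hs, hm⟩ := exists_isTwistMin κ hσ γ.2
  exact ⟨_, mk_mem_parityClass.2 hs, congrArg LoopModuli.mk (Subtype.ext hp), p, rfl, hm⟩

/-- The section of minimal twist. -/
noncomputable def twistSection (κ : ℝ) {σ : ℝ} (hσ : σ = 1 ∨ σ = -1) (b : LoopModuli) :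
    FramedModuli := (exists_twistSection κ hσ b).choose

theorem eq_twistSection_iff (κ : ℝ) {σ : ℝ} (hσ : σ = 1 ∨ σ = -1) (b : LoopModuli)
    (m : FramedModuli) : m = twistSection κ hσ b ↔ m ∈ parityClass σ ∧ forgetFraming m = b ∧
      ∃ p, FramedModuli.mk p = m ∧ p.IsTwistMin κ := by
  have hs : twistSection κ hσ b ∈ parityClass σ ∧ forgetFraming (twistSection κ hσ b) = b ∧
    ∃ p, FramedModuli.mk p = twistSection κ hσ b ∧ p.IsTwistMin κ :=
    (exists_twistSection κ hσ b).choose_spec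
  constructor
  · rintro rfl
    exact hs
  · rintro ⟨h1, h2, p, hp, hpm⟩
    obtain ⟨h1', h2', q, hq, hqm⟩ := hs
    rw [← hp] at h1 h2 ⊢
    rw [← hq] at h1' h2' ⊢
    exact mk_eq_of_isTwistMin hσ hpm hqm (mk_mem_parityClass.1 h1) (mk_mem_parityClass.1 h1')
      (h2.trans h2'.symm)

theorem twistSection_mem (κ : ℝ) {σ : ℝ} (hσ : σ = 1 ∨ σ = -1) (b : LoopModuli) :
    twistSection κ hσ b ∈ parityClass σ := ((eq_twistSection_iff κ hσ b _).1 rfl).1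

theorem forgetFraming_twistSection (κ : ℝ) {σ : ℝ} (hσ : σ = 1 ∨ σ = -1) (b : LoopModuli) :
    forgetFraming (twistSection κ hσ b) = b := ((eq_twistSection_iff κ hσ b _).1 rfl).2.1

/-- Near each loop of `noConstDensity κ`, the section of minimal twist lifts to a smooth field of
framings. -/
theorem exists_lift_twistSection (κ : ℝ) {σ : ℝ} (hσ : σ = 1 ∨ σ = -1) (γ : ImmersedLoop)
    (hγ : LoopModuli.mk γ ∈ noConstDensity κ) : ∃ W : Set (SmoothLoop Vec3), IsOpen W ∧ γ.1 ∈ W ∧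
      ∃ F : SmoothLoop Vec3 → SmoothLoop Vec3, FrechetSmoothOn F W ∧
        ∀ γ' : ImmersedLoop, γ'.1 ∈ W → ∃ hF : IsUnitNormal γ'.1 (F γ'.1),
          FramedModuli.mk ⟨γ'.1, F γ'.1, γ'.2, hF⟩ = twistSection κ hσ (LoopModuli.mk γ') := by
  obtain ⟨p, hp, hs, hm⟩ := exists_isTwistMin κ hσ γ.2
  obtain rfl : p.base = γ := Subtype.ext hp
  set V₀ := p.framing with hV₀
  obtain ⟨O, hO, hOs⟩ := isInducing_incl.isOpen_iff.1 (FramedLoop.isOpen_hasSpinor σ)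
  have ht : Transverse p.curve V₀ := transverse_of_isUnitNormal p.immersed' p.normal
  set S := {γ | Transverse γ V₀} with hS
  have hSo : IsOpen S := isOpen_transverse_fst V₀
  have hsm := frechetSmoothOn_balancedField κ V₀
  have hc1 : ContinuousOn (fun γ => (γ, balancedField κ V₀ γ)) S :=
    continuousOn_id.prodMk hsm.continuousOn
  have hc2 : ContinuousOn (fun γ => totalₗ (phaseDensity κ V₀ γ)) S :=
    continuous_totalₗ.comp_continuousOn (frechetSmoothOn_phaseDensity κ V₀).continuousOn
  have h1 := hc1.isOpen_inter_preimage hSo hO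
  have h2 := hc2.isOpen_inter_preimage hSo (isOpen_Ioo (a := (0 : ℝ)) (b := 4 * Real.pi))
  refine ⟨_, h1.inter h2, ⟨⟨ht, ?_⟩, ht, ?_⟩, balancedField κ V₀,
    hsm.mono fun _ h => h.1.1, fun γ' h' => ?_⟩
  · rw [mem_preimage]
    change (p.curve, balancedField κ V₀ p.curve) ∈ O
    rw [balancedField_of_isTwistMin hm]
    change p ∈ FramedLoop.incl ⁻¹' O
    rw [hOs]
    exact hs
  · obtain ⟨c, hc, hcm⟩ := hm
    have h3 : totalₗ (phaseDensity κ V₀ p.curve) = c * totalₗ (speed p.curve) := by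
      rw [phaseDensity, normalPart_of_isUnitNormal p.immersed' p.normal, hc, add_sub_cancel_right,
        map_smul, smul_eq_mul]
    change totalₗ (phaseDensity κ V₀ p.curve) ∈ Ioo 0 (4 * Real.pi)
    rw [h3]
    refine ⟨hcm.1.lt_of_ne fun h0 => hγ ⟨p, rfl, ?_⟩, hcm.2⟩
    have h4 : c = 0 := (mul_eq_zero.1 h0.symm).resolve_right (totalₗ_speed_pos p.immersed').ne'
    rw [hc, h4, zero_smul, zero_add]
  · have hF := isUnitNormal_balancedField (κ := κ) h'.1.1
    refine ⟨hF, (eq_twistSection_iff κ hσ _ _).2 ⟨?_, rfl, _, rfl, _, density_balancedField h'.1.1,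
      ?_⟩⟩
    · rw [mk_mem_parityClass]
      change (_ : FramedLoop) ∈ {p : FramedLoop | p.HasSpinor σ}
      rw [← hOs]
      exact h'.1.2
    · rw [div_mul_cancel₀ _ (totalₗ_speed_pos h'.1.1.immersed).ne']
      exact Ioo_subset_Ico_self h'.2.2

theorem smoothOn_twistSection (κ : ℝ) {σ : ℝ} (hσ : σ = 1 ∨ σ = -1) :
    loopManifold.SmoothOn framedManifold (twistSection κ hσ) (noConstDensity κ) := by
  refine smoothOn_of_lift isQuotientManifold_loop isQuotientManifold_framed
    isInducing_immersedLoop.continuous isInducing_incl isQuotientMap_loopModuli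
    isQuotientMap_framedModuli.continuous (isOpen_noConstDensity κ) fun γ hγ => ?_
  obtain ⟨W, hW, hγW, F, hF, hl⟩ := exists_lift_twistSection κ hσ γ hγ
  refine ⟨W, hW, hγW, fun γ => (γ, F γ), (FrechetSmoothOn.id _).prodMk hF, fun γ' h' _ => ?_⟩
  obtain ⟨h1, h2⟩ := hl γ' h'
  exact ⟨_, rfl, h2⟩

/-! ### Constant twist framings and anti-framings -/

theorem isConstantTwistMinimizing_iff {γ : SmoothLoop Vec3} (h : γ.Immersed) (V : ℝ → Vec3) :
    IsConstantTwistMinimizing γ V ↔ ∃ c : ℝ, (∀ t, twistDensity γ V t = c * speed γ t) ∧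
      c * totalₗ (speed γ) ∈ Ico 0 (4 * Real.pi) := by
  have h0 : ∀ t, speed γ t ≠ 0 := fun t => by
    rw [speed_apply h]
    exact norm_ne_zero_iff.2 (h t)
  have h1 : ∀ t c, twistRate γ V t = c ↔ twistDensity γ V t = c * speed γ t := fun t c => by
    rw [← twistRate_mul_speed (h t), ← speed_apply h]
    exact (mul_left_inj' (h0 t)).symm
  have h2 : ∀ c, (∀ t, twistDensity γ V t = c * speed γ t) →
      (totalTwist γ V ∈ Ico 0 2 ↔ c * totalₗ (speed γ) ∈ Ico 0 (4 * Real.pi)) := fun c hc => by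
    have h3 : totalTwist γ V = c * totalₗ (speed γ) / (2 * Real.pi) := by
      rw [totalTwist_eq h, totalₗ_apply, ← intervalIntegral.integral_const_mul c,
        one_div_mul_eq_div]
      simp only [hc]
    rw [h3, mem_Ico, mem_Ico, div_lt_iff₀ (by positivity), le_div_iff₀ (by positivity), zero_mul,
      show 2 * (2 * Real.pi) = 4 * Real.pi by ring]
  rw [IsConstantTwistMinimizing]
  constructor
  · rintro ⟨⟨c, hc⟩, ht⟩
    have hc' := fun t => (h1 t c).1 (hc t)
    exact ⟨c, hc', (h2 c hc').1 ht⟩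
  · rintro ⟨c, hc, ht⟩
    exact ⟨⟨c, fun t => (h1 t c).2 (hc t)⟩, (h2 c hc).2 ht⟩

theorem twistRate_eq_zero_iff {γ V : ℝ → Vec3} {t : ℝ} (h : deriv γ t ≠ 0) :
    twistRate γ V t = 0 ↔ twistDensity γ V t = 0 := by
  rw [← twistRate_mul_speed h, mul_eq_zero, or_iff_left (norm_ne_zero_iff.2 h)]

theorem AntiFramedLoop.immersed' (p : AntiFramedLoop) : p.curve.Immersed := p.immersed

theorem AntiFramedLoop.toFramedLoop_framing (p : AntiFramedLoop) :
    (p.toFramedLoop.framing : ℝ → Vec3) =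
      rotField p.curve p.framing fun t => Real.pi / 2 * t := by
  funext t
  rw [rotField_eq_twistVec, show Real.pi / 2 * t / 2 = Real.pi * t / 4 by ring]
  rfl

theorem AntiFramedLoop.density_toFramedLoop (p : AntiFramedLoop) (t : ℝ) :
    density p.curve p.toFramedLoop.framing t =
      Real.pi / 2 + twistDensity p.curve p.framing t := by
  rw [density_apply p.immersed', p.toFramedLoop_framing]
  refine twistDensity_rotField p.curve.contDiff p.immersed p.normal p.smooth ?_
  simpa using (hasDerivAt_id t).const_mul (Real.pi / 2)

/-- Every framed loop is the image under `e^{iπt/4}` of an anti-framed loop. -/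
theorem FramedLoop.exists_toFramedLoop_eq (p : FramedLoop) :
    ∃ q : AntiFramedLoop, q.toFramedLoop = p := by
  have hθ : ContDiff ℝ ∞ fun t : ℝ => -(Real.pi / 2 * t) := (contDiff_const.mul contDiff_id).neg
  refine ⟨⟨p.curve, rotField p.curve p.framing fun t => -(Real.pi / 2 * t),
    contDiff_rotField p.curve.contDiff p.immersed p.framing.contDiff hθ, fun t => ?_, p.immersed,
    isUnitNormal_rotField p.immersed p.normal _⟩, FramedLoop.ext rfl (SmoothLoop.ext fun t => ?_)⟩
  · have h1 : -(Real.pi / 2 * (t + 2)) = -(Real.pi / 2 * t) - Real.pi := by ring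
    rw [rotField, rotField, h1, Real.cos_sub_pi, Real.sin_sub_pi, p.framing.periodic, unitTangent,
      unitTangent, periodic_deriv p.curve.periodic, neg_smul, neg_smul, neg_add]
  · rw [AntiFramedLoop.toFramedLoop_framing]
    simp only
    rw [rotField_rotField p.immersed p.normal]
    simp only [add_neg_cancel]
    rw [rotField, Real.cos_zero, Real.sin_zero, one_smul, zero_smul, add_zero]

theorem isCTMF_iff (m : FramedModuli) :
    IsCTMF m ↔ ∃ p, FramedModuli.mk p = m ∧ p.IsTwistMin 0 := by
  refine exists_congr fun p => and_congr_right fun _ => ?_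
  rw [isConstantTwistMinimizing_iff p.immersed']
  refine exists_congr fun c => and_congr_left fun _ => ?_
  rw [zero_mul, zero_div, map_zero, add_zero]
  constructor
  · intro h
    refine SmoothLoop.ext fun t => ?_
    rw [density_apply p.immersed', SmoothLoop.smul_apply, h, smul_eq_mul]
  · intro h t
    rw [← density_apply p.immersed', h, SmoothLoop.smul_apply, smul_eq_mul]

theorem isAntiCTMF_iff (m : FramedModuli) :
    IsAntiCTMF m ↔ ∃ p, FramedModuli.mk p = m ∧ p.IsTwistMin 1 := by
  have h1 : ∀ q : AntiFramedLoop,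
      IsConstantTwistMinimizing q.curve q.framing ↔ q.toFramedLoop.IsTwistMin 1 := fun q => by
    rw [isConstantTwistMinimizing_iff q.immersed']
    refine exists_congr fun c => and_congr_left fun _ => ?_
    change _ ↔ density q.curve q.toFramedLoop.framing = c • speed q.curve + _
    rw [one_mul]
    constructor
    · intro h
      refine SmoothLoop.ext fun t => ?_
      rw [q.density_toFramedLoop, SmoothLoop.add_apply, SmoothLoop.smul_apply, h, smul_eq_mul,
        SmoothLoop.const_apply, add_comm]
    · intro h t
      have h2 := q.density_toFramedLoop t
      rw [h, SmoothLoop.add_apply, SmoothLoop.smul_apply, smul_eq_mul,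
        SmoothLoop.const_apply] at h2
      linarith
  constructor
  · rintro ⟨q, hq, h⟩
    exact ⟨_, hq, (h1 q).1 h⟩
  · rintro ⟨p, hp, h⟩
    obtain ⟨q, rfl⟩ := p.exists_toFramedLoop_eq
    exact ⟨q, hp, (h1 q).2 h⟩

theorem noClosedBishop_eq : noClosedBishop = noConstDensity 0 := by
  refine Set.ext fun b => not_congr (exists_congr fun p => and_congr_right fun _ => ?_)
  rw [zero_mul, zero_div, map_zero]
  constructor
  · intro h
    refine SmoothLoop.ext fun t => ?_
    rw [density_apply p.immersed']
    exact (twistRate_eq_zero_iff (p.immersed t)).1 (h t)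
  · intro h t
    rw [twistRate_eq_zero_iff (p.immersed t), ← density_apply p.immersed', h]
    rfl

theorem noAntiBishop_eq : noAntiBishop = noConstDensity 1 := by
  have h1 : ∀ q : AntiFramedLoop, (∀ t, twistRate q.curve q.framing t = 0) ↔
      density q.curve q.toFramedLoop.framing = SmoothLoop.const (1 * Real.pi / 2) := fun q => by
    rw [one_mul]
    constructor
    · intro h
      refine SmoothLoop.ext fun t => ?_
      rw [q.density_toFramedLoop, (twistRate_eq_zero_iff (q.immersed t)).1 (h t), add_zero,
        SmoothLoop.const_apply]
    · intro h t
      have h2 := q.density_toFramedLoop t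
      rw [h, SmoothLoop.const_apply] at h2
      exact (twistRate_eq_zero_iff (q.immersed t)).2 (by linarith)
  refine Set.ext fun b => not_congr ?_
  constructor
  · rintro ⟨q, hq, h⟩
    exact ⟨q.toFramedLoop, hq, (h1 q).1 h⟩
  · rintro ⟨p, hp, h⟩
    obtain ⟨q, rfl⟩ := p.exists_toFramedLoop_eq
    exact ⟨q, hp, (h1 q).2 h⟩

/-! ### The frame twisting action -/

theorem isFrechetLieGroup_groupManifold : IsFrechetLieGroup groupManifold where
  smooth_mul := by
    refine smoothOn₂_of_lift isQuotientManifold_group isQuotientManifold_group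
      isQuotientManifold_group isInducing_toLoop.continuous isInducing_toLoop.continuous
      isInducing_toLoop isOpenQuotientMap_group isOpenQuotientMap_group
      isOpenQuotientMap_group.continuous isOpen_univ isOpen_univ fun u v _ _ => ?_
    exact ⟨univ, isOpen_univ, trivial, fun f => SmoothLoop.mul f.1 f.2,
      (FrechetSmoothOn.id _).fst.mul (FrechetSmoothOn.id _).snd,
      fun u v _ _ _ => ⟨u * v, LoopGroup.toLoop_mul u v, rfl⟩⟩
  smooth_inv := by
    refine smoothOn_of_lift isQuotientManifold_group isQuotientManifold_group
      isInducing_toLoop.continuous isInducing_toLoop isQuotientMap_basedLoopGroup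
      isOpenQuotientMap_group.continuous isOpen_univ fun u _ => ?_
    exact ⟨univ, isOpen_univ, trivial, SmoothLoop.conj, (FrechetSmoothOn.id _).conj,
      fun u _ _ => ⟨u⁻¹, LoopGroup.toLoop_inv u, rfl⟩⟩

theorem FramedLoop.incl_smul (u : LoopGroup) (p : FramedLoop) :
    (u • p).incl = (p.curve, twist p.curve p.framing u.toLoop) := by
  refine Prod.ext rfl (SmoothLoop.ext fun t => ?_)
  rw [twist_apply p.immersed']
  rfl

/-- Frame twisting by a loop in the circle preserves the parity: the spinors are multiplied by the
loop. -/
theorem FramedLoop.HasSpinor.smul {σ : ℝ} {p : FramedLoop} (h : p.HasSpinor σ) (u : LoopGroup) :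
    (u • p).HasSpinor σ := by
  obtain ⟨q, hq, hσ, hs⟩ := h
  refine ⟨fun t => (u t : ℂ) • q t, u.2.1.smul hq, fun t => ?_, fun t => ?_⟩
  · simp only
    rw [hσ, u.periodic, smul_comm]
  · exact (hs t).smul (Circle.norm_coe _)

theorem smul_mem_parityClass {σ : ℝ} (g : BasedLoopGroup) {x : FramedModuli}
    (h : x ∈ parityClass σ) : g • x ∈ parityClass σ := by
  obtain ⟨u, rfl⟩ := isQuotientMap_basedLoopGroup.surjective g
  obtain ⟨p, rfl⟩ := isQuotientMap_framedModuli.surjective x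
  exact mk_mem_parityClass.2 ((mk_mem_parityClass.1 h).smul u)

theorem forgetFraming_smul (g : BasedLoopGroup) (x : FramedModuli) :
    forgetFraming (g • x) = forgetFraming x := by
  obtain ⟨u, rfl⟩ := isQuotientMap_basedLoopGroup.surjective g
  obtain ⟨p, rfl⟩ := isQuotientMap_framedModuli.surjective x
  rfl

theorem smoothOn_smul {X : Set FramedModuli} (hX : IsOpen X) :
    groupManifold.SmoothOn₂ framedManifold framedManifold (fun g x => g • x) univ X := by
  refine smoothOn₂_of_lift isQuotientManifold_group isQuotientManifold_framed
    isQuotientManifold_framed isInducing_toLoop.continuous isInducing_incl.continuous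
    isInducing_incl isOpenQuotientMap_group isOpenQuotientMap_framed
    isOpenQuotientMap_framed.continuous isOpen_univ hX fun u p _ _ => ?_
  refine ⟨{x | x.2.1.Immersed}, isOpen_immersed.preimage (continuous_fst.comp continuous_snd),
    p.immersed', fun x => (x.2.1, twist x.2.1 x.2.2 x.1), ?_,
    fun u p _ _ _ => ⟨u • p, FramedLoop.incl_smul u p, rfl⟩⟩
  exact (FrechetSmoothOn.id _).snd.fst.prodMk ((FrechetSmoothOn.id _).snd.fst.twist
    (FrechetSmoothOn.id _).snd.snd (FrechetSmoothOn.id _).fst fun _ h => h)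

theorem smoothOn_forgetFraming {X : Set FramedModuli} (hX : IsOpen X) :
    framedManifold.SmoothOn loopManifold forgetFraming X :=
  smoothOn_of_lift isQuotientManifold_framed isQuotientManifold_loop isInducing_incl.continuous
    isInducing_immersedLoop isQuotientMap_framedModuli isOpenQuotientMap_loop.continuous hX
    fun _ _ => ⟨univ, isOpen_univ, trivial, Prod.fst, (FrechetSmoothOn.id _).fst,
      fun p _ _ => ⟨p.base, rfl, rfl⟩⟩

/-- A similarity which fixes a closed curve pointwise has trivial rotation part. -/
theorem rot_eq_self_of_sim {γ : SmoothLoop Vec3} (hγ : γ.Immersed) {r : ℝ} (hr : 0 < r) {A : SO3}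
    {b : Vec3} (h : ∀ t, γ t = r • rot A (γ t) + b) (x : Vec3) : rot A x = x := by
  obtain ⟨t₁, ht⟩ := hγ.exists_spread
  obtain ⟨B, hB⟩ := exists_frameCoords_eq_rot ht
  refine rot_injective B ?_
  rw [← hB, ← hB, ← frameCoords_sim hr A x, ← derivₗ_of_sim h, ← derivₗ_of_sim h]

theorem sq_eq_one_of_twistVec_eq {T V : Vec3} (hT : ‖T‖ = 1) (hV : ‖V‖ = 1)
    (hVT : inner ℝ V T = 0) {z : ℂ} (h : twistVec T V z = V) : z ^ 2 = 1 := by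
  have h1 := congrArg (fun x => inner ℝ x V) h
  have h2 := congrArg (fun x => inner ℝ x (cross T V)) h
  simp only [twistVec, inner_add_left, inner_smul_left, conj_trivial, inner_cross_right,
    real_inner_comm (cross T V) V, real_inner_self_eq_norm_sq, norm_cross_of_orthogonal hVT, hT,
    hV] at h1 h2
  refine Complex.ext ?_ ?_
  · rw [Complex.one_re]
    linarith
  · rw [Complex.one_im]
    linarith

theorem LoopGroup.const_of_sq {u : LoopGroup} {z : ℂ} (h : ∀ t, (u t : ℂ) ^ 2 = z) :
    ∃ w : Circle, ∀ t, u t = w := by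
  have hd : ∀ t, derivₗ u.toLoop t = 0 := fun t => by
    have h1 := (u.toLoop.hasDerivAt t).pow 2
    have h2 : (u.toLoop : ℝ → ℂ) ^ 2 = fun _ => z := funext h
    have h3 := h1.unique (h2 ▸ hasDerivAt_const t z)
    simpa [LoopGroup.toLoop_apply] using h3
  refine ⟨u 0, fun t => Circle.ext ?_⟩
  exact is_const_of_deriv_eq_zero u.toLoop.differentiable hd t 0

theorem eq_one_of_smul_eq {g : BasedLoopGroup} {x : FramedModuli} (h : g • x = x) : g = 1 := by
  obtain ⟨u, rfl⟩ := isQuotientMap_basedLoopGroup.surjective g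
  obtain ⟨p, rfl⟩ := isQuotientMap_framedModuli.surjective x
  obtain ⟨r, A, b, z, hr, hγ, hV⟩ := FramedModuli.mk_eq_iff.1 h
  have hA := rot_eq_self_of_sim p.immersed' hr hγ
  have h1 : ∀ t, (u t : ℂ) ^ 2 = ((z : ℂ) ^ 2)⁻¹ := fun t => by
    have hT := norm_unitTangent (p.immersed t)
    have hVT := inner_unitTangent p.normal t
    have h2 := hV t
    rw [hA, FramedLoop.smul_framing, FramedLoop.smul_curve, twistVec_mul hT hVT] at h2
    have h3 := sq_eq_one_of_twistVec_eq hT (p.normal t).1 hVT h2.symm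
    rw [mul_pow] at h3
    exact eq_inv_of_mul_eq_one_right h3
  obtain ⟨w, hw⟩ := LoopGroup.const_of_sq h1
  refine BasedLoopGroup.mk_eq_iff.2 ⟨w⁻¹, fun t => ?_⟩
  rw [hw, mul_inv_cancel]
  rfl

theorem BasedLoopGroup.eq_of_smul_eq {g g' : BasedLoopGroup} {x : FramedModuli} (h : g • x = g' • x) :
    g = g' := by
  have h1 : (g'⁻¹ * g) • x = x := by rw [mul_smul, h, inv_smul_smul]
  exact (inv_mul_eq_one.1 (eq_one_of_smul_eq h1)).symm

/-- Framings of the same curve and the same parity differ by frame twisting: their relative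
rotation number is even, so that half of the relative angle defines a loop in the circle. -/
theorem exists_smul_eq {σ : ℝ} (hσ : σ = 1 ∨ σ = -1) {p q : FramedLoop} (hp : p.HasSpinor σ)
    (hq : q.HasSpinor σ) (hc : q.curve = p.curve) : ∃ u : LoopGroup, u • p = q := by
  obtain ⟨n, hn⟩ := FramedLoop.exists_int_integral hc
  have hpar := hp.of_integral hc hn
  have hev : Even n := by
    by_contra h1
    rw [Int.not_even_iff_odd] at h1
    rw [h1.neg_one_zpow, neg_one_mul] at hpar
    rcases hσ with rfl | rfl
    · exact FramedLoop.not_hasSpinor_of_hasSpinor hq hpar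
    · rw [neg_neg] at hpar
      exact FramedLoop.not_hasSpinor_of_hasSpinor hpar hq
  obtain ⟨m, rfl⟩ := hev
  obtain ⟨θ, h1, hd⟩ := exists_rotation p.immersed' (hc ▸ q.normal) p.normal
  set f := density p.curve q.framing - density p.curve p.framing with hf
  have hθ : ∀ t, θ t = (∫ s in (0 : ℝ)..t, f s) + θ 0 := fun t => by
    rw [integral_eq_of_hasDerivAt hd]
    ring
  have hs : ContDiff ℝ ∞ θ := by
    rw [funext hθ]
    exact f.contDiff_primitive.add contDiff_const
  refine ⟨⟨fun t => Circle.exp (θ t / 2), ?_, fun t => ?_⟩,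
    FramedLoop.ext hc.symm (SmoothLoop.ext fun t => ?_)⟩
  · simp only [Circle.coe_exp]
    exact contDiff_expI.comp (hs.div_const 2)
  · simp only
    have h2 : θ (t + 2) / 2 = θ t / 2 + m * (2 * Real.pi) := by
      rw [hθ (t + 2), primitive_add_two, hn, hθ t]
      push_cast
      ring
    rw [h2, Circle.exp_add, Circle.exp_int_mul_two_pi, mul_one]
  · rw [h1, rotField_eq_twistVec]
    rfl

theorem exists_smul_eq_of_forgetFraming_eq {σ : ℝ} (hσ : σ = 1 ∨ σ = -1) {x y : FramedModuli}
    (hx : x ∈ parityClass σ) (hy : y ∈ parityClass σ) (h : forgetFraming x = forgetFraming y) :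
    ∃ g : BasedLoopGroup, g • x = y := by
  obtain ⟨p, rfl⟩ := isQuotientMap_framedModuli.surjective x
  obtain ⟨q, rfl⟩ := isQuotientMap_framedModuli.surjective y
  obtain ⟨p', hp', hc⟩ := FramedLoop.exists_mk_eq_curve (p := p) (γ := q.base) h
  rw [← hp'] at hx ⊢
  obtain ⟨u, rfl⟩ := exists_smul_eq hσ (mk_mem_parityClass.1 hx) (mk_mem_parityClass.1 hy) hc.symm
  exact ⟨u, rfl⟩

/-! ### Local triviality -/

/-- The loop in `ℂ` whose values are the coordinates of the vector `V` in the frame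
`(U, T × U)`. -/
noncomputable def relLoop (γ V U : SmoothLoop Vec3) : SmoothLoop ℂ :=
  superpose (fun p : Vec3 × Vec3 × Vec3 => (inner ℝ p.2.1 p.2.2 : ℂ) +
    (inner ℝ p.2.1 (‖p.1‖⁻¹ • cross p.1 p.2.2) : ℝ) * Complex.I) (pair (derivₗ γ) (pair V U))

theorem contDiffOn_relLoop : ContDiffOn ℝ ∞ (fun p : Vec3 × Vec3 × Vec3 =>
    (inner ℝ p.2.1 p.2.2 : ℂ) + (inner ℝ p.2.1 (‖p.1‖⁻¹ • cross p.1 p.2.2) : ℝ) * Complex.I)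
    {p | p.1 ≠ 0} := by
  have h1 : ContDiffOn ℝ ∞ (fun p : Vec3 × Vec3 × Vec3 => inner ℝ p.2.1 p.2.2) {p | p.1 ≠ 0} :=
    (contDiff_snd.fst.inner ℝ contDiff_snd.snd).contDiffOn
  have h2 : ContDiffOn ℝ ∞ (fun p : Vec3 × Vec3 × Vec3 =>
      inner ℝ p.2.1 (‖p.1‖⁻¹ • cross p.1 p.2.2)) {p | p.1 ≠ 0} :=
    contDiff_snd.fst.contDiffOn.inner ℝ (contDiffOn_inv_norm.smul
      (ContDiffOn.cross contDiff_fst.contDiffOn contDiff_snd.snd.contDiffOn))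
  exact (Complex.ofRealCLM.contDiff.comp_contDiffOn h1).add
    ((Complex.ofRealCLM.contDiff.comp_contDiffOn h2).mul contDiffOn_const)

theorem FrechetSmoothOn.relLoop {E : Type} [AddCommGroup E] [Module ℝ E] [TopologicalSpace E]
    [IsFrechetSpace E] {W : Set E} {γ V U : E → SmoothLoop Vec3} (hγ : FrechetSmoothOn γ W)
    (hV : FrechetSmoothOn V W) (hU : FrechetSmoothOn U W) (h : ∀ x ∈ W, (γ x).Immersed) :
    FrechetSmoothOn (fun x => relLoop (γ x) (V x) (U x)) W :=
  (hγ.derivₗ.pair (hV.pair hU)).superpose (isOpen_fst_ne _) contDiffOn_relLoop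
    fun x hx t => h x hx t

theorem relLoop_of_twistVec {γ V U : SmoothLoop Vec3} (h : γ.Immersed) (hU : IsUnitNormal γ U)
    {t : ℝ} {z : ℂ} (hV : V t = twistVec (unitTangent γ t) (U t) z) :
    relLoop γ V U t = z ^ 2 := by
  have hT := norm_unitTangent (h t)
  have hUT := inner_unitTangent hU t
  have hW : ‖derivₗ γ t‖⁻¹ • cross (derivₗ γ t) (U t) = cross (unitTangent γ t) (U t) := by
    rw [unitTangent, cross_smul_left, derivₗ_apply]
  have hm : pair (derivₗ γ) (pair V U) ∈ valuedIn {p : Vec3 × Vec3 × Vec3 | p.1 ≠ 0} :=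
    fun t => h t
  rw [relLoop, superpose_apply (isOpen_fst_ne _) contDiffOn_relLoop hm]
  simp only [pair_apply]
  rw [hW, hV]
  simp only [twistVec, inner_add_left, inner_smul_left, conj_trivial, inner_cross_right,
    real_inner_comm (cross (unitTangent γ t) (U t)) (U t), real_inner_self_eq_norm_sq,
    norm_cross_of_orthogonal hUT, hT, (hU t).1]
  refine Complex.ext ?_ ?_ <;> simp

/-- The square root near `1` of a unit complex number `w ≠ -1`, as `(w + 1) / |w + 1|`. -/
noncomputable def unitSqrt (w : ℂ) : ℂ := ‖w + 1‖⁻¹ • (w + 1)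

theorem contDiffOn_unitSqrt : ContDiffOn ℝ ∞ unitSqrt {w | w + 1 ≠ 0} := by
  have h : ContDiffOn ℝ ∞ (fun w : ℂ => w + 1) {w | w + 1 ≠ 0} :=
    (contDiff_id.add contDiff_const).contDiffOn
  exact ((h.norm ℝ fun w hw => hw).inv fun w hw => norm_ne_zero_iff.2 hw).smul h

theorem isOpen_add_one_ne : IsOpen {w : ℂ | w + 1 ≠ 0} :=
  isOpen_ne_fun (continuous_id.add continuous_const) continuous_const

theorem norm_unitSqrt {w : ℂ} (h : w + 1 ≠ 0) : ‖unitSqrt w‖ = 1 := by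
  rw [unitSqrt, norm_smul, norm_inv, norm_norm, inv_mul_cancel₀ (norm_ne_zero_iff.2 h)]

theorem unitSqrt_sq {w : ℂ} (hw : ‖w‖ = 1) (h : w + 1 ≠ 0) : unitSqrt w ^ 2 = w := by
  have h1 : ((‖w + 1‖ : ℝ) : ℂ) ^ 2 = (w + 1) * (starRingEnd ℂ w + 1) := by
    have := Complex.mul_conj' (w + 1)
    rw [← this, map_add, map_one]
  have h2 : w * starRingEnd ℂ w = 1 := by
    rw [Complex.mul_conj', hw, Complex.ofReal_one, one_pow]
  have h3 : ((‖w + 1‖ : ℝ) : ℂ) ≠ 0 := by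
    exact_mod_cast norm_ne_zero_iff.2 h
  rw [unitSqrt, Complex.real_smul, mul_pow, Complex.ofReal_inv, inv_pow,
    inv_mul_eq_iff_eq_mul₀ (pow_ne_zero 2 h3), h1]
  linear_combination -(w + 1) * h2

theorem LoopGroup.exists_toLoop_eq (f : SmoothLoop ℂ) (h : ∀ t, ‖f t‖ = 1) :
    ∃ u : LoopGroup, u.toLoop = f :=
  ⟨⟨fun t => ⟨f t, mem_sphere_zero_iff_norm.2 (h t)⟩, f.contDiff,
    fun t => Circle.ext (f.periodic t)⟩, rfl⟩

/-- The square root of the loop `z` which is near the loop `u₀`, for `z` near `u₀²`. -/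
noncomputable def rootNear (u₀ z : SmoothLoop ℂ) : SmoothLoop ℂ :=
  SmoothLoop.mul u₀ (superpose unitSqrt (SmoothLoop.mul z (SmoothLoop.conj (SmoothLoop.mul u₀ u₀))))

/-- The loops `z` to which `rootNear u₀` applies. -/
def rootDomain (u₀ : SmoothLoop ℂ) : Set (SmoothLoop ℂ) :=
  {z | SmoothLoop.mul z (SmoothLoop.conj (SmoothLoop.mul u₀ u₀)) ∈ valuedIn {w | w + 1 ≠ 0}}

theorem frechetSmoothOn_mul_conj (u₀ : SmoothLoop ℂ) (S : Set (SmoothLoop ℂ)) : FrechetSmoothOn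
    (fun z => SmoothLoop.mul z (SmoothLoop.conj (SmoothLoop.mul u₀ u₀))) S :=
  (FrechetSmoothOn.id _).mul (FrechetSmoothOn.const _ _)

theorem isOpen_rootDomain (u₀ : SmoothLoop ℂ) : IsOpen (rootDomain u₀) :=
  (isOpen_valuedIn isOpen_add_one_ne).preimage
    (continuousOn_univ.1 (frechetSmoothOn_mul_conj u₀ univ).continuousOn)

theorem frechetSmoothOn_rootNear (u₀ : SmoothLoop ℂ) :
    FrechetSmoothOn (rootNear u₀) (rootDomain u₀) :=
  (FrechetSmoothOn.const u₀ _).mul ((frechetSmoothOn_mul_conj u₀ _).superpose isOpen_add_one_ne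
    contDiffOn_unitSqrt fun _ h => h)

theorem rootNear_apply {u₀ z : SmoothLoop ℂ} (h0 : ∀ t, ‖u₀ t‖ = 1) (hz : ∀ t, ‖z t‖ = 1)
    (h : z ∈ rootDomain u₀) (t : ℝ) : ‖rootNear u₀ z t‖ = 1 ∧ rootNear u₀ z t ^ 2 = z t := by
  have h1 := h t
  rw [rootNear, SmoothLoop.mul_apply, superpose_apply isOpen_add_one_ne contDiffOn_unitSqrt h]
  have h2 : ‖SmoothLoop.mul z (SmoothLoop.conj (SmoothLoop.mul u₀ u₀)) t‖ = 1 := by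
    rw [SmoothLoop.mul_apply, SmoothLoop.conj_apply, SmoothLoop.mul_apply, norm_mul,
      RCLike.norm_conj, norm_mul, hz, h0, one_mul, one_mul]
  refine ⟨by rw [norm_mul, h0, norm_unitSqrt h1, one_mul], ?_⟩
  have h3 : u₀ t * starRingEnd ℂ (u₀ t) = 1 := by
    rw [Complex.mul_conj', h0, Complex.ofReal_one, one_pow]
  rw [mul_pow, unitSqrt_sq h2 h1, SmoothLoop.mul_apply, SmoothLoop.conj_apply,
    SmoothLoop.mul_apply, map_mul]
  linear_combination z t * (u₀ t * starRingEnd ℂ (u₀ t) + 1) * h3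

theorem sq_mem_rootDomain {u₀ z : SmoothLoop ℂ} (h0 : ∀ t, ‖u₀ t‖ = 1)
    (h : ∀ t, z t = u₀ t ^ 2) : z ∈ rootDomain u₀ := fun t => by
  have h3 : u₀ t * starRingEnd ℂ (u₀ t) = 1 := by
    rw [Complex.mul_conj', h0, Complex.ofReal_one, one_pow]
  have h4 : SmoothLoop.mul z (SmoothLoop.conj (SmoothLoop.mul u₀ u₀)) t = 1 := by
    rw [SmoothLoop.mul_apply, SmoothLoop.conj_apply, SmoothLoop.mul_apply, map_mul, h]
    linear_combination (u₀ t * starRingEnd ℂ (u₀ t) + 1) * h3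
  rw [mem_ofPred_eq, h4]
  norm_num

section Trivialization

variable (κ : ℝ) {σ : ℝ} (hσ : σ = 1 ∨ σ = -1)

theorem smoothOn_smul_twistSection : loopManifold.SmoothOn₂ groupManifold framedManifold
    (fun b (g : BasedLoopGroup) => g • twistSection κ hσ b) (noConstDensity κ) univ := by
  refine smoothOn₂_of_lift isQuotientManifold_loop isQuotientManifold_group
    isQuotientManifold_framed isInducing_immersedLoop.continuous isInducing_toLoop.continuous
    isInducing_incl isOpenQuotientMap_loop isOpenQuotientMap_group
    isOpenQuotientMap_framed.continuous (isOpen_noConstDensity κ) isOpen_univ fun γ u hγ _ => ?_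
  obtain ⟨W, hW, hγW, F, hF, hl⟩ := exists_lift_twistSection κ hσ γ hγ
  refine ⟨{x | x.1 ∈ W ∩ {γ | γ.Immersed}}, (hW.inter isOpen_immersed).preimage continuous_fst,
    ⟨hγW, γ.2⟩, fun x => (x.1, twist x.1 (F x.1) x.2), ?_, fun γ' u' h' _ _ => ?_⟩
  · exact (FrechetSmoothOn.id _).fst.prodMk ((FrechetSmoothOn.id _).fst.twist
      (hF.comp (FrechetSmoothOn.id _).fst fun _ h => h.1) (FrechetSmoothOn.id _).snd
      fun _ h => h.2)
  · obtain ⟨h1, h2⟩ := hl γ' h'.1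
    refine ⟨u' • ⟨γ'.1, F γ'.1, γ'.2, h1⟩, FramedLoop.incl_smul _ _, ?_⟩
    rw [← h2]
    rfl

open Classical in
/-- The element of the based loop group which takes the section of minimal twist to `x`. -/
noncomputable def twistCoord (x : FramedModuli) : BasedLoopGroup :=
  if h : ∃ g : BasedLoopGroup, g • twistSection κ hσ (forgetFraming x) = x then h.choose else 1

theorem twistCoord_eq {x : FramedModuli} {g : BasedLoopGroup}
    (h : g • twistSection κ hσ (forgetFraming x) = x) : twistCoord κ hσ x = g := by
  have h1 : ∃ g : BasedLoopGroup, g • twistSection κ hσ (forgetFraming x) = x := ⟨g, h⟩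
  rw [twistCoord, dif_pos h1]
  exact BasedLoopGroup.eq_of_smul_eq (h1.choose_spec.trans h.symm)

theorem twistCoord_smul {x : FramedModuli} (h : x ∈ parityClass σ) :
    twistCoord κ hσ x • twistSection κ hσ (forgetFraming x) = x := by
  obtain ⟨g, hg⟩ := exists_smul_eq_of_forgetFraming_eq hσ
    (twistSection_mem κ hσ (forgetFraming x)) h (forgetFraming_twistSection κ hσ _)
  rwa [twistCoord_eq κ hσ hg]

theorem twistCoord_smul_twistSection (g : BasedLoopGroup) (b : LoopModuli) :
    twistCoord κ hσ (g • twistSection κ hσ b) = g :=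
  twistCoord_eq κ hσ (by rw [forgetFraming_smul, forgetFraming_twistSection])

theorem twistCoord_smul_eq (g : BasedLoopGroup) {x : FramedModuli} (h : x ∈ parityClass σ) :
    twistCoord κ hσ (g • x) = g * twistCoord κ hσ x :=
  twistCoord_eq κ hσ (by rw [forgetFraming_smul, mul_smul, twistCoord_smul κ hσ h])

theorem isOpen_preimage_forgetFraming {U : Set LoopModuli} (hU : IsOpen U) :
    IsOpen (parityClass σ ∩ forgetFraming ⁻¹' U) := by
  have h := (smoothOn_forgetFraming (isOpen_univ)).1
  exact (isOpen_parityClass σ).inter (hU.preimage (continuousOn_univ.1 h))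

theorem smoothOn_twistCoord : framedManifold.SmoothOn groupManifold (twistCoord κ hσ)
    (parityClass σ ∩ forgetFraming ⁻¹' noConstDensity κ) := by
  refine smoothOn_of_lift isQuotientManifold_framed isQuotientManifold_group
    isInducing_incl.continuous isInducing_toLoop isQuotientMap_framedModuli
    isOpenQuotientMap_group.continuous (isOpen_preimage_forgetFraming (isOpen_noConstDensity κ))
    fun p hp => ?_
  obtain ⟨W, hW, hγW, F, hF, hl⟩ := exists_lift_twistSection κ hσ p.base hp.2
  -- over `W`, every framing of the given parity is a frame twist of the field `F`
  have hex : ∀ p' : FramedLoop, p'.curve ∈ W → FramedModuli.mk p' ∈ parityClass σ →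
      ∃ h : IsUnitNormal p'.curve (F p'.curve),
        FramedModuli.mk ⟨p'.curve, F p'.curve, p'.immersed, h⟩ =
          twistSection κ hσ (LoopModuli.mk p'.base) ∧
        ∃ u : LoopGroup, u • (⟨p'.curve, F p'.curve, p'.immersed, h⟩ : FramedLoop) = p' := by
    intro p' h' hs
    obtain ⟨h1, h2⟩ := hl p'.base h'
    refine ⟨h1, h2, exists_smul_eq hσ (mk_mem_parityClass.1 ?_) (mk_mem_parityClass.1 hs) rfl⟩
    have h3 := twistSection_mem κ hσ (LoopModuli.mk p'.base)
    rwa [← h2] at h3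
  have hrel : ∀ (p' : FramedLoop) (h : IsUnitNormal p'.curve (F p'.curve)) (u : LoopGroup),
      u • (⟨p'.curve, F p'.curve, p'.immersed, h⟩ : FramedLoop) = p' → ∀ t,
      relLoop p'.curve p'.framing (F p'.curve) t = (u t : ℂ) ^ 2 := by
    intro p' h u hu t
    refine relLoop_of_twistVec p'.immersed' h ?_
    have h1 := congrArg (fun q : FramedLoop => q.framing t) hu
    exact h1.symm
  obtain ⟨h0, -, u₀, hu₀⟩ := hex p hγW hp.1
  have hn : ∀ (u : LoopGroup) (t : ℝ), ‖u.toLoop t‖ = 1 := fun u t => Circle.norm_coe _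
  set D : Set (SmoothLoop Vec3 × SmoothLoop Vec3) := {x | x.1 ∈ W ∩ {γ | γ.Immersed}} with hD
  have hDo : IsOpen D := (hW.inter isOpen_immersed).preimage continuous_fst
  have hz : FrechetSmoothOn (fun x : SmoothLoop Vec3 × SmoothLoop Vec3 =>
      relLoop x.1 x.2 (F x.1)) D :=
    (FrechetSmoothOn.id _).fst.relLoop (FrechetSmoothOn.id _).snd
      (hF.comp (FrechetSmoothOn.id _).fst fun _ h => h.1) fun _ h => h.2
  refine ⟨_, hz.continuousOn.isOpen_inter_preimage hDo (isOpen_rootDomain u₀.toLoop),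
    ⟨⟨hγW, p.immersed'⟩, sq_mem_rootDomain (hn u₀) (hrel p h0 u₀ hu₀)⟩,
    fun x => rootNear u₀.toLoop (relLoop x.1 x.2 (F x.1)),
    (frechetSmoothOn_rootNear _).comp (hz.mono fun _ h => h.1) fun _ h => h.2,
    fun p' h' hs => ?_⟩
  obtain ⟨h1, h2, u, hu⟩ := hex p' h'.1.1 hs.1
  have h3 := hrel p' h1 u hu
  have hroot := rootNear_apply (z := relLoop p'.curve p'.framing (F p'.curve)) (hn u₀)
    (fun t => by rw [h3, norm_pow, Circle.norm_coe, one_pow]) h'.2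
  obtain ⟨v, hv⟩ := LoopGroup.exists_toLoop_eq _ fun t => (hroot t).1
  refine ⟨v, hv, (twistCoord_eq κ hσ ?_).symm⟩
  rw [forgetFraming_mk, ← h2, FramedModuli.mk_smul_mk]
  refine congrArg FramedModuli.mk (FramedLoop.ext rfl (SmoothLoop.ext fun t => ?_))
  have h4 : (v t : ℂ) ^ 2 = (u t : ℂ) ^ 2 := by
    rw [← LoopGroup.toLoop_apply, hv, (hroot t).2, h3]
  have h5 := congrArg (fun q : FramedLoop => q.framing t) hu
  simp only [FramedLoop.smul_framing, twistVec] at h5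
  rw [FramedLoop.smul_framing, twistVec, h4]
  exact h5

end Trivialization

theorem isFrechetPrincipalBundle_parityClass {σ : ℝ} (hσ : σ = 1 ∨ σ = -1) :
    IsFrechetPrincipalBundle groupManifold framedManifold loopManifold forgetFraming
      (parityClass σ) where
  lieGroup := isFrechetLieGroup_groupManifold
  isOpen_total := isOpen_parityClass σ
  smul_mem g _ h := smul_mem_parityClass g h
  smooth_smul := smoothOn_smul (isOpen_parityClass σ)
  smooth_proj := smoothOn_forgetFraming (isOpen_parityClass σ)
  surj := eq_univ_of_forall fun b =>
    ⟨_, twistSection_mem 0 hσ b, forgetFraming_twistSection 0 hσ b⟩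
  free _ _ _ h := eq_one_of_smul_eq h
  fibers x hx y hy := ⟨exists_smul_eq_of_forgetFraming_eq hσ hx hy, by
    rintro ⟨g, rfl⟩
    exact (forgetFraming_smul g x).symm⟩
  locallyTrivial b := by
    have hb : b ∈ noConstDensity 0 ∪ noConstDensity 1 := by
      rw [noConstDensity_union]
      trivial
    obtain ⟨κ, hκ⟩ : ∃ κ, b ∈ noConstDensity κ := by
      rcases hb with h | h
      · exact ⟨_, h⟩
      · exact ⟨_, h⟩
    refine ⟨noConstDensity κ, isOpen_noConstDensity κ, hκ, twistCoord κ hσ,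
      fun b g => g • twistSection κ hσ b, smoothOn_twistCoord κ hσ,
      smoothOn_smul_twistSection κ hσ, fun b' _ g => ⟨?_, ?_, ?_⟩, fun x hx _ => ?_,
      fun x hx _ g => ?_⟩
    · exact smul_mem_parityClass g (twistSection_mem κ hσ b')
    · rw [forgetFraming_smul, forgetFraming_twistSection]
    · exact twistCoord_smul_twistSection κ hσ g b'
    · exact twistCoord_smul κ hσ hx
    · exact twistCoord_smul_eq κ hσ g hx

theorem theorem4p1 :
    ∃ (𝓑 : FrechetManifold LoopModuli) (𝓜 : FrechetManifold FramedModuli)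
      (𝓖 : FrechetManifold BasedLoopGroup),
      IsQuotientManifold (fun γ : ImmersedLoop => γ.1) LoopModuli.mk 𝓑 ∧
      IsQuotientManifold FramedLoop.incl FramedModuli.mk 𝓜 ∧
      IsQuotientManifold LoopGroup.toLoop
        (fun u : LoopGroup => (QuotientGroup.mk u : BasedLoopGroup)) 𝓖 ∧
      IsOpen noClosedBishop ∧ IsOpen noAntiBishop ∧ noClosedBishop ∪ noAntiBishop = Set.univ ∧
      ∀ x : FramedModuli,
        IsFrechetPrincipalBundle 𝓖 𝓜 𝓑 forgetFraming (connectedComponent x) ∧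
        (∃ σ : LoopModuli → FramedModuli,
          (∀ b m, m = σ b ↔ m ∈ connectedComponent x ∧ forgetFraming m = b ∧ IsCTMF m) ∧
          𝓑.SmoothOn 𝓜 σ noClosedBishop) ∧
        (∃ σ : LoopModuli → FramedModuli,
          (∀ b m, m = σ b ↔ m ∈ connectedComponent x ∧ forgetFraming m = b ∧ IsAntiCTMF m) ∧
          𝓑.SmoothOn 𝓜 σ noAntiBishop) := by
  refine ⟨loopManifold, framedManifold, groupManifold, isQuotientManifold_loop,
    isQuotientManifold_framed, isQuotientManifold_group, ?_⟩
  rw [noClosedBishop_eq, noAntiBishop_eq]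
  refine ⟨isOpen_noConstDensity 0, isOpen_noConstDensity 1, noConstDensity_union, fun x => ?_⟩
  obtain ⟨σ, hσ, hx⟩ := exists_connectedComponent_eq x
  rw [hx]
  refine ⟨isFrechetPrincipalBundle_parityClass hσ,
    ⟨twistSection 0 hσ, fun b m => ?_, smoothOn_twistSection 0 hσ⟩,
    ⟨twistSection 1 hσ, fun b m => ?_, smoothOn_twistSection 1 hσ⟩⟩
  · rw [isCTMF_iff]
    exact eq_twistSection_iff 0 hσ b m
  · rw [isAntiCTMF_iff]
    exact eq_twistSection_iff 1 hσ b m
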